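/- **Setting.** A coordinator is connected to $k\ge 1$ sites. Items arrive one at a time, in a global order; item $i$ has a weight $w_i\ge 1$ and arrives at a site chosen by an adversary who does not see the random choices, and all messages caused by an item are delivered before the next item arrives. Different occurrences count as different items. A *weighted sample without replacement (SWOR)* of size $s\ge1$ from a finite set $U$ of items is the random set obtained by choosing, $s$ times (or until $U$ is exhausted), an item not yet chosen with probability proportional to its weight. **The algorithm.** Let $r=\max\{2,k/s\}$. The level of an item of weight $w$ is the integer $j\ge 0$ with $w\in[r^j,r^{j+1})$. The key of item $i$ is $v_i=w_i/t_i$, where the $t_i$ are independent exponential variables of rate $1$. An item of level $j$ is sent to the coordinator (an early message) and withheld there as long as fewer than $4rs$ items of level $j$ have arrived before it; the item that makes their number reach $4rs$ saturates the level, the withheld items of the level are then released one after the other, in their order of arrival, into a set $S$, and the saturation is broadcast to all sites. An item of a saturated level is sent by its site (a regular message) only if its key exceeds the site's threshold, and then enters $S$ if its key exceeds $u$. Here $S$ keeps only the $s$ largest keys of the items entering it, $u$ is the $s$-th largest key in $S$ ($u=0$ if $|S|<s$), and whenever an insertion into $S$ brings $u$ into a new interval $[r^j,r^{j+1})$, $j\ge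 0$, the coordinator broadcasts $r^j$, the new threshold of the sites (initially $0$). The sample returned is the set of the $s$ items with the largest keys among $S$ and all the withheld items. In the *space-saving variant*, only those withheld items are kept whose keys are among the $s$ largest keys of all the withheld items. **Theorem 3.1.** For both variants, after any number $t$ of items the sample returned has exactly the law of a weighted SWOR of size $\min\{s,t\}$ from the first $t$ items; and almost surely both variants return the same samples at all times. Moreover there are fixed programs for the sites and the coordinator and an absolute constant $C$ such that, for all $k$, all $s$ and all streams of $n$ items of total weight $W=\sum_{i=1}^n w_i\ge 2s$: 1. the expected number of messages (a broadcast counts as $k$ messages) is, for both variants, at most $$C\,k\,\frac{\log(W/s)}{\log(1+k/s)};$$ 2. almost surely, the programs carry out the space-saving variant on these $n$ items, sending exactly its messages and answering a query at any time with its sample, where the coordinator uses at most $Cs$ memory cells of each of the three types below, also while answering a query on a copy of its memory, each site uses at most $C$ cells of each type, and each site takes at most $C$ steps for each arriving item and for each broadcast received; 3. the total number of steps of the coordinator for processing all the messages is bounded by a random variable of expected value at most $C\,k\,\log(W/s)/\log(1+k/s)$. The programs run on a random access machine with unit-cost instructions, except that a broadcast takes $k$ steps. The memory cells are of three types: words,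 holding natural numbers at most $(knW)^C$ and allowing arithmetic and indirect addressing; cells for one real number (a weight, key or threshold), which can only be copied, compared, multiplied by $r$, divided by the exponential variable of an item, or replaced by its level; and cells for one item identifier. -/

import Mathlib

open MeasureTheory ProbabilityTheory
open scoped ENNReal

noncomputable section

namespace WSWOR

/-! ### Weighted samples without replacement

Items are named by their position `0, 1, 2, …` in the global order of arrival, so that repeated
identifiers count as different items. -/

/-- The weights of the items of `R`, and zero elsewhere. -/
def massOn (w : ℕ → ℝ) (R : Finset ℕ) (i : ℕ) : ℝ≥0∞ :=
  if i ∈ R then ENNReal.ofReal (w i) else 0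

/-- A single weighted random sample: item `i ∈ R` is chosen with probability
`w i / ∑ j ∈ R, w j`. (If `R` has total weight zero, a default value is returned; this case is
never used for positive weights and nonempty `R`.) -/
def draw (w : ℕ → ℝ) (R : Finset ℕ) : PMF ℕ :=
  open Classical in
  if h : (∑' i, massOn w R i) ≠ 0 ∧ (∑' i, massOn w R i) ≠ ⊤ then
    PMF.normalize (massOn w R) h.1 h.2
  else PMF.pure 0

/-- The law of a weighted sample without replacement from `U`: `m` times, a single weighted random
sample is chosen among the items of `U` not chosen yet, and added (as long as there are any). -/
def swor (w : ℕ → ℝ) (U : Finset ℕ) : ℕ → PMF (Finset ℕ)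
  | 0 => PMF.pure ∅
  | m + 1 => (swor w U m).bind fun A =>
      if U ⊆ A then PMF.pure A else (draw w (U \ A)).map fun i => insert i A

/-! ### The precision-sampling algorithm -/

/-- The items of `A` with the `s` largest values of `v`. -/
def top (s : ℕ) (v : ℕ → ℝ) (A : Finset ℕ) : Finset ℕ :=
  A.filter fun i => (A.filter fun j => v i < v j).card < s

/-- The parameters, the input stream and the random choices: `k` sites, sample size `s`,
item `i` has weight `w i` and arrives at site `site i`, and `T i` is the exponential variable that
is used for its key. -/
structure Setting where
  k : ℕ
  s : ℕ
  site : ℕ → Fin k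
  w : ℕ → ℝ
  T : ℕ → ℝ

/-- `r = max {2, k / s}`. -/
def Setting.r (X : Setting) : ℝ := max 2 ((X.k : ℝ) / X.s)

/-- The key of an item. -/
def Setting.key (X : Setting) (i : ℕ) : ℝ := X.w i / X.T i

/-- The integer `j ≥ 0` with `r ^ j ≤ x < r ^ (j + 1)`, and `0` if `0 < x < 1`. -/
def level (r x : ℝ) : ℕ := ⌊Real.logb r x⌋₊

/-- The threshold `r ^ j` of the epoch `j` given by `r ^ j ≤ u < r ^ (j + 1)`; it is `0` as long as
`u < 1`. -/
def epochStart (r u : ℝ) : ℝ := if u < 1 then 0 else r ^ level r u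

/-- The messages. Sites send `early` (item and weight) and `regular` (item, weight and key);
the coordinator broadcasts `saturated` (a level) and `epoch` (a threshold `r ^ j`), and answers
a query by a sequence of items. -/
inductive Msg where
  | early (i : ℕ) (w : ℝ)
  | regular (i : ℕ) (w v : ℝ)
  | saturated (j : ℕ)
  | epoch (x : ℝ)
  | answer (i : ℕ)

/-- What a site stores: which levels are saturated, and the threshold of the current epoch. -/
structure SiteState where
  saturated : ℕ → Bool
  thr : ℝ

/-- What the coordinator stores: the number of early items received in each level, the set `D` of
withheld items (the union of the level sets that are not saturated), the sample `S` of the released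
items, and the `s`-th largest key `u` in `S` (zero while `S` has fewer than `s` items). -/
structure CoordState where
  count : ℕ → ℕ
  D : Finset ℕ
  S : Finset ℕ
  u : ℝ

/-- The answer of a site to the arrival of item `i` (at most one message to the coordinator). -/
def siteArrive (X : Setting) (a : SiteState) (i : ℕ) : Option Msg :=
  if a.saturated (level X.r (X.w i)) = true then
    if a.thr < X.key i then some (.regular i (X.w i) (X.key i)) else none
  else some (.early i (X.w i))

/-- A site receives a broadcast. -/
def siteReceive (a : SiteState) : Msg → SiteState
  | .saturated j => { a with saturated := Function.update a.saturated j true }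
  | .epoch x => { a with thr := x }
  | _ => a

/-- Item `i` is released to the sample `S`: it is inserted, the smallest key is dropped if there are
more than `s` items, `u` is updated, and the epoch is announced if it has changed. -/
def addToSample (X : Setting) (c : CoordState) (i : ℕ) : CoordState × List Msg :=
  let S' := top X.s X.key (insert i c.S)
  let u' := if S'.card < X.s then 0 else sInf (X.key '' (S' : Set ℕ))
  ({ c with S := S', u := u' },
    if 1 ≤ u' ∧ epochStart X.r u' ≠ epochStart X.r c.u then [.epoch (epochStart X.r u')] else [])

/-- Release of several items, one after the other. -/
def addAll (X : Setting) : CoordState → List ℕ → CoordState × List Msg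
  | c, [] => (c, [])
  | c, i :: l =>
      let p := addToSample X c i
      let q := addAll X p.1 l
      (q.1, p.2 ++ q.2)

/-- The coordinator receives a message from a site; the result is its new state and the list of its
broadcasts. An early item of level `j` is withheld; as soon as level `j` has received `4 r s` items
it is saturated, and its withheld items are released in their order of arrival.
If `trim` is `false`, all items of unsaturated levels are kept; if `trim` is `true` (the variant that
saves space), only those withheld items are kept whose keys are among the `s` largest keys of all the
withheld items. -/
def coordReceive (trim : Bool) (X : Setting) (c : CoordState) : Msg → CoordState × List Msg
  | .early i w =>
      let j := level X.r w
      let D' := if trim = true then top X.s X.key (insert i c.D) else insert i c.D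
      let count' := Function.update c.count j (c.count j + 1)
      if 4 * X.r * X.s ≤ (count' j : ℝ) then
        let q := addAll X
          { c with count := count', D := D'.filter fun m => level X.r (X.w m) ≠ j }
          ((D'.filter fun m => level X.r (X.w m) = j).sort (· ≤ ·))
        (q.1, q.2 ++ [.saturated j])
      else ({ c with count := count', D := D' }, [])
  | .regular i _ v => if c.u < v then addToSample X c i else (c, [])
  | _ => (c, [])

/-- The state of the whole network. -/
structure Net (k : ℕ) where
  sites : Fin k → SiteState
  coord : CoordState

/-- The message sent to the coordinator when item `t` arrives, from the given state. -/
def Net.up (X : Setting) (N : Net X.k) (t : ℕ) : Option Msg :=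
  siteArrive X (N.sites (X.site t)) t

/-- The new state of the coordinator, and its broadcasts, when item `t` arrives. -/
def Net.reply (trim : Bool) (X : Setting) (N : Net X.k) (t : ℕ) : CoordState × List Msg :=
  match N.up X t with
  | none => (N.coord, [])
  | some m => coordReceive trim X N.coord m

/-- The state of the network after the first `t` items have arrived and all the messages they caused
have been delivered. -/
def net (trim : Bool) (X : Setting) : ℕ → Net X.k
  | 0 => { sites := fun _ => ⟨fun _ => false, 0⟩, coord := ⟨fun _ => 0, ∅, ∅, 0⟩ }
  | t + 1 =>
      let N := net trim X t
      let a := N.reply trim X t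
      { sites := fun y => a.2.foldl siteReceive (N.sites y), coord := a.1 }

/-- The sample that the coordinator returns after the first `t` items. -/
def sample (trim : Bool) (X : Setting) (t : ℕ) : Finset ℕ :=
  top X.s X.key ((net trim X t).coord.S ∪ (net trim X t).coord.D)

/-- The message from site `X.site t` caused by item `t`. -/
def up (trim : Bool) (X : Setting) (t : ℕ) : Option Msg := (net trim X t).up X t

/-- The broadcasts of the coordinator caused by item `t`. -/
def down (trim : Bool) (X : Setting) (t : ℕ) : List Msg := ((net trim X t).reply trim X t).2

/-- The number of messages caused by the first `n` items; a broadcast counts `k` times. -/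
def messages (trim : Bool) (X : Setting) (n : ℕ) : ℕ :=
  ∑ t ∈ Finset.range n, ((up trim X t).toList.length + X.k * (down trim X t).length)

/-! ### A random access machine with a step count

Each processor has a word memory (natural numbers), a memory for real numbers (weights, keys,
thresholds), and a memory for item identifiers. Words can be used for arithmetic and as addresses;
real numbers can only be copied, compared, multiplied by `r`, divided by an exponential variable,
or replaced by their level. Item identifiers can only be copied and sent. -/

structure Mem where
  word : ℕ → ℕ
  real : ℕ → ℝ
  item : ℕ → Option ℕ

/-- Operations on words. -/
inductive Op where
  | plus | minus | times | quot | rem | shiftLeft | less | equal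

def Op.apply : Op → ℕ → ℕ → ℕ
  | .plus, x, y => x + y
  | .minus, x, y => x - y
  | .times, x, y => x * y
  | .quot, x, y => x / y
  | .rem, x, y => x % y
  | .shiftLeft, x, y => x * 2 ^ y
  | .less, x, y => if x < y then 1 else 0
  | .equal, x, y => if x = y then 1 else 0

/-- Word expressions; `cell a` is the content of the word cell with address `a`. -/
inductive Expr where
  | const (c : ℕ)
  | cell (a : Expr)
  | bin (o : Op) (a b : Expr)

/-- The time for the evaluation of an expression. -/
def Expr.cost : Expr → ℕ
  | .const _ => 1
  | .cell a => a.cost + 1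
  | .bin _ a b => a.cost + b.cost + 1

/-- The data that the execution of a program depends on: every memory has `size` cells, a word holds
a natural number at most `maxWord`; moreover the real number `r`, the number `k` of sites, and the
exponential variables. -/
structure Env where
  size : ℕ
  maxWord : ℕ
  r : ℝ
  k : ℕ
  T : ℕ → ℝ

/-- The value of an expression, undefined if a cell outside the memory is read or if some
intermediate result does not fit into a word. -/
def Expr.eval (E : Env) (σ : Mem) : Expr → Option ℕ
  | .const c => if c ≤ E.maxWord then some c else none
  | .cell a =>
      match a.eval E σ with
      | some x => if x < E.size then some (σ.word x) else none
      | none => none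
  | .bin o a b =>
      match a.eval E σ, b.eval E σ with
      | some x, some y => if o.apply x y ≤ E.maxWord then some (o.apply x y) else none
      | _, _ => none

/-- `a` evaluates to the address `x` of a cell of the memory. -/
def Expr.Addr (E : Env) (σ : Mem) (a : Expr) (x : ℕ) : Prop := a.eval E σ = some x ∧ x < E.size

/-- Tests: a word is nonzero, or a strict comparison of two real cells. -/
inductive Test where
  | nonzero (e : Expr)
  | realLess (a b : Expr)

def Test.cost : Test → ℕ
  | .nonzero e => e.cost + 1
  | .realLess a b => a.cost + b.cost + 1

/-- The test `b` is defined in the state `σ`, and its outcome is `p`. -/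
inductive Test.Is (E : Env) (σ : Mem) : Test → Prop → Prop
  | nonzero {e : Expr} {x : ℕ} : e.eval E σ = some x → Test.Is E σ (.nonzero e) (x ≠ 0)
  | realLess {a b : Expr} {x y : ℕ} : a.Addr E σ x → b.Addr E σ y →
      Test.Is E σ (.realLess a b) (σ.real x < σ.real y)

/-- Programs. -/
inductive Cmd where
  | skip
  | seq (c d : Cmd)
  | ite (b : Test) (c d : Cmd)
  | loop (b : Test) (c : Cmd)
  | setWord (a e : Expr)
  | setReal (a b : Expr)
  | setItem (a b : Expr)
  | scale (a b : Expr)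
  | getLevel (a b : Expr)
  | makeKey (a b c : Expr)
  | sendEarly (a b : Expr)
  | sendRegular (a b c : Expr)
  | castSaturated (e : Expr)
  | castEpoch (a : Expr)
  | answer (a : Expr)

/-- `Exec E c σ σ' o t`: the program `c`, started in the memory `σ`, halts in the memory `σ'` after
`t` steps, and sends the messages `o` meanwhile. A broadcast takes `k` steps. A program that accesses
a cell outside its memory, or computes a number that does not fit into a word, gets stuck. -/
inductive Exec (E : Env) : Cmd → Mem → Mem → List Msg → ℕ → Prop
  | skip {σ : Mem} : Exec E .skip σ σ [] 1
  | seq {c d : Cmd} {σ σ' σ'' : Mem} {o o' : List Msg} {t t' : ℕ} :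
      Exec E c σ σ' o t → Exec E d σ' σ'' o' t' → Exec E (.seq c d) σ σ'' (o ++ o') (t + t')
  | iteTrue {b : Test} {c d : Cmd} {σ σ' : Mem} {o : List Msg} {t : ℕ} {p : Prop} :
      b.Is E σ p → p → Exec E c σ σ' o t → Exec E (.ite b c d) σ σ' o (b.cost + t)
  | iteFalse {b : Test} {c d : Cmd} {σ σ' : Mem} {o : List Msg} {t : ℕ} {p : Prop} :
      b.Is E σ p → ¬ p → Exec E d σ σ' o t → Exec E (.ite b c d) σ σ' o (b.cost + t)
  | loopStop {b : Test} {c : Cmd} {σ : Mem} {p : Prop} :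
      b.Is E σ p → ¬ p → Exec E (.loop b c) σ σ [] b.cost
  | loopStep {b : Test} {c : Cmd} {σ σ' σ'' : Mem} {o o' : List Msg} {t t' : ℕ} {p : Prop} :
      b.Is E σ p → p → Exec E c σ σ' o t → Exec E (.loop b c) σ' σ'' o' t' →
      Exec E (.loop b c) σ σ'' (o ++ o') (b.cost + t + t')
  | setWord {a e : Expr} {σ : Mem} {x y : ℕ} : a.Addr E σ x → e.eval E σ = some y →
      Exec E (.setWord a e) σ { σ with word := Function.update σ.word x y } [] (a.cost + e.cost + 1)
  | setReal {a b : Expr} {σ : Mem} {x y : ℕ} : a.Addr E σ x → b.Addr E σ y →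
      Exec E (.setReal a b) σ { σ with real := Function.update σ.real x (σ.real y) } []
        (a.cost + b.cost + 1)
  | setItem {a b : Expr} {σ : Mem} {x y : ℕ} : a.Addr E σ x → b.Addr E σ y →
      Exec E (.setItem a b) σ { σ with item := Function.update σ.item x (σ.item y) } []
        (a.cost + b.cost + 1)
  | scale {a b : Expr} {σ : Mem} {x y : ℕ} : a.Addr E σ x → b.Addr E σ y →
      Exec E (.scale a b) σ { σ with real := Function.update σ.real x (E.r * σ.real y) } []
        (a.cost + b.cost + 1)
  | getLevel {a b : Expr} {σ : Mem} {x y : ℕ} : a.Addr E σ x → b.Addr E σ y →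
      level E.r (σ.real y) ≤ E.maxWord →
      Exec E (.getLevel a b) σ
        { σ with word := Function.update σ.word x (level E.r (σ.real y)) } [] (a.cost + b.cost + 1)
  | makeKey {a b c : Expr} {σ : Mem} {x y z i : ℕ} : a.Addr E σ x → b.Addr E σ y → c.Addr E σ z →
      σ.item z = some i →
      Exec E (.makeKey a b c) σ { σ with real := Function.update σ.real x (σ.real y / E.T i) } []
        (a.cost + b.cost + c.cost + 1)
  | sendEarly {a b : Expr} {σ : Mem} {x y i : ℕ} : a.Addr E σ x → b.Addr E σ y →
      σ.item x = some i →
      Exec E (.sendEarly a b) σ σ [.early i (σ.real y)] (a.cost + b.cost + 1)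
  | sendRegular {a b c : Expr} {σ : Mem} {x y z i : ℕ} : a.Addr E σ x → b.Addr E σ y →
      c.Addr E σ z → σ.item x = some i →
      Exec E (.sendRegular a b c) σ σ [.regular i (σ.real y) (σ.real z)]
        (a.cost + b.cost + c.cost + 1)
  | castSaturated {e : Expr} {σ : Mem} {j : ℕ} : e.eval E σ = some j →
      Exec E (.castSaturated e) σ σ [.saturated j] (e.cost + E.k + 1)
  | castEpoch {a : Expr} {σ : Mem} {x : ℕ} : a.Addr E σ x →
      Exec E (.castEpoch a) σ σ [.epoch (σ.real x)] (a.cost + E.k + 1)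
  | answer {a : Expr} {σ : Mem} {x i : ℕ} : a.Addr E σ x → σ.item x = some i →
      Exec E (.answer a) σ σ [.answer i] (a.cost + 1)

/-- The memory of every processor at the beginning: the words `s`, `k` in the word cells `0` and `1`,
the constant `1` in the real cell `2`, all other cells empty. -/
def Mem.start (s k : ℕ) : Mem where
  word := fun a => if a = 0 then s else if a = 1 then k else 0
  real := fun a => if a = 2 then 1 else 0
  item := fun _ => none

/-- An item arrives at a site: it is written into item cell `0`, its weight into real cell `0`. -/
def Mem.arrival (σ : Mem) (i : ℕ) (w : ℝ) : Mem :=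
  { σ with item := Function.update σ.item 0 (some i), real := Function.update σ.real 0 w }

/-- A message is received: its kind is written into word cell `2`, its content into word cell `3`,
the real cells `0` and `1` and the item cell `0`. -/
def Mem.receive (σ : Mem) : Msg → Mem
  | .early i w =>
      { word := Function.update σ.word 2 0, real := Function.update σ.real 0 w,
        item := Function.update σ.item 0 (some i) }
  | .regular i w v =>
      { word := Function.update σ.word 2 1,
        real := Function.update (Function.update σ.real 0 w) 1 v,
        item := Function.update σ.item 0 (some i) }
  | .saturated j => { σ with word := Function.update (Function.update σ.word 2 2) 3 j }
  | .epoch x =>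
      { σ with word := Function.update σ.word 2 3, real := Function.update σ.real 0 x }
  | .answer _ => σ

/-- Programs for all the processors: what a site does with an arriving item and with a broadcast,
and what the coordinator does with a message and with a query. -/
structure Protocol where
  arrive : Cmd
  notice : Cmd
  coord : Cmd
  query : Cmd

/-- A site processes a list of broadcasts, sending nothing, in at most `b` steps for each. -/
inductive Notices (E : Env) (c : Cmd) (b : ℕ) : List Msg → Mem → Mem → Prop
  | nil {σ : Mem} : Notices E c b [] σ σ
  | cons {m : Msg} {l : List Msg} {σ σ' σ'' : Mem} {t : ℕ} :
      Exec E c (σ.receive m) σ' [] t → t ≤ b → Notices E c b l σ' σ'' →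
      Notices E c b (m :: l) σ σ''

/-- The programs `P` carry out the algorithm (in the variant that saves space) on the first `n` items
of the stream: they send exactly the messages of the algorithm, in the same order, and the
answer to a query after any number `t ≤ n` of items is exactly the sample of the algorithm. Here
words are at most `B`, each site has memories of `C` cells and spends at most `C` steps on each
arriving item and on each broadcast, the coordinator has memories of `C * s` cells, and its total
time (for all messages received) is at most `τ`. A query is answered within the same space, on a copy
of the memory. -/
def Realizes (P : Protocol) (C B : ℕ) (X : Setting) (n τ : ℕ) : Prop :=
  let Es : Env := ⟨C, B, X.r, X.k, X.T⟩
  let Ec : Env := ⟨C * X.s, B, X.r, X.k, X.T⟩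
  ∃ (site : ℕ → Fin X.k → Mem) (coord : ℕ → Mem) (time : ℕ → ℕ),
    (∀ y, site 0 y = Mem.start X.s X.k) ∧ coord 0 = Mem.start X.s X.k ∧
    (∀ t < n,
      (∃ σ b, Exec Es P.arrive ((site t (X.site t)).arrival t (X.w t)) σ (up true X t).toList b ∧
        b ≤ C ∧ Notices Es P.notice C (down true X t) σ (site (t + 1) (X.site t))) ∧
      (∀ y, y ≠ X.site t → Notices Es P.notice C (down true X t) (site t y) (site (t + 1) y)) ∧
      match up true X t with
      | none => coord (t + 1) = coord t ∧ time t = 0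
      | some m => Exec Ec P.coord ((coord t).receive m) (coord (t + 1)) (down true X t) (time t)) ∧
    (∀ t ≤ n, ∃ (σ : Mem) (l : List ℕ) (b : ℕ), Exec Ec P.query (coord t) σ (l.map Msg.answer) b ∧
      l.Nodup ∧ l.toFinset = sample true X t) ∧
    ∑ t ∈ Finset.range n, time t ≤ τ

/-! ### Expected values and the bound -/

/-- The expected value of `f` exists and is at most `b`. -/
def ExpLE {Ω : Type*} [MeasurableSpace Ω] (μ : Measure Ω) (f : Ω → ℕ) (b : ℝ) : Prop :=
  Integrable (fun ω => (f ω : ℝ)) μ ∧ ∫ ω, (f ω : ℝ) ∂μ ≤ b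

/-- `k log (W / s) / log (1 + k / s)`. -/
def rate (k s : ℕ) (W : ℝ) : ℝ :=
  (k : ℝ) * (Real.log (W / s) / Real.log (1 + (k : ℝ) / s))

end WSWOR

end

noncomputable section

namespace WSWOR

/-! ### A layer above the machine: arrays and a weakest precondition calculus

The memory of each type is divided into 32 interleaved arrays: entry `i` of array `a` is stored in the
cell `32 * i + a`. -/

/-! Correctness. Almost surely the keys are positive and distinct (`Setting.Good`), and then both
variants return exactly the items with the `s` largest keys seen so far (`sample_eq`). Behind this
is the invariant `NetInv`: those items are always stored. A site suppresses an item only if its key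
is at most the threshold, hence at most `u`, so `s` stored keys already beat it; trimming and
truncation discard only items beaten by `s` others (`top_sandwich`). As a key is a weight divided by
an exponential variable, the largest keys are the winners of an exponential race, and lack of memory
makes each further winner a weighted draw from the remaining items (`ExpSeq.race_first`,
`ExpSeq.measure_top_succ`, `ExpSeq.measure_top`).

Messages. Early messages and saturations are bounded deterministically by the total weight
(`Setting.early_le`, `Setting.sats_le`). The expected number of epochs is logarithmic, by Markov's
inequality for the number of keys beyond `r ^ j` (`ExpSeq.lintegral_epo_le`). A regular message in
epoch `q` needs a key above the threshold `r ^ (q - 1)`; by concavity of `1 - exp (-x)`, a key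
reaches `r ^ q` with at least `1 / r` of that probability, and an epoch admits at most `s` keys
beyond `r ^ q` (`card_jumps_le`). As the epoch is independent of the next key, the expected number
of regular messages is at most `r * s` times one plus the expected number of epochs
(`ExpSeq.lintegral_regs_le`). Everything is of order `r s log_r (W / s)`, which the rate dominates
(`mul_logb_le_rate`). Measurability and independence hold because a run is determined by comparisons
of keys with each other and with powers of `r` (`Similar`).

The machine. The sample and the withheld items live in buffers of fewer than `2 s` entries. A full
buffer is cut down to `s` entries by a linear-time selection (`select_spec`), and the removed
entries pay for it, so an insertion takes constant amortized time; a new epoch or a saturation takes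
time of order `s + k` (`insertItem_spec`, `settleEarly_spec`). The counters of the levels are packed
as digits into `s` words, for which words polynomial in `k n W` suffice (`Setting.pow_bits_pow_le`);
a site keeps the saturated levels as a bit mask. In total the coordinator's time is a constant times
`load`, the quantity that also bounds the messages (`realizes`, `ExpSeq.lintegral_load_le`). -/

/-- Entry `i` of the word array `a`. -/
def Mem.W (σ : Mem) (a : Fin 32) (i : ℕ) : ℕ := σ.word (32 * i + a)

/-- Entry `i` of the real array `a`. -/
def Mem.R (σ : Mem) (a : Fin 32) (i : ℕ) : ℝ := σ.real (32 * i + a)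

/-- Entry `i` of the item array `a`. -/
def Mem.I (σ : Mem) (a : Fin 32) (i : ℕ) : Option ℕ := σ.item (32 * i + a)

def Mem.setW (σ : Mem) (a : Fin 32) (i x : ℕ) : Mem :=
  { σ with word := Function.update σ.word (32 * i + a) x }

def Mem.setR (σ : Mem) (a : Fin 32) (i : ℕ) (x : ℝ) : Mem :=
  { σ with real := Function.update σ.real (32 * i + a) x }

def Mem.setI (σ : Mem) (a : Fin 32) (i : ℕ) (x : Option ℕ) : Mem :=
  { σ with item := Function.update σ.item (32 * i + a) x }

/-- Quotient and remainder modulo 32 recover the entry and the array from the cell, so writing into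
one array never disturbs another. -/
theorem cell_eq_iff (a b : Fin 32) (i j : ℕ) :
    32 * j + (b : ℕ) = 32 * i + a ↔ b = a ∧ j = i := by
  rw [Fin.ext_iff]; omega

@[simp] theorem W_setW (σ : Mem) (a b : Fin 32) (i j x : ℕ) :
    (σ.setW a i x).W b j = if b = a ∧ j = i then x else σ.W b j := by
  simp [Mem.W, Mem.setW, Function.update_apply, cell_eq_iff]
@[simp] theorem R_setR (σ : Mem) (a b : Fin 32) (i j : ℕ) (x : ℝ) :
    (σ.setR a i x).R b j = if b = a ∧ j = i then x else σ.R b j := by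
  simp [Mem.R, Mem.setR, Function.update_apply, cell_eq_iff]
@[simp] theorem I_setI (σ : Mem) (a b : Fin 32) (i j : ℕ) (x : Option ℕ) :
    (σ.setI a i x).I b j = if b = a ∧ j = i then x else σ.I b j := by
  simp [Mem.I, Mem.setI, Function.update_apply, cell_eq_iff]
@[simp] theorem W_setR (σ : Mem) (a : Fin 32) (i : ℕ) (x : ℝ) : (σ.setR a i x).W = σ.W := rfl
@[simp] theorem W_setI (σ : Mem) (a : Fin 32) (i : ℕ) (x : Option ℕ) : (σ.setI a i x).W = σ.W := rfl
@[simp] theorem R_setW (σ : Mem) (a : Fin 32) (i x : ℕ) : (σ.setW a i x).R = σ.R := rfl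
@[simp] theorem R_setI (σ : Mem) (a : Fin 32) (i : ℕ) (x : Option ℕ) : (σ.setI a i x).R = σ.R := rfl
@[simp] theorem I_setW (σ : Mem) (a : Fin 32) (i x : ℕ) : (σ.setW a i x).I = σ.I := rfl
@[simp] theorem I_setR (σ : Mem) (a : Fin 32) (i : ℕ) (x : ℝ) : (σ.setR a i x).I = σ.I := rfl

/-- Word expressions that refer to arrays. -/
inductive HE where
  | c (n : ℕ)
  | w (a : Fin 32) (i : HE)
  | b (o : Op) (x y : HE)

/-- The cell of an array entry. -/
def cellOf (a : Fin 32) (e : Expr) : Expr := .bin .plus (.bin .times (.const 32) e) (.const a)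

@[simp] def HE.toE : HE → Expr
  | .c n => .const n
  | .w a i => .cell (cellOf a i.toE)
  | .b o x y => .bin o x.toE y.toE

@[simp] def HE.val (σ : Mem) : HE → ℕ
  | .c n => n
  | .w a i => σ.W a (i.val σ)
  | .b o x y => o.apply (x.val σ) (y.val σ)

/-- The evaluation succeeds if all the arrays have `K` entries. -/
@[simp] def HE.ok (B K : ℕ) (σ : Mem) : HE → Prop
  | .c n => n ≤ B
  | .w _ i => i.ok B K σ ∧ i.val σ < K
  | .b o x y => x.ok B K σ ∧ y.ok B K σ ∧ o.apply (x.val σ) (y.val σ) ≤ B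

@[simp] def HE.cost : HE → ℕ
  | .c _ => 1
  | .w _ i => i.cost + 5
  | .b _ x y => x.cost + y.cost + 1

theorem HE.cost_toE (e : HE) : e.toE.cost = e.cost := by
  induction e with
  | c n => rfl
  | w a i ih => simp [cellOf, Expr.cost, ih]; omega
  | b o x y hx hy => simp [Expr.cost, hx, hy]

/-- The environment has room for `K` entries in each array. -/
structure Env.Fits (E : Env) (K : ℕ) : Prop where
  size : 32 * K ≤ E.size
  word : 32 * K ≤ E.maxWord

theorem cellOf_addr {E : Env} {K : ℕ} (hE : E.Fits K) {σ : Mem} {e : Expr} {i : ℕ}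
    (he : e.eval E σ = some i) (hi : i < K) (a : Fin 32) : (cellOf a e).Addr E σ (32 * i + a) := by
  have h1 := hE.size
  have h2 := hE.word
  have h3 := a.2
  refine ⟨?_, by omega⟩
  have h4 : 32 ≤ E.maxWord := by omega
  have h5 : 32 * i ≤ E.maxWord := by omega
  have h6 : (a : ℕ) ≤ E.maxWord := by omega
  have h7 : 32 * i + (a : ℕ) ≤ E.maxWord := by omega
  simp [cellOf, Expr.eval, he, Op.apply, h4, h5, h6, h7]

theorem HE.eval_toE {E : Env} {K : ℕ} (hE : E.Fits K) {σ : Mem} {e : HE}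
    (h : e.ok E.maxWord K σ) : e.toE.eval E σ = some (e.val σ) := by
  induction e with
  | c n => simpa [Expr.eval] using h
  | w a i ih =>
      obtain ⟨h1, h2⟩ := cellOf_addr hE (ih h.1) h.2 a
      simp [Expr.eval, h1, h2, Mem.W]
  | b o x y hx hy =>
      simp only [HE.ok] at h
      simp [Expr.eval, hx h.1, hy h.2.1, h.2.2]

theorem HE.addr {E : Env} {K : ℕ} (hE : E.Fits K) {σ : Mem} {e : HE}
    (h : e.ok E.maxWord K σ) (hK : e.val σ < K) (a : Fin 32) :
    (cellOf a e.toE).Addr E σ (32 * e.val σ + a) := cellOf_addr hE (HE.eval_toE hE h) hK a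

/-- Tests that refer to arrays. -/
inductive HT where
  | nz (e : HE)
  | lt (a : Fin 32) (i : HE) (b : Fin 32) (j : HE)

def HT.toT : HT → Test
  | .nz e => .nonzero e.toE
  | .lt a i b j => .realLess (cellOf a i.toE) (cellOf b j.toE)

def HT.val (σ : Mem) : HT → Prop
  | .nz e => e.val σ ≠ 0
  | .lt a i b j => σ.R a (i.val σ) < σ.R b (j.val σ)

def HT.ok (B K : ℕ) (σ : Mem) : HT → Prop
  | .nz e => e.ok B K σ
  | .lt _ i _ j => i.ok B K σ ∧ i.val σ < K ∧ j.ok B K σ ∧ j.val σ < K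

def HT.cost : HT → ℕ
  | .nz e => e.cost + 1
  | .lt _ i _ j => i.cost + j.cost + 9

@[simp] theorem HT.val_nz (σ : Mem) (e : HE) : (HT.nz e).val σ = (e.val σ ≠ 0) := rfl
@[simp] theorem HT.val_lt (σ : Mem) (a b : Fin 32) (i j : HE) :
    (HT.lt a i b j).val σ = (σ.R a (i.val σ) < σ.R b (j.val σ)) := rfl
@[simp] theorem HT.ok_nz (B K : ℕ) (σ : Mem) (e : HE) : (HT.nz e).ok B K σ = e.ok B K σ := rfl
@[simp] theorem HT.ok_lt (B K : ℕ) (σ : Mem) (a b : Fin 32) (i j : HE) : (HT.lt a i b j).ok B K σ =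
    (i.ok B K σ ∧ i.val σ < K ∧ j.ok B K σ ∧ j.val σ < K) := rfl
@[simp] theorem HT.cost_nz (e : HE) : (HT.nz e).cost = e.cost + 1 := rfl
@[simp] theorem HT.cost_lt (a b : Fin 32) (i j : HE) :
    (HT.lt a i b j).cost = i.cost + j.cost + 9 := rfl

theorem HT.cost_toT (b : HT) : b.toT.cost = b.cost := by
  cases b <;> simp [HT.toT, HT.cost, Test.cost, cellOf, Expr.cost, HE.cost_toE]; omega

theorem HT.is {E : Env} {K : ℕ} (hE : E.Fits K) {σ : Mem} {b : HT}
    (h : b.ok E.maxWord K σ) : b.toT.Is E σ (b.val σ) := by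
  cases b with
  | nz e => exact .nonzero (HE.eval_toE hE h)
  | lt a i b j => exact .realLess (HE.addr hE h.1 h.2.1 a) (HE.addr hE h.2.2.1 h.2.2.2 b)

/-- Programs that refer to arrays. -/
inductive HC where
  | skip
  | seq (c d : HC)
  | ite (b : HT) (c d : HC)
  | loop (b : HT) (c : HC)
  | putW (a : Fin 32) (i e : HE)
  | putR (a : Fin 32) (i : HE) (b : Fin 32) (j : HE)
  | putI (a : Fin 32) (i : HE) (b : Fin 32) (j : HE)
  | scale (a : Fin 32) (i : HE) (b : Fin 32) (j : HE)
  | getLevel (a : Fin 32) (i : HE) (b : Fin 32) (j : HE)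
  | makeKey (a : Fin 32) (i : HE) (b : Fin 32) (j : HE) (d : Fin 32) (l : HE)
  | sendEarly (a : Fin 32) (i : HE) (b : Fin 32) (j : HE)
  | sendRegular (a : Fin 32) (i : HE) (b : Fin 32) (j : HE) (d : Fin 32) (l : HE)
  | castSaturated (e : HE)
  | castEpoch (a : Fin 32) (i : HE)
  | answer (a : Fin 32) (i : HE)

def HC.toC : HC → Cmd
  | .skip => .skip
  | .seq c d => .seq c.toC d.toC
  | .ite b c d => .ite b.toT c.toC d.toC
  | .loop b c => .loop b.toT c.toC
  | .putW a i e => .setWord (cellOf a i.toE) e.toE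
  | .putR a i b j => .setReal (cellOf a i.toE) (cellOf b j.toE)
  | .putI a i b j => .setItem (cellOf a i.toE) (cellOf b j.toE)
  | .scale a i b j => .scale (cellOf a i.toE) (cellOf b j.toE)
  | .getLevel a i b j => .getLevel (cellOf a i.toE) (cellOf b j.toE)
  | .makeKey a i b j d l => .makeKey (cellOf a i.toE) (cellOf b j.toE) (cellOf d l.toE)
  | .sendEarly a i b j => .sendEarly (cellOf a i.toE) (cellOf b j.toE)
  | .sendRegular a i b j d l => .sendRegular (cellOf a i.toE) (cellOf b j.toE) (cellOf d l.toE)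
  | .castSaturated e => .castSaturated e.toE
  | .castEpoch a i => .castEpoch (cellOf a i.toE)
  | .answer a i => .answer (cellOf a i.toE)

/-- The index `i` is defined and within the arrays. -/
@[simp] def HE.ix (E : Env) (K : ℕ) (σ : Mem) (i : HE) : Prop := i.ok E.maxWord K σ ∧ i.val σ < K

/-- A precondition for the program to halt with memory, messages and time satisfying `Q`. -/
def wp (E : Env) (K : ℕ) : HC → Mem → (Mem → List Msg → ℕ → Prop) → Prop
  | .skip, σ, Q => Q σ [] 1
  | .seq c d, σ, Q =>
      wp E K c σ fun σ' o t => wp E K d σ' fun σ'' o' t' => Q σ'' (o ++ o') (t + t')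
  | .ite b c d, σ, Q => b.ok E.maxWord K σ ∧
      (b.val σ → wp E K c σ fun σ' o t => Q σ' o (b.cost + t)) ∧
      (¬ b.val σ → wp E K d σ fun σ' o t => Q σ' o (b.cost + t))
  | .loop b c, σ, Q => ∃ σ' o t, Exec E (HC.loop b c).toC σ σ' o t ∧ Q σ' o t
  | .putW a i e, σ, Q => i.ix E K σ ∧ e.ok E.maxWord K σ ∧
      Q (σ.setW a (i.val σ) (e.val σ)) [] (i.cost + e.cost + 5)
  | .putR a i b j, σ, Q => i.ix E K σ ∧ j.ix E K σ ∧
      Q (σ.setR a (i.val σ) (σ.R b (j.val σ))) [] (i.cost + j.cost + 9)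
  | .putI a i b j, σ, Q => i.ix E K σ ∧ j.ix E K σ ∧
      Q (σ.setI a (i.val σ) (σ.I b (j.val σ))) [] (i.cost + j.cost + 9)
  | .scale a i b j, σ, Q => i.ix E K σ ∧ j.ix E K σ ∧
      Q (σ.setR a (i.val σ) (E.r * σ.R b (j.val σ))) [] (i.cost + j.cost + 9)
  | .getLevel a i b j, σ, Q => i.ix E K σ ∧ j.ix E K σ ∧
      level E.r (σ.R b (j.val σ)) ≤ E.maxWord ∧
      Q (σ.setW a (i.val σ) (level E.r (σ.R b (j.val σ)))) [] (i.cost + j.cost + 9)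
  | .makeKey a i b j d l, σ, Q => i.ix E K σ ∧ j.ix E K σ ∧ l.ix E K σ ∧
      ∃ m, σ.I d (l.val σ) = some m ∧
      Q (σ.setR a (i.val σ) (σ.R b (j.val σ) / E.T m)) [] (i.cost + j.cost + l.cost + 13)
  | .sendEarly a i b j, σ, Q => i.ix E K σ ∧ j.ix E K σ ∧
      ∃ m, σ.I a (i.val σ) = some m ∧
      Q σ [.early m (σ.R b (j.val σ))] (i.cost + j.cost + 9)
  | .sendRegular a i b j d l, σ, Q => i.ix E K σ ∧ j.ix E K σ ∧ l.ix E K σ ∧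
      ∃ m, σ.I a (i.val σ) = some m ∧
      Q σ [.regular m (σ.R b (j.val σ)) (σ.R d (l.val σ))] (i.cost + j.cost + l.cost + 13)
  | .castSaturated e, σ, Q => e.ok E.maxWord K σ ∧ Q σ [.saturated (e.val σ)] (e.cost + E.k + 1)
  | .castEpoch a i, σ, Q => i.ix E K σ ∧ Q σ [.epoch (σ.R a (i.val σ))] (i.cost + 4 + E.k + 1)
  | .answer a i, σ, Q => i.ix E K σ ∧ ∃ m, σ.I a (i.val σ) = some m ∧
      Q σ [.answer m] (i.cost + 5)

-- The clause for loops, `wp.eq_4`, is left out on purpose: `simp` executes straight-line code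
-- symbolically and stops at each loop, where an invariant has to be supplied.
attribute [simp] wp.eq_1 wp.eq_2 wp.eq_3 wp.eq_5 wp.eq_6 wp.eq_7 wp.eq_8 wp.eq_9
  wp.eq_10 wp.eq_11 wp.eq_12 wp.eq_13 wp.eq_14 wp.eq_15

theorem cost_cellOf (a : Fin 32) (i : HE) : (cellOf a i.toE).cost = i.cost + 4 := by
  simp [cellOf, Expr.cost, HE.cost_toE]; omega

theorem cast_time {Q : Mem → List Msg → ℕ → Prop} {σ : Mem} {o : List Msg} {t t' : ℕ}
    (h : Q σ o t) (ht : t = t') : Q σ o t' := ht ▸ h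

/-- Each clause of `wp` carries the side conditions of the corresponding rule of `Exec` (addresses
in range, words not too large), and the loop clause contains an execution outright. -/
theorem wp_sound {E : Env} {K : ℕ} (hE : E.Fits K) (c : HC) :
    ∀ {σ : Mem} {Q : Mem → List Msg → ℕ → Prop}, wp E K c σ Q →
      ∃ σ' o t, Exec E c.toC σ σ' o t ∧ Q σ' o t := by
  induction c with
  | skip => intro σ Q h; exact ⟨_, _, _, .skip, h⟩
  | seq c d hc hd =>
      intro σ Q h
      obtain ⟨σ1, o1, t1, e1, h1⟩ := hc h
      obtain ⟨σ2, o2, t2, e2, h2⟩ := hd h1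
      exact ⟨_, _, _, .seq e1 e2, h2⟩
  | ite b c d hc hd =>
      intro σ Q h
      obtain ⟨h0, h1, h2⟩ := h
      have := HT.is hE h0
      by_cases hb : b.val σ
      · obtain ⟨σ1, o1, t1, e1, h1⟩ := hc (h1 hb)
        exact ⟨_, _, _, .iteTrue this hb e1, by rwa [HT.cost_toT]⟩
      · obtain ⟨σ1, o1, t1, e1, h1⟩ := hd (h2 hb)
        exact ⟨_, _, _, .iteFalse this hb e1, by rwa [HT.cost_toT]⟩
  | loop b c => intro σ Q h; exact h
  | putW a i e =>
      intro σ Q h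
      refine ⟨_, _, _, .setWord (HE.addr hE h.1.1 h.1.2 a) (HE.eval_toE hE h.2.1), ?_⟩
      rw [cost_cellOf, HE.cost_toE]
      exact cast_time h.2.2 (by omega)
  | putR a i b j =>
      intro σ Q h
      refine ⟨_, _, _, .setReal (HE.addr hE h.1.1 h.1.2 a) (HE.addr hE h.2.1.1 h.2.1.2 b), ?_⟩
      rw [cost_cellOf, cost_cellOf]
      exact cast_time h.2.2 (by omega)
  | putI a i b j =>
      intro σ Q h
      refine ⟨_, _, _, .setItem (HE.addr hE h.1.1 h.1.2 a) (HE.addr hE h.2.1.1 h.2.1.2 b), ?_⟩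
      rw [cost_cellOf, cost_cellOf]
      exact cast_time h.2.2 (by omega)
  | scale a i b j =>
      intro σ Q h
      refine ⟨_, _, _, .scale (HE.addr hE h.1.1 h.1.2 a) (HE.addr hE h.2.1.1 h.2.1.2 b), ?_⟩
      rw [cost_cellOf, cost_cellOf]
      exact cast_time h.2.2 (by omega)
  | getLevel a i b j =>
      intro σ Q h
      refine ⟨_, _, _, .getLevel (HE.addr hE h.1.1 h.1.2 a) (HE.addr hE h.2.1.1 h.2.1.2 b)
        h.2.2.1, ?_⟩
      rw [cost_cellOf, cost_cellOf]
      exact cast_time h.2.2.2 (by omega)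
  | makeKey a i b j d l =>
      intro σ Q h
      obtain ⟨h1, h2, h3, m, hm, h4⟩ := h
      refine ⟨_, _, _, .makeKey (HE.addr hE h1.1 h1.2 a) (HE.addr hE h2.1 h2.2 b)
        (HE.addr hE h3.1 h3.2 d) hm, ?_⟩
      rw [cost_cellOf, cost_cellOf, cost_cellOf]
      exact cast_time h4 (by omega)
  | sendEarly a i b j =>
      intro σ Q h
      obtain ⟨h1, h2, m, hm, h4⟩ := h
      refine ⟨_, _, _, .sendEarly (HE.addr hE h1.1 h1.2 a) (HE.addr hE h2.1 h2.2 b) hm, ?_⟩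
      rw [cost_cellOf, cost_cellOf]
      exact cast_time h4 (by omega)
  | sendRegular a i b j d l =>
      intro σ Q h
      obtain ⟨h1, h2, h3, m, hm, h4⟩ := h
      refine ⟨_, _, _, .sendRegular (HE.addr hE h1.1 h1.2 a) (HE.addr hE h2.1 h2.2 b)
        (HE.addr hE h3.1 h3.2 d) hm, ?_⟩
      rw [cost_cellOf, cost_cellOf, cost_cellOf]
      exact cast_time h4 (by omega)
  | castSaturated e =>
      intro σ Q h
      refine ⟨_, _, _, .castSaturated (HE.eval_toE hE h.1), ?_⟩
      rw [HE.cost_toE]; exact h.2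
  | castEpoch a i =>
      intro σ Q h
      refine ⟨_, _, _, .castEpoch (HE.addr hE h.1.1 h.1.2 a), ?_⟩
      rw [cost_cellOf]; exact h.2
  | answer a i =>
      intro σ Q h
      obtain ⟨h1, m, hm, h4⟩ := h
      refine ⟨_, _, _, .answer (HE.addr hE h1.1 h1.2 a) hm, ?_⟩
      rw [cost_cellOf]; exact h4

/-- The glue between specifications: the postcondition proved for a subprogram is weakened to the
goal left by the surrounding program. -/
theorem wp_mono {E : Env} {K : ℕ} (c : HC) :
    ∀ {σ : Mem} {Q Q' : Mem → List Msg → ℕ → Prop}, wp E K c σ Q →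
      (∀ σ' o t, Q σ' o t → Q' σ' o t) → wp E K c σ Q' := by
  induction c with
  | seq c d hc hd =>
      intro σ Q Q' h hQ
      exact hc h fun _ _ _ h1 => hd h1 fun _ _ _ h2 => hQ _ _ _ h2
  | ite b c d hc hd =>
      intro σ Q Q' h hQ
      exact ⟨h.1, fun hb => hc (h.2.1 hb) fun _ _ _ h1 => hQ _ _ _ h1,
        fun hb => hd (h.2.2 hb) fun _ _ _ h1 => hQ _ _ _ h1⟩
  | loop b c =>
      intro σ Q Q' h hQ
      obtain ⟨a, b, c, d, e⟩ := h
      exact ⟨a, b, c, d, hQ _ _ _ e⟩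
  | skip => intro σ Q Q' h hQ; exact hQ _ _ _ h
  | putW | putR | putI | scale | castSaturated | castEpoch =>
      intro σ Q Q' h hQ
      simp only [wp] at h ⊢
      refine h.imp_right ?_
      first | exact fun h => h.imp_right (hQ _ _ _) | exact hQ _ _ _
  | getLevel => intro σ Q Q' h hQ; exact ⟨h.1, h.2.1, h.2.2.1, hQ _ _ _ h.2.2.2⟩
  | makeKey | sendRegular =>
      intro σ Q Q' h hQ
      obtain ⟨h1, h2, h3, m, hm, h4⟩ := h
      exact ⟨h1, h2, h3, m, hm, hQ _ _ _ h4⟩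
  | sendEarly =>
      intro σ Q Q' h hQ
      obtain ⟨h1, h2, m, hm, h4⟩ := h
      exact ⟨h1, h2, m, hm, hQ _ _ _ h4⟩
  | answer =>
      intro σ Q Q' h hQ
      obtain ⟨h1, m, hm, h4⟩ := h
      exact ⟨h1, m, hm, hQ _ _ _ h4⟩

/-- A loop with `n` rounds: the invariant `J i` relates the memory, the messages and the time after
`i` rounds. -/
theorem wp_loop {E : Env} {K : ℕ} (hE : E.Fits K) {b : HT} {c : HC} {σ : Mem}
    {Q : Mem → List Msg → ℕ → Prop} (n : ℕ) (J : ℕ → Mem → List Msg → ℕ → Prop)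
    (h0 : J 0 σ [] 0)
    (hs : ∀ i < n, ∀ σ o t, J i σ o t → b.ok E.maxWord K σ ∧ b.val σ ∧
      wp E K c σ fun σ' o' t' => J (i + 1) σ' (o ++ o') (t + (b.cost + t')))
    (hn : ∀ σ o t, J n σ o t → b.ok E.maxWord K σ ∧ ¬ b.val σ ∧ Q σ o (t + b.cost)) :
    wp E K (.loop b c) σ Q := by
  have key : ∀ m i, i + m = n → ∀ σ o t, J i σ o t →
      ∃ σ' o' t', Exec E (HC.loop b c).toC σ σ' o' t' ∧ Q σ' (o ++ o') (t + t') := by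
    intro m
    induction m with
    | zero =>
        intro i hi σ o t hJ
        obtain rfl : i = n := by omega
        obtain ⟨h1, h2, h3⟩ := hn σ o t hJ
        exact ⟨σ, [], _, .loopStop (HT.is hE h1) h2, by rw [HT.cost_toT, List.append_nil]; exact h3⟩
    | succ m ih =>
        intro i hi σ o t hJ
        obtain ⟨h1, h2, h3⟩ := hs i (by omega) σ o t hJ
        obtain ⟨σ1, o1, t1, e1, h4⟩ := wp_sound hE c h3
        obtain ⟨σ2, o2, t2, e2, h5⟩ := ih (i + 1) (by omega) _ _ _ h4
        refine ⟨σ2, _, _, .loopStep (HT.is hE h1) h2 e1 e2, ?_⟩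
        rw [HT.cost_toT]
        rw [List.append_assoc] at h5
        exact cast_time h5 (by omega)
  obtain ⟨σ', o', t', h1, h2⟩ := key n 0 (by omega) σ [] 0 h0
  exact ⟨σ', o', t', h1, by simpa using h2⟩

/-- A loop with `n` rounds that sends nothing, each round taking at most `M` steps. -/
theorem wp_silent_loop {E : Env} {K : ℕ} (hE : E.Fits K) {b : HT} {c : HC} {σ : Mem}
    {Q : Mem → List Msg → ℕ → Prop} (n M : ℕ) (J : ℕ → Mem → Prop)
    (h0 : J 0 σ)
    (hs : ∀ i < n, ∀ σ, J i σ → b.ok E.maxWord K σ ∧ b.val σ ∧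
      wp E K c σ fun σ' o t => o = [] ∧ b.cost + t ≤ M ∧ J (i + 1) σ')
    (hn : ∀ σ t, J n σ → t ≤ n * M + b.cost → b.ok E.maxWord K σ ∧ ¬ b.val σ ∧ Q σ [] t) :
    wp E K (.loop b c) σ Q := by
  refine wp_loop hE n (fun i σ o t => o = [] ∧ t ≤ i * M ∧ J i σ) ⟨rfl, by simp, h0⟩ ?_ ?_
  · rintro i hi σ o t ⟨rfl, ht, hJ⟩
    obtain ⟨h1, h2, h3⟩ := hs i hi σ hJ
    refine ⟨h1, h2, wp_mono c h3 ?_⟩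
    rintro σ' o t' ⟨rfl, h4, h5⟩
    exact ⟨rfl, by rw [add_mul]; omega, h5⟩
  · rintro σ o t ⟨rfl, ht, hJ⟩
    exact hn σ _ hJ (by omega)

-- From here on `wp` is unfolded through its equations only; otherwise unification would expand
-- whole programs.
attribute [irreducible] wp

infixr:60 " ;; " => HC.seq
infixl:65 " +ₑ " => HE.b Op.plus
infixl:65 " -ₑ " => HE.b Op.minus
infixl:70 " *ₑ " => HE.b Op.times
infixl:70 " /ₑ " => HE.b Op.quot
infixl:70 " %ₑ " => HE.b Op.rem
infix:50 " <ₑ " => HE.b Op.less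
infix:50 " =ₑ " => HE.b Op.equal

/-- A word variable. -/
abbrev HE.v (a : Fin 32) : HE := .w a (.c 0)

/-- Assignment to a word variable. -/
abbrev HC.set (a : Fin 32) (e : HE) : HC := .putW a (.c 0) e

attribute [simp] Op.apply

/-! ### Frame conditions, and stretches of rounds of a silent loop. -/

/-- The memories agree outside the given arrays. -/
structure Same (ws rs is : List (Fin 32)) (σ σ' : Mem) : Prop where
  W : ∀ a, a ∉ ws → σ'.W a = σ.W a
  R : ∀ a, a ∉ rs → σ'.R a = σ.R a
  I : ∀ a, a ∉ is → σ'.I a = σ.I a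

theorem Same.refl (ws rs is : List (Fin 32)) (σ : Mem) : Same ws rs is σ σ :=
  ⟨fun _ _ => rfl, fun _ _ => rfl, fun _ _ => rfl⟩

theorem Same.trans {ws rs is : List (Fin 32)} {σ σ' σ'' : Mem} (h : Same ws rs is σ σ')
    (h' : Same ws rs is σ' σ'') : Same ws rs is σ σ'' :=
  ⟨fun a ha => (h'.W a ha).trans (h.W a ha), fun a ha => (h'.R a ha).trans (h.R a ha),
    fun a ha => (h'.I a ha).trans (h.I a ha)⟩

theorem Same.mono {ws rs is ws' rs' is' : List (Fin 32)} {σ σ' : Mem} (h : Same ws rs is σ σ')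
    (hw : ws ⊆ ws') (hr : rs ⊆ rs') (hi : is ⊆ is') : Same ws' rs' is' σ σ' :=
  ⟨fun a ha => h.W a fun h => ha (hw h), fun a ha => h.R a fun h => ha (hr h),
    fun a ha => h.I a fun h => ha (hi h)⟩

theorem Same.setW {ws rs is : List (Fin 32)} {σ σ' : Mem} (h : Same ws rs is σ σ') (a : Fin 32)
    (ha : a ∈ ws) (i x : ℕ) : Same ws rs is σ (σ'.setW a i x) := by
  refine ⟨fun b hb => ?_, h.R, h.I⟩
  have : b ≠ a := by rintro rfl; exact hb ha
  funext j
  simp [this, h.W b hb]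

theorem Same.setR {ws rs is : List (Fin 32)} {σ σ' : Mem} (h : Same ws rs is σ σ') (a : Fin 32)
    (ha : a ∈ rs) (i : ℕ) (x : ℝ) : Same ws rs is σ (σ'.setR a i x) := by
  refine ⟨h.W, fun b hb => ?_, h.I⟩
  have : b ≠ a := by rintro rfl; exact hb ha
  funext j
  simp [this, h.R b hb]

theorem Same.setI {ws rs is : List (Fin 32)} {σ σ' : Mem} (h : Same ws rs is σ σ') (a : Fin 32)
    (ha : a ∈ is) (i : ℕ) (x : Option ℕ) : Same ws rs is σ (σ'.setI a i x) := by
  refine ⟨h.W, h.R, fun b hb => ?_⟩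
  have : b ≠ a := by rintro rfl; exact hb ha
  funext j
  simp [this, h.I b hb]

/-- Rounds of a loop that sends nothing. -/
inductive Iter (E : Env) (K : ℕ) (b : HT) (c : HC) : Mem → Mem → ℕ → Prop
  | refl (σ : Mem) : Iter E K b c σ σ 0
  | step {σ σ' σ'' : Mem} {t t' : ℕ} : b.ok E.maxWord K σ → b.val σ → Exec E c.toC σ σ' [] t →
      Iter E K b c σ' σ'' t' → Iter E K b c σ σ'' (b.cost + t + t')

/-- The selection runs in a single loop whose number of rounds is not known in advance. Its run is
composed of stretches of rounds, each supplied by an induction hypothesis. -/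
theorem Iter.trans {E : Env} {K : ℕ} {b : HT} {c : HC} {σ σ' σ'' : Mem} {t t' : ℕ}
    (h : Iter E K b c σ σ' t) (h' : Iter E K b c σ' σ'' t') : Iter E K b c σ σ'' (t + t') := by
  induction h with
  | refl σ => simpa using h'
  | step h1 h2 h3 _ ih =>
      rw [add_assoc]
      exact .step h1 h2 h3 (ih h')

theorem Iter.exec {E : Env} {K : ℕ} (hE : E.Fits K) {b : HT} {c : HC} {σ σ' : Mem} {t : ℕ}
    (h : Iter E K b c σ σ' t) (hb : b.ok E.maxWord K σ') (hb' : ¬ b.val σ') :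
    Exec E (HC.loop b c).toC σ σ' [] (t + b.cost) := by
  induction h with
  | refl σ =>
      rw [← HT.cost_toT, zero_add]
      exact .loopStop (HT.is hE hb) hb'
  | step h1 h2 h3 _ ih =>
      rw [add_assoc, ← HT.cost_toT]
      have := Exec.loopStep (HT.is hE h1) h2 h3 (ih hb hb')
      rwa [HT.cost_toT] at this ⊢

/-! ### Selection by medians of medians -/

/-- The segment of length `n` of the scratch array that starts at `b`. -/
def seg (σ : Mem) (b n : ℕ) : List ℝ := (List.range n).map fun j => σ.R 6 (b + j)

theorem seg_length (σ : Mem) (b n : ℕ) : (seg σ b n).length = n := by simp [seg]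

@[simp] theorem seg_setW (σ : Mem) (a : Fin 32) (i x b n : ℕ) :
    seg (σ.setW a i x) b n = seg σ b n := rfl

@[simp] theorem seg_setI (σ : Mem) (a : Fin 32) (i : ℕ) (x : Option ℕ) (b n : ℕ) :
    seg (σ.setI a i x) b n = seg σ b n := rfl

theorem seg_succ (σ : Mem) (b n : ℕ) : seg σ b (n + 1) = seg σ b n ++ [σ.R 6 (b + n)] := by
  simp [seg, List.range_succ]

theorem seg_congr {σ σ' : Mem} {b n : ℕ} (h : ∀ j, b ≤ j → j < b + n → σ'.R 6 j = σ.R 6 j) :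
    seg σ' b n = seg σ b n := by
  refine List.map_congr_left fun j hj => ?_
  rw [List.mem_range] at hj
  exact h _ (by omega) (by omega)

/-- Keeps the entries of the current segment that satisfy `b`; their number is stored. -/
def keep (b : HT) : HC :=
  .set 17 (.c 0) ;; .set 18 (.c 0) ;;
  .loop (.nz (.v 17 <ₑ .v 16))
    (.ite b (.putR 6 (.v 20 +ₑ .v 18) 6 (.v 20 +ₑ .v 17) ;; .set 18 (.v 18 +ₑ .c 1)) .skip ;;
      .set 17 (.v 17 +ₑ .c 1))

/-- The write position never overtakes the read position, so compaction in place destroys only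
entries that have been examined. The test has to be right only in memories that differ from `σ` in
what the loop itself changes. -/
theorem keep_spec {E : Env} {K : ℕ} (hE : E.Fits K) {b : HT} {p : ℝ → Bool} {σ : Mem}
    (hK : σ.W 20 0 + σ.W 16 0 ≤ K) (hK1 : 8 ≤ K)
    (hb : ∀ τ, Same [17, 18] [6] [] σ τ → τ.W 17 0 < σ.W 16 0 → b.ok E.maxWord K τ ∧
      b.cost ≤ 40 ∧ (b.val τ ↔ p (τ.R 6 (σ.W 20 0 + τ.W 17 0)) = true)) :
    wp E K (keep b) σ fun σ' o t => o = [] ∧ t ≤ 150 * σ.W 16 0 + 100 ∧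
      Same [17, 18] [6] [] σ σ' ∧ (∀ j < σ.W 20 0, σ'.R 6 j = σ.R 6 j) ∧
      seg σ' (σ.W 20 0) (σ'.W 18 0) = (seg σ (σ.W 20 0) (σ.W 16 0)).filter p := by
  have hw := hE.word
  simp [keep]
  and_intros
  all_goals try omega
  refine wp_silent_loop hE (σ.W 16 0) 150 (fun i τ => Same [17, 18] [6] [] σ τ ∧ τ.W 17 0 = i ∧
    τ.W 18 0 ≤ i ∧ (∀ j, j < σ.W 20 0 ∨ σ.W 20 0 + i ≤ j → τ.R 6 j = σ.R 6 j) ∧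
    seg τ (σ.W 20 0) (τ.W 18 0) = (seg σ (σ.W 20 0) i).filter p) ?_ ?_ ?_
  · refine ⟨((Same.refl _ _ _ σ).setW _ (by simp) _ _).setW _ (by simp) _ _, by simp, by simp,
      by simp, by simp [seg]⟩
  · rintro i hi τ ⟨hS, h17, h18, hR, hseg⟩
    have h16 := congrFun (hS.W 16 (by decide)) 0
    have h20 := congrFun (hS.W 20 (by decide)) 0
    obtain ⟨hb1, hb2, hb3⟩ := hb τ hS (by omega)
    have hRi := hR (σ.W 20 0 + i) (by omega)
    simp [h16, h17, h20, hi]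
    rw [h17, hRi] at hb3
    and_intros
    all_goals try omega
    all_goals intro hv
    · have hp := hb3.1 hv
      and_intros
      all_goals try omega
      · exact ((hS.setR _ (by simp) _ _).setW _ (by simp) _ _).setW _ (by simp) _ _
      · intro j hj
        rw [if_neg (by omega), hR j (by omega)]
      · rw [seg_succ, seg_succ, List.filter_append, ← hseg]
        simp [hp, hRi]
        refine seg_congr fun j hj hj' => ?_
        simp
        omega
    · have hp : p (σ.R 6 (σ.W 20 0 + i)) = false := by simpa [hb3] using hv
      and_intros
      all_goals try omega
      · exact hS.setW _ (by simp) _ _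
      · exact fun j hj => hR j (by omega)
      · rw [seg_succ, List.filter_append, ← hseg]
        simp [hp]
  · rintro τ t ⟨hS, h17, h18, hR, hseg⟩ ht
    have h16 := congrFun (hS.W 16 (by decide)) 0
    simp [h16, h17] at ht ⊢
    exact ⟨by omega, by omega, hS, fun j hj => hR j (Or.inl hj), hseg⟩

/-- Counts the entries of the segment given by the variables `21` and `22` that exceed `v`. -/
def countGt : HC :=
  .set 23 (.c 0) ;; .set 19 (.c 0) ;;
  .loop (.nz (.v 23 <ₑ .v 22))
    (.ite (.lt 7 (.c 0) 6 (.v 21 +ₑ .v 23)) (.set 19 (.v 19 +ₑ .c 1)) .skip ;;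
      .set 23 (.v 23 +ₑ .c 1))

theorem countGt_spec {E : Env} {K : ℕ} (hE : E.Fits K) {σ : Mem}
    (hK : σ.W 21 0 + σ.W 22 0 ≤ K) (hK1 : 8 ≤ K) :
    wp E K countGt σ fun σ' o t => o = [] ∧ t ≤ 150 * σ.W 22 0 + 100 ∧
      Same [19, 23] [] [] σ σ' ∧
      σ'.W 19 0 = (seg σ (σ.W 21 0) (σ.W 22 0)).countP fun x => decide (σ.R 7 0 < x) := by
  have hw := hE.word
  simp [countGt]
  and_intros
  all_goals try omega
  refine wp_silent_loop hE (σ.W 22 0) 150 (fun i τ => Same [19, 23] [] [] σ τ ∧ τ.W 23 0 = i ∧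
    τ.W 19 0 ≤ i ∧
    τ.W 19 0 = (seg σ (σ.W 21 0) i).countP fun x => decide (σ.R 7 0 < x)) ?_ ?_ ?_
  · refine ⟨((Same.refl _ _ _ σ).setW _ (by simp) _ _).setW _ (by simp) _ _, by simp, by simp,
      by simp [seg]⟩
  · rintro i hi τ ⟨hS, h23, h19, hc⟩
    have h22 := congrFun (hS.W 22 (by decide)) 0
    have h21 := congrFun (hS.W 21 (by decide)) 0
    have h6 := hS.R 6 (by decide)
    have h7 := hS.R 7 (by decide)
    simp [h22, h21, h23, hi, h6, h7]
    and_intros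
    all_goals try omega
    all_goals intro hv
    · and_intros
      all_goals try omega
      · exact (hS.setW _ (by simp) _ _).setW _ (by simp) _ _
      · rw [seg_succ, List.countP_append, ← hc]
        simp [hv]
    · and_intros
      all_goals try omega
      · exact hS.setW _ (by simp) _ _
      · rw [seg_succ, List.countP_append, ← hc]
        simp [hv]
  · rintro τ t ⟨hS, h23, h19, hc⟩ ht
    have h22 := congrFun (hS.W 22 (by decide)) 0
    simp [h22, h23] at ht ⊢
    exact ⟨by omega, by omega, hS, hc⟩

/-- Writes the medians of the groups of five entries behind the current segment. -/
def medians : HC :=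
  .set 22 (.c 5) ;; .set 24 (.v 16 /ₑ .c 5 *ₑ .c 5) ;; .set 17 (.c 0) ;;
  .loop (.nz (.v 17 <ₑ .v 24))
    (.putR 7 (.c 0) 6 (.v 20 +ₑ .v 17) ;; .set 21 (.v 20 +ₑ .v 17 /ₑ .c 5 *ₑ .c 5) ;; countGt ;;
      .ite (.nz (.v 19 =ₑ .c 2)) (.putR 6 (.v 20 +ₑ .v 16 +ₑ .v 17 /ₑ .c 5) 6 (.v 20 +ₑ .v 17)) .skip ;;
      .set 17 (.v 17 +ₑ .c 1))

/-- The number of entries in its group of five that exceed entry `x`. -/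
def above (f : ℕ → ℝ) (x : ℕ) : ℕ :=
  ((List.range 5).map fun r => f (x / 5 * 5 + r)).countP fun y => decide (f x < y)

/-- An entry is a median of its group when exactly two members exceed it, so each entry is tested by
a count over its group and nothing is sorted. The medians go behind the segment, which must stay
intact for the later round with the pivot. -/
theorem medians_spec {E : Env} {K : ℕ} (hE : E.Fits K) {σ : Mem}
    (hK : σ.W 20 0 + σ.W 16 0 + σ.W 16 0 / 5 ≤ K) (hK1 : 8 ≤ K) {f : ℕ → ℝ}
    (hf : ∀ j, f j = σ.R 6 (σ.W 20 0 + j))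
    (hmed : ∀ q < σ.W 16 0 / 5, ∃ r < 5, above f (5 * q + r) = 2) :
    wp E K medians σ fun σ' o t => o = [] ∧ t ≤ 1000 * σ.W 16 0 + 200 ∧
      Same [17, 19, 21, 22, 23, 24] [6, 7] [] σ σ' ∧
      (∀ j < σ.W 20 0 + σ.W 16 0, σ'.R 6 j = σ.R 6 j) ∧
      ∀ q < σ.W 16 0 / 5, ∃ r < 5, σ'.R 6 (σ.W 20 0 + σ.W 16 0 + q) = f (5 * q + r) ∧
        above f (5 * q + r) = 2 := by
  have hw := hE.word
  simp [medians]
  and_intros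
  all_goals try omega
  -- The loop stops at a multiple of five: an incomplete last group has no median and is ignored.
  refine wp_silent_loop hE (σ.W 16 0 / 5 * 5) 1000 (fun i τ =>
    Same [17, 19, 21, 22, 23, 24] [6, 7] [] σ τ ∧ τ.W 17 0 = i ∧ τ.W 22 0 = 5 ∧
    τ.W 24 0 = σ.W 16 0 / 5 * 5 ∧
    (∀ j < σ.W 20 0 + σ.W 16 0, τ.R 6 j = σ.R 6 j) ∧
    ∀ q r, r < 5 → 5 * q + r < i → above f (5 * q + r) = 2 →
      ∃ r < 5, τ.R 6 (σ.W 20 0 + σ.W 16 0 + q) = f (5 * q + r) ∧ above f (5 * q + r) = 2) ?_ ?_ ?_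
  · refine ⟨(((Same.refl _ _ _ σ).setW _ (by simp) _ _).setW _ (by simp) _ _).setW _ (by simp) _ _,
      by simp, by simp, by simp, by simp, by simp⟩
  · rintro i hi τ ⟨hS, h17, h22, h24, hR, hm⟩
    have h16 := congrFun (hS.W 16 (by decide)) 0
    have h20 := congrFun (hS.W 20 (by decide)) 0
    simp [h20, h17, hi, h24]
    and_intros
    all_goals try omega
    refine wp_mono _ (countGt_spec hE ?_ hK1) ?_
    · simp [h22]; omega
    rintro τ' o t ⟨rfl, ht, hS', hc⟩
    have k20 := congrFun (hS'.W 20 (by decide)) 0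
    have k17 := congrFun (hS'.W 17 (by decide)) 0
    have k16 := congrFun (hS'.W 16 (by decide)) 0
    have k22 := congrFun (hS'.W 22 (by decide)) 0
    have k24 := congrFun (hS'.W 24 (by decide)) 0
    have k6 := hS'.R 6 (by decide)
    simp [h16, h17, h20, h22, h24] at k20 k17 k16 k22 k24 ht
    have hab : τ'.W 19 0 = above f i := by
      rw [hc, above, seg]
      simp only [W_setW, W_setR, h22]
      congr 1
      · funext y
        simp [hf, hR (σ.W 20 0 + i) (by omega)]
      · simp
        intro r hr
        rw [hf, ← add_assoc]
        exact hR _ (by omega)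
    have hS2 : Same [17, 19, 21, 22, 23, 24] [6, 7] [] σ τ' :=
      ((hS.setR 7 (by simp) 0 (τ.R 6 (σ.W 20 0 + i))).setW 21 (by simp) 0
        (σ.W 20 0 + i / 5 * 5)).trans (hS'.mono (by decide) (by decide) (by decide))
    have hR2 : ∀ j, τ'.R 6 j = τ.R 6 j := fun j => by simp [k6]
    simp [k20, k17, k16, k22, k24, hab]
    and_intros
    all_goals try omega
    · split_ifs <;> omega
    all_goals intro h2
    · and_intros
      all_goals try omega
      · exact (hS2.setR _ (by simp) _ _).setW _ (by simp) _ _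
      · intro j hj
        rw [if_neg (by omega), hR2, hR j hj]
      · intro q r hr hlt h3
        by_cases hq : q = i / 5
        · subst hq
          refine ⟨i % 5, Nat.mod_lt _ (by norm_num), ?_, ?_⟩
          · rw [if_pos rfl, hR2, hR _ (by omega), hf]
            congr 1; omega
          · rwa [Nat.div_add_mod]
        · obtain ⟨r', hr', h4, h5⟩ := hm q r hr (by omega) h3
          exact ⟨r', hr', by rw [if_neg hq, hR2, h4], h5⟩
    · and_intros
      all_goals try omega
      · exact hS2.setW _ (by simp) _ _
      · intro j hj
        rw [hR2, hR j hj]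
      · intro q r hr hlt h3
        by_cases hq : 5 * q + r = i
        · rw [hq] at h3; exact absurd h3 h2
        · obtain ⟨r', hr', h4, h5⟩ := hm q r hr (by omega) h3
          exact ⟨r', hr', by rw [hR2, h4], h5⟩
  · rintro τ t ⟨hS, h17, h22, h24, hR, hm⟩ ht
    simp [h24, h17] at ht ⊢
    refine ⟨by omega, by omega, hS, hR, fun q hq => ?_⟩
    obtain ⟨r, hr, h2⟩ := hmed q hq
    exact hm q r hr (by omega) h2

/-! ### Ranks in finite sets, and the quality of the median of the medians. -/

/-- The number of larger values strictly decreases as `v` increases, so it is injective on `A`; its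
values lie below `A.card`, so all of them are attained. -/
theorem exists_rank {ι : Type*} (A : Finset ι) {v : ι → ℝ} (hv : Set.InjOn v A) {m : ℕ}
    (hm : m < A.card) : ∃ i ∈ A, (A.filter fun j => v i < v j).card = m := by
  classical
  have hlt : ∀ i ∈ A, ∀ j ∈ A, v i < v j →
      (A.filter fun l => v j < v l).card < (A.filter fun l => v i < v l).card := by
    intro i _ j hj hij
    refine Finset.card_lt_card ⟨fun l hl => ?_, fun h => ?_⟩
    · rw [Finset.mem_filter] at hl ⊢
      exact ⟨hl.1, hij.trans hl.2⟩
    · have := h (Finset.mem_filter.2 ⟨hj, hij⟩)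
      simp at this
  have hinj : Set.InjOn (fun i => (A.filter fun l => v i < v l).card) A := by
    intro i hi j hj hij
    by_contra hne
    rcases lt_or_gt_of_ne (fun h => hne (hv hi hj h)) with h | h
    · have := hlt i hi j hj h; simp only at hij; omega
    · have := hlt j hj i hi h; simp only at hij; omega
  have himg : A.image (fun i => (A.filter fun l => v i < v l).card) = Finset.range A.card := by
    apply Finset.eq_of_subset_of_card_le
    · intro x hx
      obtain ⟨i, hi, rfl⟩ := Finset.mem_image.1 hx
      rw [Finset.mem_range]
      refine Finset.card_lt_card ⟨Finset.filter_subset _ _, fun h => ?_⟩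
      have := h hi
      simp at this
    · rw [Finset.card_image_of_injOn hinj, Finset.card_range]
  have := Finset.mem_range.2 hm
  rw [← himg] at this
  simpa using this

theorem countP_range (n : ℕ) (p : ℕ → Prop) [DecidablePred p] :
    (List.range n).countP (fun j => decide (p j)) = ((Finset.range n).filter p).card := by
  rw [List.countP_eq_length_filter]
  rfl

theorem countP_seg (σ : Mem) (b n : ℕ) (p : ℝ → Prop) [DecidablePred p] :
    (seg σ b n).countP (fun x => decide (p x)) =
      ((Finset.range n).filter fun j => p (σ.R 6 (b + j))).card := by
  rw [seg, List.countP_map]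
  exact countP_range n fun j => p (σ.R 6 (b + j))

theorem above_eq (f : ℕ → ℝ) (q r : ℕ) (hr : r < 5) : above f (5 * q + r) =
    ((Finset.range 5).filter fun l => f (5 * q + r) < f (5 * q + l)).card := by
  have : (5 * q + r) / 5 * 5 = 5 * q := by omega
  rw [above, List.countP_map, this]
  exact countP_range 5 fun l => f (5 * q + r) < f (5 * q + l)

theorem card_filter_blocks (g : ℕ) (p : ℕ → Prop) [DecidablePred p] :
    ((Finset.range (5 * g)).filter p).card =
      ∑ q ∈ Finset.range g, ((Finset.range 5).filter fun r => p (5 * q + r)).card := by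
  induction g with
  | zero => simp
  | succ g ih =>
      rw [Finset.sum_range_succ, ← ih, Finset.card_filter, Finset.card_filter, Finset.card_filter,
        mul_add, mul_one, Finset.sum_range_add]

/-- The groups are disjoint and each marked one contributes three indices; what an incomplete last
group contributes is dropped. -/
theorem le_card_filter_of_blocks {n : ℕ} (p : ℕ → Prop) [DecidablePred p] (m : ℕ → Prop)
    [DecidablePred m]
    (h : ∀ q < n / 5, m q → 3 ≤ ((Finset.range 5).filter fun r => p (5 * q + r)).card) :
    3 * ((Finset.range (n / 5)).filter m).card ≤ ((Finset.range n).filter p).card := by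
  calc 3 * ((Finset.range (n / 5)).filter m).card
      = ∑ q ∈ (Finset.range (n / 5)).filter m, 3 := by rw [Finset.sum_const, smul_eq_mul, mul_comm]
    _ ≤ ∑ q ∈ (Finset.range (n / 5)).filter m, ((Finset.range 5).filter fun r => p (5 * q + r)).card :=
        Finset.sum_le_sum fun q hq => by
          rw [Finset.mem_filter, Finset.mem_range] at hq
          exact h q hq.1 hq.2
    _ ≤ ∑ q ∈ Finset.range (n / 5), ((Finset.range 5).filter fun r => p (5 * q + r)).card :=
        Finset.sum_le_sum_of_subset (Finset.filter_subset _ _)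
    _ = ((Finset.range (5 * (n / 5))).filter p).card := (card_filter_blocks _ _).symm
    _ ≤ _ := Finset.card_le_card (Finset.filter_subset_filter _
        (Finset.range_subset_range.2 (Nat.mul_div_le n 5)))

theorem exists_median {f : ℕ → ℝ} {n : ℕ} (hf : Set.InjOn f (Finset.range n : Set ℕ)) {q : ℕ}
    (hq : q < n / 5) : ∃ r < 5, above f (5 * q + r) = 2 := by
  obtain ⟨r, hr, h⟩ := exists_rank (Finset.range 5) (v := fun r => f (5 * q + r)) (m := 2) (by
    intro a ha b hb hab
    simp only [Finset.coe_range, Set.mem_Iio] at ha hb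
    have := hf (by simp; omega) (by simp; omega) hab
    omega) (by simp)
  rw [Finset.mem_range] at hr
  exact ⟨r, hr, by rw [above_eq f q r hr, h]⟩

/-- The median `v` of the medians `m q` of the groups of five has few entries on either side. -/
theorem median_of_medians {f m : ℕ → ℝ} {n : ℕ}
    (hm : ∀ q < n / 5, ∃ r < 5, m q = f (5 * q + r) ∧ above f (5 * q + r) = 2) {v : ℝ}
    (hv : ∃ q < n / 5, m q = v)
    (hrk : ((Finset.range (n / 5)).filter fun q => v < m q).card = n / 10) :
    ((Finset.range n).filter fun j => v < f j).card ≤ n - 3 * (n / 5 - n / 10) ∧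
      ((Finset.range n).filter fun j => f j < v).card ≤ n - 3 * (n / 10 + 1) := by
  constructor
  -- A group whose median is at most `v` has three entries not above `v`: all five except the two
  -- above its median.
  · have h1 := le_card_filter_of_blocks (n := n) (fun j => ¬ v < f j) (fun q => ¬ v < m q) (by
      intro q hq hmq
      obtain ⟨r, hr, h1, h2⟩ := hm q hq
      rw [above_eq f q r hr] at h2
      have h3 := Finset.card_filter_add_card_filter_not (s := Finset.range 5)
        (fun l => f (5 * q + r) < f (5 * q + l))
      rw [Finset.card_range] at h3
      have h4 : ((Finset.range 5).filter fun l => ¬ f (5 * q + r) < f (5 * q + l)).card ≤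
          ((Finset.range 5).filter fun l => ¬ v < f (5 * q + l)).card := by
        refine Finset.card_le_card fun l hl => ?_
        rw [Finset.mem_filter] at hl ⊢
        exact ⟨hl.1, fun h => hl.2 (lt_of_le_of_lt (h1 ▸ not_lt.1 hmq) h)⟩
      omega)
    have h2 := Finset.card_filter_add_card_filter_not (s := Finset.range n) (fun j => v < f j)
    have h3 := Finset.card_filter_add_card_filter_not (s := Finset.range (n / 5)) (fun q => v < m q)
    rw [Finset.card_range] at h2 h3
    omega
  -- A group whose median is at least `v` has three entries not below `v`: the median and the two
  -- above it. The group with median `v` itself accounts for the extra one in `n / 10 + 1`.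
  · have h1 := le_card_filter_of_blocks (n := n) (fun j => ¬ f j < v) (fun q => v ≤ m q) (by
      intro q hq hmq
      obtain ⟨r, hr, h1, h2⟩ := hm q hq
      rw [above_eq f q r hr] at h2
      have h4 : insert r ((Finset.range 5).filter fun l => f (5 * q + r) < f (5 * q + l)) ⊆
          ((Finset.range 5).filter fun l => ¬ f (5 * q + l) < v) := by
        intro l hl
        rw [Finset.mem_insert, Finset.mem_filter] at hl
        rw [Finset.mem_filter]
        rcases hl with rfl | hl
        · exact ⟨Finset.mem_range.2 hr, not_lt.2 (h1 ▸ hmq)⟩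
        · exact ⟨hl.1, not_lt.2 ((h1 ▸ hmq).trans hl.2.le)⟩
      have := Finset.card_le_card h4
      rw [Finset.card_insert_of_notMem (by simp)] at this
      omega)
    have h2 := Finset.card_filter_add_card_filter_not (s := Finset.range n) (fun j => f j < v)
    rw [Finset.card_range] at h2
    have h3 : ((Finset.range (n / 5)).filter fun q => v < m q).card + 1 ≤
        ((Finset.range (n / 5)).filter fun q => v ≤ m q).card := by
      obtain ⟨q, hq, h⟩ := hv
      rw [← Finset.card_insert_of_notMem
        (s := (Finset.range (n / 5)).filter fun q => v < m q) (a := q) (by simp [h])]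
      refine Finset.card_le_card fun l hl => ?_
      rw [Finset.mem_insert, Finset.mem_filter] at hl
      rw [Finset.mem_filter]
      rcases hl with rfl | hl
      · exact ⟨Finset.mem_range.2 hq, h.ge⟩
      · exact ⟨hl.1, hl.2.le⟩
    omega

/-! ### Ranks on either side of a pivot. -/

theorem countP_split {L : List ℝ} (hL : L.Nodup) {v : ℝ} (hv : v ∈ L) :
    (L.filter fun x => decide (v < x)).length + (L.filter fun x => decide (x < v)).length + 1 =
      L.length := by
  have h1 := List.length_eq_length_filter_add (l := L) (fun x => decide (v < x))
  have h2 := List.length_eq_length_filter_add (l := L.filter fun x => !decide (v < x))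
    (fun x => decide (x < v))
  rw [List.filter_filter, List.filter_filter] at h2
  have h3 : (L.filter fun x => (decide (x < v) && !decide (v < x))) =
      L.filter fun x => decide (x < v) := by
    refine List.filter_congr fun x _ => ?_
    by_cases h : x < v <;> simp [h, le_of_lt]
  have h4 : (L.filter fun x => (!decide (x < v) && !decide (v < x))).length = 1 := by
    have : (L.filter fun x => (!decide (x < v) && !decide (v < x))) = L.filter (· == v) := by
      refine List.filter_congr fun x _ => ?_
      rcases lt_trichotomy x v with h | rfl | h
      · simp [h, h.ne]
      · simp
      · simp [h, h.ne']
    rw [this, ← List.countP_eq_length_filter]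
    exact List.count_eq_one_of_mem hL hv
  rw [h3, h4] at h2
  omega

/-- Everything above `x` lies on the upper side of the pivot, so the rank asked for does not change
when the search moves there. -/
theorem countP_of_gt {L : List ℝ} {v x : ℝ} (hx : v < x) :
    L.countP (fun y => decide (x < y)) =
      (L.filter fun y => decide (v < y)).countP fun y => decide (x < y) := by
  rw [List.countP_filter]
  refine List.countP_congr fun y _ => ?_
  simp only [Bool.and_eq_true, decide_eq_true_eq]
  exact ⟨fun h => ⟨h, hx.trans h⟩, fun h => h.1⟩

/-- Below the pivot, the whole upper side and the pivot itself count as larger; this is why the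
program lowers the rank by `g + 1` when it moves to the lower side. -/
theorem countP_of_lt {L : List ℝ} (hL : L.Nodup) {v x : ℝ} (hv : v ∈ L) (hx : x < v) :
    L.countP (fun y => decide (x < y)) =
      ((L.filter fun y => decide (y < v)).countP fun y => decide (x < y)) +
        L.countP (fun y => decide (v < y)) + 1 := by
  have hA := countP_split hL hv
  have hA' := List.length_eq_length_filter_add (l := L) (fun y => decide (x < y))
  have hB := List.length_eq_length_filter_add (l := L.filter fun y => decide (y < v))
    (fun y => decide (x < y))
  rw [List.filter_filter] at hB
  rw [List.filter_filter] at hB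
  have h3 : (L.filter fun y => (!decide (x < y) && decide (y < v))) =
      L.filter fun y => !decide (x < y) := by
    refine List.filter_congr fun y _ => ?_
    by_cases h : x < y
    · simp [h]
    · simp [h, lt_of_le_of_lt (not_lt.1 h) hx]
  rw [h3] at hB
  rw [List.countP_filter, List.countP_eq_length_filter, List.countP_eq_length_filter,
    List.countP_eq_length_filter]
  omega

/-! ### Selection with an explicit stack of subproblems. -/

/-- A round with a pivot `v` for the top frame. -/
def pivotStep : HC :=
  .set 16 (.w 8 (.v 14)) ;; .set 20 (.w 7 (.v 14)) ;; .set 21 (.v 20) ;; .set 22 (.v 16) ;;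
  countGt ;;
  .ite (.nz (.v 19 =ₑ .w 9 (.v 14))) (.set 14 (.v 14 -ₑ .c 1))
    (.ite (.nz (.w 9 (.v 14) <ₑ .v 19))
      (keep (.lt 7 (.c 0) 6 (.v 20 +ₑ .v 17)) ;; .putW 8 (.v 14) (.v 18) ;; .set 15 (.c 0))
      (keep (.lt 6 (.v 20 +ₑ .v 17) 7 (.c 0)) ;; .putW 8 (.v 14) (.v 18) ;;
        .putW 9 (.v 14) (.w 9 (.v 14) -ₑ (.v 19 +ₑ .c 1)) ;; .set 15 (.c 0)))

/-- A round that looks for a pivot for the top frame. -/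
def splitStep : HC :=
  .set 16 (.w 8 (.v 14)) ;; .set 20 (.w 7 (.v 14)) ;;
  .ite (.nz (.v 16 <ₑ .c 100)) (.putR 7 (.c 0) 6 (.v 20) ;; .set 15 (.c 1))
    (medians ;; .set 14 (.v 14 +ₑ .c 1) ;; .putW 7 (.v 14) (.v 20 +ₑ .v 16) ;;
      .putW 8 (.v 14) (.v 16 /ₑ .c 5) ;; .putW 9 (.v 14) (.v 16 /ₑ .c 10))

/-- The word arrays used by the selection. -/
abbrev selW : List (Fin 32) := [7, 8, 9, 14, 15, 16, 17, 18, 19, 20, 21, 22, 23, 24]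

/-- The memories agree below frame `D`, whose segment starts at `lo`. -/
structure Below (D lo : ℕ) (σ σ' : Mem) : Prop where
  same : Same selW [6, 7] [] σ σ'
  Q : ∀ j < lo, σ'.R 6 j = σ.R 6 j
  lo : ∀ d < D, σ'.W 7 d = σ.W 7 d
  len : ∀ d < D, σ'.W 8 d = σ.W 8 d
  rk : ∀ d < D, σ'.W 9 d = σ.W 9 d

theorem Below.trans {D lo : ℕ} {σ σ' σ'' : Mem} (h : Below D lo σ σ') (h' : Below D lo σ' σ'') :
    Below D lo σ σ'' :=
  ⟨h.same.trans h'.same, fun j hj => (h'.Q j hj).trans (h.Q j hj),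
    fun j hj => (h'.lo j hj).trans (h.lo j hj), fun j hj => (h'.len j hj).trans (h.len j hj),
    fun j hj => (h'.rk j hj).trans (h.rk j hj)⟩

theorem Below.mono {D lo D' lo' : ℕ} {σ σ' : Mem} (h : Below D lo σ σ') (hD : D' ≤ D)
    (hlo : lo' ≤ lo) : Below D' lo' σ σ' :=
  ⟨h.same, fun j hj => h.Q j (hj.trans_le hlo), fun j hj => h.lo j (hj.trans_le hD),
    fun j hj => h.len j (hj.trans_le hD), fun j hj => h.rk j (hj.trans_le hD)⟩

/-- The top frame is number `D`; it asks for the entry with exactly `rk` larger entries in the segment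
of length `n` that starts at `lo`. -/
structure Frame (σ : Mem) (D lo n rk : ℕ) : Prop where
  d : σ.W 14 0 = D
  lo : σ.W 7 D = lo
  len : σ.W 8 D = n
  rk : σ.W 9 D = rk

/-- When the pivot is the answer, the frame is popped while real variable `7` and the flag in word
variable `15` stay as they are. The flag means that a pivot is present, so a solved subproblem hands
its answer to the frame below as the pivot there. Otherwise the frame shrinks to one side and the
flag is cleared, as a new pivot is needed. -/
theorem pivotStep_spec {E : Env} {K : ℕ} (hE : E.Fits K) {σ : Mem} {D lo n rk : ℕ}
    (hF : Frame σ D lo n rk) (hK : lo + n ≤ K) (hD : D < K) (hK1 : 8 ≤ K) (hrk : rk < n) :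
    wp E K pivotStep σ fun σ' o t => o = [] ∧ t ≤ 300 * n + 400 ∧ Below D lo σ σ' ∧
      (let g := (seg σ lo n).countP fun x => decide (σ.R 7 0 < x)
       σ'.R 7 0 = σ.R 7 0 ∧
       ((g = rk ∧ σ'.W 15 0 = σ.W 15 0 ∧ σ'.W 14 0 = D - 1) ∨
        (rk < g ∧ σ'.W 15 0 = 0 ∧ Frame σ' D lo g rk ∧
          seg σ' lo g = (seg σ lo n).filter fun x => decide (σ.R 7 0 < x)) ∨
        (g < rk ∧ σ'.W 15 0 = 0 ∧ ∃ m, Frame σ' D lo m (rk - (g + 1)) ∧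
          seg σ' lo m = (seg σ lo n).filter fun x => decide (x < σ.R 7 0)))) := by
  have hw := hE.word
  obtain ⟨hd, hlo, hlen, hrk'⟩ := hF
  simp [pivotStep, hd, hlo, hlen]
  and_intros
  all_goals try omega
  refine wp_mono _ (countGt_spec hE ?_ hK1) ?_
  · simp; omega
  rintro τ o t ⟨rfl, ht, hS, hg⟩
  have k16 := congrFun (hS.W 16 (by decide)) 0
  have k20 := congrFun (hS.W 20 (by decide)) 0
  have k14 := congrFun (hS.W 14 (by decide)) 0
  have k9 := congrFun (hS.W 9 (by decide))
  have k8 := congrFun (hS.W 8 (by decide))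
  have k7 := congrFun (hS.W 7 (by decide))
  have k15 := congrFun (hS.W 15 (by decide))
  have r6 := hS.R 6 (by decide)
  have r7 := hS.R 7 (by decide)
  have hseg : seg τ lo n = seg σ lo n := seg_congr fun j _ _ => by simp [r6]
  simp [hd] at k16 k20 k14 k8 k9 k7 k15 ht hg r6 r7
  have hB : Below D lo σ τ := by
    refine ⟨?_, fun j _ => by simp [r6], fun j _ => by simp [k7], fun j _ => by simp [k8],
      fun j _ => by simp [k9]⟩
    refine Same.trans ?_ (hS.mono (by decide) (by decide) (by decide))
    exact ((((Same.refl _ _ _ σ).setW _ (by simp) _ _).setW _ (by simp) _ _).setW _ (by simp) _ _).setW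
      _ (by simp) _ _
  generalize hgg : (seg σ lo n).countP (fun x => decide (σ.R 7 0 < x)) = g at *
  replace hg := hg.trans hgg
  simp [k14, k9, hrk', hg]
  and_intros
  all_goals try omega
  · split_ifs <;> omega
  · intro h
    and_intros
    all_goals try omega
    · exact ⟨hB.same.setW _ (by simp) _ _, hB.Q, by simpa using hB.lo, by simpa using hB.len,
        by simpa using hB.rk⟩
    · rw [r7]
    · exact Or.inl ⟨h, by rw [k15]⟩
  · intro h
    and_intros
    all_goals try omega
    · split_ifs <;> omega
    · intro h1
      refine wp_mono _ (keep_spec hE (p := fun x => decide (σ.R 7 0 < x)) ?_ hK1 ?_) ?_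
      · omega
      · intro τ' hS' h17
        have l20 := congrFun (hS'.W 20 (by decide)) 0
        have s7 := hS'.R 7 (by decide)
        simp [l20, k20, s7, r7]
        and_intros
        all_goals omega
      · rintro τ' o t' ⟨rfl, ht', hS', hQ, hs⟩
        have l14 := congrFun (hS'.W 14 (by decide)) 0
        have l9 := congrFun (hS'.W 9 (by decide))
        have l8 := congrFun (hS'.W 8 (by decide))
        have l7 := congrFun (hS'.W 7 (by decide))
        have s7 := hS'.R 7 (by decide)
        rw [k20, k16, hseg] at hs
        have hlen' := congrArg List.length hs
        rw [seg_length, ← List.countP_eq_length_filter, hgg] at hlen'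
        simp [l14, k14]
        and_intros
        all_goals try omega
        · refine hB.trans ⟨((hS'.mono (by decide) (by decide) (by decide)).setW 8 (by simp) _ _).setW
            15 (by simp) _ _, fun j hj => by simp; exact hQ j (by omega), fun d hd => by simp [l7],
            fun d hd => ?_, fun d hd => by simp [l9]⟩
          have : d ≠ D := by omega
          simp [l8, this]
        · rw [s7, r7]
        · refine Or.inr (Or.inl ⟨h1, ⟨by simp [l14, k14], by simp [l7, k7, hlo],
            by simp [hlen'], by simp [l9, k9, hrk']⟩, ?_⟩)
          rw [hlen'] at hs
          exact hs
    · intro h1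
      refine wp_mono _ (keep_spec hE (p := fun x => decide (x < σ.R 7 0)) ?_ hK1 ?_) ?_
      · omega
      · intro τ' hS' h17
        have l20 := congrFun (hS'.W 20 (by decide)) 0
        have s7 := hS'.R 7 (by decide)
        simp [l20, k20, s7, r7]
        and_intros
        all_goals omega
      · rintro τ' o t' ⟨rfl, ht', hS', hQ, hs⟩
        have l14 := congrFun (hS'.W 14 (by decide)) 0
        have l19 := congrFun (hS'.W 19 (by decide)) 0
        have l9 := congrFun (hS'.W 9 (by decide))
        have l8 := congrFun (hS'.W 8 (by decide))
        have l7 := congrFun (hS'.W 7 (by decide))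
        have s7 := hS'.R 7 (by decide)
        rw [k20, k16, hseg] at hs
        have hlen' := congrArg List.length hs
        rw [seg_length, ← List.countP_eq_length_filter] at hlen'
        have hle := List.countP_le_length (l := seg σ lo n) (p := fun x => decide (x < σ.R 7 0))
        rw [seg_length] at hle
        simp [l14, k14, l9, k9, hrk', l19, hg]
        and_intros
        all_goals try omega
        · refine hB.trans ⟨(((hS'.mono (by decide) (by decide) (by decide)).setW 8 (by simp) _ _).setW
            9 (by simp) _ _).setW 15 (by simp) _ _, fun j hj => by simp; exact hQ j (by omega),
            fun d hd => by simp [l7], fun d hd => ?_, fun d hd => ?_⟩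
          all_goals have : d ≠ D := by omega
          all_goals simp [l8, l9, this]
        · rw [s7, r7]
        · refine Or.inr (Or.inr ⟨by omega, τ'.W 18 0, ⟨by simp [l14, k14], by simp [l7, k7, hlo],
            by simp, by simp⟩, ?_⟩)
          exact hs

theorem splitStep_small {E : Env} {K : ℕ} (hE : E.Fits K) {σ : Mem} {D lo n rk : ℕ}
    (hF : Frame σ D lo n rk) (hK : lo + n ≤ K) (hD : D < K) (hK1 : 8 ≤ K) (hrk : rk < n)
    (hn : n < 100) :
    wp E K splitStep σ fun σ' o t => o = [] ∧ t ≤ 100 ∧ Below D lo σ σ' ∧ Frame σ' D lo n rk ∧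
      σ'.W 15 0 = 1 ∧ seg σ' lo n = seg σ lo n ∧ σ'.R 7 0 = σ.R 6 lo := by
  have hw := hE.word
  obtain ⟨hd, hlo, hlen, hrk'⟩ := hF
  simp [splitStep, hd, hlo, hlen, hn]
  and_intros
  all_goals try omega
  · refine ⟨?_, fun j _ => by simp, fun j _ => by simp, fun j _ => by simp, fun j _ => by simp⟩
    exact ((((Same.refl _ _ _ σ).setW _ (by simp) _ _).setW _ (by simp) _ _).setR _ (by simp) _ _).setW
      _ (by simp) _ _
  · exact ⟨by simp [hd], by simp [hlo], by simp [hlen], by simp [hrk']⟩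
  · exact seg_congr fun j _ _ => by simp

/-- The medians form a new top frame just behind the current segment, with rank `n / 10`, that is,
the question for their own median; `hK` leaves room for them. -/
theorem splitStep_large {E : Env} {K : ℕ} (hE : E.Fits K) {σ : Mem} {D lo n rk : ℕ}
    (hF : Frame σ D lo n rk) (hK : 4 * lo + 5 * n ≤ 4 * K) (hD : D + 1 < K) (hK1 : 8 ≤ K)
    (hn : ¬ n < 100) (hnd : (seg σ lo n).Nodup) (h15 : σ.W 15 0 = 0) :
    wp E K splitStep σ fun σ' o t => o = [] ∧ t ≤ 1000 * n + 500 ∧ Below D lo σ σ' ∧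
      Frame σ' (D + 1) (lo + n) (n / 5) (n / 10) ∧ σ'.W 7 D = lo ∧ σ'.W 8 D = n ∧ σ'.W 9 D = rk ∧
      σ'.W 15 0 = 0 ∧ (∀ j < lo + n, σ'.R 6 j = σ.R 6 j) ∧
      ∀ q < n / 5, ∃ r < 5, σ'.R 6 (lo + n + q) = σ.R 6 (lo + (5 * q + r)) ∧
        above (fun j => σ.R 6 (lo + j)) (5 * q + r) = 2 := by
  have hw := hE.word
  obtain ⟨hd, hlo, hlen, hrk'⟩ := hF
  simp [splitStep, hd, hlo, hlen, hn]
  and_intros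
  all_goals try omega
  have hinj : Set.InjOn (fun j => σ.R 6 (lo + j)) (Finset.range n : Set ℕ) := by
    have := List.inj_on_of_nodup_map hnd
    intro a ha b hb hab
    exact this (by simpa using ha) (by simpa using hb) hab
  intro _
  refine wp_mono _ (medians_spec hE (f := fun j => σ.R 6 (lo + j)) ?_ hK1 ?_ ?_) ?_
  · simp; omega
  · simp
  · intro q hq
    exact exists_median hinj (by simpa using hq)
  rintro τ o t ⟨rfl, ht, hS, hR, hm⟩
  have k16 := congrFun (hS.W 16 (by decide)) 0
  have k20 := congrFun (hS.W 20 (by decide)) 0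
  have k14 := congrFun (hS.W 14 (by decide)) 0
  have k9 := congrFun (hS.W 9 (by decide))
  have k8 := congrFun (hS.W 8 (by decide))
  have k7 := congrFun (hS.W 7 (by decide))
  have k15 := congrFun (hS.W 15 (by decide)) 0
  simp at k16 k20 k14 k9 k8 k7 k15 ht hR hm
  simp [k14, hd, k16, k20, k7, k8, k9, hlo, hlen, hrk', k15, h15]
  and_intros
  all_goals try omega
  · refine ⟨?_, fun j hj => by simp; exact hR j (by omega), fun d hd => ?_, fun d hd => ?_,
      fun d hd => ?_⟩
    · refine Same.setW (Same.setW (Same.setW (Same.setW (Same.trans ?_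
        (hS.mono (by decide) (by decide) (by decide))) _ (by simp) _ _) _ (by simp) _ _)
          _ (by simp) _ _) _ (by simp) _ _
      exact ((Same.refl _ _ _ σ).setW _ (by simp) _ _).setW _ (by simp) _ _
    all_goals have : d ≠ D + 1 := by omega
    all_goals simp [this, k7, k8, k9]
  · exact ⟨by simp, by simp, by simp, by simp⟩

/-- One round of the selection. -/
def selectStep : HC := .ite (.nz (.v 15)) pivotStep splitStep

/-- Selection of the entry with exactly `σ.W 25 0` larger entries among the first `σ.W 26 0` entries
of the scratch array. -/
def select : HC :=
  .set 14 (.c 1) ;; .set 15 (.c 0) ;; .putW 7 (.c 1) (.c 0) ;; .putW 8 (.c 1) (.v 26) ;;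
  .putW 9 (.c 1) (.v 25) ;; .loop (.nz (.v 14)) selectStep

/-- The selection finds the answer for a top frame of length `n`. -/
def Solves (E : Env) (K n : ℕ) : Prop :=
  ∀ (σ : Mem) (D lo rk : ℕ), σ.W 15 0 = 0 → Frame σ D lo n rk → 1 ≤ D → rk < n → D ≤ lo + 1 →
    4 * lo + 5 * n ≤ 4 * K → (seg σ lo n).Nodup →
    ∃ σ' t, Iter E K (.nz (.v 14)) selectStep σ σ' t ∧ t ≤ 100000 * n ∧ Below D lo σ σ' ∧
      σ'.W 15 0 = 1 ∧ σ'.W 14 0 = D - 1 ∧ σ'.R 7 0 ∈ seg σ lo n ∧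
      ((seg σ lo n).countP fun x => decide (σ'.R 7 0 < x)) = rk

theorem seg_mem {σ : Mem} {b n : ℕ} {x : ℝ} : x ∈ seg σ b n ↔ ∃ j < n, σ.R 6 (b + j) = x := by
  simp [seg]

theorem iter_one {E : Env} {K : ℕ} (hE : E.Fits K) {b : HT} {c : HC} {σ : Mem}
    {Q : Mem → List Msg → ℕ → Prop} (hb : b.ok E.maxWord K σ) (hv : b.val σ)
    (h : wp E K c σ Q) (hQ : ∀ σ' o t, Q σ' o t → o = []) :
    ∃ σ' t, Iter E K b c σ σ' (b.cost + t) ∧ Q σ' [] t := by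
  obtain ⟨σ', o, t, h1, h2⟩ := wp_sound hE c h
  obtain rfl := hQ _ _ _ h2
  exact ⟨σ', t, .step hb hv h1 (.refl _), h2⟩

/-- A round with a pivot, followed by the solution of the remaining problem. -/
theorem pivot_solves {E : Env} {K : ℕ} (hE : E.Fits K) (hK1 : 8 ≤ K) {n : ℕ}
    (ih : ∀ m < n, Solves E K m) {σ : Mem} {D lo rk M : ℕ} (h15 : σ.W 15 0 = 1)
    (hF : Frame σ D lo n rk) (hD : 1 ≤ D) (hrk : rk < n) (hDlo : D ≤ lo + 1) (hDK : D < K)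
    (hK : 4 * lo + 5 * n ≤ 4 * K) (hnd : (seg σ lo n).Nodup) (hv : σ.R 7 0 ∈ seg σ lo n)
    (hM1 : ((seg σ lo n).countP fun x => decide (σ.R 7 0 < x)) ≤ M)
    (hM2 : ((seg σ lo n).countP fun x => decide (x < σ.R 7 0)) ≤ M) :
    ∃ σ' t, Iter E K (.nz (.v 14)) selectStep σ σ' t ∧ t ≤ 100000 * M + 300 * n + 500 ∧
      Below D lo σ σ' ∧ σ'.W 15 0 = 1 ∧ σ'.W 14 0 = D - 1 ∧ σ'.R 7 0 ∈ seg σ lo n ∧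
      ((seg σ lo n).countP fun x => decide (σ'.R 7 0 < x)) = rk := by
  have hw := hE.word
  have h14 := hF.d
  obtain ⟨τ, t, h1, ht, h2⟩ := iter_one hE (b := .nz (.v 14)) (c := selectStep) (σ := σ)
    (Q := fun σ' o t => o = [] ∧ t ≤ 300 * n + 450 ∧ Below D lo σ σ' ∧
      (let g := (seg σ lo n).countP fun x => decide (σ.R 7 0 < x)
       σ'.R 7 0 = σ.R 7 0 ∧
       ((g = rk ∧ σ'.W 15 0 = 1 ∧ σ'.W 14 0 = D - 1) ∨
        (rk < g ∧ σ'.W 15 0 = 0 ∧ Frame σ' D lo g rk ∧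
          seg σ' lo g = (seg σ lo n).filter fun x => decide (σ.R 7 0 < x)) ∨
        (g < rk ∧ σ'.W 15 0 = 0 ∧ ∃ m, Frame σ' D lo m (rk - (g + 1)) ∧
          seg σ' lo m = (seg σ lo n).filter fun x => decide (x < σ.R 7 0)))))
    (by simp; omega) (by simp; omega) (by
      simp only [selectStep, wp.eq_3, HT.val_nz, HE.val, h15, HT.ok_nz, HE.ok]
      refine ⟨⟨by omega, by omega⟩, fun _ => ?_, fun h => by omega⟩
      refine wp_mono _ (pivotStep_spec hE hF (by omega) hDK hK1 hrk) ?_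
      rintro σ' o t ⟨ho, ht, h⟩
      simp only [h15] at h
      exact ⟨ho, by simp; omega, h⟩) (fun _ _ _ h => h.1)
  obtain ⟨ht, hB, hv', hcase⟩ := h2
  have hsplit := countP_split hnd hv
  rw [← List.countP_eq_length_filter, ← List.countP_eq_length_filter, seg_length] at hsplit
  rcases hcase with ⟨hg, h3, h4⟩ | ⟨hg, h3, hF', hs⟩ | ⟨hg, h3, m, hF', hs⟩
  · refine ⟨τ, _, h1, by simp; omega, hB, by omega, h4, by rwa [hv'], by rwa [hv']⟩
  · generalize hgg : (seg σ lo n).countP (fun x => decide (σ.R 7 0 < x)) = g at *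
    obtain ⟨σ', t', k1, k2, k3, k4, k5, k6, k7⟩ := ih g (by omega) τ D lo rk h3 hF' hD (by omega)
      hDlo (by omega) (by rw [hs]; exact hnd.filter _)
    rw [hs] at k6 k7
    rw [List.mem_filter, decide_eq_true_eq] at k6
    refine ⟨σ', _, h1.trans k1, ?_, hB.trans k3, k4, k5, k6.1, ?_⟩
    · simp
      have : 100000 * g ≤ 100000 * M := by omega
      omega
    · rw [countP_of_gt k6.2, k7]
  · have hm := congrArg List.length hs
    rw [seg_length, ← List.countP_eq_length_filter] at hm
    generalize hgg : (seg σ lo n).countP (fun x => decide (σ.R 7 0 < x)) = g at *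
    obtain ⟨σ', t', k1, k2, k3, k4, k5, k6, k7⟩ := ih m (by omega) τ D lo _ h3 hF' hD (by omega)
      hDlo (by omega) (by rw [hs]; exact hnd.filter _)
    rw [hs] at k6 k7
    rw [List.mem_filter, decide_eq_true_eq] at k6
    refine ⟨σ', _, h1.trans k1, ?_, hB.trans k3, k4, k5, k6.1, ?_⟩
    · simp
      omega
    · rw [countP_of_lt hnd hv k6.2, k7, hgg]
      omega

/-- Strong induction on the length. For `n < 100` the first entry is the pivot: the cost of such a
round is constant and at least one entry goes. Otherwise the time satisfies `T n ≤ T (n / 5) + T (n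
- 3 * (n / 5 - n / 10)) + O(n)`, where the two arguments sum to about `9 n / 10`; the remaining
tenth pays for the linear term. Nested segments have total length at most `n + n / 5 + n / 25 + …`,
about `5 n / 4`, whence the condition `4 * lo + 5 * n ≤ 4 * K`, which passes from `(lo, n)` to `(lo
+ n, n / 5)`. The condition `D ≤ lo + 1` bounds the depth of the stack by the space used so far, so
that the arrays of frames suffice too. -/
theorem solves {E : Env} {K : ℕ} (hE : E.Fits K) (hK1 : 8 ≤ K) (n : ℕ) : Solves E K n := by
  induction n using Nat.strong_induction_on with
  | _ n ih =>
  intro σ D lo rk h15 hF hD hrk hDlo hK hnd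
  have hw := hE.word
  have h14 := hF.d
  by_cases hn : n < 100
  · obtain ⟨τ, t, h1, -, ht, hB, hF', k15, hs, hv⟩ := iter_one hE (b := .nz (.v 14))
      (c := selectStep) (σ := σ)
      (Q := fun σ' o t => o = [] ∧ t ≤ 200 ∧ Below D lo σ σ' ∧ Frame σ' D lo n rk ∧
        σ'.W 15 0 = 1 ∧ seg σ' lo n = seg σ lo n ∧ σ'.R 7 0 = σ.R 6 lo)
      (by simp; omega) (by simp; omega) (by
        simp only [selectStep, wp.eq_3, HT.val_nz, HE.val, h15, HT.ok_nz, HE.ok]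
        refine ⟨⟨by omega, by omega⟩, fun h => by omega, fun _ => ?_⟩
        refine wp_mono _ (splitStep_small hE hF (by omega) (by omega) hK1 hrk hn) ?_
        rintro σ' o t ⟨ho, ht, h⟩
        exact ⟨ho, by simp; omega, h⟩) (fun _ _ _ h => h.1)
    have hmem : τ.R 7 0 ∈ seg τ lo n := by
      rw [hs, seg_mem]
      exact ⟨0, by omega, by rw [hv, add_zero]⟩
    rw [← hs] at hnd
    have hsplit := countP_split hnd hmem
    rw [← List.countP_eq_length_filter, ← List.countP_eq_length_filter, seg_length] at hsplit
    -- Any pivot leaves at most `n - 1` entries on a side, since it belongs to neither.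
    obtain ⟨σ', t', k1, k2, k3, k4⟩ := pivot_solves hE hK1 ih k15 hF' hD hrk hDlo (by omega) hK hnd
      hmem (M := n - 1) (by omega) (by omega)
    rw [hs] at k4
    refine ⟨σ', _, h1.trans k1, ?_, hB.trans k3, k4⟩
    simp
    omega
  · obtain ⟨τ, t, h1, -, ht, hB, hF', k7, k8, k9, k15, hR, hm⟩ := iter_one hE (b := .nz (.v 14))
      (c := selectStep) (σ := σ)
      (Q := fun σ' o t => o = [] ∧ t ≤ 1000 * n + 600 ∧ Below D lo σ σ' ∧
        Frame σ' (D + 1) (lo + n) (n / 5) (n / 10) ∧ σ'.W 7 D = lo ∧ σ'.W 8 D = n ∧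
        σ'.W 9 D = rk ∧ σ'.W 15 0 = 0 ∧ (∀ j < lo + n, σ'.R 6 j = σ.R 6 j) ∧
        ∀ q < n / 5, ∃ r < 5, σ'.R 6 (lo + n + q) = σ.R 6 (lo + (5 * q + r)) ∧
          above (fun j => σ.R 6 (lo + j)) (5 * q + r) = 2)
      (by simp; omega) (by simp; omega) (by
        simp only [selectStep, wp.eq_3, HT.val_nz, HE.val, h15, HT.ok_nz, HE.ok]
        refine ⟨⟨by omega, by omega⟩, fun h => by omega, fun _ => ?_⟩
        refine wp_mono _ (splitStep_large hE hF hK (by omega) hK1 hn hnd h15) ?_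
        rintro σ' o t ⟨ho, ht, h⟩
        exact ⟨ho, by simp; omega, h⟩) (fun _ _ _ h => h.1)
    have hinj : Set.InjOn (fun j => σ.R 6 (lo + j)) (Finset.range n : Set ℕ) := by
      have := List.inj_on_of_nodup_map hnd
      intro a ha b hb hab
      exact this (by simpa using ha) (by simpa using hb) hab
    have hnd' : (seg τ (lo + n) (n / 5)).Nodup := by
      refine List.Nodup.map_on ?_ List.nodup_range
      intro a ha b hb hab
      rw [List.mem_range] at ha hb
      obtain ⟨r, hr, h, -⟩ := hm a ha
      obtain ⟨r', hr', h', -⟩ := hm b hb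
      rw [h, h'] at hab
      have := hinj (by simp; omega) (by simp; omega) hab
      omega
    obtain ⟨τ', t', j1, j2, j3, j15, j14, jv, jrk⟩ := ih (n / 5) (by omega) τ (D + 1) (lo + n)
      (n / 10) k15 hF' (by omega) (by omega) (by omega) (by omega) hnd'
    have hseg : seg τ' lo n = seg σ lo n := seg_congr fun j _ hj => by
      rw [j3.Q j hj, hR j hj]
    have hF2 : Frame τ' D lo n rk := ⟨by omega, by rw [j3.lo D (by omega), k7],
      by rw [j3.len D (by omega), k8], by rw [j3.rk D (by omega), k9]⟩
    obtain ⟨hm1, hm2⟩ := median_of_medians (f := fun j => σ.R 6 (lo + j))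
      (m := fun q => τ.R 6 (lo + n + q)) hm (v := τ'.R 7 0) (seg_mem.1 jv)
      (by rw [← jrk, countP_seg])
    rw [← countP_seg σ lo n fun x => τ'.R 7 0 < x] at hm1
    rw [← countP_seg σ lo n fun x => x < τ'.R 7 0] at hm2
    have hmem : τ'.R 7 0 ∈ seg σ lo n := by
      obtain ⟨q, hq, h⟩ := seg_mem.1 jv
      obtain ⟨r, hr, h', -⟩ := hm q hq
      exact seg_mem.2 ⟨5 * q + r, by omega, by rw [← h, h']⟩
    rw [← hseg] at hnd hmem hm1 hm2
    -- One bound serves both sides, because `n / 5 - n / 10 ≤ n / 10 + 1`.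
    obtain ⟨σ', t'', l1, l2, l3, l4⟩ := pivot_solves hE hK1 ih j15 hF2 hD hrk hDlo (by omega) hK hnd
      hmem (M := n - 3 * (n / 5 - n / 10)) hm1 (by omega)
    rw [hseg] at l4
    refine ⟨σ', _, h1.trans (j1.trans l1), ?_, hB.trans ((j3.mono (by omega) (by omega)).trans l3), l4⟩
    simp
    omega

theorem select_spec {E : Env} {K : ℕ} (hE : E.Fits K) (hK1 : 8 ≤ K) {σ : Mem} {n : ℕ}
    (h26 : σ.W 26 0 = n) (hrk : σ.W 25 0 < n) (hK : 5 * n ≤ 4 * K) (hnd : (seg σ 0 n).Nodup) :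
    wp E K select σ fun σ' o t => o = [] ∧ t ≤ 100000 * n + 100 ∧ Same selW [6, 7] [] σ σ' ∧
      σ'.R 7 0 ∈ seg σ 0 n ∧
      ((seg σ 0 n).countP fun x => decide (σ'.R 7 0 < x)) = σ.W 25 0 := by
  have hw := hE.word
  simp [select, h26]
  and_intros
  all_goals try omega
  generalize hτ : (((((σ.setW 14 0 1).setW 15 0 0).setW 7 1 0).setW 8 1 n).setW 9 1 (σ.W 25 0)) = τ
  have hs : seg τ 0 n = seg σ 0 n := by rw [← hτ]; simp
  obtain ⟨σ', t, h1, h2, h3, h4, h5, h6, h7⟩ := solves hE hK1 n τ 1 0 (σ.W 25 0) (by simp [← hτ])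
    (by rw [← hτ]; exact ⟨by simp, by simp, by simp, by simp⟩) le_rfl hrk (by omega) (by omega)
    (by rwa [hs])
  have hS : Same selW [6, 7] [] σ τ := by
    rw [← hτ]
    exact (((((Same.refl _ _ _ σ).setW _ (by simp) _ _).setW _ (by simp) _ _).setW _ (by simp) _ _).setW
      _ (by simp) _ _).setW _ (by simp) _ _
  rw [hs] at h6 h7
  rw [wp.eq_4]
  refine ⟨σ', [], _, h1.exec hE (by simp; omega) (by simp [h5]), rfl, ?_, hS.trans h3.same, h6, h7⟩
  simp
  omega

/-! ### The items with the largest keys -/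

theorem mem_top {s : ℕ} {v : ℕ → ℝ} {A : Finset ℕ} {i : ℕ} :
    i ∈ top s v A ↔ i ∈ A ∧ (A.filter fun j => v i < v j).card < s := by
  simp [top]

theorem top_subset (s : ℕ) (v : ℕ → ℝ) (A : Finset ℕ) : top s v A ⊆ A := Finset.filter_subset _ _

theorem mem_top_of_subset {s : ℕ} {v : ℕ → ℝ} {A B : Finset ℕ} (h : B ⊆ A) {i : ℕ} (hi : i ∈ B)
    (hA : i ∈ top s v A) : i ∈ top s v B :=
  mem_top.2 ⟨hi, lt_of_le_of_lt (Finset.card_le_card (Finset.filter_subset_filter _ h))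
    (mem_top.1 hA).2⟩

/-- For distinct values, the number of larger elements maps the chosen elements bijectively onto the
numbers below both `s` and `A.card`. -/
theorem card_top {s : ℕ} {v : ℕ → ℝ} (hv : Function.Injective v) (A : Finset ℕ) :
    (top s v A).card = min s A.card := by
  classical
  have hinj : Set.InjOn (fun i => (A.filter fun l => v i < v l).card) A := by
    intro i hi j hj hij
    have hlt : ∀ i ∈ A, ∀ j ∈ A, v i < v j →
        (A.filter fun l => v j < v l).card < (A.filter fun l => v i < v l).card := by
      intro i _ j hj hij
      refine Finset.card_lt_card ⟨fun l hl => ?_, fun h => ?_⟩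
      · rw [Finset.mem_filter] at hl ⊢
        exact ⟨hl.1, hij.trans hl.2⟩
      · have := h (Finset.mem_filter.2 ⟨hj, hij⟩)
        simp at this
    by_contra hne
    simp only at hij
    rcases lt_or_gt_of_ne (fun h => hne (hv h)) with h | h
    · have := hlt i hi j hj h; omega
    · have := hlt j hj i hi h; omega
  have himg : (top s v A).image (fun i => (A.filter fun l => v i < v l).card) =
      Finset.range (min s A.card) := by
    ext m
    rw [Finset.mem_image, Finset.mem_range, lt_min_iff]
    constructor
    · rintro ⟨i, hi, rfl⟩
      refine ⟨(mem_top.1 hi).2, Finset.card_lt_card ⟨Finset.filter_subset _ _, fun h => ?_⟩⟩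
      have := h (mem_top.1 hi).1
      simp at this
    · rintro ⟨h1, h2⟩
      obtain ⟨i, hi, h⟩ := exists_rank A hv.injOn h2
      exact ⟨i, mem_top.2 ⟨hi, by omega⟩, h⟩
  rw [← Finset.card_image_of_injOn (hinj.mono (top_subset s v A)), himg, Finset.card_range]

/-- As `p` is closed upwards, everything that beats an element with `p` has `p` as well, so ranks do
not change under the filter. -/
theorem top_filter {s : ℕ} {v : ℕ → ℝ} (A : Finset ℕ) (p : ℕ → Prop) [DecidablePred p]
    (hp : ∀ i j, p i → v i < v j → p j) : (top s v A).filter p = top s v (A.filter p) := by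
  ext i
  rw [Finset.mem_filter, mem_top, mem_top, Finset.mem_filter]
  have : p i → ((A.filter p).filter fun j => v i < v j) = A.filter fun j => v i < v j := by
    intro h
    ext j
    simp only [Finset.mem_filter]
    exact ⟨fun h => ⟨h.1.1, h.2⟩, fun h' => ⟨⟨h'.1, hp i j h h'.2⟩, h'.2⟩⟩
  constructor
  · rintro ⟨⟨h1, h2⟩, h3⟩
    exact ⟨⟨h1, h3⟩, by rwa [this h3]⟩
  · rintro ⟨⟨h1, h2⟩, h3⟩
    rw [this h2] at h3
    exact ⟨⟨h1, h3⟩, h2⟩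

theorem card_top_filter {s : ℕ} {v : ℕ → ℝ} (hv : Function.Injective v) (A : Finset ℕ)
    (p : ℕ → Prop) [DecidablePred p] (hp : ∀ i j, p i → v i < v j → p j) :
    ((top s v A).filter p).card = min s (A.filter p).card := by
  rw [top_filter A p hp, card_top hv]

/-- Removing competitors only improves ranks, so the top of `A` stays in the top of `B`, and the
cardinalities leave no room for more. This justifies all the pruning, both in the algorithm and in
the lazily compressed buffers. -/
theorem top_sandwich {s : ℕ} {v : ℕ → ℝ} (hv : Function.Injective v) {A B : Finset ℕ}
    (h1 : top s v A ⊆ B) (h2 : B ⊆ A) : top s v B = top s v A := by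
  symm
  refine Finset.eq_of_subset_of_card_le (fun i hi => mem_top_of_subset h2 (h1 hi) hi) ?_
  rw [card_top hv, card_top hv]
  exact min_le_min le_rfl (Finset.card_le_card h2)

theorem top_top {s : ℕ} {v : ℕ → ℝ} (hv : Function.Injective v) (A : Finset ℕ) :
    top s v (top s v A) = top s v A := top_sandwich hv le_rfl (top_subset s v A)

theorem top_union_top {s : ℕ} {v : ℕ → ℝ} (hv : Function.Injective v) (A B : Finset ℕ) :
    top s v (top s v A ∪ B) = top s v (A ∪ B) := by
  refine top_sandwich hv (fun i hi => ?_) (Finset.union_subset_union_left (top_subset s v A))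
  rcases Finset.mem_union.1 ((mem_top.1 hi).1) with h | h
  · exact Finset.mem_union_left _ (mem_top_of_subset Finset.subset_union_left h hi)
  · exact Finset.mem_union_right _ h

theorem top_insert_top {s : ℕ} {v : ℕ → ℝ} (hv : Function.Injective v) (A : Finset ℕ) (i : ℕ) :
    top s v (insert i (top s v A)) = top s v (insert i A) := by
  rw [Finset.insert_eq, Finset.insert_eq, Finset.union_comm, top_union_top hv, Finset.union_comm]

theorem top_eq_self {s : ℕ} {v : ℕ → ℝ} {A : Finset ℕ} (h : A.card ≤ s) : top s v A = A := by
  refine Finset.Subset.antisymm (top_subset s v A) fun i hi => mem_top.2 ⟨hi, ?_⟩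
  refine lt_of_lt_of_le (Finset.card_lt_card ⟨Finset.filter_subset _ _, fun h => ?_⟩) h
  have := h hi
  simp at this

/-! ### Epochs -/

/-- The `s`-th largest key in a set of at most `s` items. -/
def uOf (X : Setting) (S : Finset ℕ) : ℝ := if S.card < X.s then 0 else sInf (X.key '' (S : Set ℕ))

/-- The number of integers `j ≥ 0` with `r ^ j ≤ u`. -/
def epochIdx (r u : ℝ) : ℕ := if u < 1 then 0 else level r u + 1

theorem pow_le_iff_level {r x : ℝ} (hr : 1 < r) (hx : 1 ≤ x) (j : ℕ) : r ^ j ≤ x ↔ j ≤ level r x := by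
  rw [level, Nat.le_floor_iff (Real.logb_nonneg hr hx), Real.le_logb_iff_rpow_le hr (by linarith),
    Real.rpow_natCast]

/-- Comparisons of `u` with powers of `r` become comparisons of natural numbers. The shift by one in
`epochIdx` reserves the index `0` for `u < 1`, where the threshold is zero. -/
theorem pow_le_iff {r : ℝ} (hr : 1 < r) (u : ℝ) (j : ℕ) : r ^ j ≤ u ↔ j < epochIdx r u := by
  unfold epochIdx
  split_ifs with h
  · have : 1 ≤ r ^ j := one_le_pow₀ hr.le
    constructor
    · intro h'; linarith
    · intro h'; omega
  · rw [pow_le_iff_level hr (not_lt.1 h)]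
    omega

theorem epochStart_eq (r u : ℝ) : epochStart r u = if epochIdx r u = 0 then 0 else r ^ (epochIdx r u - 1) := by
  unfold epochStart epochIdx
  split_ifs <;> first | rfl | omega | skip
  all_goals simp_all

theorem epochIdx_mono {r : ℝ} (hr : 1 < r) {u u' : ℝ} (h : u ≤ u') : epochIdx r u ≤ epochIdx r u' := by
  by_contra hlt
  have := (pow_le_iff hr u (epochIdx r u')).2 (by omega)
  have := (pow_le_iff hr u' (epochIdx r u')).1 (this.trans h)
  omega

theorem epochStart_le {r : ℝ} (hr : 1 < r) {u : ℝ} (hu : 0 ≤ u) : epochStart r u ≤ u := by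
  rw [epochStart_eq]
  split_ifs with h
  · exact hu
  · exact (pow_le_iff hr u _).2 (by omega)

theorem epochStart_eq_iff {r : ℝ} (hr : 1 < r) (u u' : ℝ) :
    epochStart r u = epochStart r u' ↔ epochIdx r u = epochIdx r u' := by
  constructor
  · intro h
    rw [epochStart_eq, epochStart_eq] at h
    have h0 : ∀ n, r ^ n ≠ 0 := fun n => pow_ne_zero n (by linarith)
    split_ifs at h with h1 h2 h2
    · omega
    · exact absurd h.symm (h0 _)
    · exact absurd h (h0 _)
    · have := pow_right_injective₀ (by linarith) hr.ne' h
      omega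
  · intro h
    rw [epochStart_eq, epochStart_eq, h]

theorem one_le_iff_epochIdx {r : ℝ} (hr : 1 < r) (u : ℝ) : 1 ≤ u ↔ 0 < epochIdx r u := by
  rw [← pow_le_iff hr u 0, pow_zero]

/-- The first value beyond the epoch number `j`. -/
theorem uOf_eq {X : Setting} {S : Finset ℕ} (h : ¬ S.card < X.s) (hs : 0 < X.s) :
    (∃ i ∈ S, uOf X S = X.key i) ∧ ∀ i ∈ S, uOf X S ≤ X.key i := by
  have hne : (X.key '' (S : Set ℕ)).Nonempty := by
    rw [Set.image_nonempty, Finset.coe_nonempty, ← Finset.card_pos]; omega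
  have hfin : (X.key '' (S : Set ℕ)).Finite := S.finite_toSet.image _
  rw [uOf, if_neg h]
  refine ⟨?_, fun i hi => csInf_le hfin.bddBelow ⟨i, hi, rfl⟩⟩
  obtain ⟨i, hi, h'⟩ := hne.csInf_mem hfin
  exact ⟨i, hi, h'.symm⟩

/-- The keys of the items are positive and distinct. -/
structure Setting.Good (X : Setting) : Prop where
  inj : Function.Injective X.key
  pos : ∀ i, 0 < X.key i
  s_pos : 0 < X.s
  one_le : ∀ i, 1 ≤ X.w i

theorem Setting.two_le_r (X : Setting) : 2 ≤ X.r := le_max_left _ _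

theorem Setting.one_lt_r (X : Setting) : 1 < X.r := by linarith [X.two_le_r]

theorem uOf_nonneg {X : Setting} (hX : X.Good) (S : Finset ℕ) : 0 ≤ uOf X S := by
  by_cases h : S.card < X.s
  · rw [uOf, if_pos h]
  · obtain ⟨⟨i, -, h⟩, -⟩ := uOf_eq h hX.s_pos
    rw [h]; exact (hX.pos i).le

/-- Replaces the infimum by a count. Positivity of `x` takes care of the default value `0` for an
incomplete sample. -/
theorem le_uOf_iff {X : Setting} (hX : X.Good) {S : Finset ℕ} (hS : S.card ≤ X.s) {x : ℝ}
    (hx : 0 < x) : x ≤ uOf X S ↔ X.s ≤ (S.filter fun i => x ≤ X.key i).card := by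
  by_cases h : S.card < X.s
  · have := Finset.card_filter_le S fun i => x ≤ X.key i
    rw [uOf, if_pos h]
    constructor
    · intro h'; linarith
    · intro h'; omega
  · obtain ⟨⟨i, hi, h1⟩, h2⟩ := uOf_eq h hX.s_pos
    constructor
    · intro hle
      rw [Finset.filter_true_of_mem fun j hj => hle.trans (h2 j hj)]
      omega
    · intro hle
      have : S.filter (fun i => x ≤ X.key i) = S :=
        Finset.eq_of_subset_of_card_le (Finset.filter_subset _ _) (by omega)
      rw [← this, Finset.mem_filter] at hi
      rw [h1]; exact hi.2

/-- Truncation replaces a count of large keys by its minimum with `s`, which a comparison with `s`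
does not notice; so `u` may be read off from the untruncated set. -/
theorem le_uOf_top_iff {X : Setting} (hX : X.Good) (A : Finset ℕ) {x : ℝ} (hx : 0 < x) :
    x ≤ uOf X (top X.s X.key A) ↔ X.s ≤ (A.filter fun i => x ≤ X.key i).card := by
  rw [le_uOf_iff hX (by rw [card_top hX.inj]; exact min_le_left _ _) hx,
    card_top_filter hX.inj A _ fun i j h h' => h.trans h'.le]
  omega

theorem uOf_top_mono {X : Setting} (hX : X.Good) {A B : Finset ℕ} (h : A ⊆ B) :
    uOf X (top X.s X.key A) ≤ uOf X (top X.s X.key B) := by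
  rcases (uOf_nonneg hX (top X.s X.key A)).eq_or_lt with h0 | h0
  · rw [← h0]; exact uOf_nonneg hX _
  · rw [le_uOf_top_iff hX B h0]
    exact ((le_uOf_top_iff hX A h0).1 le_rfl).trans
      (Finset.card_le_card (Finset.filter_subset_filter _ h))

/-! ### The coordinator -/

/-- The number of items that saturates a level. -/
def Setting.cap (X : Setting) : ℕ := max (8 * X.s) (4 * X.k)

/-- Multiplying the maximum out shows that the saturation bound is an integer, so the machine can
test saturation with words alone. -/
theorem Setting.cap_eq {X : Setting} (hs : 0 < X.s) : 4 * X.r * X.s = (X.cap : ℝ) := by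
  have : (0 : ℝ) < X.s := by exact_mod_cast hs
  rw [Setting.r, Setting.cap, Nat.cast_max, mul_assoc, max_mul_of_nonneg _ _ this.le,
    mul_max_of_nonneg _ _ (by norm_num : (0 : ℝ) ≤ 4)]
  push_cast
  congr 1
  · ring
  · field_simp

/-- The state of the coordinator is consistent: `u` belongs to `S`. -/
structure CoordState.Ok (X : Setting) (c : CoordState) : Prop where
  card : c.S.card ≤ X.s
  u : c.u = uOf X c.S

theorem CoordState.Ok.top {X : Setting} {c : CoordState} (h : c.Ok X) : top X.s X.key c.S = c.S :=
  top_eq_self h.card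

theorem addToSample_S (X : Setting) (c : CoordState) (i : ℕ) :
    (addToSample X c i).1.S = top X.s X.key (insert i c.S) := rfl

theorem addToSample_ok {X : Setting} (hX : X.Good) (c : CoordState) (i : ℕ) :
    (addToSample X c i).1.Ok X :=
  ⟨by rw [addToSample_S, card_top hX.inj]; exact min_le_left _ _, rfl⟩

theorem addToSample_u_le {X : Setting} (hX : X.Good) {c : CoordState} (hc : c.Ok X) (i : ℕ) :
    c.u ≤ (addToSample X c i).1.u := by
  rw [(addToSample_ok hX c i).u, addToSample_S, hc.u, ← hc.top]
  nth_rewrite 2 [hc.top]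
  exact uOf_top_mono hX (Finset.subset_insert _ _)

/-- Since `u` never decreases, the threshold changes exactly when the epoch index rises. In this
form the numbers of broadcasts telescope. -/
theorem addToSample_msgs {X : Setting} (hX : X.Good) {c : CoordState} (hc : c.Ok X) (i : ℕ) :
    (addToSample X c i).2 = if epochIdx X.r c.u < epochIdx X.r (addToSample X c i).1.u then
      [.epoch (epochStart X.r (addToSample X c i).1.u)] else [] := by
  have h1 := epochIdx_mono X.one_lt_r (addToSample_u_le hX hc i)
  have h2 : (addToSample X c i).2 = if 1 ≤ (addToSample X c i).1.u ∧
    epochStart X.r (addToSample X c i).1.u ≠ epochStart X.r c.u then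
      [.epoch (epochStart X.r (addToSample X c i).1.u)] else [] := rfl
  rw [h2]
  congr 1
  rw [one_le_iff_epochIdx X.one_lt_r, Ne, epochStart_eq_iff X.one_lt_r]
  exact propext ⟨fun h => by omega, fun h => by omega⟩

/-- The truncations after the single insertions combine into one by `top_union_top`. Every broadcast
raises the epoch index by at least one, and a site retains only the last threshold sent. -/
theorem addAll_ok {X : Setting} (hX : X.Good) (l : List ℕ) : ∀ {c : CoordState}, c.Ok X →
    (addAll X c l).1.Ok X ∧ (addAll X c l).1.S = top X.s X.key (c.S ∪ l.toFinset) ∧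
      (addAll X c l).1.D = c.D ∧ (addAll X c l).1.count = c.count ∧
      c.u ≤ (addAll X c l).1.u ∧
      (∀ m ∈ (addAll X c l).2, ∃ x, m = .epoch x) ∧
      (addAll X c l).2.length ≤ epochIdx X.r (addAll X c l).1.u - epochIdx X.r c.u ∧
      ∀ a : SiteState, a.thr = epochStart X.r c.u → (addAll X c l).2.foldl siteReceive a =
        { a with thr := epochStart X.r (addAll X c l).1.u } := by
  induction l with
  | nil =>
      intro c hc
      refine ⟨hc, by simp [addAll, hc.top], rfl, rfl, le_rfl, by simp [addAll], by simp [addAll], ?_⟩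
      intro a ha
      simp [addAll, ← ha]
  | cons i l ih =>
      intro c hc
      obtain ⟨h1, h2, h3, h4, h5, h6, h7, h8⟩ := ih (addToSample_ok hX c i)
      have hu := addToSample_u_le hX hc i
      have hm := addToSample_msgs hX hc i
      have e1 := epochIdx_mono X.one_lt_r hu
      have e2 := epochIdx_mono X.one_lt_r h5
      simp only [addAll]
      refine ⟨h1, ?_, h3, h4, hu.trans h5, ?_, ?_, ?_⟩
      · rw [h2, addToSample_S, top_union_top hX.inj]
        congr 1
        ext j; simp
      · intro m hm'
        rcases List.mem_append.1 hm' with h | h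
        · rw [hm] at h
          split_ifs at h
          · exact ⟨_, List.mem_singleton.1 h⟩
          · simp at h
        · exact h6 m h
      · rw [List.length_append, hm]
        split_ifs with h
        · simp only [List.length_singleton]; omega
        · simp only [List.length_nil]; omega
      · intro a ha
        rw [List.foldl_append, hm]
        split_ifs with h
        · rw [List.foldl_cons, List.foldl_nil, h8 _ rfl]
          simp [siteReceive]
        · have : epochStart X.r (addToSample X c i).1.u = epochStart X.r c.u :=
            (epochStart_eq_iff X.one_lt_r _ _).2 (by omega)
          rw [List.foldl_nil, h8 a (by rw [ha, this])]

theorem addToSample_eq_addAll (X : Setting) (c : CoordState) (i : ℕ) :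
    addToSample X c i = addAll X c [i] := by
  simp [addAll]

/-! ### The network -/

/-- The level of an item. -/
def Setting.lev (X : Setting) (i : ℕ) : ℕ := level X.r (X.w i)

/-- The number of items of level `j` among the first `t` items. -/
def Setting.cnt (X : Setting) (t j : ℕ) : ℕ := ((Finset.range t).filter fun i => X.lev i = j).card

theorem Setting.cnt_succ (X : Setting) (t j : ℕ) :
    X.cnt (t + 1) j = X.cnt t j + if X.lev t = j then 1 else 0 := by
  unfold Setting.cnt
  rw [Finset.range_add_one, Finset.filter_insert]
  split_ifs with h
  · rw [Finset.card_insert_of_notMem (by simp)]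
  · simp

theorem Setting.cap_pos {X : Setting} (hs : 0 < X.s) : 0 < X.cap :=
  lt_max_of_lt_left (by omega)

/-- The state of the coordinator after the first `t` items. -/
abbrev co (trim : Bool) (X : Setting) (t : ℕ) : CoordState := (net trim X t).coord

/-- The field `top_sub` is what correctness rests on; the others keep it going. `sat` and `thr` say
that every site is up to date, `count` stops at the bound because items of saturated levels are no
longer counted, and the level conditions make `S` and `D` disjoint. -/
structure NetInv (trim : Bool) (X : Setting) (t : ℕ) : Prop where
  count : ∀ j, (co trim X t).count j = min (X.cnt t j) X.cap
  sat : ∀ y j, ((net trim X t).sites y).saturated j = decide (X.cap ≤ X.cnt t j)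
  thr : ∀ y, ((net trim X t).sites y).thr = epochStart X.r (co trim X t).u
  ok : (co trim X t).Ok X
  S_sub : (co trim X t).S ⊆ Finset.range t
  D_sub : (co trim X t).D ⊆ Finset.range t
  S_lev : ∀ i ∈ (co trim X t).S, X.cap ≤ X.cnt t (X.lev i)
  D_lev : ∀ i ∈ (co trim X t).D, X.cnt t (X.lev i) < X.cap
  D_card : trim = true → (co trim X t).D.card ≤ X.s
  top_sub : top X.s X.key (Finset.range t) ⊆ (co trim X t).S ∪ (co trim X t).D

theorem NetInv.up_eq {trim : Bool} {X : Setting} {t : ℕ} (h : NetInv trim X t) :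
    up trim X t = if X.cap ≤ X.cnt t (X.lev t) then
      if epochStart X.r (co trim X t).u < X.key t then some (.regular t (X.w t) (X.key t)) else none
      else some (.early t (X.w t)) := by
  have h1 := h.sat (X.site t) (X.lev t)
  simp only [up, Net.up, siteArrive, h.thr]
  rw [show level X.r (X.w t) = X.lev t from rfl, h1]
  simp

/-- The withheld items just after the arrival of the early item `t`. -/
def held (trim : Bool) (X : Setting) (t : ℕ) : Finset ℕ :=
  if trim = true then top X.s X.key (insert t (co trim X t).D) else insert t (co trim X t).D

/-- The coordinator after counting the early item `t` that saturates its level. -/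
def counted (trim : Bool) (X : Setting) (t : ℕ) : CoordState :=
  { co trim X t with
    count := Function.update (co trim X t).count (X.lev t) ((co trim X t).count (X.lev t) + 1)
    D := (held trim X t).filter fun m => X.lev m ≠ X.lev t }

/-- The items released when the early item `t` saturates its level. -/
def released (trim : Bool) (X : Setting) (t : ℕ) : List ℕ :=
  ((held trim X t).filter fun m => X.lev m = X.lev t).sort (· ≤ ·)

/-- A regular item above the threshold but not above `u` is rejected by the coordinator; it shares a
case with the accepted ones, because inserting it would change nothing. This also allows the program
to insert every regular item without comparing it to `u`. -/
theorem reply_cases {trim : Bool} {X : Setting} (hX : X.Good) {t : ℕ} (h : NetInv trim X t) :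
    (X.cap ≤ X.cnt t (X.lev t) ∧ up trim X t = none ∧ X.key t ≤ epochStart X.r (co trim X t).u ∧
      co trim X (t + 1) = co trim X t ∧ down trim X t = []) ∨
    (X.cap ≤ X.cnt t (X.lev t) ∧ up trim X t = some (.regular t (X.w t) (X.key t)) ∧
      epochStart X.r (co trim X t).u < X.key t ∧
      co trim X (t + 1) = (addAll X (co trim X t) [t]).1 ∧
      down trim X t = (addAll X (co trim X t) [t]).2) ∨
    (X.cnt t (X.lev t) + 1 < X.cap ∧ up trim X t = some (.early t (X.w t)) ∧
      co trim X (t + 1) = { co trim X t with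
        count := Function.update (co trim X t).count (X.lev t) ((co trim X t).count (X.lev t) + 1)
        D := held trim X t } ∧ down trim X t = []) ∨
    (X.cnt t (X.lev t) + 1 = X.cap ∧ up trim X t = some (.early t (X.w t)) ∧
      co trim X (t + 1) = (addAll X (counted trim X t) (released trim X t)).1 ∧
      down trim X t = (addAll X (counted trim X t) (released trim X t)).2 ++ [.saturated (X.lev t)]) := by
  have hup := h.up_eq
  have hco : co trim X (t + 1) = ((net trim X t).reply trim X t).1 := rfl
  have hdn : down trim X t = ((net trim X t).reply trim X t).2 := rfl
  have hrep : (net trim X t).reply trim X t = match up trim X t with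
    | none => (co trim X t, [])
    | some m => coordReceive trim X (co trim X t) m := rfl
  by_cases hsat : X.cap ≤ X.cnt t (X.lev t)
  · rw [if_pos hsat] at hup
    by_cases hthr : epochStart X.r (co trim X t).u < X.key t
    · rw [if_pos hthr] at hup
      refine Or.inr (Or.inl ⟨hsat, hup, hthr, ?_⟩)
      rw [hco, hdn, hrep, hup]
      simp only [coordReceive]
      rw [addToSample_eq_addAll]
      split_ifs with hu
      · exact ⟨rfl, rfl⟩
      -- All `s` elements of the sample have keys at least `u`, hence at least the new key, and by
      -- distinctness larger ones; truncation drops the new item at once.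
      · have hS : top X.s X.key (insert t (co trim X t).S) = (co trim X t).S := by
          have hnot : t ∉ (co trim X t).S := fun h' => by simpa using h.S_sub h'
          have hle : X.key t ≤ uOf X (co trim X t).S := h.ok.u ▸ not_lt.1 hu
          have hc := (le_uOf_iff hX h.ok.card (hX.pos t)).1 hle
          have hfil : ((co trim X t).S.filter fun i => X.key t ≤ X.key i) = (co trim X t).S :=
            Finset.eq_of_subset_of_card_le (Finset.filter_subset _ _) (h.ok.card.trans hc)
          refine Eq.trans ?_ h.ok.top
          symm
          refine top_sandwich hX.inj (fun i hi => ?_) (Finset.subset_insert _ _)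
          rcases Finset.mem_insert.1 (mem_top.1 hi).1 with rfl | h'
          · exfalso
            have h2 := (mem_top.1 hi).2
            have : (co trim X i).S ⊆ (insert i (co trim X i).S).filter fun j => X.key i < X.key j := by
              intro j hj
              have hj' := hj
              rw [← hfil, Finset.mem_filter] at hj'
              refine Finset.mem_filter.2 ⟨Finset.mem_insert_of_mem hj, lt_of_le_of_ne hj'.2 ?_⟩
              intro he
              exact hnot (hX.inj he ▸ hj)
            have := Finset.card_le_card this
            have := Finset.card_filter_le (co trim X i).S fun j => X.key i ≤ X.key j
            omega
          · exact h'
        have hu' : (addToSample X (co trim X t) t).1.u = (co trim X t).u := by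
          rw [(addToSample_ok hX _ t).u, addToSample_S, hS, h.ok.u]
        rw [← addToSample_eq_addAll]
        constructor
        · have : (addToSample X (co trim X t) t).1 = { co trim X t with
              S := (addToSample X (co trim X t) t).1.S
              u := (addToSample X (co trim X t) t).1.u } := rfl
          rw [this, hu', addToSample_S, hS]
        · rw [addToSample_msgs hX h.ok, hu', if_neg (lt_irrefl _)]
    · rw [if_neg hthr] at hup
      refine Or.inl ⟨hsat, hup, not_lt.1 hthr, ?_⟩
      rw [hco, hdn, hrep, hup]
      exact ⟨rfl, rfl⟩
  · rw [if_neg hsat] at hup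
    have hcnt := h.count (X.lev t)
    have hiff : 4 * X.r * X.s ≤ ((Function.update (co trim X t).count (X.lev t)
        ((co trim X t).count (X.lev t) + 1) (X.lev t) : ℕ) : ℝ) ↔
        X.cap ≤ X.cnt t (X.lev t) + 1 := by
      rw [Setting.cap_eq hX.s_pos, Nat.cast_le, Function.update_self]
      omega
    have hlev : ∀ i, level X.r (X.w i) = X.lev i := fun _ => rfl
    by_cases h1 : X.cap ≤ X.cnt t (X.lev t) + 1
    · refine Or.inr (Or.inr (Or.inr ⟨by omega, hup, ?_⟩))
      rw [hco, hdn, hrep, hup]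
      simp only [coordReceive, hlev]
      rw [if_pos (hiff.2 h1)]
      exact ⟨rfl, rfl⟩
    · refine Or.inr (Or.inr (Or.inl ⟨by omega, hup, ?_⟩))
      rw [hco, hdn, hrep, hup]
      simp only [coordReceive, hlev]
      rw [if_neg fun h' => h1 (hiff.1 h')]
      exact ⟨rfl, rfl⟩

theorem held_subset (trim : Bool) (X : Setting) (t : ℕ) :
    held trim X t ⊆ insert t (co trim X t).D := by
  unfold held
  split_ifs
  · exact top_subset _ _ _
  · exact le_rfl

theorem top_insert_subset_held (trim : Bool) (X : Setting) (t : ℕ) :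
    top X.s X.key (insert t (co trim X t).D) ⊆ held trim X t := by
  unfold held
  split_ifs
  · exact le_rfl
  · exact top_subset _ _ _

theorem sites_succ (trim : Bool) (X : Setting) (t : ℕ) (y : Fin X.k) :
    (net trim X (t + 1)).sites y = (down trim X t).foldl siteReceive ((net trim X t).sites y) := rfl

theorem mem_released {trim : Bool} {X : Setting} {t i : ℕ} :
    i ∈ (released trim X t).toFinset ↔ i ∈ held trim X t ∧ X.lev i = X.lev t := by
  simp [released]

theorem netInv_zero {trim : Bool} {X : Setting} (hX : X.Good) : NetInv trim X 0 where
  count j := by simp [co, net, Setting.cnt]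
  sat y j := by
    have := Setting.cap_pos hX.s_pos
    simp [net, Setting.cnt]; omega
  thr y := by simp [co, net, epochStart]
  ok := ⟨by simp [co, net], by simp [co, net, uOf, hX.s_pos]⟩
  S_sub := by simp [co, net]
  D_sub := by simp [co, net]
  S_lev := by simp [co, net]
  D_lev := by simp [co, net]
  D_card := by simp [co, net]
  top_sub := by simp [top]

/-- An element of the new top set is the new item or was in the old top set and hence stored
(`htop`). Having fewer than `s` superiors among all items, it survives every truncation of a set of
items that contains it (`hstay`). -/
theorem netInv_succ {trim : Bool} {X : Setting} (hX : X.Good) {t : ℕ} (h : NetInv trim X t) :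
    NetInv trim X (t + 1) := by
  have hcs := X.cnt_succ t
  have hcap := Setting.cap_pos hX.s_pos
  have hsub := Finset.range_subset_range.2 (Nat.le_succ t)
  have hmono : ∀ j, X.cnt t j ≤ X.cnt (t + 1) j := fun j => by rw [hcs]; omega
  have htop : ∀ i ∈ top X.s X.key (Finset.range (t + 1)),
      i = t ∨ i ∈ (co trim X t).S ∨ i ∈ (co trim X t).D := by
    intro i hi
    rcases eq_or_ne i t with h0 | h0
    · exact Or.inl h0
    · have h1 := Finset.mem_range.1 (mem_top.1 hi).1
      have h2 := h.top_sub (mem_top_of_subset hsub (Finset.mem_range.2 (by omega)) hi)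
      exact Or.inr (Finset.mem_union.1 h2)
  have hstay : ∀ A : Finset ℕ, A ⊆ Finset.range (t + 1) → ∀ i ∈ A,
      i ∈ top X.s X.key (Finset.range (t + 1)) → i ∈ top X.s X.key A :=
    fun A hA i hi h' => mem_top_of_subset hA hi h'
  have hheld : held trim X t ⊆ Finset.range (t + 1) := by
    refine (held_subset trim X t).trans fun i hi => ?_
    rcases Finset.mem_insert.1 hi with rfl | hi
    · simp
    · exact hsub (h.D_sub hi)
  have hheld' : ∀ i ∈ top X.s X.key (Finset.range (t + 1)), i ∈ insert t (co trim X t).D →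
      i ∈ held trim X t := by
    intro i hi h'
    refine top_insert_subset_held trim X t (hstay _ ?_ i h' hi)
    intro l hl
    rcases Finset.mem_insert.1 hl with rfl | hl
    · simp
    · exact hsub (h.D_sub hl)
  have hheldcard : trim = true → (held trim X t).card ≤ X.s := by
    intro ht
    rw [held, if_pos ht, card_top hX.inj]
    exact min_le_left _ _
  rcases reply_cases hX h with ⟨hs, -, hk, hc, hd⟩ | ⟨hs, -, hk, hc, hd⟩ | ⟨hs, -, hc, hd⟩ |
    ⟨hs, -, hc, hd⟩
  · constructor
    · intro j; rw [hc, h.count, hcs]; split_ifs with h1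
      · rw [← h1]; omega
      · rfl
    · intro y j; rw [sites_succ, hd, List.foldl_nil, h.sat, hcs]
      split_ifs with h1
      · rw [← h1, decide_eq_decide]; omega
      · rfl
    · intro y; rw [sites_succ, hd, hc]; exact h.thr y
    · rw [hc]; exact h.ok
    · rw [hc]; exact h.S_sub.trans hsub
    · rw [hc]; exact h.D_sub.trans hsub
    · rw [hc]; exact fun i hi => (h.S_lev i hi).trans (hmono _)
    · rw [hc]; intro i hi
      rw [hcs, if_neg]
      · exact h.D_lev i hi
      · intro h'; have := h.D_lev i hi; rw [← h'] at this; omega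
    · rw [hc]; exact h.D_card
    · rw [hc]
      intro i hi
      rcases htop i hi with rfl | h'
      -- The suppressed item is at most the threshold, hence at most `u`; the `s` sample items with
      -- keys at least `u` keep it out of the top set.
      · exfalso
        have hu : 0 ≤ (co trim X i).u := h.ok.u ▸ uOf_nonneg hX _
        have h1 := (le_uOf_iff hX h.ok.card (hX.pos i)).1
          (hk.trans (h.ok.u ▸ epochStart_le X.one_lt_r hu))
        have h2 := (mem_top.1 hi).2
        have : ((co trim X i).S.filter fun j => X.key i ≤ X.key j) ⊆
            (Finset.range (i + 1)).filter fun j => X.key i < X.key j := by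
          intro j hj
          rw [Finset.mem_filter] at hj ⊢
          refine ⟨hsub (h.S_sub hj.1), lt_of_le_of_ne hj.2 fun he => ?_⟩
          have := h.S_sub hj.1
          rw [← hX.inj he] at this
          simp at this
        have := Finset.card_le_card this
        omega
      · exact Finset.mem_union.2 h'
  · obtain ⟨a1, a2, a3, a4, a5, a6, a7, a8⟩ := addAll_ok hX [t] h.ok
    have hS : (co trim X (t + 1)).S = top X.s X.key (insert t (co trim X t).S) := by
      rw [hc, a2]
      congr 1
      ext j; simp
    have hsite : ∀ y, (net trim X (t + 1)).sites y = { (net trim X t).sites y with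
        thr := epochStart X.r (co trim X (t + 1)).u } := by
      intro y
      rw [sites_succ, hd, a8 _ (h.thr y), hc]
    constructor
    · intro j; rw [hc, a4, h.count, hcs]; split_ifs with h1
      · rw [← h1]; omega
      · rfl
    · intro y j; rw [hsite]; simp only; rw [h.sat, hcs]
      split_ifs with h1
      · rw [← h1, decide_eq_decide]; omega
      · rfl
    · intro y; rw [hsite]
    · rw [hc]; exact a1
    · rw [hS]
      intro i hi
      rcases Finset.mem_insert.1 (mem_top.1 hi).1 with rfl | h'
      · simp
      · exact hsub (h.S_sub h')
    · rw [hc, a3]; exact h.D_sub.trans hsub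
    · rw [hS]
      intro i hi
      rcases Finset.mem_insert.1 (mem_top.1 hi).1 with rfl | h'
      · exact hs.trans (hmono _)
      · exact (h.S_lev i h').trans (hmono _)
    · rw [hc, a3]; intro i hi
      rw [hcs, if_neg]
      · exact h.D_lev i hi
      · intro h'; have := h.D_lev i hi; rw [← h'] at this; omega
    · rw [hc, a3]; exact h.D_card
    · rw [hS, hc, a3]
      intro i hi
      rw [Finset.mem_union]
      have hS' : insert t (co trim X t).S ⊆ Finset.range (t + 1) := by
        intro l hl
        rcases Finset.mem_insert.1 hl with rfl | hl
        · simp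
        · exact hsub (h.S_sub hl)
      rcases htop i hi with rfl | h' | h'
      · exact Or.inl (hstay _ hS' _ (Finset.mem_insert_self _ _) hi)
      · exact Or.inl (hstay _ hS' _ (Finset.mem_insert_of_mem h') hi)
      · exact Or.inr h'
  · have hcount := h.count (X.lev t)
    constructor
    · intro j; rw [hc, hcs]
      simp only [Function.update_apply]
      rcases eq_or_ne j (X.lev t) with rfl | h1
      · simp; omega
      · rw [if_neg h1, if_neg h1.symm]; exact h.count j
    · intro y j; rw [sites_succ, hd, List.foldl_nil, h.sat, hcs]
      split_ifs with h1
      · rw [← h1, decide_eq_decide]; omega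
      · rfl
    · intro y; rw [sites_succ, hd, hc]; exact h.thr y
    · rw [hc]; exact ⟨h.ok.card, h.ok.u⟩
    · rw [hc]; exact h.S_sub.trans hsub
    · rw [hc]; exact hheld
    · rw [hc]; exact fun i hi => (h.S_lev i hi).trans (hmono _)
    · rw [hc]; intro i hi
      rw [hcs]
      rcases Finset.mem_insert.1 (held_subset trim X t hi) with rfl | h'
      · simp; omega
      · have := h.D_lev i h'
        split_ifs with h1
        · rw [← h1]; omega
        · omega
    · rw [hc]; exact hheldcard
    · rw [hc]
      intro i hi
      rw [Finset.mem_union]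
      rcases htop i hi with rfl | h' | h'
      · exact Or.inr (hheld' _ hi (Finset.mem_insert_self _ _))
      · exact Or.inl h'
      · exact Or.inr (hheld' _ hi (Finset.mem_insert_of_mem h'))
  · obtain ⟨a1, a2, a3, a4, a5, a6, a7, a8⟩ := addAll_ok hX (released trim X t) (c := counted trim X t)
      ⟨h.ok.card, h.ok.u⟩
    have hcount := h.count (X.lev t)
    have hsite : ∀ y, (net trim X (t + 1)).sites y =
        { saturated := Function.update ((net trim X t).sites y).saturated (X.lev t) true
          thr := epochStart X.r (co trim X (t + 1)).u } := by
      intro y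
      rw [sites_succ, hd, List.foldl_append, a8 _ (h.thr y), hc]
      rfl
    have hS : (co trim X (t + 1)).S = top X.s X.key ((co trim X t).S ∪ (released trim X t).toFinset) := by
      rw [hc, a2]; rfl
    have hD : (co trim X (t + 1)).D = (held trim X t).filter fun m => X.lev m ≠ X.lev t := by
      rw [hc, a3]; rfl
    have hSr : (co trim X t).S ∪ (released trim X t).toFinset ⊆ Finset.range (t + 1) := by
      refine Finset.union_subset (h.S_sub.trans hsub) fun i hi => ?_
      exact hheld (mem_released.1 hi).1
    constructor
    · intro j; rw [hc, a4, hcs]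
      simp only [counted, Function.update_apply]
      rcases eq_or_ne j (X.lev t) with rfl | h1
      · simp; omega
      · rw [if_neg h1, if_neg h1.symm]; exact h.count j
    · intro y j; rw [hsite]
      simp only [Function.update_apply, h.sat, hcs]
      rcases eq_or_ne j (X.lev t) with rfl | h1
      · simp; omega
      · simp [h1, h1.symm]
    · intro y; rw [hsite]
    · rw [hc]; exact a1
    · rw [hS]; exact (top_subset _ _ _).trans hSr
    · rw [hD]; exact (Finset.filter_subset _ _).trans hheld
    · rw [hS]
      intro i hi
      rcases Finset.mem_union.1 (mem_top.1 hi).1 with h' | h'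
      · exact (h.S_lev i h').trans (hmono _)
      · rw [(mem_released.1 h').2, hcs]; simp; omega
    · rw [hD]; intro i hi
      rw [Finset.mem_filter] at hi
      rw [hcs, if_neg (Ne.symm hi.2)]
      rcases Finset.mem_insert.1 (held_subset trim X t hi.1) with rfl | h'
      · exact absurd rfl hi.2
      · exact h.D_lev i h'
    · intro ht
      rw [hD]
      exact (Finset.card_filter_le _ _).trans (hheldcard ht)
    · rw [hS, hD]
      intro i hi
      rw [Finset.mem_union]
      have key : i ∈ insert t (co trim X t).D →
          i ∈ top X.s X.key ((co trim X t).S ∪ (released trim X t).toFinset) ∨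
          i ∈ (held trim X t).filter fun m => X.lev m ≠ X.lev t := by
        intro h'
        have h2 := hheld' i hi h'
        by_cases h3 : X.lev i = X.lev t
        · exact Or.inl (hstay _ hSr i (Finset.mem_union_right _ (mem_released.2 ⟨h2, h3⟩)) hi)
        · exact Or.inr (Finset.mem_filter.2 ⟨h2, h3⟩)
      rcases htop i hi with rfl | h' | h'
      · exact key (Finset.mem_insert_self _ _)
      · exact Or.inl (hstay _ hSr i (Finset.mem_union_left _ h') hi)
      · exact key (Finset.mem_insert_of_mem h')

theorem netInv {X : Setting} (hX : X.Good) (trim : Bool) (t : ℕ) : NetInv trim X t := by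
  induction t with
  | zero => exact netInv_zero hX
  | succ t ih => exact netInv_succ hX ih

theorem sample_eq {X : Setting} (hX : X.Good) (trim : Bool) (t : ℕ) :
    sample trim X t = top X.s X.key (Finset.range t) :=
  top_sandwich hX.inj (netInv hX trim t).top_sub
    (Finset.union_subset (netInv hX trim t).S_sub (netInv hX trim t).D_sub)

/-! ### Counting the messages -/

/-- Item `t` belongs to a level that is saturated when it arrives. -/
abbrev Setting.Late (X : Setting) (t : ℕ) : Prop := X.cap ≤ X.cnt t (X.lev t)

/-- The number of early messages caused by the first `n` items. -/
def Setting.early (X : Setting) (n : ℕ) : ℕ := ((Finset.range n).filter fun t => ¬ X.Late t).card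

/-- The number of levels saturated by the first `n` items. -/
def Setting.sats (X : Setting) (n : ℕ) : ℕ :=
  ((Finset.range n).filter fun t => X.cnt t (X.lev t) + 1 = X.cap).card

/-- The number of regular messages caused by the first `n` items. -/
def regs (trim : Bool) (X : Setting) (n : ℕ) : ℕ :=
  ((Finset.range n).filter fun t => X.Late t ∧ epochStart X.r (co trim X t).u < X.key t).card

/-- The number of the current epoch. -/
abbrev epo (trim : Bool) (X : Setting) (t : ℕ) : ℕ := epochIdx X.r (co trim X t).u

/-- All that the counting arguments need to know about a step: the sample is enlarged by some set
and truncated, and a regular item belongs to that set. -/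
theorem exists_S_succ {X : Setting} (hX : X.Good) (trim : Bool) (t : ℕ) :
    ∃ F : Finset ℕ, (co trim X (t + 1)).S = top X.s X.key ((co trim X t).S ∪ F) ∧
      (X.Late t → epochStart X.r (co trim X t).u < X.key t → t ∈ F) := by
  have h := netInv hX trim t
  rcases reply_cases hX h with ⟨hs, -, hk, hc, hd⟩ | ⟨hs, -, hk, hc, hd⟩ | ⟨hs, -, hc, hd⟩ |
    ⟨hs, -, hc, hd⟩
  · exact ⟨∅, by rw [hc, Finset.union_empty, h.ok.top], fun _ h' => absurd h' (not_lt.2 hk)⟩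
  · exact ⟨{t}, by rw [hc, (addAll_ok hX [t] h.ok).2.1]; rfl, fun _ _ => Finset.mem_singleton_self t⟩
  · exact ⟨∅, by rw [hc, Finset.union_empty, h.ok.top], fun h' => by simp only [Setting.Late] at h'; omega⟩
  · refine ⟨_, by rw [hc, (addAll_ok hX _ (c := counted trim X t) ⟨h.ok.card, h.ok.u⟩).2.1]; rfl,
      fun h' => by simp only [Setting.Late] at h'; omega⟩

theorem u_succ {X : Setting} (hX : X.Good) (trim : Bool) (t : ℕ) :
    (co trim X t).u ≤ (co trim X (t + 1)).u := by
  obtain ⟨F, hF, -⟩ := exists_S_succ hX trim t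
  rw [(netInv hX trim t).ok.u, (netInv hX trim (t + 1)).ok.u, hF, ← (netInv hX trim t).ok.top]
  nth_rewrite 2 [(netInv hX trim t).ok.top]
  exact uOf_top_mono hX Finset.subset_union_left

theorem epo_succ {X : Setting} (hX : X.Good) (trim : Bool) (t : ℕ) :
    epo trim X t ≤ epo trim X (t + 1) := epochIdx_mono X.one_lt_r (u_succ hX trim t)

theorem epo_mono {X : Setting} (hX : X.Good) (trim : Bool) : Monotone (epo trim X) :=
  monotone_nat_of_le_succ (epo_succ hX trim)

theorem down_length {X : Setting} (hX : X.Good) (trim : Bool) (t : ℕ) :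
    (down trim X t).length ≤ (if X.cnt t (X.lev t) + 1 = X.cap then 1 else 0) +
      (epo trim X (t + 1) - epo trim X t) := by
  have h := netInv hX trim t
  rcases reply_cases hX h with ⟨hs, -, hk, hc, hd⟩ | ⟨hs, -, hk, hc, hd⟩ | ⟨hs, -, hc, hd⟩ |
    ⟨hs, -, hc, hd⟩
  · simp [hd]
  · have := (addAll_ok hX [t] h.ok).2.2.2.2.2.2.1
    rw [hd, epo, hc]
    exact this.trans (Nat.le_add_left _ _)
  · simp [hd]
  · have := (addAll_ok hX (released trim X t) (c := counted trim X t)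
      ⟨h.ok.card, h.ok.u⟩).2.2.2.2.2.2.1
    rw [hd, epo, hc, if_pos hs, List.length_append, List.length_singleton, add_comm]
    exact Nat.add_le_add_left this 1

theorem up_length {X : Setting} (hX : X.Good) (trim : Bool) (t : ℕ) :
    (up trim X t).toList.length = (if ¬ X.Late t then 1 else 0) +
      if X.Late t ∧ epochStart X.r (co trim X t).u < X.key t then 1 else 0 := by
  rw [(netInv hX trim t).up_eq]
  by_cases h1 : X.Late t <;> by_cases h2 : epochStart X.r (co trim X t).u < X.key t <;> simp [h1, h2]

theorem epo_zero {X : Setting} (trim : Bool) : epo trim X 0 = 0 := by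
  simp [epo, co, net, epochIdx]

theorem sum_epo {X : Setting} (hX : X.Good) (trim : Bool) (n : ℕ) :
    ∑ t ∈ Finset.range n, (epo trim X (t + 1) - epo trim X t) = epo trim X n := by
  induction n with
  | zero => simp [epo_zero]
  | succ n ih =>
      rw [Finset.sum_range_succ, ih]
      have := epo_succ hX trim n
      omega

theorem messages_le {X : Setting} (hX : X.Good) (trim : Bool) (n : ℕ) :
    messages trim X n ≤ X.early n + X.k * X.sats n + regs trim X n + X.k * epo trim X n := by
  rw [← sum_epo hX, Setting.early, Setting.sats, regs, Finset.card_filter, Finset.card_filter,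
    Finset.card_filter, Finset.mul_sum, Finset.mul_sum, ← Finset.sum_add_distrib,
    ← Finset.sum_add_distrib, ← Finset.sum_add_distrib, messages]
  refine Finset.sum_le_sum fun t _ => ?_
  have h1 := up_length hX trim t
  have h2 := Nat.mul_le_mul_left X.k (down_length hX trim t)
  rw [mul_add] at h2
  omega

theorem cnt_le (X : Setting) (t j : ℕ) : X.cnt t j ≤ t :=
  (Finset.card_filter_le _ _).trans (Finset.card_range t).le

/-- Fewer than `X.cap` items cannot saturate any level, so nothing has been released yet. -/
theorem epo_eq_zero {X : Setting} (hX : X.Good) (trim : Bool) {n : ℕ} (hn : n < X.cap) :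
    epo trim X n = 0 := by
  have h := netInv hX trim n
  have hS : (co trim X n).S = ∅ := by
    refine Finset.eq_empty_of_forall_notMem fun i hi => ?_
    have := h.S_lev i hi
    have := cnt_le X n (X.lev i)
    omega
  rw [epo, h.ok.u, hS]
  simp [uOf, hX.s_pos, epochIdx]

/-- In one epoch, at most `s` messages have keys beyond the epoch. -/
theorem card_jumps_le {X : Setting} (hX : X.Good) (trim : Bool) (q n : ℕ) :
    ((Finset.range n).filter fun t => X.Late t ∧ epo trim X t = q ∧ X.r ^ q ≤ X.key t).card ≤ X.s := by
  have hr : ∀ q, 0 < X.r ^ q := fun q => pow_pos (by linarith [X.two_le_r]) _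
  -- The potential is the number of sample items with keys at least `r ^ q`. In epoch `q` it is
  -- below `s`, since `u < r ^ q`, and each counted item then raises it by at least one; truncation
  -- to `s` items never lowers it.
  refine le_trans (b := ((co trim X n).S.filter fun l => X.r ^ q ≤ X.key l).card) ?_
    ((Finset.card_filter_le _ _).trans (netInv hX trim n).ok.card)
  induction n with
  | zero => simp
  | succ n ih =>
      obtain ⟨F, hF, hF'⟩ := exists_S_succ hX trim n
      have h := netInv hX trim n
      have hle : ((co trim X n).S.filter fun l => X.r ^ q ≤ X.key l).card ≤ X.s :=
        (Finset.card_filter_le _ _).trans h.ok.card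
      have hmono : ((co trim X n).S.filter fun l => X.r ^ q ≤ X.key l) ⊆
          (((co trim X n).S ∪ F).filter fun l => X.r ^ q ≤ X.key l) :=
        Finset.filter_subset_filter _ Finset.subset_union_left
      rw [hF, card_top_filter hX.inj _ _ fun i j h h' => h.trans h'.le, Finset.range_add_one,
        Finset.filter_insert]
      split_ifs with hev
      · obtain ⟨h1, h2, h3⟩ := hev
        have hlt : epochStart X.r (co trim X n).u < X.key n := by
          refine lt_of_lt_of_le ?_ h3
          rw [epochStart_eq, show epochIdx X.r (co trim X n).u = q from h2]
          split_ifs with h0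
          · exact hr q
          · exact pow_lt_pow_right₀ X.one_lt_r (by omega)
        have hcard : ¬ X.s ≤ ((co trim X n).S.filter fun l => X.r ^ q ≤ X.key l).card := by
          rw [← le_uOf_iff hX h.ok.card (hr q), ← h.ok.u, pow_le_iff X.one_lt_r,
            show epochIdx X.r (co trim X n).u = q from h2]
          omega
        have hnS : n ∉ (co trim X n).S := fun h' => by simpa using h.S_sub h'
        have : insert n ((co trim X n).S.filter fun l => X.r ^ q ≤ X.key l) ⊆
            (((co trim X n).S ∪ F).filter fun l => X.r ^ q ≤ X.key l) := by
          refine Finset.insert_subset (Finset.mem_filter.2 ⟨Finset.mem_union_right _ (hF' h1 hlt), h3⟩)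
            hmono
        have := Finset.card_le_card this
        rw [Finset.card_insert_of_notMem (by simp [hnS])] at this
        rw [Finset.card_insert_of_notMem (by simp)]
        omega
      · have := Finset.card_le_card hmono
        omega

/-! ### The run depends on comparisons of keys only -/

/-- The settings `X` and `Y` with the same stream have similar keys for the first `n` items: their
comparisons with each other and with the thresholds have the same outcome. -/
structure Similar (X Y : Setting) (n : ℕ) : Prop where
  lt : ∀ i < n, ∀ j < n, (X.key i < X.key j ↔ Y.key i < Y.key j)
  epoch : ∀ i < n, epochIdx X.r (X.key i) = epochIdx Y.r (Y.key i)
  strict : ∀ i < n, (epochStart X.r (X.key i) < X.key i ↔ epochStart Y.r (Y.key i) < Y.key i)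
  pos : ∀ i < n, (0 < X.key i ↔ 0 < Y.key i)

/-- A threshold is zero or a power of `r`. -/
def IsThr (r x : ℝ) : Prop := x = 0 ∨ ∃ j : ℕ, x = r ^ j

theorem isThr_epochStart (r u : ℝ) : IsThr r (epochStart r u) := by
  unfold epochStart
  split_ifs
  · exact Or.inl rfl
  · exact Or.inr ⟨_, rfl⟩

/-- Sites compare strictly with powers of `r`, whereas `epochIdx` decides weak comparisons. The only
missing information is whether the key equals its own `epochStart`, which explains the field
`strict` of `Similar`. -/
theorem pow_lt_iff {r : ℝ} (hr : 1 < r) (x : ℝ) (j : ℕ) : r ^ j < x ↔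
    j + 1 < epochIdx r x ∨ (j + 1 = epochIdx r x ∧ epochStart r x < x) := by
  have h := pow_le_iff hr x
  rcases lt_trichotomy (j + 1) (epochIdx r x) with h1 | h1 | h1
  · have h2 := (h (j + 1)).2 h1
    have : r ^ j < r ^ (j + 1) := pow_lt_pow_right₀ hr (by omega)
    exact ⟨fun _ => Or.inl h1, fun _ => this.trans_le h2⟩
  · rw [epochStart_eq, ← h1, if_neg (by omega), Nat.add_sub_cancel]
    simp
  · constructor
    · intro h'
      have := (h j).1 h'.le
      omega
    · omega

/-- Two settings with the same stream. -/
structure SameStream (X Y : Setting) : Prop where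
  s : X.s = Y.s
  w : X.w = Y.w
  r : X.r = Y.r

namespace Similar

variable {X Y : Setting} {n : ℕ}

theorem thr_lt (h : Similar X Y n) (hXY : SameStream X Y) {x : ℝ} (hx : IsThr X.r x) {i : ℕ}
    (hi : i < n) : x < X.key i ↔ x < Y.key i := by
  rcases hx with rfl | ⟨j, rfl⟩
  · exact h.pos i hi
  · rw [pow_lt_iff X.one_lt_r, h.epoch i hi, h.strict i hi, hXY.r, ← pow_lt_iff Y.one_lt_r]

theorem top_eq (h : Similar X Y n) (hXY : SameStream X Y) {A : Finset ℕ}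
    (hA : A ⊆ Finset.range n) : top X.s X.key A = top Y.s Y.key A := by
  unfold top
  refine Finset.filter_congr fun i hi => ?_
  rw [hXY.s, Finset.filter_congr fun j hj => h.lt i (Finset.mem_range.1 (hA hi)) j
    (Finset.mem_range.1 (hA hj))]

/-- Values of `u` that correspond to each other. -/
def URel (X Y : Setting) (n : ℕ) (u u' : ℝ) : Prop :=
  (u = 0 ∧ u' = 0) ∨ ∃ m < n, u = X.key m ∧ u' = Y.key m

theorem URel.epoch (h : Similar X Y n) {u u' : ℝ} (hu : URel X Y n u u') :
    epochIdx X.r u = epochIdx Y.r u' := by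
  rcases hu with ⟨rfl, rfl⟩ | ⟨m, hm, rfl, rfl⟩
  · simp [epochIdx]
  · exact h.epoch m hm

theorem URel.start (h : Similar X Y n) (hXY : SameStream X Y) {u u' : ℝ} (hu : URel X Y n u u') :
    epochStart X.r u = epochStart Y.r u' := by
  rw [epochStart_eq, epochStart_eq, hu.epoch h, hXY.r]

theorem URel.lt (h : Similar X Y n) {u u' : ℝ} (hu : URel X Y n u u') {i : ℕ} (hi : i < n) :
    u < X.key i ↔ u' < Y.key i := by
  rcases hu with ⟨rfl, rfl⟩ | ⟨m, hm, rfl, rfl⟩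
  · exact h.pos i hi
  · exact h.lt m hm i hi

/-- As the keys compare alike, the smallest key in the sample belongs to the same item in both
settings. -/
theorem uOf_rel (h : Similar X Y n) (hXY : SameStream X Y) {S : Finset ℕ}
    (hS : S ⊆ Finset.range n) : URel X Y n (uOf X S) (uOf Y S) := by
  unfold uOf
  rw [hXY.s]
  split_ifs
  · exact Or.inl ⟨rfl, rfl⟩
  · rcases S.eq_empty_or_nonempty with rfl | hne
    · left; simp
    · obtain ⟨m, hm, hmin⟩ := S.exists_min_image X.key hne
      have hm' := Finset.mem_range.1 (hS hm)
      refine Or.inr ⟨m, hm', ?_, ?_⟩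
      · exact IsLeast.csInf_eq ⟨⟨m, hm, rfl⟩, by rintro _ ⟨l, hl, rfl⟩; exact hmin l hl⟩
      · refine IsLeast.csInf_eq ⟨⟨m, hm, rfl⟩, ?_⟩
        rintro _ ⟨l, hl, rfl⟩
        have := hmin l hl
        rw [← not_lt, h.lt l (Finset.mem_range.1 (hS hl)) m hm', not_lt] at this
        exact this

/-- Corresponding states of the coordinator. -/
structure CRel (X Y : Setting) (n : ℕ) (c c' : CoordState) : Prop where
  count : c.count = c'.count
  D : c.D = c'.D
  S : c.S = c'.S
  D_sub : c.D ⊆ Finset.range n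
  S_sub : c.S ⊆ Finset.range n
  u : URel X Y n c.u c'.u

theorem addToSample_rel (h : Similar X Y n) (hXY : SameStream X Y) {c c' : CoordState}
    (hc : CRel X Y n c c') {i : ℕ} (hi : i < n) :
    CRel X Y n (addToSample X c i).1 (addToSample Y c' i).1 ∧
      (addToSample X c i).2 = (addToSample Y c' i).2 := by
  have hsub : insert i c.S ⊆ Finset.range n :=
    Finset.insert_subset (Finset.mem_range.2 hi) hc.S_sub
  have hS : (addToSample X c i).1.S = (addToSample Y c' i).1.S := by
    rw [addToSample_S, addToSample_S, ← hc.S, h.top_eq hXY hsub]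
  have hSn : (addToSample X c i).1.S ⊆ Finset.range n := (top_subset _ _ _).trans hsub
  have hu : URel X Y n (addToSample X c i).1.u (addToSample Y c' i).1.u := by
    have := h.uOf_rel hXY hSn
    nth_rewrite 2 [hS] at this
    exact this
  refine ⟨⟨hc.count, hc.D, hS, hc.D_sub, hSn, hu⟩, ?_⟩
  have e : ∀ (Z : Setting) (c : CoordState), (addToSample Z c i).2 =
    if 1 ≤ (addToSample Z c i).1.u ∧
    epochStart Z.r (addToSample Z c i).1.u ≠ epochStart Z.r c.u then
      [.epoch (epochStart Z.r (addToSample Z c i).1.u)] else [] := fun _ _ => rfl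
  rw [e, e, hu.start h hXY, hc.u.start h hXY]
  have h1 := one_le_iff_epochIdx X.one_lt_r (addToSample X c i).1.u
  rw [hu.epoch h, ← one_le_iff_epochIdx Y.one_lt_r] at h1
  simp only [h1]

theorem addAll_rel (h : Similar X Y n) (hXY : SameStream X Y) (l : List ℕ) :
    ∀ {c c' : CoordState}, CRel X Y n c c' → (∀ i ∈ l, i < n) →
    CRel X Y n (addAll X c l).1 (addAll Y c' l).1 ∧ (addAll X c l).2 = (addAll Y c' l).2 ∧
      ∀ m ∈ (addAll X c l).2, ∃ x, m = .epoch x ∧ IsThr X.r x := by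
  induction l with
  | nil => intro c c' hc _; exact ⟨hc, rfl, by simp [addAll]⟩
  | cons i l ih =>
      intro c c' hc hl
      obtain ⟨h1, h2⟩ := h.addToSample_rel hXY hc (hl i (by simp))
      obtain ⟨h3, h4, h5⟩ := ih h1 fun j hj => hl j (by simp [hj])
      refine ⟨h3, by simp only [addAll, h2, h4], fun m hm => ?_⟩
      rcases List.mem_append.1 (by simpa only [addAll] using hm) with hm | hm
      · have e : (addToSample X c i).2 = if 1 ≤ (addToSample X c i).1.u ∧
          epochStart X.r (addToSample X c i).1.u ≠ epochStart X.r c.u then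
            [.epoch (epochStart X.r (addToSample X c i).1.u)] else [] := rfl
        rw [e] at hm
        split_ifs at hm
        · exact ⟨_, List.mem_singleton.1 hm, isThr_epochStart _ _⟩
        · simp at hm
      · exact h5 m hm

theorem saturate_rel (h : Similar X Y n) (hXY : SameStream X Y) {l : List ℕ} {j : ℕ}
    {c c' : CoordState} (hc : CRel X Y n c c') (hl : ∀ i ∈ l, i < n) :
    CRel X Y n (addAll X c l).1 (addAll Y c' l).1 ∧
      (addAll X c l).2 ++ [Msg.saturated j] = (addAll Y c' l).2 ++ [Msg.saturated j] ∧
      ∀ m ∈ (addAll X c l).2 ++ [Msg.saturated j], ∀ x, m = .epoch x → IsThr Y.r x := by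
  obtain ⟨h1, h2, h3⟩ := h.addAll_rel hXY l hc hl
  refine ⟨h1, by rw [h2], fun m hm x hx => ?_⟩
  rcases List.mem_append.1 hm with hm | hm
  · obtain ⟨x', hx', h4⟩ := h3 m hm
    rw [hx', Msg.epoch.injEq] at hx
    exact hXY.r ▸ hx ▸ h4
  · rw [List.mem_singleton.1 hm] at hx
    cases hx

/-- Corresponding messages to the coordinator. -/
def MRel (X Y : Setting) (m m' : Option Msg) : Prop :=
  m = m' ∧ (m = none ∨ ∃ i w, m = some (.early i w)) ∨
    ∃ i, m = some (.regular i (X.w i) (X.key i)) ∧ m' = some (.regular i (Y.w i) (Y.key i))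

/-- Corresponding states of the network. -/
structure NRel (X Y : Setting) (n : ℕ) (trim : Bool) (t : ℕ) (hk : X.k = Y.k) : Prop where
  co : CRel X Y n (co trim X t) (co trim Y t)
  site : ∀ y, (net trim X t).sites y = (net trim Y t).sites (y.cast hk)
  thr : ∀ y, IsThr X.r ((net trim X t).sites y).thr

end Similar

theorem foldl_thr {r : ℝ} (l : List Msg) (hl : ∀ m ∈ l, ∀ x, m = .epoch x → IsThr r x) :
    ∀ a : SiteState, IsThr r a.thr → IsThr r (l.foldl siteReceive a).thr := by
  induction l with
  | nil => exact fun a ha => ha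
  | cons m l ih =>
      intro a ha
      refine ih (fun m hm => hl m (by simp [hm])) _ ?_
      cases m <;> simp only [siteReceive] <;> first | exact ha | exact hl _ (by simp) _ rfl

/-- Every branch of the algorithm is decided by the stream or by a comparison that `Similar`
preserves. Regular messages contain keys, so they merely correspond; broadcasts contain only levels
and powers of `r`, so they coincide, and with them the states of the sites. -/
theorem Similar.step {X Y : Setting} {n : ℕ} (h : Similar X Y n) (hXY : SameStream X Y)
    (hk : X.k = Y.k) (hsite : ∀ i, (X.site i).cast hk = Y.site i) {trim : Bool} {t : ℕ} (ht : t < n)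
    (hN : NRel X Y n trim t hk) :
    NRel X Y n trim (t + 1) hk ∧ (up trim X t).isSome = (up trim Y t).isSome ∧
      down trim X t = down trim Y t := by
  have hs := hN.site (X.site t)
  rw [hsite t] at hs
  have hw : ∀ i, level X.r (X.w i) = level Y.r (Y.w i) := fun i => by rw [hXY.r, hXY.w]
  have hup : MRel X Y (up trim X t) (up trim Y t) := by
    simp only [up, Net.up, siteArrive]
    rw [← hs, ← hw]
    simp only [← h.thr_lt hXY (hN.thr _) ht]
    split_ifs
    · exact Or.inr ⟨t, rfl, rfl⟩
    · exact Or.inl ⟨rfl, Or.inl rfl⟩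
    · exact Or.inl ⟨by rw [hXY.w], Or.inr ⟨_, _, rfl⟩⟩
  have hupt : ∀ i w, up trim X t = some (.early i w) → i = t := by
    intro i w he
    simp only [up, Net.up, siteArrive] at he
    split_ifs at he
    · simp at he
    · simp only [Option.some.injEq, Msg.early.injEq] at he
      exact he.1.symm
  have hupt' : ∀ i w v, up trim X t = some (.regular i w v) → i = t := by
    intro i w v he
    simp only [up, Net.up, siteArrive] at he
    split_ifs at he
    · simp only [Option.some.injEq, Msg.regular.injEq] at he
      exact he.1.symm
    · simp at he
  have hco : ∀ Z : Setting, WSWOR.co trim Z (t + 1) = ((net trim Z t).reply trim Z t).1 := fun _ => rfl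
  have hdn : ∀ Z : Setting, down trim Z t = ((net trim Z t).reply trim Z t).2 := fun _ => rfl
  have hrep : ∀ Z : Setting, (net trim Z t).reply trim Z t = match up trim Z t with
    | none => (WSWOR.co trim Z t, [])
    | some m => coordReceive trim Z (WSWOR.co trim Z t) m := fun _ => rfl
  have hsub : insert t (WSWOR.co trim X t).D ⊆ Finset.range n :=
    Finset.insert_subset (Finset.mem_range.2 ht) hN.co.D_sub
  have main : CRel X Y n (WSWOR.co trim X (t + 1)) (WSWOR.co trim Y (t + 1)) ∧
      down trim X t = down trim Y t ∧
      ∀ m ∈ down trim X t, ∀ x, m = .epoch x → IsThr X.r x := by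
    rw [hco, hco, hdn, hdn, hrep, hrep]
    rcases hup with ⟨he, hX | ⟨i, w, hX⟩⟩ | ⟨i, hX, hY⟩
    · rw [← he, hX]
      exact ⟨hN.co, rfl, by simp⟩
    · rw [← he, hX]
      obtain rfl := hupt i w hX
      simp only [coordReceive]
      have hlev : level X.r w = level Y.r w := by rw [hXY.r]
      have hD : (if trim = true then top X.s X.key (insert i (WSWOR.co trim X i).D)
          else insert i (WSWOR.co trim X i).D) =
          if trim = true then top Y.s Y.key (insert i (WSWOR.co trim Y i).D)
          else insert i (WSWOR.co trim Y i).D := by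
        rw [← hN.co.D, h.top_eq hXY hsub]
      have hDs : (if trim = true then top X.s X.key (insert i (WSWOR.co trim X i).D)
          else insert i (WSWOR.co trim X i).D) ⊆ Finset.range n := by
        split_ifs
        · exact (top_subset _ _ _).trans hsub
        · exact hsub
      rw [← hD, hlev, ← hN.co.count, hXY.r, hXY.s]
      have hw' : ∀ i, level Y.r (X.w i) = level Y.r (Y.w i) := fun i => by rw [hXY.w]
      simp only [hw']
      rw [hXY.s] at hDs
      clear hD
      generalize (if trim = true then top Y.s X.key (insert i (WSWOR.co trim X i).D)
          else insert i (WSWOR.co trim X i).D) = D' at hDs ⊢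
      split_ifs
      · refine saturate_rel h hXY ?_ fun i hi => ?_
        · exact ⟨rfl, rfl, hN.co.S, (Finset.filter_subset _ _).trans hDs, hN.co.S_sub, hN.co.u⟩
        · simp only [Finset.mem_sort, Finset.mem_filter] at hi
          exact Finset.mem_range.1 (hDs hi.1)
      · exact ⟨⟨rfl, rfl, hN.co.S, hDs, hN.co.S_sub, hN.co.u⟩, rfl, by simp⟩
    · rw [hX, hY]
      obtain rfl := hupt' _ _ _ hX
      simp only [coordReceive]
      simp only [hN.co.u.lt h ht, addToSample_eq_addAll]
      split_ifs
      · obtain ⟨h1, h2, h3⟩ := h.addAll_rel hXY [i] hN.co (by simpa using ht)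
        refine ⟨h1, h2, fun m hm x hx => ?_⟩
        obtain ⟨x', hx', h4⟩ := h3 m hm
        rw [hx', Msg.epoch.injEq] at hx
        exact hx ▸ h4
      · exact ⟨hN.co, rfl, by simp⟩
  refine ⟨⟨main.1, fun y => ?_, fun y => ?_⟩, ?_, main.2.1⟩
  · rw [sites_succ, sites_succ, main.2.1, hN.site]
  · rw [sites_succ]
    exact foldl_thr _ main.2.2 _ (hN.thr y)
  · rcases hup with ⟨he, -⟩ | ⟨i, hX, hY⟩
    · rw [he]
    · rw [hX, hY]; rfl

theorem Similar.net {X Y : Setting} {n : ℕ} (h : Similar X Y n) (hXY : SameStream X Y)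
    (hk : X.k = Y.k) (hsite : ∀ i, (X.site i).cast hk = Y.site i) (trim : Bool) :
    ∀ t ≤ n, NRel X Y n trim t hk
  | 0, _ => ⟨⟨rfl, rfl, rfl, by simp [co, WSWOR.net], by simp [co, WSWOR.net], Or.inl ⟨rfl, rfl⟩⟩,
      fun _ => rfl, fun _ => Or.inl rfl⟩
  | t + 1, ht => (h.step hXY hk hsite ht (h.net hXY hk hsite trim t (by omega))).1

theorem Similar.messages_eq {X Y : Setting} {n : ℕ} (h : Similar X Y n) (hXY : SameStream X Y)
    (hk : X.k = Y.k) (hsite : ∀ i, (X.site i).cast hk = Y.site i) (trim : Bool) :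
    messages trim X n = messages trim Y n := by
  refine Finset.sum_congr rfl fun t ht => ?_
  have ht := Finset.mem_range.1 ht
  obtain ⟨-, h2, h3⟩ := h.step hXY hk hsite ht (h.net hXY hk hsite trim t ht.le)
  rw [h3, hk]
  congr 1
  revert h2
  cases up trim X t <;> cases up trim Y t <;> simp

theorem Similar.epo_eq {X Y : Setting} {n : ℕ} (h : Similar X Y n) (hXY : SameStream X Y)
    (hk : X.k = Y.k) (hsite : ∀ i, (X.site i).cast hk = Y.site i) (trim : Bool) :
    epo trim X n = epo trim Y n :=
  (h.net hXY hk hsite trim n le_rfl).co.u.epoch h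

theorem Similar.regs_eq {X Y : Setting} {n : ℕ} (h : Similar X Y n) (hXY : SameStream X Y)
    (hk : X.k = Y.k) (hsite : ∀ i, (X.site i).cast hk = Y.site i) (trim : Bool) :
    regs trim X n = regs trim Y n := by
  unfold regs
  congr 1
  refine Finset.filter_congr fun t ht => ?_
  have ht := Finset.mem_range.1 ht
  have hc := (h.net hXY hk hsite trim t ht.le).co
  have hl : X.Late t ↔ Y.Late t := by
    simp only [Setting.Late, Setting.cap, Setting.cnt, Setting.lev, hXY.s, hk, hXY.r, hXY.w]
    exact Iff.rfl
  rw [hl, hc.u.start h hXY, ← hXY.r, hXY.r, ← hc.u.start h hXY,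
    h.thr_lt hXY (isThr_epochStart _ _) ht]

/-! ### Measurability of events decided by comparisons of keys. -/

theorem measurable_level (r : ℝ) : Measurable (level r) := by
  unfold level Real.logb
  fun_prop

theorem measurable_epochIdx (r : ℝ) : Measurable (epochIdx r) := by
  unfold epochIdx
  have := measurable_level r
  exact Measurable.ite (measurableSet_lt measurable_id measurable_const) measurable_const
    (by fun_prop)

theorem measurable_epochStart (r : ℝ) : Measurable (epochStart r) := by
  unfold epochStart
  have := measurable_level r
  exact Measurable.ite (measurableSet_lt measurable_id measurable_const) measurable_const
    (by fun_prop)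

/-- An event that depends only on comparisons of the first `n` keys is measurable. -/
theorem measurableSet_of_similar {Ω : Type*} [MeasurableSpace Ω] {X : Ω → Setting} {n : ℕ}
    (hkey : ∀ i < n, Measurable fun ω => (X ω).key i) (hr : ∀ ω ω', (X ω).r = (X ω').r)
    {P : Ω → Prop} (hP : ∀ ω ω', Similar (X ω) (X ω') n → (P ω ↔ P ω')) :
    MeasurableSet {ω | P ω} := by
  let sig : Ω → (Fin n → Fin n → Prop) × (Fin n → ℕ) × (Fin n → Prop) × (Fin n → Prop) := fun ω =>
    (fun i j => (X ω).key i < (X ω).key j, fun i => epochIdx (X ω).r ((X ω).key i),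
      fun i => epochStart (X ω).r ((X ω).key i) < (X ω).key i, fun i => 0 < (X ω).key i)
  have hsig : Measurable sig := by
    rcases isEmpty_or_nonempty Ω with hΩ | ⟨⟨ω₀⟩⟩
    · exact measurable_of_empty _
    refine Measurable.prodMk ?_ (Measurable.prodMk ?_ (Measurable.prodMk ?_ ?_))
    · refine measurable_pi_lambda _ fun i => measurable_pi_lambda _ fun j => ?_
      exact measurableSet_setOfPred.1 (measurableSet_lt (hkey i i.2) (hkey j j.2))
    · refine measurable_pi_lambda _ fun i => ?_
      simp only [hr _ ω₀]
      exact (measurable_epochIdx _).comp (hkey i i.2)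
    · refine measurable_pi_lambda _ fun i => ?_
      simp only [hr _ ω₀]
      exact measurableSet_setOfPred.1 (measurableSet_lt ((measurable_epochStart _).comp (hkey i i.2))
        (hkey i i.2))
    · refine measurable_pi_lambda _ fun i => ?_
      exact measurableSet_setOfPred.1 (measurableSet_lt measurable_const (hkey i i.2))
  -- By `hP` the event is a union of fibres of the signature, whose values form a countable set; so
  -- it is the preimage of a measurable set.
  have : {ω | P ω} = sig ⁻¹' (sig '' {ω | P ω}) := by
    refine Set.Subset.antisymm (Set.subset_preimage_image _ _) ?_
    rintro ω ⟨ω', h, he⟩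
    simp only [sig, Prod.mk.injEq] at he
    obtain ⟨h1, h2, h3, h4⟩ := he
    refine (hP ω' ω ⟨fun i hi j hj => ?_, fun i hi => congrFun h2 ⟨i, hi⟩, fun i hi => ?_,
      fun i hi => ?_⟩).1 h
    · exact iff_of_eq (congrFun (congrFun h1 ⟨i, hi⟩) ⟨j, hj⟩)
    · exact iff_of_eq (congrFun h3 ⟨i, hi⟩)
    · exact iff_of_eq (congrFun h4 ⟨i, hi⟩)
  rw [this]
  exact hsig (Set.to_countable _).measurableSet

/-! ### Exponential races -/

/-- `T` is a sequence of independent exponential variables of rate `1`. -/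
structure ExpSeq {Ω : Type*} [MeasurableSpace Ω] (μ : Measure Ω) (T : ℕ → Ω → ℝ) : Prop where
  meas : ∀ i, Measurable (T i)
  indep : iIndepFun T μ
  law : ∀ i, μ.map (T i) = expMeasure 1

theorem expMeasure_Ioi {c x : ℝ} (hc : 0 < c) (hx : 0 ≤ x) :
    expMeasure c (Set.Ioi x) = ENNReal.ofReal (Real.exp (-(c * x))) := by
  have := isProbabilityMeasure_expMeasure hc
  have h := cdf_expMeasure_eq hc x
  rw [cdf_eq_real, if_pos hx] at h
  have h2 : (expMeasure c).real (Set.Ioi x) = Real.exp (-(c * x)) := by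
    rw [← Set.compl_Iic, probReal_compl_eq_one_sub measurableSet_Iic, h]
    ring
  rw [← h2, ofReal_measureReal]

theorem expMeasure_Iic_zero {c : ℝ} (hc : 0 < c) : expMeasure c (Set.Iic 0) = 0 := by
  have := isProbabilityMeasure_expMeasure hc
  have h := cdf_expMeasure_eq hc 0
  rw [cdf_eq_real] at h
  simp only [le_refl, if_true, mul_zero, neg_zero, Real.exp_zero, sub_self] at h
  rwa [measureReal_eq_zero_iff] at h

/-- The joint law is a product, so by Fubini one may freeze `Y` and compute the probability over `V`
alone. This stands in for conditioning on `Y`. -/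
theorem _root_.ProbabilityTheory.IndepFun.measure_eq_lintegral {Ω β γ : Type*} [MeasurableSpace Ω]
    [MeasurableSpace β] [MeasurableSpace γ] {μ : Measure Ω} [IsFiniteMeasure μ] {Y : Ω → β}
    {V : Ω → γ} (h : IndepFun Y V μ) (hY : Measurable Y) (hV : Measurable V) {S : Set (β × γ)}
    (hS : MeasurableSet S) :
    μ {ω | (Y ω, V ω) ∈ S} = ∫⁻ ω, μ {ω' | (Y ω, V ω') ∈ S} ∂μ := by
  have h1 := h.map_prod_eq_prod_map_map hY.aemeasurable hV.aemeasurable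
  have h2 : μ {ω | (Y ω, V ω) ∈ S} = μ.map (fun ω => (Y ω, V ω)) S :=
    (Measure.map_apply (hY.prodMk hV) hS).symm
  rw [h2, h1, Measure.prod_apply hS, lintegral_map (measurable_measure_prodMk_left hS) hY]
  refine lintegral_congr fun ω => ?_
  rw [Measure.map_apply hV (measurable_prodMk_left hS)]
  rfl

namespace ExpSeq

variable {Ω : Type*} [MeasurableSpace Ω] {μ : Measure Ω} {T : ℕ → Ω → ℝ}

theorem tail (h : ExpSeq μ T) (i : ℕ) {x : ℝ} (hx : 0 ≤ x) :
    μ {ω | x < T i ω} = ENNReal.ofReal (Real.exp (-x)) := by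
  have := expMeasure_Ioi one_pos hx
  rw [← h.law i, Measure.map_apply (h.meas i) measurableSet_Ioi, one_mul] at this
  exact this

theorem ae_pos (h : ExpSeq μ T) : ∀ᵐ ω ∂μ, ∀ i, 0 < T i ω := by
  refine ae_all_iff.2 fun i => ?_
  have := expMeasure_Iic_zero one_pos
  rw [← h.law i, Measure.map_apply (h.meas i) measurableSet_Iic] at this
  rw [ae_iff]
  simp only [not_lt]
  exact this

theorem map_noAtom (h : ExpSeq μ T) (i : ℕ) (x : ℝ) : μ {ω | T i ω = x} = 0 := by
  have h1 : expMeasure 1 {x} = 0 := withDensity_absolutelyContinuous _ _ (measure_singleton x)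
  rw [← h.law i, Measure.map_apply (h.meas i) (measurableSet_singleton x)] at h1
  exact h1

/-- With `T i` frozen, equality of the two keys prescribes a single value for `T j`, whose law has
no atoms. -/
theorem ae_ne [IsProbabilityMeasure μ] (h : ExpSeq μ T) (w : ℕ → ℝ) (hw : ∀ i, 1 ≤ w i) :
    ∀ᵐ ω ∂μ, ∀ i j, i ≠ j → w i / T i ω ≠ w j / T j ω := by
  have key : ∀ i j, i ≠ j → ∀ᵐ ω ∂μ, T j ω ≠ T i ω / w i * w j := by
    intro i j hij
    have hS : MeasurableSet {p : ℝ × ℝ | p.2 = p.1 / w i * w j} :=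
      measurableSet_eq_fun measurable_snd (by fun_prop)
    have h1 := (h.indep.indepFun hij).measure_eq_lintegral (h.meas i) (h.meas j) hS
    simp only [Set.mem_ofPred_eq] at h1
    rw [ae_iff]
    simp only [ne_eq, not_not]
    rw [h1]
    simp [h.map_noAtom]
  have : ∀ᵐ ω ∂μ, ∀ i j, i ≠ j → T j ω ≠ T i ω / w i * w j :=
    ae_all_iff.2 fun i => ae_all_iff.2 fun j => by
      by_cases hij : i = j
      · simp [hij]
      · filter_upwards [key i j hij] with ω hω _ using hω
  filter_upwards [this, h.ae_pos] with ω h1 h2 i j hij he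
  refine h1 i j hij ?_
  have hi := h2 i
  have hj := h2 j
  have := hw i
  have := hw j
  rw [div_eq_div_iff hi.ne' hj.ne'] at he
  field_simp
  linarith

/-- The probability that all items of `R` come after time `z`. -/
theorem race_all (h : ExpSeq μ T) (w : ℕ → ℝ) (hw : ∀ i, 0 ≤ w i) (R : Finset ℕ) {z : ℝ}
    (hz : 0 ≤ z) :
    μ {ω | ∀ l ∈ R, z * w l < T l ω} = ENNReal.ofReal (Real.exp (-(z * ∑ l ∈ R, w l))) := by
  have h1 := h.indep.measure_inter_preimage_eq_mul R (sets := fun l => Set.Ioi (z * w l))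
    (fun _ _ => measurableSet_Ioi)
  have h2 : {ω | ∀ l ∈ R, z * w l < T l ω} = ⋂ i ∈ R, T i ⁻¹' Set.Ioi (z * w i) := by
    ext ω; simp
  have h3 : ∀ l, μ (T l ⁻¹' Set.Ioi (z * w l)) = ENNReal.ofReal (Real.exp (-(z * w l))) :=
    fun l => h.tail l (mul_nonneg hz (hw l))
  rw [h2, h1, Finset.prod_congr rfl fun l _ => h3 l, ← ENNReal.ofReal_prod_of_nonneg fun _ _ => (Real.exp_pos _).le, ← Real.exp_sum,
    Finset.sum_neg_distrib, Finset.mul_sum]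

/-- The exponential density of rate `1` times `exp (-(c * t))` is `1 / (1 + c)` times the density of
rate `1 + c`. -/
theorem lintegral_tail (h : ExpSeq μ T) (i : ℕ) {c x : ℝ} (hc : 0 ≤ c) (hx : 0 ≤ x) :
    ∫⁻ ω, {ω | x < T i ω}.indicator (fun ω => ENNReal.ofReal (Real.exp (-(c * T i ω)))) ω ∂μ =
      ENNReal.ofReal (1 / (1 + c)) * ENNReal.ofReal (Real.exp (-((1 + c) * x))) := by
  have hm : Measurable fun t : ℝ =>
      (Set.Ioi x).indicator (fun t => ENNReal.ofReal (Real.exp (-(c * t)))) t :=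
    Measurable.indicator (by fun_prop) measurableSet_Ioi
  have h1 := lintegral_map (μ := μ) hm (h.meas i)
  have h2 : ∀ ω, {ω | x < T i ω}.indicator (fun ω => ENNReal.ofReal (Real.exp (-(c * T i ω)))) ω =
    (Set.Ioi x).indicator (fun t => ENNReal.ofReal (Real.exp (-(c * t)))) (T i ω) := fun ω => by
      simp [Set.indicator]
  rw [lintegral_congr h2, ← h1, h.law i, ← expMeasure_Ioi (by linarith) hx]
  unfold expMeasure gammaMeasure
  rw [lintegral_withDensity_eq_lintegral_mul _ (by exact (measurable_gammaPDFReal 1 1).ennreal_ofReal) hm,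
    withDensity_apply _ measurableSet_Ioi, ← lintegral_indicator measurableSet_Ioi,
    ← lintegral_const_mul _ (Measurable.indicator
      (by exact (measurable_gammaPDFReal 1 (1 + c)).ennreal_ofReal) measurableSet_Ioi)]
  refine lintegral_congr fun t => ?_
  by_cases ht : x < t
  · have h0 : 0 ≤ t := by linarith
    have e1 := exponentialPDF_of_nonneg (r := 1) h0
    have e2 := exponentialPDF_of_nonneg (r := 1 + c) h0
    unfold exponentialPDF exponentialPDFReal at e1 e2
    simp only [Pi.mul_apply, Set.indicator, Set.mem_Ioi, ht, if_true]
    unfold gammaPDF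
    rw [e1, e2, ← ENNReal.ofReal_mul (by positivity), ← ENNReal.ofReal_mul (by positivity)]
    congr 1
    rw [show -((1 + c) * t) = -(1 * t) + -(c * t) by ring, Real.exp_add]
    field_simp
  · simp [Set.indicator, ht]

/-- The probability that all items of `R` come after time `z`, and item `i` is the first of them. -/
theorem race_first [IsProbabilityMeasure μ] (h : ExpSeq μ T) (w : ℕ → ℝ) (hw : ∀ i, 1 ≤ w i) {R : Finset ℕ} {i : ℕ}
    (hi : i ∈ R) {z : ℝ} (hz : 0 ≤ z) :
    μ {ω | (∀ l ∈ R, z * w l < T l ω) ∧ ∀ l ∈ R.erase i, T i ω / w i * w l < T l ω} =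
      ENNReal.ofReal (w i / ∑ l ∈ R, w l) * μ {ω | ∀ l ∈ R, z * w l < T l ω} := by
  have hw0 : ∀ i, 0 ≤ w i := fun i => by linarith [hw i]
  have hwi := hw i
  set R' := R.erase i with hR'
  -- The weight of the rivals of `i` relative to `w i`: once `T i` is known, all rivals come later
  -- with probability `exp (-(c * T i))`, and `1 / (1 + c)` is the proportion of `w i` in the total
  -- weight.
  set c := (∑ l ∈ R', w l) / w i with hcdef
  have hc : 0 ≤ c := div_nonneg (Finset.sum_nonneg fun l _ => hw0 l) (hw0 i)
  have hsum : w i + ∑ l ∈ R', w l = ∑ l ∈ R, w l := Finset.add_sum_erase R w hi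
  have hsumc : ∑ l ∈ R, w l = (1 + c) * w i := by
    rw [← hsum, hcdef]; field_simp
  have e : {ω | (∀ l ∈ R, z * w l < T l ω) ∧ ∀ l ∈ R', T i ω / w i * w l < T l ω} =
      {ω | (T i ω, fun l : R' => T l ω) ∈
        {p : ℝ × (R' → ℝ) | z * w i < p.1 ∧ ∀ l : R', p.1 / w i * w l < p.2 l}} := by
    ext ω
    simp only [Set.mem_ofPred_eq, Subtype.forall]
    refine ⟨fun ⟨h1, h2⟩ => ⟨h1 i hi, h2⟩, fun ⟨h1, h2⟩ => ⟨fun l hl => ?_, h2⟩⟩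
    by_cases hli : l = i
    · rwa [hli]
    · refine lt_of_le_of_lt ?_ (h2 l (Finset.mem_erase.2 ⟨hli, hl⟩))
      refine mul_le_mul_of_nonneg_right ?_ (hw0 l)
      rw [le_div_iff₀ (by linarith)]
      exact h1.le
  have hS : MeasurableSet {p : ℝ × (R' → ℝ) | z * w i < p.1 ∧ ∀ l : R', p.1 / w i * w l < p.2 l} := by
    refine MeasurableSet.inter (measurableSet_lt measurable_const measurable_fst) ?_
    have : {p : ℝ × (R' → ℝ) | ∀ l : R', p.1 / w i * w l < p.2 l} =
        ⋂ l : R', {p : ℝ × (R' → ℝ) | p.1 / w i * w l < p.2 l} := by ext; simp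
    have h2 := MeasurableSet.iInter fun l : R' =>
      measurableSet_lt (f := fun p : ℝ × (R' → ℝ) => p.1 / w i * w l) (g := fun p => p.2 l)
        (by fun_prop) (by fun_prop)
    rw [← this] at h2
    exact h2
  have hind : IndepFun (T i) (fun ω (l : R') => T l ω) μ := by
    have h1 := h.indep.indepFun_finset {i} R' (by simp [hR']) h.meas
    exact h1.comp (φ := fun f : ({i} : Finset ℕ) → ℝ => f ⟨i, by simp⟩) (ψ := id)
      (measurable_pi_apply _) measurable_id
  rw [e, hind.measure_eq_lintegral (h.meas i) (measurable_pi_lambda _ fun l => h.meas l) hS,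
    h.race_all w hw0 R hz]
  have e2 : ∀ ω, μ {ω' | (T i ω, fun l : R' => T l ω') ∈
        {p : ℝ × (R' → ℝ) | z * w i < p.1 ∧ ∀ l : R', p.1 / w i * w l < p.2 l}} =
      {ω | z * w i < T i ω}.indicator (fun ω => ENNReal.ofReal (Real.exp (-(c * T i ω)))) ω := by
    intro ω
    simp only [Set.mem_ofPred_eq, Set.indicator, Subtype.forall]
    split_ifs with ht
    · have h0 : 0 ≤ T i ω / w i := div_nonneg ((mul_nonneg hz (hw0 i)).trans ht.le) (hw0 i)
      simp only [ht, true_and]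
      rw [h.race_all w hw0 R' h0, hcdef]
      congr 3
      ring
    · simp [ht]
  rw [lintegral_congr e2, h.lintegral_tail i hc (mul_nonneg hz (hw0 i)), hsumc]
  congr 2
  · have : (1 + c) ≠ 0 := by linarith
    field_simp
  · congr 1
    ring

end ExpSeq

/-! ### The law of the largest keys -/

theorem top_eq_iff {v : ℕ → ℝ} (hv : Function.Injective v) {U A : Finset ℕ} (hA : A ⊆ U) :
    top A.card v U = A ↔ ∀ a ∈ A, ∀ l ∈ U \ A, v l < v a := by
  constructor
  · intro h a ha l hl
    obtain ⟨hl1, hl2⟩ := Finset.mem_sdiff.1 hl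
    by_contra hlt
    have hne : v a ≠ v l := fun e => hl2 (hv e ▸ ha)
    have hlt : v a < v l := lt_of_le_of_ne (not_lt.1 hlt) hne
    rw [← h, mem_top] at hl2
    refine hl2 ⟨hl1, lt_of_le_of_lt (Finset.card_le_card fun j hj => ?_) (mem_top.1 (h.symm ▸ ha)).2⟩
    rw [Finset.mem_filter] at hj ⊢
    exact ⟨hj.1, hlt.trans hj.2⟩
  · intro h
    symm
    refine Finset.eq_of_subset_of_card_le (fun a ha => mem_top.2 ⟨hA ha, ?_⟩) ?_
    · refine Finset.card_lt_card ⟨fun j hj => ?_, fun hs => ?_⟩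
      · rw [Finset.mem_filter] at hj
        by_contra hja
        exact absurd hj.2 (not_lt.2 (h a ha j (Finset.mem_sdiff.2 ⟨hj.1, hja⟩)).le)
      · exact absurd (Finset.mem_filter.1 (hs ha)).2 (lt_irrefl _)
    · rw [card_top hv]
      exact min_le_left _ _

theorem top_succ_iff {v : ℕ → ℝ} (hv : Function.Injective v) {U A : Finset ℕ} {i : ℕ}
    (hA : A ⊆ U) (hi : i ∈ U \ A) :
    top A.card v U = A ∧ top (A.card + 1) v U = insert i A ↔
      (∀ a ∈ A, ∀ l ∈ U \ A, v l < v a) ∧ ∀ l ∈ (U \ A).erase i, v l < v i := by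
  obtain ⟨hi1, hi2⟩ := Finset.mem_sdiff.1 hi
  rw [top_eq_iff hv hA, ← Finset.card_insert_of_notMem hi2,
    top_eq_iff hv (Finset.insert_subset hi1 hA)]
  have e : U \ insert i A = (U \ A).erase i := by
    ext l; simp only [Finset.mem_sdiff, Finset.mem_insert, Finset.mem_erase]; tauto
  rw [e]
  constructor
  · exact fun ⟨h1, h2⟩ => ⟨h1, h2 i (Finset.mem_insert_self _ _)⟩
  · refine fun ⟨h1, h2⟩ => ⟨h1, fun a ha l hl => ?_⟩
    rcases Finset.mem_insert.1 ha with rfl | ha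
    · exact h2 l hl
    · exact h1 a ha l (Finset.mem_of_mem_erase hl)

theorem _root_.Finset.measurable_sup_of_measurable {ι α : Type*} [MeasurableSpace α] (A : Finset ι)
    {f : ι → α → NNReal} (hf : ∀ i, Measurable (f i)) : Measurable fun x => A.sup fun i => f i x := by
  classical
  induction A using Finset.induction_on with
  | empty => simp
  | insert i A hi ih => simpa only [Finset.sup_insert] using! (hf i).sup ih

namespace ExpSeq

variable {Ω : Type*} [MeasurableSpace Ω] {μ : Measure Ω} [IsProbabilityMeasure μ]
  {T : ℕ → Ω → ℝ}

theorem key_lt_iff {Ω : Type*} {T : ℕ → Ω → ℝ} {w : ℕ → ℝ} (hw : ∀ i, 1 ≤ w i) {ω : Ω} (hT : ∀ i, 0 < T i ω) (i l : ℕ) :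
    w l / T l ω < w i / T i ω ↔ T i ω / w i * w l < T l ω := by
  have h1 := hT i
  have h2 := hT l
  have h3 : 0 < w i := by linarith [hw i]
  rw [div_lt_div_iff₀ h2 h1, div_mul_eq_mul_div, div_lt_iff₀ h3]
  constructor <;> intro h <;> linarith

omit [IsProbabilityMeasure μ] in
theorem measurableSet_top_eq (h : ExpSeq μ T) (w : ℕ → ℝ) (U : Finset ℕ) (m : ℕ) (A : Finset ℕ) :
    MeasurableSet {ω | top m (fun l => w l / T l ω) U = A} := by
  have hk : ∀ i, Measurable fun ω => w i / T i ω := fun i => by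
    have := h.meas i
    fun_prop
  have e : ∀ i, MeasurableSet {ω | (U.filter fun j => w i / T i ω < w j / T j ω).card < m} := by
    intro i
    have : Measurable fun ω => (U.filter fun j => w i / T i ω < w j / T j ω).card := by
      simp only [Finset.card_filter]
      exact Finset.measurable_fun_sum _ fun j _ =>
        Measurable.ite (measurableSet_lt (hk i) (hk j)) measurable_const measurable_const
    exact this measurableSet_Iio
  have e2 : {ω | top m (fun l => w l / T l ω) U = A} = ⋂ i : ℕ,
      {ω | i ∈ U ∧ (U.filter fun j => w i / T i ω < w j / T j ω).card < m ↔ i ∈ A} := by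
    ext ω
    simp only [Set.mem_ofPred_eq, Set.mem_iInter, Finset.ext_iff, mem_top]
  rw [e2]
  refine MeasurableSet.iInter fun i => ?_
  have e3 := (e i)
  by_cases h1 : i ∈ U <;> by_cases h2 : i ∈ A <;> simp only [h1, h2, true_and, false_and, iff_true, iff_false]
  · exact e3
  · exact e3.compl
  · simp
  · simp

/-- Item `l` arrives at time `T l / w l`. The set `A` consists of the first arrivals exactly if all
others come after `Z`, the last arrival in `A`, and `Z` is independent of the others. For every
fixed value of `Z`, `race_first` gives the same conditional chance that `i` is next: this is the
lack of memory. -/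
theorem measure_top_succ (h : ExpSeq μ T) {w : ℕ → ℝ} (hw : ∀ i, 1 ≤ w i) {U A : Finset ℕ} {i : ℕ}
    (hA : A ⊆ U) (hi : i ∈ U \ A) :
    μ {ω | top A.card (fun l => w l / T l ω) U = A ∧
        top (A.card + 1) (fun l => w l / T l ω) U = insert i A} =
      ENNReal.ofReal (w i / ∑ l ∈ U \ A, w l) *
        μ {ω | top A.card (fun l => w l / T l ω) U = A} := by
  set R := U \ A with hR
  -- Nonnegative reals make the supremum over an empty `A` equal to `0`, the start of the race.
  let φ : (A → ℝ) → NNReal := fun f => Finset.univ.sup fun a : A => Real.toNNReal (f a / w a)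
  have hφ : Measurable φ := Finset.measurable_sup_of_measurable _ fun a => by fun_prop
  let Z : Ω → NNReal := fun ω => φ fun a => T a ω
  have hZ : Measurable Z := hφ.comp (measurable_pi_lambda _ fun a => h.meas a)
  let V : Ω → R → ℝ := fun ω l => T l ω
  have hV : Measurable V := measurable_pi_lambda _ fun l => h.meas l
  have hind : IndepFun Z V μ := by
    have h1 := h.indep.indepFun_finset A R (by
      rw [hR]; exact Finset.disjoint_sdiff) h.meas
    exact h1.comp hφ measurable_id
  have hinj : ∀ᵐ ω ∂μ, Function.Injective fun l => w l / T l ω := by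
    filter_upwards [h.ae_ne w hw] with ω hω i j hij
    by_contra hne
    exact hω i j hne hij
  let S1 : Set (NNReal × (R → ℝ)) := {p | ∀ l : R, (p.1 : ℝ) * w l < p.2 l}
  let S2 : Set (NNReal × (R → ℝ)) := {p | ∀ l : R, (l : ℕ) ∈ R.erase i →
    p.2 ⟨i, hi⟩ / w i * w l < p.2 l}
  have hS1 : MeasurableSet S1 := by
    have e : S1 = ⋂ l : R, {p : NNReal × (R → ℝ) | (p.1 : ℝ) * w l < p.2 l} := by ext; simp [S1]
    rw [e]
    exact MeasurableSet.iInter fun l => measurableSet_lt (by fun_prop) (by fun_prop)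
  have hS2 : MeasurableSet S2 := by
    have e : S2 = ⋂ l : R, {p : NNReal × (R → ℝ) | (l : ℕ) ∈ R.erase i →
      p.2 ⟨i, hi⟩ / w i * w l < p.2 l} := by ext; simp [S2]
    rw [e]
    refine MeasurableSet.iInter fun l => ?_
    by_cases hl : (l : ℕ) ∈ R.erase i
    · simp only [hl, true_imp_iff]
      exact measurableSet_lt (by fun_prop) (by fun_prop)
    · simp [hl]
  have hZlt : ∀ ω, (∀ i, 0 < T i ω) →
      ((∀ a ∈ A, ∀ l ∈ R, w l / T l ω < w a / T a ω) ↔ (Z ω, V ω) ∈ S1) := by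
    intro ω hT
    have e : ∀ l ∈ R, ((Z ω : ℝ) * w l < T l ω ↔ ∀ a ∈ A, w l / T l ω < w a / T a ω) := by
      intro l _
      have hwl : 0 < w l := by linarith [hw l]
      have h1 : (Z ω : ℝ) * w l < T l ω ↔ Z ω < Real.toNNReal (T l ω / w l) := by
        rw [← NNReal.coe_lt_coe, Real.coe_toNNReal _ (div_pos (hT l) hwl).le, lt_div_iff₀ hwl]
      rw [h1]
      change Finset.univ.sup (fun a : A => Real.toNNReal (T a ω / w a)) < _ ↔ _
      rw [Finset.sup_lt_iff (by simpa using div_pos (hT l) hwl)]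
      simp only [Finset.mem_univ, true_imp_iff, Subtype.forall]
      refine forall₂_congr fun a ha => ?_
      rw [Real.toNNReal_lt_toNNReal_iff (div_pos (hT l) hwl), key_lt_iff hw hT, lt_div_iff₀ hwl]
    simp only [S1, Set.mem_ofPred_eq, Subtype.forall, V]
    exact ⟨fun h' l hl => (e l hl).2 fun a ha => h' a ha l hl, fun h' a ha l hl =>
      (e l hl).1 (h' l hl) a ha⟩
  have ae1 : {ω | top A.card (fun l => w l / T l ω) U = A} =ᵐ[μ] {ω | (Z ω, V ω) ∈ S1} := by
    filter_upwards [hinj, h.ae_pos] with ω h1 h2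
    exact propext ((top_eq_iff h1 hA).trans (hZlt ω h2))
  have ae2 : {ω | top A.card (fun l => w l / T l ω) U = A ∧
      top (A.card + 1) (fun l => w l / T l ω) U = insert i A} =ᵐ[μ]
      {ω | (Z ω, V ω) ∈ S1 ∩ S2} := by
    filter_upwards [hinj, h.ae_pos] with ω h1 h2
    refine propext ((top_succ_iff h1 hA hi).trans (and_congr (hZlt ω h2) ?_))
    simp only [S2, Set.mem_ofPred_eq, Subtype.forall, V]
    refine ⟨fun h' l _ hl => (key_lt_iff hw h2 i l).1 (h' l hl), fun h' l hl =>
      (key_lt_iff hw h2 i l).2 (h' l (Finset.mem_of_mem_erase hl) hl)⟩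
  rw [measure_congr ae1, measure_congr ae2, hind.measure_eq_lintegral hZ hV hS1,
    hind.measure_eq_lintegral hZ hV (hS1.inter hS2), ← lintegral_const_mul _ ?_]
  · refine lintegral_congr fun ω => ?_
    have := h.race_first w hw hi (z := Z ω) (Z ω).2
    simp only [Set.mem_inter_iff, S1, S2, Set.mem_ofPred_eq, Subtype.forall, V]
    rw [← this]
    congr 1
    ext ω'
    simp only [Set.mem_ofPred_eq]
    exact and_congr_right fun _ => ⟨fun h' l hl => h' l (Finset.mem_of_mem_erase hl) hl,
      fun h' l _ hl => h' l hl⟩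
  · have : Measurable fun z : NNReal => μ {ω' | (z, V ω') ∈ S1} := by
      have e : (fun z : NNReal => μ {ω' | (z, V ω') ∈ S1}) = fun z => μ.map V (Prod.mk z ⁻¹' S1) := by
        ext z
        rw [Measure.map_apply hV (measurable_prodMk_left hS1)]
        rfl
      rw [e]
      exact measurable_measure_prodMk_left hS1
    exact this.comp hZ

end ExpSeq

theorem draw_apply {w : ℕ → ℝ} (hw : ∀ i, 1 ≤ w i) {R : Finset ℕ} (hR : R.Nonempty) (i : ℕ) :
    draw w R i = if i ∈ R then ENNReal.ofReal (w i / ∑ l ∈ R, w l) else 0 := by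
  have hw0 : ∀ i, 0 ≤ w i := fun i => by linarith [hw i]
  have hs : ∑' i, massOn w R i = ENNReal.ofReal (∑ l ∈ R, w l) := by
    rw [tsum_eq_sum (s := R) fun i hi => by simp [massOn, hi],
      ENNReal.ofReal_sum_of_nonneg fun i _ => hw0 i]
    exact Finset.sum_congr rfl fun i hi => by simp [massOn, hi]
  have hpos : 0 < ∑ l ∈ R, w l := Finset.sum_pos (fun i _ => by linarith [hw i]) hR
  have h : (∑' i, massOn w R i) ≠ 0 ∧ (∑' i, massOn w R i) ≠ ⊤ := by
    rw [hs]
    exact ⟨by simpa using hpos, ENNReal.ofReal_ne_top⟩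
  rw [draw, dif_pos h, PMF.normalize_apply, hs, ← ENNReal.ofReal_inv_of_pos hpos]
  unfold massOn
  split_ifs
  · rw [← ENNReal.ofReal_mul (hw0 i), div_eq_mul_inv]
  · simp

/-- Induction on the number of draws. Splitting according to the set of the first `m` winners
mirrors the bind in `swor`; apart from `U` itself, only sets of exactly `m` elements have positive
probability. -/
theorem ExpSeq.measure_top {Ω : Type*} [MeasurableSpace Ω] {μ : Measure Ω} [IsProbabilityMeasure μ]
    {T : ℕ → Ω → ℝ} (h : ExpSeq μ T) {w : ℕ → ℝ} (hw : ∀ i, 1 ≤ w i) (U : Finset ℕ) (m : ℕ) :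
    ∀ A, μ {ω | top m (fun l => w l / T l ω) U = A} = swor w U m A := by
  have hinj : ∀ᵐ ω ∂μ, Function.Injective fun l => w l / T l ω := by
    filter_upwards [h.ae_ne w hw] with ω hω i j hij
    by_contra hne
    exact hω i j hne hij
  induction m with
  | zero =>
      intro A
      have : ∀ ω, top 0 (fun l => w l / T l ω) U = ∅ := fun ω => by simp [top]
      simp only [this, swor, PMF.pure_apply]
      by_cases hA : A = ∅
      · simp [hA]
      · simp [hA, Ne.symm hA]
  | succ m ih =>
      intro B
      have hsub : ∀ ω, top m (fun l => w l / T l ω) U ∈ U.powerset := fun ω =>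
        Finset.mem_powerset.2 (top_subset _ _ _)
      have part : μ {ω | top (m + 1) (fun l => w l / T l ω) U = B} = ∑ A ∈ U.powerset,
          μ {ω | top m (fun l => w l / T l ω) U = A ∧ top (m + 1) (fun l => w l / T l ω) U = B} := by
        rw [← measure_biUnion_finset]
        · congr 1
          ext ω
          simp only [Set.mem_ofPred_eq, Set.mem_iUnion, exists_prop]
          exact ⟨fun h' => ⟨_, hsub ω, rfl, h'⟩, fun ⟨_, _, _, h'⟩ => h'⟩
        · intro A _ A' _ hAA'
          refine Set.disjoint_left.2 fun ω h1 h2 => hAA' ?_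
          exact h1.1.symm.trans h2.1
        · exact fun A _ => (h.measurableSet_top_eq w U m A).inter (h.measurableSet_top_eq w U (m + 1) B)
      rw [part, swor, PMF.bind_apply, tsum_eq_sum (s := U.powerset)]
      · refine Finset.sum_congr rfl fun A hA => ?_
        have hA := Finset.mem_powerset.1 hA
        rw [← ih A]
        split_ifs with hUA
        · obtain rfl := Finset.Subset.antisymm hA hUA
          have e : ∀ ω, top m (fun l => w l / T l ω) A = A → top (m + 1) (fun l => w l / T l ω) A = A :=
            fun ω h' => Finset.Subset.antisymm (top_subset _ _ _) fun i hi =>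
              mem_top.2 ⟨hi, (mem_top.1 (h'.symm ▸ hi : i ∈ top m _ A)).2.trans (Nat.lt_succ_self m)⟩
          rw [PMF.pure_apply]
          split_ifs with hB
          · subst hB
            rw [mul_one]
            congr 1
            ext ω
            exact ⟨fun h' => h'.1, fun h' => ⟨h', e ω h'⟩⟩
          · rw [mul_zero]
            refine measure_mono_null (fun ω h' => ?_) (measure_empty (μ := μ))
            exact hB (h'.2.symm.trans (e ω h'.1))
        · have hcard : A.card < U.card := Finset.card_lt_card ⟨hA, hUA⟩
          have hne : (U \ A).Nonempty := Finset.sdiff_nonempty.2 hUA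
          by_cases hm : A.card = m
          · subst hm
            rw [PMF.map_apply]
            simp only [draw_apply hw hne]
            by_cases hB : ∃ i ∈ U \ A, B = insert i A
            · obtain ⟨i, hi, rfl⟩ := hB
              have hi2 := Finset.mem_sdiff.1 hi
              rw [h.measure_top_succ hw hA hi, tsum_eq_single i, if_pos rfl, if_pos hi, mul_comm]
              intro j hj
              by_cases hjA : j ∈ A
              · simp [hjA]
              · rw [if_neg]
                intro he
                have : i ∈ insert j A := he ▸ Finset.mem_insert_self i A
                rcases Finset.mem_insert.1 this with h1 | h1
                · exact hj h1.symm
                · exact hi2.2 h1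
            · have z : ∀ j, (if B = insert j A then if j ∈ U \ A then
                  ENNReal.ofReal (w j / ∑ l ∈ U \ A, w l) else 0 else 0) = 0 := by
                intro j
                split_ifs with h1 h2
                · exact absurd ⟨j, h2, h1⟩ hB
                · rfl
                · rfl
              simp only [z, tsum_zero, mul_zero]
              rw [← nonpos_iff_eq_zero, ← measure_empty (μ := μ)]
              refine measure_mono_ae ?_
              filter_upwards [hinj] with ω hω h'
              refine hB ?_
              have h1 : A ⊆ B := by
                intro a ha
                rw [← h'.2]
                rw [← h'.1] at ha
                exact mem_top.2 ⟨(mem_top.1 ha).1, (mem_top.1 ha).2.trans (Nat.lt_succ_self _)⟩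
              have h2 : A.card + 1 = B.card := by
                rw [← h'.2, card_top hω]
                omega
              obtain ⟨i, hi, rfl⟩ := Finset.exists_eq_insert_iff.2 ⟨h1, h2⟩
              refine ⟨i, Finset.mem_sdiff.2 ⟨?_, hi⟩, rfl⟩
              exact top_subset _ _ _ (h'.2.symm ▸ Finset.mem_insert_self i A)
          · have z : μ {ω | top m (fun l => w l / T l ω) U = A} = 0 := by
              rw [← nonpos_iff_eq_zero, ← measure_empty (μ := μ)]
              refine measure_mono_ae ?_
              filter_upwards [hinj] with ω hω h'
              have h1 := card_top (s := m) hω U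
              rw [show top m (fun l => w l / T l ω) U = A from h'] at h1
              omega
            rw [z, zero_mul]
            exact measure_mono_null (fun ω h' => h'.1) z
      · intro A hA
        rw [← ih A]
        have : {ω | top m (fun l => w l / T l ω) U = A} = ∅ := by
          ext ω
          simp only [Set.mem_ofPred_eq, Set.mem_empty_iff_false, iff_false]
          rintro rfl
          exact hA (hsub ω)
        rw [this, measure_empty, zero_mul]

/-! ### Expected values of the numbers of messages -/

/-- The random setting with a fixed stream. -/
def stream {Ω : Type*} (k s : ℕ) (site : ℕ → Fin k) (w : ℕ → ℝ) (T : ℕ → Ω → ℝ) (ω : Ω) : Setting :=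
  ⟨k, s, site, w, fun i => T i ω⟩

/-- The threshold of an epoch. -/
def thrOf (r : ℝ) (q : ℕ) : ℝ := if q = 0 then 0 else r ^ (q - 1)

namespace ExpSeq

variable {Ω : Type*} [MeasurableSpace Ω] {μ : Measure Ω} {T : ℕ → Ω → ℝ}
  {k s : ℕ} {site : ℕ → Fin k} {w : ℕ → ℝ}

theorem ae_good [IsProbabilityMeasure μ] (h : ExpSeq μ T) (hs : 0 < s) (hw : ∀ i, 1 ≤ w i) :
    ∀ᵐ ω ∂μ, (stream k s site w T ω).Good := by
  filter_upwards [h.ae_ne w hw, h.ae_pos] with ω h1 h2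
  refine ⟨fun i j hij => ?_, fun i => ?_, hs, hw⟩
  · by_contra hne
    exact h1 i j hne hij
  · have := hw i
    exact div_pos (show 0 < w i by linarith) (h2 i)

theorem measurable_key (h : ExpSeq μ T) (i : ℕ) :
    Measurable fun ω => (stream k s site w T ω).key i :=
  Measurable.div measurable_const (h.meas i)

theorem measurable_of_similar (h : ExpSeq μ T) (n : ℕ) {f : Ω → ℕ}
    (hf : ∀ ω ω', Similar (stream k s site w T ω) (stream k s site w T ω') n → f ω = f ω') :
    Measurable f :=
  measurable_to_countable' fun m => measurableSet_of_similar (X := stream k s site w T)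
    (fun i _ => h.measurable_key i) (fun _ _ => rfl)
    fun ω ω' hh => by rw [Set.mem_singleton_iff, Set.mem_singleton_iff, hf ω ω' hh]

theorem measurable_messages (h : ExpSeq μ T) (trim : Bool) (n : ℕ) :
    Measurable fun ω => messages trim (stream k s site w T ω) n :=
  h.measurable_of_similar n fun _ _ hh => hh.messages_eq ⟨rfl, rfl, rfl⟩ rfl (fun _ => rfl) trim

theorem measurable_regs (h : ExpSeq μ T) (trim : Bool) (n : ℕ) :
    Measurable fun ω => regs trim (stream k s site w T ω) n :=
  h.measurable_of_similar n fun _ _ hh => hh.regs_eq ⟨rfl, rfl, rfl⟩ rfl (fun _ => rfl) trim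

theorem measurable_epo (h : ExpSeq μ T) (trim : Bool) (n : ℕ) :
    Measurable fun ω => epo trim (stream k s site w T ω) n :=
  h.measurable_of_similar n fun _ _ hh => hh.epo_eq ⟨rfl, rfl, rfl⟩ rfl (fun _ => rfl) trim

theorem measure_le_key [IsProbabilityMeasure μ] (h : ExpSeq μ T) (hw : ∀ i, 1 ≤ w i) (i : ℕ) {x : ℝ}
    (hx : 0 < x) : μ {ω | x ≤ w i / T i ω} = ENNReal.ofReal (1 - Real.exp (-(w i / x))) := by
  have hwi : 0 < w i := by linarith [hw i]
  have h1 : {ω | x ≤ w i / T i ω} =ᵐ[μ] ({ω | w i / x < T i ω}ᶜ : Set Ω) := by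
    filter_upwards [h.ae_pos] with ω hω
    have := hω i
    refine propext ?_
    change x ≤ w i / T i ω ↔ ¬ (w i / x < T i ω)
    rw [not_lt, le_div_iff₀ this, le_div_iff₀ hx, mul_comm]
  rw [measure_congr h1, prob_compl_eq_one_sub (measurableSet_lt measurable_const (h.meas i)),
    h.tail i (div_pos hwi hx).le, ENNReal.ofReal_sub _ (Real.exp_pos _).le, ENNReal.ofReal_one]

theorem measure_le_key_le [IsProbabilityMeasure μ] (h : ExpSeq μ T) (hw : ∀ i, 1 ≤ w i) (i : ℕ)
    {x : ℝ} (hx : 0 < x) : μ {ω | x ≤ w i / T i ω} ≤ ENNReal.ofReal (w i / x) := by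
  rw [h.measure_le_key hw i hx]
  refine ENNReal.ofReal_le_ofReal ?_
  have := Real.add_one_le_exp (-(w i / x))
  linarith

/-- By concavity of `1 - exp (-x)`, in the form of Bernoulli's inequality, raising the bound for a
key by a factor `r` costs at most a factor `r` in probability. In epoch `0` every key may pass, but
a key reaches `1` with probability at least `1 / 2`, as weights are at least `1`; here `r ≥ 2` is
used. -/
theorem measure_thr_lt [IsProbabilityMeasure μ] (h : ExpSeq μ T) (hw : ∀ i, 1 ≤ w i) {r : ℝ}
    (hr : 2 ≤ r) (q i : ℕ) :
    μ {ω | thrOf r q < w i / T i ω} ≤ ENNReal.ofReal r * μ {ω | r ^ q ≤ w i / T i ω} := by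
  have hwi := hw i
  have hr0 : 0 < r := by linarith
  rw [h.measure_le_key hw i (pow_pos hr0 q), ← ENNReal.ofReal_mul hr0.le]
  cases q with
  | zero =>
      refine prob_le_one.trans ?_
      rw [← ENNReal.ofReal_one]
      refine ENNReal.ofReal_le_ofReal ?_
      have h1 : Real.exp (-(w i / r ^ 0)) ≤ 1 / 2 := by
        rw [pow_zero, div_one, Real.exp_neg, ← one_div]
        refine one_div_le_one_div_of_le two_pos ?_
        have := Real.add_one_le_exp (w i)
        linarith
      nlinarith
  | succ q =>
      have hq : 0 < r ^ q := pow_pos hr0 q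
      have h1 : μ {ω | thrOf r (q + 1) < w i / T i ω} ≤ μ {ω | r ^ q ≤ w i / T i ω} := by
        refine measure_mono fun ω hω => ?_
        simp only [thrOf, Nat.succ_ne_zero, if_false, Nat.add_sub_cancel, Set.mem_ofPred_eq] at hω ⊢
        exact hω.le
      refine h1.trans ?_
      rw [h.measure_le_key hw i hq]
      refine ENNReal.ofReal_le_ofReal ?_
      have h2 := one_add_mul_self_le_rpow_one_add (s := Real.exp (-(w i / r ^ (q + 1))) - 1)
        (by linarith [Real.exp_pos (-(w i / r ^ (q + 1)))]) (p := r) (by linarith)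
      rw [add_sub_cancel, ← Real.exp_mul] at h2
      have h3 : -(w i / r ^ (q + 1)) * r = -(w i / r ^ q) := by
        rw [pow_succ]; field_simp
      rw [h3] at h2
      linarith

/-- To get beyond `r ^ j`, the value `u` needs `s` keys of at least `r ^ j`. Their expected number
is at most the total weight over `r ^ j`, and Markov's inequality applies. -/
theorem measure_lt_epo [IsProbabilityMeasure μ] (h : ExpSeq μ T) (hs : 0 < s) (hw : ∀ i, 1 ≤ w i)
    (trim : Bool) (n j : ℕ) :
    μ {ω | j < epo trim (stream k s site w T ω) n} ≤
      ENNReal.ofReal ((∑ i ∈ Finset.range n, w i) / (s * (max 2 ((k : ℝ) / s)) ^ j)) := by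
  set r : ℝ := max 2 ((k : ℝ) / s) with hr
  have hr0 : 0 < r := lt_of_lt_of_le two_pos (le_max_left _ _)
  have hrj : 0 < r ^ j := pow_pos hr0 j
  have hs' : (0 : ℝ) < s := Nat.cast_pos.2 hs
  let f : Ω → ℝ≥0∞ := fun ω => ∑ i ∈ Finset.range n, {ω | r ^ j ≤ w i / T i ω}.indicator 1 ω
  have hms : ∀ i, MeasurableSet {ω | r ^ j ≤ w i / T i ω} := fun i =>
    measurableSet_le measurable_const (h.measurable_key (k := k) (s := s) (site := site) i)
  have hf : Measurable f := Finset.measurable_fun_sum _ fun i _ => measurable_one.indicator (hms i)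
  have h1 : μ {ω | j < epo trim (stream k s site w T ω) n} ≤ μ {ω | (s : ℝ≥0∞) ≤ f ω} := by
    refine measure_mono_ae ?_
    filter_upwards [h.ae_good (k := k) (site := site) hs hw] with ω hX hω
    have hN := netInv hX trim n
    have h2 : r ^ j ≤ (co trim (stream k s site w T ω) n).u :=
      (pow_le_iff (r := r) (stream k s site w T ω).one_lt_r _ j).2 hω
    rw [hN.ok.u, le_uOf_iff hX hN.ok.card hrj] at h2
    have h3 : f ω = ((Finset.range n).filter fun i => r ^ j ≤ w i / T i ω).card := by
      simp only [f, Finset.card_filter, Nat.cast_sum, Set.indicator, Set.mem_ofPred_eq, Pi.one_apply,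
        Nat.cast_ite, Nat.cast_one, Nat.cast_zero]
    change (s : ℝ≥0∞) ≤ f ω
    rw [h3, Nat.cast_le]
    refine le_trans h2 (Finset.card_le_card ?_)
    exact Finset.filter_subset_filter _ hN.S_sub
  have h2 := mul_meas_ge_le_lintegral hf (μ := μ) (s : ℝ≥0∞)
  have h3 : ∫⁻ ω, f ω ∂μ ≤ ENNReal.ofReal ((∑ i ∈ Finset.range n, w i) / r ^ j) := by
    rw [lintegral_finsetSum _ fun i _ => measurable_one.indicator (hms i), Finset.sum_div,
      ENNReal.ofReal_sum_of_nonneg fun i _ => div_nonneg (by linarith [hw i]) hrj.le]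
    refine Finset.sum_le_sum fun i _ => ?_
    rw [lintegral_indicator_one (hms i)]
    exact h.measure_le_key_le hw i hrj
  refine h1.trans ?_
  have h4 : (s : ℝ≥0∞) = ENNReal.ofReal s := (ENNReal.ofReal_natCast s).symm
  rw [mul_comm (s : ℝ), ← div_div, ENNReal.ofReal_div_of_pos hs', ENNReal.le_div_iff_mul_le
    (Or.inl (by simpa using hs.ne')) (Or.inl ENNReal.ofReal_ne_top), mul_comm, ← h4]
  exact h2.trans h3

theorem natCast_eq_tsum (m : ℕ) : (m : ℝ≥0∞) = ∑' j : ℕ, if j < m then 1 else 0 := by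
  rw [tsum_eq_sum (s := Finset.range m) fun j hj => by simpa using hj]
  rw [Finset.sum_congr rfl fun j hj => if_pos (Finset.mem_range.1 hj)]
  simp

theorem lintegral_natCast {f : Ω → ℕ} (hf : Measurable f) :
    ∫⁻ ω, (f ω : ℝ≥0∞) ∂μ = ∑' j : ℕ, μ {ω | j < f ω} := by
  have hm : ∀ j, MeasurableSet {ω | j < f ω} := fun j => hf measurableSet_Ioi
  simp_rw [natCast_eq_tsum (f _)]
  rw [lintegral_tsum fun j => (Measurable.ite (hm j) measurable_const measurable_const).aemeasurable]
  refine tsum_congr fun j => ?_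
  rw [← lintegral_indicator_one (hm j)]
  refine lintegral_congr fun ω => ?_
  simp [Set.indicator]

/-- The expectation is the sum of the tails. Up to the first power of `r` beyond `y` they are
bounded by `1`, and from there on by a geometric series with sum `2`. -/
theorem lintegral_le_logb [IsProbabilityMeasure μ] {f : Ω → ℕ} (hf : Measurable f) {r y : ℝ}
    (hr2 : 2 ≤ r) (hy : 1 ≤ y) (hj : ∀ j, μ {ω | j < f ω} ≤ ENNReal.ofReal (y / r ^ j)) :
    ∫⁻ ω, (f ω : ℝ≥0∞) ∂μ ≤ ENNReal.ofReal (Real.logb r y + 3) := by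
  have hlog : (level r y : ℝ) ≤ Real.logb r y := Nat.floor_le (Real.logb_nonneg (by linarith) hy)
  obtain ⟨N, hN⟩ : ∃ N, N = level r y + 1 := ⟨_, rfl⟩
  have hlt : y < r ^ N := by
    by_contra hc
    have := (pow_le_iff_level (by linarith) hy N).1 (not_lt.1 hc)
    omega
  have hN' : (N : ℝ) ≤ Real.logb r y + 1 := by
    rw [hN]; push_cast; linarith
  rw [lintegral_natCast hf, ← Summable.sum_add_tsum_nat_add' (k := N) ENNReal.summable]
  have h1 : ∑ j ∈ Finset.range N, μ {ω | j < f ω} ≤ N := by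
    refine (Finset.sum_le_sum fun j _ => prob_le_one).trans ?_
    simp
  have h2 : ∑' j, μ {ω | j + N < f ω} ≤ ENNReal.ofReal 2 := by
    rw [← tsum_geometric_two, ENNReal.ofReal_tsum_of_nonneg (fun _ => by positivity)
      summable_geometric_two]
    refine ENNReal.tsum_le_tsum fun j => (hj _).trans (ENNReal.ofReal_le_ofReal ?_)
    have hrN : 0 < r ^ N := pow_pos (by linarith) N
    have hrj : (2 : ℝ) ^ j ≤ r ^ j := pow_le_pow_left₀ (by norm_num) hr2 j
    have h2j : (0 : ℝ) < 2 ^ j := by positivity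
    rw [div_pow, one_pow, pow_add, div_le_div_iff₀ (by positivity) h2j, one_mul, mul_comm]
    exact mul_le_mul hrj hlt.le (by linarith) (by linarith)
  refine (add_le_add h1 h2).trans ?_
  rw [← ENNReal.ofReal_natCast, ← ENNReal.ofReal_add (by positivity) (by positivity)]
  exact ENNReal.ofReal_le_ofReal (by linarith)

theorem lintegral_epo_le [IsProbabilityMeasure μ] (h : ExpSeq μ T) (hs : 0 < s) (hw : ∀ i, 1 ≤ w i)
    (trim : Bool) (n : ℕ) (hW : (s : ℝ) ≤ ∑ i ∈ Finset.range n, w i) :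
    ∫⁻ ω, (epo trim (stream k s site w T ω) n : ℝ≥0∞) ∂μ ≤
      ENNReal.ofReal (Real.logb (max 2 ((k : ℝ) / s)) ((∑ i ∈ Finset.range n, w i) / s) + 3) := by
  have hs' : (0 : ℝ) < s := Nat.cast_pos.2 hs
  refine lintegral_le_logb (h.measurable_epo trim n) (le_max_left _ _) ((one_le_div hs').2 hW)
    fun j => ?_
  rw [div_div]
  exact h.measure_lt_epo hs hw trim n j

end ExpSeq

theorem epochStart_eq_thrOf (r u : ℝ) : epochStart r u = thrOf r (epochIdx r u) := epochStart_eq r u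

namespace ExpSeq

variable {Ω : Type*} [MeasurableSpace Ω] {μ : Measure Ω} {T : ℕ → Ω → ℝ}
  {k s : ℕ} {site : ℕ → Fin k} {w : ℕ → ℝ}

/-- The current epoch is independent of the key of the next item. -/
theorem measure_epo_inter (h : ExpSeq μ T) (trim : Bool) (t q : ℕ) {B : Set ℝ}
    (hB : MeasurableSet B) :
    μ {ω | epo trim (stream k s site w T ω) t = q ∧ w t / T t ω ∈ B} =
      μ {ω | epo trim (stream k s site w T ω) t = q} * μ {ω | w t / T t ω ∈ B} := by
  -- The epoch before item `t` is decided by comparisons of the earlier keys, so it is measurable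
  -- for the σ-algebra of the earlier exponential variables, which is independent of `T t`.
  have hind := indep_iSup_of_disjoint (m := fun i => MeasurableSpace.comap (T i) inferInstance)
    (fun i => (h.meas i).comap_le) h.indep (S := (Finset.range t : Set ℕ)) (T := {t}) (by simp)
  refine (Indep_iff _ _ _).1 hind {ω | epo trim (stream k s site w T ω) t = q}
    {ω | w t / T t ω ∈ B} ?_ ?_
  · refine @measurableSet_of_similar Ω (⨆ i ∈ (Finset.range t : Set ℕ),
      MeasurableSpace.comap (T i) inferInstance) (stream k s site w T) t (fun i hi => ?_)
      (fun _ _ => rfl) _ fun ω ω' hh => by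
        rw [hh.epo_eq ⟨rfl, rfl, rfl⟩ rfl (fun _ => rfl) trim]
    have h1 : Measurable[MeasurableSpace.comap (T i) inferInstance] (T i) := comap_measurable _
    have h2 : MeasurableSpace.comap (T i) inferInstance ≤ ⨆ i ∈ (Finset.range t : Set ℕ),
        MeasurableSpace.comap (T i) inferInstance :=
      le_iSup₂_of_le i (by simpa using hi) le_rfl
    exact (measurable_const_div _).comp (h1.mono h2 le_rfl)
  · have h1 : Measurable[MeasurableSpace.comap (T t) inferInstance] (T t) := comap_measurable _
    have h2 : MeasurableSpace.comap (T t) inferInstance ≤ ⨆ i ∈ ({t} : Set ℕ),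
        MeasurableSpace.comap (T i) inferInstance :=
      le_iSup₂_of_le t rfl le_rfl
    exact ((measurable_const_div (w t)).comp (h1.mono h2 le_rfl)) hB

/-- Let `F t q` say that item `t` meets epoch `q` and passes its threshold, and `G t q` that its key
even reaches `r ^ q`. Independence and `measure_thr_lt` give `μ (F t q) ≤ r * μ (G t q)`. For fixed
`q`, at most `s` of the events `G t q` with late `t` occur, and none unless epoch `q` is reached;
summing over `q` produces one plus the expected number of epochs. -/
theorem lintegral_regs_le [IsProbabilityMeasure μ] (h : ExpSeq μ T) (hs : 0 < s) (hw : ∀ i, 1 ≤ w i)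
    (trim : Bool) (n : ℕ) :
    ∫⁻ ω, (regs trim (stream k s site w T ω) n : ℝ≥0∞) ∂μ ≤
      ENNReal.ofReal (max 2 ((k : ℝ) / s)) * s *
        (1 + ∫⁻ ω, (epo trim (stream k s site w T ω) n : ℝ≥0∞) ∂μ) := by
  set r : ℝ := max 2 ((k : ℝ) / s) with hr
  have hr2 : 2 ≤ r := le_max_left _ _
  -- Lateness depends on the weights only, so the values of the exponential variables are immaterial
  -- here.
  let Late : ℕ → Prop := fun t => (⟨k, s, site, w, fun _ => 1⟩ : Setting).Late t
  have hepo : ∀ t q, MeasurableSet {ω | epo trim (stream k s site w T ω) t = q} := fun t q =>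
    h.measurable_epo trim t (measurableSet_singleton q)
  have hkey : ∀ t, Measurable fun ω => w t / T t ω := fun t =>
    h.measurable_key (k := k) (s := s) (site := site) t
  let F : ℕ → ℕ → Set Ω := fun t q =>
    {ω | epo trim (stream k s site w T ω) t = q ∧ w t / T t ω ∈ Set.Ioi (thrOf r q)}
  let G : ℕ → ℕ → Set Ω := fun t q =>
    {ω | epo trim (stream k s site w T ω) t = q ∧ w t / T t ω ∈ Set.Ici (r ^ q)}
  have hF : ∀ t q, MeasurableSet (F t q) := fun t q => (hepo t q).inter (hkey t measurableSet_Ioi)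
  have hG : ∀ t q, MeasurableSet (G t q) := fun t q => (hepo t q).inter (hkey t measurableSet_Ici)
  have hFG : ∀ t q, μ (F t q) ≤ ENNReal.ofReal r * μ (G t q) := by
    intro t q
    rw [h.measure_epo_inter trim t q measurableSet_Ioi, h.measure_epo_inter trim t q measurableSet_Ici,
      mul_left_comm]
    exact mul_le_mul_right (h.measure_thr_lt hw hr2 q t) _
  have h1 : ∀ ω, (regs trim (stream k s site w T ω) n : ℝ≥0∞) =
      ∑ t ∈ (Finset.range n).filter Late, ∑' q, (F t q).indicator 1 ω := by
    intro ω
    unfold regs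
    rw [← Finset.filter_filter, Finset.card_filter, Nat.cast_sum]
    refine Finset.sum_congr rfl fun t _ => ?_
    rw [tsum_eq_single (epo trim (stream k s site w T ω) t) fun q hq => by
      rw [Set.indicator_of_notMem fun hm => hq hm.1.symm]]
    have : epochStart (stream k s site w T ω).r (co trim (stream k s site w T ω) t).u <
        (stream k s site w T ω).key t ↔ ω ∈ F t (epo trim (stream k s site w T ω) t) := by
      rw [epochStart_eq_thrOf]
      exact ⟨fun h' => ⟨rfl, h'⟩, fun h' => h'.2⟩
    by_cases hh : ω ∈ F t (epo trim (stream k s site w T ω) t)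
    · rw [if_pos (this.2 hh), Set.indicator_of_mem hh]; simp
    · rw [if_neg (fun h' => hh (this.1 h')), Set.indicator_of_notMem hh]; simp
  have h2 : ∀ q, ∑ t ∈ (Finset.range n).filter Late, μ (G t q) ≤
      s * μ {ω | q ≤ epo trim (stream k s site w T ω) n} := by
    intro q
    have hm : MeasurableSet {ω | q ≤ epo trim (stream k s site w T ω) n} :=
      h.measurable_epo trim n measurableSet_Ici
    rw [← lintegral_indicator_one hm, ← lintegral_const_mul _ (measurable_one.indicator hm),
      Finset.sum_congr rfl fun t _ => (lintegral_indicator_one (hG t q)).symm,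
      ← lintegral_finsetSum _ fun t _ => measurable_one.indicator (hG t q)]
    refine lintegral_mono_ae ?_
    filter_upwards [h.ae_good (k := k) (site := site) hs hw] with ω hX
    have e : ∑ t ∈ (Finset.range n).filter Late, (G t q).indicator (1 : Ω → ℝ≥0∞) ω =
        ((((Finset.range n).filter Late).filter fun t => ω ∈ G t q).card : ℝ≥0∞) := by
      rw [Finset.card_filter, Nat.cast_sum]
      refine Finset.sum_congr rfl fun t _ => ?_
      by_cases hh : ω ∈ G t q <;> simp [hh]
    rw [e]
    by_cases hq : q ≤ epo trim (stream k s site w T ω) n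
    · rw [Set.indicator_of_mem (show ω ∈ {ω | q ≤ epo trim (stream k s site w T ω) n} from hq),
        Pi.one_apply, mul_one, Nat.cast_le, Finset.filter_filter]
      have := card_jumps_le hX trim q n
      exact this
    · rw [Finset.filter_false_of_mem]
      · simp
      · intro t ht hh
        refine hq ?_
        rw [← hh.1]
        exact epo_mono hX trim (Finset.mem_range.1 (Finset.mem_filter.1 ht).1).le
  have h3 : ∑' q : ℕ, μ {ω | q ≤ epo trim (stream k s site w T ω) n} ≤
      1 + ∫⁻ ω, (epo trim (stream k s site w T ω) n : ℝ≥0∞) ∂μ := by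
    rw [tsum_eq_zero_add' ENNReal.summable, lintegral_natCast (h.measurable_epo trim n)]
    exact add_le_add prob_le_one le_rfl
  rw [lintegral_congr h1, lintegral_finsetSum _ fun t _ => Measurable.tsum fun q =>
    measurable_one.indicator (hF t q)]
  calc ∑ t ∈ (Finset.range n).filter Late, ∫⁻ ω, ∑' q, (F t q).indicator 1 ω ∂μ
      = ∑ t ∈ (Finset.range n).filter Late, ∑' q, μ (F t q) := by
        refine Finset.sum_congr rfl fun t _ => ?_
        rw [lintegral_tsum fun q => (measurable_one.indicator (hF t q)).aemeasurable]
        exact tsum_congr fun q => lintegral_indicator_one (hF t q)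
    _ ≤ ∑ t ∈ (Finset.range n).filter Late, ∑' q, ENNReal.ofReal r * μ (G t q) :=
        Finset.sum_le_sum fun t _ => ENNReal.tsum_le_tsum fun q => hFG t q
    _ = ∑' q, ENNReal.ofReal r * ∑ t ∈ (Finset.range n).filter Late, μ (G t q) := by
        rw [← Summable.tsum_finsetSum fun _ _ => ENNReal.summable]
        exact tsum_congr fun q => (Finset.mul_sum _ _ _).symm
    _ ≤ ∑' q : ℕ, ENNReal.ofReal r * s * μ {ω | q ≤ epo trim (stream k s site w T ω) n} :=
        ENNReal.tsum_le_tsum fun q => by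
          rw [mul_assoc]
          exact mul_le_mul_right (h2 q) _
    _ ≤ _ := by
        rw [ENNReal.tsum_mul_left]
        exact mul_le_mul_right h3 _

end ExpSeq

/-! ### The bounds in terms of the rate -/

section Counting

variable {X : Setting} (hs : 0 < X.s) (hw : ∀ i, 1 ≤ X.w i) (n : ℕ)
include hw

theorem Setting.pow_lev_le (i : ℕ) : X.r ^ X.lev i ≤ X.w i :=
  (pow_le_iff_level X.one_lt_r (hw i) _).2 le_rfl

theorem Setting.cnt_mul_le (j : ℕ) :
    X.cnt n j * X.r ^ j ≤ ∑ i ∈ Finset.range n, X.w i := by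
  rw [Setting.cnt, ← nsmul_eq_mul]
  refine (Finset.card_nsmul_le_sum _ X.w _ fun i hi => ?_).trans
    (Finset.sum_le_sum_of_subset_of_nonneg (Finset.filter_subset _ _) fun i _ _ => by linarith [hw i])
  rw [← (Finset.mem_filter.1 hi).2]
  exact X.pow_lev_le hw i

theorem Setting.natCast_le_sum : (n : ℝ) ≤ ∑ i ∈ Finset.range n, X.w i := by
  have := Finset.card_nsmul_le_sum (Finset.range n) X.w 1 fun i _ => hw i
  simpa using this

include hs

/-- A saturated level `j` has received at least `4 r s` items of weight at least `r ^ j`, so `r ^ (j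
+ 1) ≤ W / s`, and no level is saturated twice. -/
theorem Setting.sats_le (hW : (X.s : ℝ) ≤ ∑ i ∈ Finset.range n, X.w i) :
    X.sats n ≤ level X.r ((∑ i ∈ Finset.range n, X.w i) / X.s) := by
  have hs' : (0 : ℝ) < X.s := Nat.cast_pos.2 hs
  have hr := X.two_le_r
  rw [← Finset.card_range (level _ _), Setting.sats]
  refine Finset.card_le_card_of_injOn X.lev (fun t ht => ?_) fun t ht t' ht' hl => ?_
  · obtain ⟨ht1, ht2⟩ := Finset.mem_filter.1 ht
    have ht1 := Finset.mem_range.1 ht1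
    rw [Finset.mem_coe, Finset.mem_range, ← Nat.succ_le_iff, ← pow_le_iff_level X.one_lt_r
      ((one_le_div hs').2 hW), le_div_iff₀ hs']
    have h1 : X.cap ≤ X.cnt n (X.lev t) := by
      rw [← ht2, Setting.cnt, Setting.cnt, ← Finset.card_insert_of_notMem (a := t) (by simp)]
      refine Finset.card_le_card fun i hi => ?_
      simp only [Finset.mem_insert, Finset.mem_filter, Finset.mem_range] at hi ⊢
      rcases hi with rfl | hi
      · exact ⟨ht1, rfl⟩
      · exact ⟨by omega, hi.2⟩
    have h2 := X.cnt_mul_le hw n (X.lev t)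
    have h3 : (X.cap : ℝ) ≤ X.cnt n (X.lev t) := Nat.cast_le.2 h1
    have hp : 0 < X.r ^ X.lev t := pow_pos (by linarith) _
    rw [← X.cap_eq hs] at h3
    refine le_trans ?_ ((mul_le_mul_of_nonneg_right h3 hp.le).trans h2)
    rw [pow_succ]
    have : 0 ≤ X.r ^ X.lev t * X.r * X.s := by positivity
    nlinarith
  · obtain ⟨-, h1⟩ := Finset.mem_filter.1 ht
    obtain ⟨-, h2⟩ := Finset.mem_filter.1 ht'
    have key : ∀ a b, a < b → X.lev a = X.lev b → X.cnt a (X.lev a) + 1 ≤ X.cnt b (X.lev b) := by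
      intro a b hab hl
      rw [Setting.cnt, Setting.cnt, ← Finset.card_insert_of_notMem (a := a) (by simp)]
      refine Finset.card_le_card fun i hi => ?_
      simp only [Finset.mem_insert, Finset.mem_filter, Finset.mem_range] at hi ⊢
      rcases hi with rfl | hi
      · exact ⟨hab, hl⟩
      · exact ⟨by omega, by rw [hi.2, hl]⟩
    rcases lt_trichotomy t t' with h | h | h
    · have := key t t' h hl; omega
    · exact h
    · have := key t' t h hl.symm; omega

/-- Let `r ^ N` be the first power beyond `W / s`. Each of the `N` levels below has at most `X.cap`
early items, and at most `s` items can weigh `r ^ N` or more. -/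
theorem Setting.early_le (hW : (X.s : ℝ) ≤ ∑ i ∈ Finset.range n, X.w i) :
    X.early n ≤ X.cap * (level X.r ((∑ i ∈ Finset.range n, X.w i) / X.s) + 1) + X.s := by
  have hs' : (0 : ℝ) < X.s := Nat.cast_pos.2 hs
  have hr := X.two_le_r
  set W := ∑ i ∈ Finset.range n, X.w i
  obtain ⟨N, hN⟩ : ∃ N, N = level X.r (W / X.s) + 1 := ⟨_, rfl⟩
  have hlt : W < X.s * X.r ^ N := by
    by_contra hc
    have := (pow_le_iff_level X.one_lt_r ((one_le_div hs').2 hW) N).1 (by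
      rw [le_div_iff₀ hs', mul_comm]; exact not_lt.1 hc)
    omega
  rw [← hN, Setting.early]
  have h1 : ((Finset.range n).filter fun t => ¬ X.Late t) ⊆
      ((Finset.range N).biUnion fun j => (Finset.range n).filter fun t => X.lev t = j ∧ ¬ X.Late t) ∪
        (Finset.range n).filter fun t => N ≤ X.lev t := by
    intro t ht
    simp only [Finset.mem_union, Finset.mem_biUnion, Finset.mem_filter, Finset.mem_range] at ht ⊢
    by_cases h : X.lev t < N
    · exact Or.inl ⟨_, h, ht.1, rfl, ht.2⟩
    · exact Or.inr ⟨ht.1, not_lt.1 h⟩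
  refine (Finset.card_le_card h1).trans ((Finset.card_union_le _ _).trans (add_le_add ?_ ?_))
  · refine Finset.card_biUnion_le.trans ?_
    rw [mul_comm]
    refine (Finset.sum_le_card_nsmul _ _ X.cap fun j _ => ?_).trans (by simp)
    clear h1 hlt
    -- The bound by the number of items of level `j` is included for the induction: an early item
    -- arrives while that number is still below the bound.
    suffices h : ∀ m, ((Finset.range m).filter fun t => X.lev t = j ∧ ¬ X.Late t).card ≤
      min (X.cnt m j) X.cap from (h n).trans (min_le_right _ _)
    intro m
    induction m with
    | zero => simp
    | succ m ih =>
        rw [Finset.range_add_one, Finset.filter_insert, X.cnt_succ]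
        split_ifs with h2 h3 h3
        · rw [Finset.card_insert_of_notMem (by simp)]
          have : X.cnt m j < X.cap := by
            have h4 : X.cnt m (X.lev m) < X.cap := not_le.1 h2.2
            rwa [h2.1] at h4
          omega
        · exact absurd h2.1 h3
        · omega
        · omega
  · have h2 := Finset.card_nsmul_le_sum ((Finset.range n).filter fun t => N ≤ X.lev t) X.w (X.r ^ N)
      fun i hi => (pow_le_pow_right₀ X.one_lt_r.le (Finset.mem_filter.1 hi).2).trans
        (X.pow_lev_le hw i)
    have h3 := h2.trans (Finset.sum_le_sum_of_subset_of_nonneg (Finset.filter_subset _ _)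
      fun i _ _ => by linarith [hw i])
    rw [nsmul_eq_mul] at h3
    have hp : 0 < X.r ^ N := pow_pos (by linarith) _
    have h4 := lt_of_mul_lt_mul_right (h3.trans_lt hlt) hp.le
    exact_mod_cast h4.le

end Counting

/-! ### Comparison of all the counts with the rate. -/

/-- The chord from `1` to `y` lies below the concave logarithm, so `log x ≥ (x - 1) / (y - 1) * log
y`, and `x ≥ 2` bounds the quotient below by `x / (2 y)`. Needed for streams too light to saturate a
level. -/
theorem log_sub_mul_le {x y : ℝ} (hx : 2 ≤ x) (hxy : x ≤ y) :
    x / (2 * y) * Real.log y ≤ Real.log x := by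
  have hy : 0 < y - 1 := by linarith
  have hly : 0 ≤ Real.log y := Real.log_nonneg (by linarith)
  have h1 : y ^ ((x - 1) / (y - 1)) ≤ x := by
    have := rpow_one_add_le_one_add_mul_self (s := y - 1) (by linarith) (p := (x - 1) / (y - 1))
      (div_nonneg (by linarith) hy.le) ((div_le_one hy).2 (by linarith))
    rw [div_mul_cancel₀ _ hy.ne'] at this
    simpa using this
  have h2 := Real.log_le_log (Real.rpow_pos_of_pos (by linarith) _) h1
  rw [Real.log_rpow (by linarith)] at h2
  refine le_trans (mul_le_mul_of_nonneg_right ?_ hly) h2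
  rw [div_le_div_iff₀ (by linarith) hy]
  nlinarith

/-- The bound `r s log_r (W / s)` is at most three times the rate. -/
theorem mul_logb_le_rate {k s : ℕ} (hk : 0 < k) (hs : 0 < s) {W : ℝ} (hW : (s : ℝ) ≤ W) :
    max 2 ((k : ℝ) / s) * s * Real.logb (max 2 ((k : ℝ) / s)) (W / s) ≤ 3 * rate k s W := by
  have hs' : (0 : ℝ) < s := Nat.cast_pos.2 hs
  have hk' : (0 : ℝ) < k := Nat.cast_pos.2 hk
  have hL : 0 ≤ Real.log (W / s) := Real.log_nonneg ((one_le_div hs').2 hW)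
  have hks : 0 < (k : ℝ) / s := div_pos hk' hs'
  have hlk : 0 < Real.log (1 + (k : ℝ) / s) := Real.log_pos (by linarith)
  set r := max 2 ((k : ℝ) / s) with hr
  have hlr : 0 < Real.log r := Real.log_pos (by linarith [le_max_left 2 ((k : ℝ) / s)])
  -- For `k / s ≤ 2`, where `r = 2`, use `log (1 + x) ≤ x` and `3 log 2 > 2`. Otherwise `r s = k`,
  -- and `1 + r ≤ r ^ 2` gives a factor `2`.
  have key : r * s * Real.log (1 + (k : ℝ) / s) ≤ 3 * k * Real.log r := by
    rcases le_total ((k : ℝ) / s) 2 with h | h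
    · have : r = 2 := max_eq_left h
      rw [this]
      have h1 : Real.log (1 + (k : ℝ) / s) ≤ (k : ℝ) / s := by
        have := Real.log_le_sub_one_of_pos (x := 1 + (k : ℝ) / s) (by linarith)
        linarith
      have h2 : 2 * s * Real.log (1 + (k : ℝ) / s) ≤ 2 * s * ((k : ℝ) / s) := by gcongr
      have h3 : 2 * s * ((k : ℝ) / s) = 2 * k := by field_simp
      have := Real.log_two_gt_d9
      nlinarith
    · have hrk : r = (k : ℝ) / s := max_eq_right h
      have h3 : r * s = k := by rw [hrk]; field_simp
      rw [h3, ← hrk]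
      have h1 : Real.log (1 + r) ≤ Real.log (r ^ 2) := by
        refine Real.log_le_log (by linarith) ?_
        nlinarith
      rw [Real.log_pow] at h1
      push_cast at h1
      nlinarith
  rw [rate, Real.logb, mul_div_assoc', mul_div_assoc', mul_div_assoc', div_le_div_iff₀ hlr hlk]
  nlinarith [mul_le_mul_of_nonneg_right key hL]

/-- `log (4 y) log y = O(y)`. -/
theorem log_mul_log_le {y : ℝ} (hy : 1 ≤ y) : Real.log (4 * y) * Real.log y ≤ 8 * y := by
  have h0 : 0 < y := by linarith
  have h1 : Real.log y ≤ 2 * Real.sqrt y := by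
    have := Real.log_le_sub_one_of_pos (Real.sqrt_pos.2 h0)
    rw [Real.log_sqrt h0.le] at this
    linarith
  have h2 : Real.log (4 * y) ≤ 4 * Real.sqrt y := by
    have := Real.log_le_sub_one_of_pos (Real.sqrt_pos.2 (by linarith : 0 < 4 * y))
    have h4 : Real.sqrt 4 = 2 := by
      rw [show (4 : ℝ) = 2 ^ 2 by norm_num, Real.sqrt_sq (by norm_num)]
    rw [Real.log_sqrt (by linarith), Real.sqrt_mul (by norm_num), h4] at this
    linarith
  have h3 := Real.log_nonneg hy
  have h4 := Real.sq_sqrt h0.le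
  have h5 := Real.sqrt_nonneg y
  nlinarith [mul_le_mul h2 h1 h3 (by linarith)]

/-- A bound for the number of messages and, up to a constant factor, for the time of the
coordinator. -/
def load (trim : Bool) (X : Setting) (n : ℕ) : ℕ :=
  Nat.log 2 X.cap + 1 + X.early n + regs trim X n + (X.s + X.k) * (X.sats n + epo trim X n)

theorem messages_le_load {X : Setting} (hX : X.Good) (trim : Bool) (n : ℕ) :
    messages trim X n ≤ load trim X n := by
  have := messages_le hX trim n
  unfold load
  nlinarith [Nat.zero_le (X.s * (X.sats n + epo trim X n))]

theorem regs_eq_zero (trim : Bool) {X : Setting} {n : ℕ} (hn : n < X.cap) : regs trim X n = 0 := by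
  unfold regs
  rw [Finset.card_eq_zero, Finset.filter_eq_empty_iff]
  intro t ht h
  have h1 := cnt_le X t (X.lev t)
  have h2 : X.cap ≤ X.cnt t (X.lev t) := h.1
  have := Finset.mem_range.1 ht
  omega

theorem one_le_logb {r s W : ℝ} (hr : 2 ≤ r) (hs : 0 < s) (hW : 4 * r * s ≤ W) :
    1 ≤ Real.logb r (W / s) := by
  rw [Real.le_logb_iff_rpow_le (by linarith) (div_pos (by nlinarith) hs), Real.rpow_one,
    le_div_iff₀ hs]
  nlinarith

/-- The deterministic part of the load. -/
theorem fixed_load_le {X : Setting} (hs : 0 < X.s) (hw : ∀ i, 1 ≤ X.w i) (n : ℕ)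
    (hW : 2 * (X.s : ℝ) ≤ ∑ i ∈ Finset.range n, X.w i) :
    ((Nat.log 2 X.cap + 1 + X.early n + (X.s + X.k) * X.sats n : ℕ) : ℝ) ≤
      45 * (X.r * X.s * Real.logb X.r ((∑ i ∈ Finset.range n, X.w i) / X.s)) := by
  have hs' : (1 : ℝ) ≤ X.s := Nat.one_le_cast.2 hs
  have hr := X.two_le_r
  have hcap := X.cap_eq hs
  have hW' : (X.s : ℝ) ≤ ∑ i ∈ Finset.range n, X.w i := by linarith
  have hearly := X.early_le hs hw n hW'
  have hsats := X.sats_le hs hw n hW'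
  have hnW := X.natCast_le_sum hw n
  have hkr : (X.k : ℝ) ≤ X.r * X.s := by
    rw [← div_le_iff₀ (by linarith)]; exact le_max_right _ _
  have hen : X.early n ≤ n := (Finset.card_filter_le _ _).trans (Finset.card_range n).le
  generalize (∑ i ∈ Finset.range n, X.w i) = W at *
  have hx : 2 ≤ W / X.s := by rwa [le_div_iff₀ (by linarith)]
  have hlr : 0 < Real.log X.r := Real.log_pos (by linarith)
  have hl2 := Real.log_two_gt_d9
  have hlx : Real.log 2 ≤ Real.log (W / X.s) := Real.log_le_log two_pos hx
  obtain ⟨L, hL⟩ : ∃ L, L = Real.logb X.r (W / X.s) := ⟨_, rfl⟩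
  have hLe : L * Real.log X.r = Real.log (W / X.s) := by
    rw [hL, Real.logb, div_mul_cancel₀ _ hlr.ne']
  have hL0 : 0 < L := by
    by_contra hc
    nlinarith
  have hlev : (level X.r (W / X.s) : ℝ) ≤ L := by rw [hL]; exact Nat.floor_le (hL ▸ hL0.le)
  obtain ⟨y, hy⟩ : ∃ y, y = X.r * X.s := ⟨_, rfl⟩
  have hry : X.r ≤ y := by nlinarith
  have hsy : X.s ≤ y := by nlinarith
  rw [← hL, ← hy]
  rw [mul_assoc, ← hy] at hcap
  rw [← hy] at hkr
  -- `L` may be as small as `log 2 / log r`, because only `W ≥ 2 s` is known; so the bound rests on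
  -- `log (4 y) log r = O(y)`.
  have e1 : ((Nat.log 2 X.cap : ℕ) : ℝ) + 1 ≤ 34 * (y * L) := by
    have h1 : ((Nat.log 2 X.cap : ℕ) : ℝ) ≤ Real.logb 2 X.cap := by
      rw [Real.le_logb_iff_rpow_le (by norm_num) (by rw [← hcap]; linarith), Real.rpow_natCast]
      exact_mod_cast Nat.pow_log_le_self 2 (by
        intro h0; rw [h0, Nat.cast_zero] at hcap; linarith)
    have h2 : 1 ≤ Real.logb 2 X.cap := by
      rw [Real.le_logb_iff_rpow_le (by norm_num) (by rw [← hcap]; linarith), Real.rpow_one, ← hcap]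
      linarith
    rw [← hcap] at h1 h2
    have h3 := log_mul_log_le (y := y) (by linarith)
    have h4 : Real.log X.r ≤ Real.log y := Real.log_le_log (by linarith) hry
    have h5 : 0 ≤ Real.log (4 * y) := Real.log_nonneg (by linarith)
    have h6 : Real.log (4 * y) * Real.log X.r ≤ 8 * y := (mul_le_mul_of_nonneg_left h4 h5).trans h3
    have h7 : Real.logb 2 (4 * y) * Real.log 2 = Real.log (4 * y) := by
      rw [Real.logb, div_mul_cancel₀ _ (by linarith)]
    have h8 : 2 * Real.logb 2 (4 * y) * (Real.log 2 * Real.log X.r) ≤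
        34 * (y * L) * (Real.log 2 * Real.log X.r) := by
      have e1 : 2 * Real.logb 2 (4 * y) * (Real.log 2 * Real.log X.r) =
        2 * (Real.log (4 * y) * Real.log X.r) := by rw [← h7]; ring
      have e2 : 34 * (y * L) * (Real.log 2 * Real.log X.r) =
        34 * y * Real.log 2 * Real.log (W / X.s) := by rw [← hLe]; ring
      rw [e1, e2]
      have hy0 : 0 ≤ y := by linarith
      have e3 : 34 * y * Real.log 2 * Real.log 2 ≤ 34 * y * Real.log 2 * Real.log (W / X.s) :=
        mul_le_mul_of_nonneg_left hlx (by positivity)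
      have e4 : (0.48 : ℝ) ≤ Real.log 2 * Real.log 2 := by nlinarith
      nlinarith
    have h9 := le_of_mul_le_mul_right h8 (mul_pos (by linarith) hlr)
    linarith
  have e2 : (X.early n : ℝ) ≤ 9 * (y * L) := by
    have hen' : (X.early n : ℝ) ≤ n := Nat.cast_le.2 hen
    have hyL : 0 < y * L := mul_pos (by linarith) hL0
    -- For heavy streams `L ≥ 1` absorbs the additive terms of `early_le`. For light ones every item
    -- may be early, but `n ≤ W`, and `log_sub_mul_le` with `x = W / s` and `y = 4 r` bounds `W` by
    -- `8 r s L`.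
    by_cases h4 : 4 * y ≤ W
    · have hL1 : 1 ≤ L := hL ▸ one_le_logb hr (by linarith) (by rw [mul_assoc, ← hy]; exact h4)
      have h5 : (X.early n : ℝ) ≤ X.cap * (level X.r (W / X.s) + 1) + X.s := by exact_mod_cast hearly
      rw [← hcap] at h5
      nlinarith
    · have h5 : W ≤ 8 * (y * L) := by
        have hs0 : (0 : ℝ) < X.s := by linarith
        have h6 := log_sub_mul_le (x := W / X.s) (y := 4 * X.r) hx (by
          rw [div_le_iff₀ hs0, mul_assoc, ← hy]; linarith)
        have h7 : Real.log X.r ≤ Real.log (4 * X.r) := Real.log_le_log (by linarith) (by linarith)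
        have h8 : W / X.s / (2 * (4 * X.r)) * Real.log X.r ≤ L * Real.log X.r := by
          rw [hLe]
          exact (mul_le_mul_of_nonneg_left h7 (by positivity)).trans h6
        have h9 := le_of_mul_le_mul_right h8 hlr
        rw [div_div, div_le_iff₀ (by positivity)] at h9
        rw [hy]
        linarith
      linarith
  have e3 : ((X.s : ℝ) + X.k) * X.sats n ≤ 2 * (y * L) := by
    have h1 : (X.sats n : ℝ) ≤ L := le_trans (by exact_mod_cast hsats) hlev
    have h2 : (X.s : ℝ) + X.k ≤ 2 * y := by linarith
    have := mul_le_mul h2 h1 (Nat.cast_nonneg _) (by linarith)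
    linarith
  push_cast
  linarith

namespace ExpSeq

variable {Ω : Type*} [MeasurableSpace Ω] {μ : Measure Ω} {T : ℕ → Ω → ℝ}
  {k s : ℕ} {site : ℕ → Fin k} {w : ℕ → ℝ}

/-- With fewer than `4 r s` items there are neither regular messages nor epochs. Otherwise `W ≥ n ≥
4 r s`, so the logarithm is at least `1` and absorbs the additive constants. -/
theorem lintegral_random_load_le [IsProbabilityMeasure μ] (h : ExpSeq μ T) (hs : 0 < s)
    (hw : ∀ i, 1 ≤ w i) (trim : Bool) (n : ℕ) (hW : 2 * (s : ℝ) ≤ ∑ i ∈ Finset.range n, w i) :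
    ∫⁻ ω, (regs trim (stream k s site w T ω) n : ℝ≥0∞) ∂μ + (s + k : ℕ) *
      ∫⁻ ω, (epo trim (stream k s site w T ω) n : ℝ≥0∞) ∂μ ≤
      ENNReal.ofReal (13 * (max 2 ((k : ℝ) / s) * s *
        Real.logb (max 2 ((k : ℝ) / s)) ((∑ i ∈ Finset.range n, w i) / s))) := by
  let X₀ : Setting := ⟨k, s, site, w, fun _ => 1⟩
  by_cases hn : n < X₀.cap
  · have h1 : ∫⁻ ω, (regs trim (stream k s site w T ω) n : ℝ≥0∞) ∂μ = 0 := by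
      have : ∀ ω, regs trim (stream k s site w T ω) n = 0 := fun ω => regs_eq_zero trim hn
      simp [this]
    have h2 : ∫⁻ ω, (epo trim (stream k s site w T ω) n : ℝ≥0∞) ∂μ = 0 := by
      rw [lintegral_eq_zero_iff' (by
        have := h.measurable_epo (k := k) (s := s) (site := site) (w := w) trim n
        exact ((measurable_from_top (f := fun m : ℕ => (m : ℝ≥0∞))).comp this).aemeasurable)]
      filter_upwards [h.ae_good (k := k) (site := site) hs hw] with ω hX
      rw [epo_eq_zero hX trim hn]
      simp
    rw [h1, h2]
    simp
  · have hs' : (1 : ℝ) ≤ s := Nat.one_le_cast.2 hs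
    have hcap := X₀.cap_eq hs
    have hWn := X₀.natCast_le_sum hw n
    have hr : (2 : ℝ) ≤ max 2 ((k : ℝ) / s) := le_max_left _ _
    have hkr : (k : ℝ) ≤ max 2 ((k : ℝ) / s) * s := by
      rw [← div_le_iff₀ (by linarith)]; exact le_max_right _ _
    have hn' : (X₀.cap : ℝ) ≤ n := Nat.cast_le.2 (not_lt.1 hn)
    have h4W : 4 * max 2 ((k : ℝ) / s) * s ≤ ∑ i ∈ Finset.range n, w i :=
      hcap.le.trans (hn'.trans hWn)
    have hL := one_le_logb hr (by linarith) h4W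
    have h1 := h.lintegral_epo_le (k := k) (site := site) hs hw trim n (by linarith)
    have h2 := h.lintegral_regs_le (k := k) (site := site) hs hw trim n
    obtain ⟨L, hLe⟩ : ∃ L, L = Real.logb (max 2 ((k : ℝ) / s))
      ((∑ i ∈ Finset.range n, w i) / s) := ⟨_, rfl⟩
    rw [← hLe] at hL h1 ⊢
    generalize max 2 ((k : ℝ) / s) = r at *
    have h3 : ∫⁻ ω, (epo trim (stream k s site w T ω) n : ℝ≥0∞) ∂μ ≤ ENNReal.ofReal (4 * L) :=
      h1.trans (ENNReal.ofReal_le_ofReal (by linarith))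
    have h4 : 1 + ∫⁻ ω, (epo trim (stream k s site w T ω) n : ℝ≥0∞) ∂μ ≤ ENNReal.ofReal (5 * L) := by
      refine (add_le_add_right h3 1).trans ?_
      rw [← ENNReal.ofReal_one, ← ENNReal.ofReal_add (by norm_num) (by linarith)]
      exact ENNReal.ofReal_le_ofReal (by linarith)
    have h5 := h2.trans (mul_le_mul_right h4 _)
    have h6 := mul_le_mul_right h3 ((s + k : ℕ) : ℝ≥0∞)
    refine (add_le_add h5 h6).trans ?_
    rw [← ENNReal.ofReal_natCast s, ← ENNReal.ofReal_natCast (s + k),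
      ← ENNReal.ofReal_mul (by linarith), ← ENNReal.ofReal_mul (by positivity),
      ← ENNReal.ofReal_mul (by positivity), ← ENNReal.ofReal_add (by positivity) (by positivity)]
    refine ENNReal.ofReal_le_ofReal ?_
    have h7 : (((s + k : ℕ) : ℕ) : ℝ) ≤ 2 * (r * s) := by
      push_cast
      nlinarith
    have h8 := mul_le_mul_of_nonneg_right h7 (by linarith : 0 ≤ 4 * L)
    nlinarith

theorem measurable_load (h : ExpSeq μ T) (trim : Bool) (n : ℕ) :
    Measurable fun ω => load trim (stream k s site w T ω) n :=
  h.measurable_of_similar n fun _ _ hh => by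
    unfold load
    rw [hh.regs_eq ⟨rfl, rfl, rfl⟩ rfl (fun _ => rfl) trim,
      hh.epo_eq ⟨rfl, rfl, rfl⟩ rfl (fun _ => rfl) trim]
    rfl

/-- The constant is `3 * (45 + 13)`: the deterministic and the random part, times the loss in
`mul_logb_le_rate`. -/
theorem lintegral_load_le [IsProbabilityMeasure μ] (h : ExpSeq μ T) (hs : 0 < s)
    (hw : ∀ i, 1 ≤ w i) (trim : Bool) (n : ℕ) (hW : 2 * (s : ℝ) ≤ ∑ i ∈ Finset.range n, w i) :
    ∫⁻ ω, (load trim (stream k s site w T ω) n : ℝ≥0∞) ∂μ ≤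
      ENNReal.ofReal (174 * rate k s (∑ i ∈ Finset.range n, w i)) := by
  let X₀ : Setting := ⟨k, s, site, w, fun _ => 1⟩
  have hk : 0 < k := (site 0).pos
  have h1 := fixed_load_le (X := X₀) hs hw n hW
  have h2 := h.lintegral_random_load_le (k := k) (site := site) hs hw trim n hW
  have h3 := mul_logb_le_rate hk hs (W := ∑ i ∈ Finset.range n, w i)
    (by linarith [(Nat.cast_nonneg s : (0 : ℝ) ≤ s)])
  obtain ⟨D, hD⟩ : ∃ D, D = Nat.log 2 X₀.cap + 1 + X₀.early n + (X₀.s + X₀.k) * X₀.sats n := ⟨_, rfl⟩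
  rw [← hD] at h1
  have e : ∀ ω, (load trim (stream k s site w T ω) n : ℝ≥0∞) =
      D + (regs trim (stream k s site w T ω) n + (s + k : ℕ) * epo trim (stream k s site w T ω) n) := by
    intro ω
    have : load trim (stream k s site w T ω) n = D + (regs trim (stream k s site w T ω) n +
        (s + k) * epo trim (stream k s site w T ω) n) := by
      have e1 : load trim (stream k s site w T ω) n = Nat.log 2 X₀.cap + 1 + X₀.early n +
        regs trim (stream k s site w T ω) n +
        (s + k) * (X₀.sats n + epo trim (stream k s site w T ω) n) := rfl
      rw [e1, hD]
      change _ = Nat.log 2 X₀.cap + 1 + X₀.early n + (s + k) * X₀.sats n + _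
      ring
    rw [this]
    push_cast
    ring
  have hcast : Measurable fun m : ℕ => (m : ℝ≥0∞) := measurable_from_top
  have hmr : Measurable fun ω => (regs trim (stream k s site w T ω) n : ℝ≥0∞) := hcast.comp (h.measurable_regs (k := k) (s := s) (site := site) (w := w) trim n)
  have hme : Measurable fun ω => (epo trim (stream k s site w T ω) n : ℝ≥0∞) := hcast.comp (h.measurable_epo (k := k) (s := s) (site := site) (w := w) trim n)
  rw [lintegral_congr e, lintegral_add_left measurable_const, lintegral_add_left hmr,
    lintegral_const_mul _ hme, lintegral_const, measure_univ, mul_one]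
  refine (add_le_add_right h2 _).trans ?_
  have hrs : X₀.r = max 2 ((k : ℝ) / s) := rfl
  have hXs : (X₀.s : ℝ) = s := rfl
  have hXw : X₀.w = w := rfl
  rw [hrs, hXs, hXw] at h1
  have h0 : (0 : ℝ) ≤ D := Nat.cast_nonneg D
  rw [← ENNReal.ofReal_natCast, ← ENNReal.ofReal_add h0 (by linarith)]
  exact ENNReal.ofReal_le_ofReal (by linarith)

end ExpSeq

theorem expLE_of_lintegral {Ω : Type*} [MeasurableSpace Ω] {μ : Measure Ω} {f : Ω → ℕ} {b : ℝ}
    (hf : Measurable f) (hb : 0 ≤ b) (h : ∫⁻ ω, (f ω : ℝ≥0∞) ∂μ ≤ ENNReal.ofReal b) :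
    ExpLE μ f b := by
  have hm : Measurable fun ω => (f ω : ℝ) := measurable_from_top.comp hf
  have e : ∀ ω, ENNReal.ofReal (f ω : ℝ) = f ω := fun ω => ENNReal.ofReal_natCast _
  have h0 : 0 ≤ᵐ[μ] fun ω => (f ω : ℝ) := Filter.Eventually.of_forall fun ω => Nat.cast_nonneg _
  refine ⟨⟨hm.aestronglyMeasurable, ?_⟩, ?_⟩
  · rw [hasFiniteIntegral_iff_ofReal h0, lintegral_congr e]
    exact h.trans_lt ENNReal.ofReal_lt_top
  · rw [integral_eq_lintegral_of_nonneg_ae h0 hm.aestronglyMeasurable, lintegral_congr e]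
    exact (ENNReal.toReal_mono ENNReal.ofReal_ne_top h).trans (ENNReal.toReal_ofReal hb).le

/-! ### Buffers of items -/

/-- The arrays `a` store the items of the list `L`, their keys and their levels. -/
def Buf (X : Setting) (σ : Mem) (a : Fin 32) (L : List ℕ) : Prop :=
  ∀ j (h : j < L.length), σ.I a j = some L[j] ∧ σ.R a j = X.key L[j] ∧ σ.W a j = X.lev L[j]

theorem Buf.congr {X : Setting} {σ σ' : Mem} {a : Fin 32} {L : List ℕ} (h : Buf X σ a L)
    (hI : σ'.I a = σ.I a) (hR : σ'.R a = σ.R a) (hW : σ'.W a = σ.W a) : Buf X σ' a L := by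
  intro j hj
  rw [hI, hR, hW]
  exact h j hj

theorem Buf.append {X : Setting} {σ σ' : Mem} {a : Fin 32} {L : List ℕ} {i : ℕ} (h : Buf X σ a L)
    (hlt : ∀ j < L.length, σ'.I a j = σ.I a j ∧ σ'.R a j = σ.R a j ∧ σ'.W a j = σ.W a j)
    (heq : σ'.I a L.length = some i ∧ σ'.R a L.length = X.key i ∧ σ'.W a L.length = X.lev i) :
    Buf X σ' a (L ++ [i]) := by
  intro j hj
  by_cases hjL : j < L.length
  · rw [List.getElem_append_left hjL]
    obtain ⟨h1, h2, h3⟩ := hlt j hjL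
    rw [h1, h2, h3]
    exact h j hjL
  · have : j = L.length := by
      rw [List.length_append, List.length_singleton] at hj
      omega
    subst this
    simpa using heq

/-- Removes the entries of the buffer `a`, of length `ln`, that satisfy `b`. -/
def sift (a ln : Fin 32) (b : HT) : HC :=
  .set 17 (.c 0) ;; .set 18 (.c 0) ;;
  .loop (.nz (.v 17 <ₑ .v ln))
    (.ite b .skip
      (.putR a (.v 18) a (.v 17) ;; .putI a (.v 18) a (.v 17) ;; .putW a (.v 18) (.w a (.v 17)) ;;
        .set 18 (.v 18 +ₑ .c 1)) ;;
      .set 17 (.v 17 +ₑ .c 1)) ;;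
  .set ln (.v 18)

/-- Compaction in place of three parallel arrays. The order of the survivors is kept, which later
makes the release follow the order of arrival. -/
theorem sift_spec {E : Env} {K : ℕ} (hE : E.Fits K) (hK1 : 8 ≤ K) {X : Setting} {a ln : Fin 32}
    {b : HT} {p : ℕ → Bool} {σ : Mem} {L : List ℕ} (ha7 : a ≠ 17) (ha8 : a ≠ 18) (hal : a ≠ ln)
    (hl7 : ln ≠ 17) (hl8 : ln ≠ 18) (hL : Buf X σ a L) (hln : σ.W ln 0 = L.length)
    (hK : L.length ≤ K) (hlev : ∀ i ∈ L, X.lev i ≤ E.maxWord)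
    (hb : ∀ τ i, Same [17, 18, a] [a] [a] σ τ → τ.W 17 0 = i → ∀ h : i < L.length,
      τ.R a i = X.key L[i] → τ.W a i = X.lev L[i] → b.ok E.maxWord K τ ∧ b.cost ≤ 40 ∧
      (b.val τ ↔ p L[i] = false)) :
    wp E K (sift a ln b) σ fun σ' o t => o = [] ∧ t ≤ 200 * L.length + 100 ∧
      Same [17, 18, a, ln] [a] [a] σ σ' ∧ σ'.W ln 0 = (L.filter p).length ∧
      Buf X σ' a (L.filter p) := by
  have hw := hE.word
  simp only [sift, wp.eq_2, wp.eq_5]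
  simp
  and_intros
  all_goals try omega
  refine wp_silent_loop hE L.length 200 (fun i τ => Same [17, 18, a] [a] [a] σ τ ∧ τ.W 17 0 = i ∧
    τ.W 18 0 = ((L.take i).filter p).length ∧ Buf X τ a ((L.take i).filter p) ∧
    ∀ j (h : j < L.length), i ≤ j →
      τ.I a j = some L[j] ∧ τ.R a j = X.key L[j] ∧ τ.W a j = X.lev L[j]) ?_ ?_ ?_
  · refine ⟨((Same.refl _ _ _ σ).setW _ (by simp) _ _).setW _ (by simp) _ _, by simp, by simp,
      fun j hj => by simp at hj, fun j hj _ => ?_⟩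
    simp [ha7, ha8]
    exact hL j hj
  · rintro i hi τ ⟨hS, h17, h18, hB, hrest⟩
    have hl := congrFun (hS.W ln (by simp [hl7, hl8, hal.symm])) 0
    obtain ⟨hI, hR, hW⟩ := hrest i hi le_rfl
    obtain ⟨hb1, hb2, hb3⟩ := hb τ i hS h17 hi hR hW
    have hle : ((L.take i).filter p).length ≤ i :=
      (List.length_filter_le _ _).trans (by simp)
    have hlv := hlev _ (List.getElem_mem hi)
    have htake0 : p L[i] = false → (L.take (i + 1)).filter p = (L.take i).filter p := fun hp => by
      rw [List.take_succ_eq_append_getElem hi, List.filter_append, List.filter_singleton, hp]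
      simp
    have htake1 : p L[i] = true → (L.take (i + 1)).filter p = (L.take i).filter p ++ [L[i]] :=
      fun hp => by
        rw [List.take_succ_eq_append_getElem hi, List.filter_append, List.filter_singleton, hp]
        simp
    simp [hl, hln, h17, hi, h18, hW, ha7, ha8, ha7.symm, ha8.symm]
    and_intros
    all_goals try omega
    · intro hv
      have hp := hb3.1 hv
      and_intros
      all_goals try omega
      · exact hS.setW _ (by simp) _ _
      · rw [htake0 hp]
      · rw [htake0 hp]
        exact hB.congr rfl rfl (by funext j; simp [ha7])
      · intro j hj hij
        exact hrest j hj (by omega)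
    · intro hv
      have hp : p L[i] = true := by simpa using fun h => hv (hb3.2 h)
      and_intros
      all_goals try omega
      · exact ((((hS.setR _ (by simp) _ _).setI _ (by simp) _ _).setW _ (by simp) _ _).setW _
          (by simp) _ _).setW _ (by simp) _ _
      · rw [htake1 hp, List.length_append, List.length_singleton]
      · rw [htake1 hp]
        refine hB.append (fun j hj => ?_) ?_
        · have : j ≠ ((L.take i).filter p).length := by omega
          simp [ha7, ha8, this]
        · simp [ha7, ha8, hI, hR]
      · intro j hj hij
        have : j ≠ ((L.take i).filter p).length := by omega
        simp [this]
        exact hrest j hj (by omega)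
  · rintro τ t ⟨hS, h17, h18, hB, -⟩ ht
    have hl := congrFun (hS.W ln (by simp [hl7, hl8, hal.symm])) 0
    have hle : (L.filter p).length ≤ L.length := List.length_filter_le _ _
    rw [List.take_length] at h18 hB
    simp [hl, hln, h17, h18] at ht ⊢
    and_intros
    all_goals try omega
    · exact (hS.mono (by simp) (by simp) (by simp)).setW _ (by simp) _ _
    · exact hB.congr rfl rfl (by funext j; simp [hal])

/-- Copies the keys of the buffer `a`, of length `ln`, to the scratch array, starting from the
position in variable `18`, which is advanced. -/
def copyKeys (a ln : Fin 32) : HC :=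
  .set 17 (.c 0) ;;
  .loop (.nz (.v 17 <ₑ .v ln))
    (.putR 6 (.v 18) a (.v 17) ;; .set 18 (.v 18 +ₑ .c 1) ;; .set 17 (.v 17 +ₑ .c 1))

theorem copyKeys_spec {E : Env} {K : ℕ} (hE : E.Fits K) (hK1 : 8 ≤ K) {X : Setting} {a ln : Fin 32}
    {σ : Mem} {L L' : List ℕ} (ha : a ≠ 6) (hl7 : ln ≠ 17) (hl8 : ln ≠ 18)
    (hL : Buf X σ a L) (hln : σ.W ln 0 = L.length) (hK : L'.length + L.length ≤ K)
    (h18 : σ.W 18 0 = L'.length) (hs : seg σ 0 L'.length = L'.map X.key) :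
    wp E K (copyKeys a ln) σ fun σ' o t => o = [] ∧ t ≤ 100 * L.length + 100 ∧
      Same [17, 18] [6] [] σ σ' ∧ σ'.W 18 0 = (L' ++ L).length ∧
      seg σ' 0 (L' ++ L).length = (L' ++ L).map X.key := by
  have hw := hE.word
  simp only [copyKeys, wp.eq_2, wp.eq_5]
  simp
  and_intros
  all_goals try omega
  refine wp_silent_loop hE L.length 100 (fun i τ => Same [17, 18] [6] [] σ τ ∧ τ.W 17 0 = i ∧
    τ.W 18 0 = L'.length + i ∧ seg τ 0 (L'.length + i) = (L' ++ L.take i).map X.key) ?_ ?_ ?_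
  · exact ⟨(Same.refl _ _ _ σ).setW _ (by simp) _ _, by simp, by simp [h18], by simpa using hs⟩
  · rintro i hi τ ⟨hS, h17, h18, hseg⟩
    have hl := congrFun (hS.W ln (by simp [hl7, hl8])) 0
    have hR := congrFun (hS.R a (by simp [ha])) i
    have hk := (hL i hi).2.1
    simp [hl, hln, h17, hi, h18]
    and_intros
    all_goals try omega
    · exact ((hS.setR _ (by simp) _ _).setW _ (by simp) _ _).setW _ (by simp) _ _
    · have hlt : i < (L.map X.key).length := by simpa using hi
      rw [← add_assoc, seg_succ, List.take_succ_eq_append_getElem hlt, ← List.append_assoc]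
      congr 1
      · rw [← List.map_take, ← List.map_append, ← hseg]
        exact seg_congr fun j _ hj => by simp; omega
      · simp [hR, hk]
  · rintro τ t ⟨hS, h17, h18, hseg⟩ ht
    have hl := congrFun (hS.W ln (by simp [hl7, hl8])) 0
    rw [List.take_length] at hseg
    simp [hl, hln, h17] at ht ⊢
    and_intros
    all_goals try omega
    simpa using hseg

/-! ### From a selected rank to the items with the largest keys. -/

theorem card_filter_toFinset {L : List ℕ} (hL : L.Nodup) (p : ℕ → Prop) [DecidablePred p] :
    (L.toFinset.filter p).card = L.countP fun i => decide (p i) := by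
  have : L.toFinset.filter p = (L.filter fun i => decide (p i)).toFinset := by ext i; simp
  rw [this, List.toFinset_card_of_nodup (hL.filter _), List.countP_eq_length_filter]

/-- A key `v` with exactly `m - 1` larger keys is the `m`-th largest one. -/
theorem mem_top_iff_of_rank {v : ℕ → ℝ} {L : List ℕ} (hL : L.Nodup) {n : ℕ} (hn : 0 < n) {x : ℝ}
    (hx : x ∈ L.map v) (hc : ((L.map v).countP fun y => decide (x < y)) = n - 1) :
    ∀ i ∈ L, i ∈ top n v L.toFinset ↔ ¬ v i < x := by
  obtain ⟨m, hm, rfl⟩ := List.mem_map.1 hx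
  rw [List.countP_map] at hc
  have hc' : (L.toFinset.filter fun j => v m < v j).card = n - 1 := by
    rw [card_filter_toFinset hL]; exact hc
  intro i hi
  rw [mem_top]
  constructor
  · rintro ⟨-, h2⟩ hlt
    have : insert m (L.toFinset.filter fun j => v m < v j) ⊆
        L.toFinset.filter fun j => v i < v j := by
      intro j hj
      rcases Finset.mem_insert.1 hj with rfl | hj
      · exact Finset.mem_filter.2 ⟨List.mem_toFinset.2 hm, hlt⟩
      · rw [Finset.mem_filter] at hj ⊢
        exact ⟨hj.1, hlt.trans hj.2⟩
    have := Finset.card_le_card this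
    rw [Finset.card_insert_of_notMem (by simp), hc'] at this
    omega
  · intro h2
    refine ⟨List.mem_toFinset.2 hi, ?_⟩
    have : (L.toFinset.filter fun j => v i < v j) ⊆ L.toFinset.filter fun j => v m < v j := by
      intro j hj
      rw [Finset.mem_filter] at hj ⊢
      exact ⟨hj.1, lt_of_le_of_lt (not_lt.1 h2) hj.2⟩
    have := Finset.card_le_card this
    omega

theorem eq_uOf_of_rank {X : Setting} (hX : X.Good) {L : List ℕ} (hL : L.Nodup)
    (hs : X.s ≤ L.length) {x : ℝ} (hx : x ∈ L.map X.key)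
    (h : ∀ i ∈ L, i ∈ top X.s X.key L.toFinset ↔ ¬ X.key i < x) :
    x = uOf X (top X.s X.key L.toFinset) := by
  obtain ⟨m, hm, rfl⟩ := List.mem_map.1 hx
  have hcard : ¬ (top X.s X.key L.toFinset).card < X.s := by
    rw [card_top hX.inj, List.toFinset_card_of_nodup hL, not_lt]
    exact le_min le_rfl hs
  rw [uOf, if_neg hcard]
  symm
  refine IsLeast.csInf_eq ⟨⟨m, (h m hm).2 (lt_irrefl _), rfl⟩, ?_⟩
  rintro _ ⟨i, hi, rfl⟩
  exact not_lt.1 ((h i (List.mem_toFinset.1 (top_subset _ _ _ hi))).1 hi)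

/-- The sublist of the items with the `s` largest keys. -/
def topList (X : Setting) (L : List ℕ) : List ℕ :=
  L.filter fun i => decide (i ∈ top X.s X.key L.toFinset)

theorem topList_toFinset (X : Setting) (L : List ℕ) :
    (topList X L).toFinset = top X.s X.key L.toFinset := by
  ext i
  simp only [topList, List.toFinset_filter, Finset.mem_filter, decide_eq_true_eq]
  exact ⟨fun h => h.2, fun h => ⟨top_subset _ _ _ h, h⟩⟩

theorem topList_sublist (X : Setting) (L : List ℕ) : (topList X L).Sublist L :=
  List.filter_sublist

theorem topList_length {X : Setting} (hX : X.Good) {L : List ℕ} (hL : L.Nodup) :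
    (topList X L).length = min X.s L.length := by
  rw [← List.toFinset_card_of_nodup (hL.sublist (topList_sublist X L)), topList_toFinset,
    card_top hX.inj, List.toFinset_card_of_nodup hL]

/-- The word arrays changed by the compression of a buffer. -/
def compW (a ln : Fin 32) : List (Fin 32) := a :: ln :: 25 :: 26 :: selW

/-- Keeps only the `s` largest keys of the buffer `a`, of length `ln`. -/
def compress (a ln : Fin 32) : HC :=
  .set 18 (.c 0) ;; copyKeys a ln ;; .set 26 (.v ln) ;; .set 25 (.v 0 -ₑ .c 1) ;; select ;;
    sift a ln (.lt a (.v 17) 7 (.c 0))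

/-- The keys are copied first, because the selection overwrites its input. The key with exactly `s -
1` larger ones separates the top items from the rest, so one pass removes the rest. For the sample
that key is the new `u`, left in real variable `7` for `advance`. -/
theorem compress_spec {E : Env} {K : ℕ} (hE : E.Fits K) (hK1 : 8 ≤ K) {X : Setting} (hX : X.Good)
    {a ln : Fin 32} (h : (a = 4 ∧ ln = 10) ∨ (a = 5 ∧ ln = 11)) {σ : Mem} {L : List ℕ}
    (hL : Buf X σ a L) (hln : σ.W ln 0 = L.length) (hnd : L.Nodup) (h0 : σ.W 0 0 = X.s)
    (hs : X.s ≤ L.length) (hK : 5 * L.length ≤ 4 * K) (hlev : ∀ i ∈ L, X.lev i ≤ E.maxWord) :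
    wp E K (compress a ln) σ fun σ' o t => o = [] ∧ t ≤ 101000 * L.length + 1000 ∧
      Same (compW a ln) [a, 6, 7] [a] σ σ' ∧ σ'.W ln 0 = (topList X L).length ∧
      Buf X σ' a (topList X L) ∧ σ'.R 7 0 = uOf X (top X.s X.key L.toFinset) := by
  have hw := hE.word
  have hsp := hX.s_pos
  have ha : a ≠ 6 ∧ a ≠ 7 ∧ a ≠ 17 ∧ a ≠ 18 ∧ a ≠ ln ∧ ln ≠ 17 ∧ ln ≠ 18 ∧ a ≠ 25 ∧ a ≠ 26 ∧
    ln ≠ 25 ∧ ln ≠ 26 ∧ a ∉ selW ∧ ln ∉ selW ∧ ln ≠ 0 ∧ a ≠ 0 := by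
    rcases h with ⟨rfl, rfl⟩ | ⟨rfl, rfl⟩ <;> decide
  obtain ⟨a6, a7, a17, a18, al, l17, l18, a25, a26, l25, l26, asel, lsel, l0, a0⟩ := ha
  simp only [compress, wp.eq_2, wp.eq_5]
  simp [-Fin.isValue]
  and_intros
  all_goals try omega
  refine wp_mono _ (copyKeys_spec hE hK1 (X := X) (L := L) (L' := []) a6 l17 l18
    (hL.congr rfl rfl (by funext j; simp [a18])) (by simp [l18, hln]) (by simp; omega) (by simp)
    (by simp [seg])) ?_
  rintro τ o t ⟨rfl, ht, hS, -, hseg⟩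
  have k0 := congrFun (hS.W 0 (by decide)) 0
  have kl := congrFun (hS.W ln (by simp [l17, l18])) 0
  have ka := hS.W a (by simp [a17, a18])
  have kRa := hS.R a (by simp [a6])
  have kIa := hS.I a (by simp)
  simp [l18, hln, h0] at k0 kl
  simp only [List.nil_append] at hseg
  simp [k0, kl]
  and_intros
  all_goals try omega
  have hndk : (L.map X.key).Nodup := hnd.map hX.inj
  refine wp_mono _ (select_spec hE hK1 (n := L.length) (by simp) (by simp; omega) hK
    (by simpa [hseg] using hndk)) ?_
  rintro τ' o t' ⟨rfl, ht', hS', hv, hc⟩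
  simp only [seg_setW, hseg] at hv hc
  have j0 := congrFun (hS'.W 0 (by decide)) 0
  have jl := congrFun (hS'.W ln lsel) 0
  have ja := hS'.W a asel
  have jRa := hS'.R a (by simp [a6, a7])
  have jIa := hS'.I a (by simp)
  simp [l25, l26, kl] at jl
  simp [-List.countP_map] at hc
  have htop := mem_top_iff_of_rank hnd hsp hv hc
  have hu := eq_uOf_of_rank hX hnd hs hv htop
  refine wp_mono _ (sift_spec hE hK1 (X := X) (L := L)
    (p := fun i => decide (i ∈ top X.s X.key L.toFinset)) a17 a18 al l17 l18 ?_ jl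
    (by omega) hlev ?_) ?_
  · refine hL.congr ?_ ?_ ?_
    · rw [jIa]; simp [kIa]
    · rw [jRa]; simp [kRa]
    · rw [ja]; funext j; simp [ka, a18, a25, a26]
  · intro ρ i hSρ h17 hi hR hW
    have r7 := congrFun (hSρ.R 7 (by simp [a7.symm])) 0
    simp [h17, hR, r7]
    refine ⟨by omega, ?_⟩
    rw [htop _ (List.getElem_mem hi), not_not]
  · rintro ρ o t'' ⟨rfl, ht'', hS'', hlen, hB⟩
    have r7 := congrFun (hS''.R 7 (by simp [a7.symm])) 0
    refine ⟨by simp, by omega, ?_, hlen, hB, by rw [r7, hu]⟩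
    have s1 : Same (compW a ln) [a, 6, 7] [a] σ τ :=
      ((Same.refl _ _ _ σ).setW 18 (by simp [compW, selW]) _ _).trans
        (hS.mono (by simp [compW, selW]) (by simp) (by simp))
    refine (((s1.setW 26 (by simp [compW]) _ _).setW 25 (by simp [compW]) _ _).trans
      (hS'.mono ?_ (by simp) (by simp))).trans (hS''.mono ?_ (by simp) (by simp))
    · intro x hx; simp [compW, hx]
    · simp [compW, selW]

/-! ### Insertion into the sample -/

/-- Raises the next power of `r` above the threshold in real variable `7`. -/
def advance : HC :=
  .set 29 (.c 1) ;;
  .loop (.nz (.v 29))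
    (.ite (.lt 7 (.c 0) 2 (.c 0)) (.set 29 (.c 0)) (.putR 8 (.c 0) 2 (.c 0) ;; .scale 2 (.c 0) 2 (.c 0)))

/-- The next power is multiplied by `r` until it exceeds `u`, once per epoch passed. Real variable
`8` keeps the power before it, which is the threshold to be announced. The extra round only clears
the loop flag. -/
theorem advance_spec {E : Env} {K : ℕ} (hE : E.Fits K) (hK1 : 8 ≤ K) (hr : 1 < E.r) {σ : Mem}
    {q : ℕ} (h2 : σ.R 2 0 = E.r ^ q) (hq : q ≤ epochIdx E.r (σ.R 7 0)) :
    wp E K advance σ fun σ' o t => o = [] ∧ t ≤ 100 * (epochIdx E.r (σ.R 7 0) - q) + 200 ∧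
      Same [29] [2, 8] [] σ σ' ∧ σ'.R 2 0 = E.r ^ epochIdx E.r (σ.R 7 0) ∧
      (q < epochIdx E.r (σ.R 7 0) → σ'.R 8 0 = E.r ^ (epochIdx E.r (σ.R 7 0) - 1)) := by
  have hw := hE.word
  simp [advance]
  and_intros
  all_goals try omega
  set q' := epochIdx E.r (σ.R 7 0) with hq'
  refine wp_silent_loop hE (q' - q + 1) 100 (fun i τ => Same [29] [2, 8] [] σ τ ∧
    τ.R 2 0 = E.r ^ (min (q + i) q') ∧ (0 < i → q < q' → τ.R 8 0 = E.r ^ (min (q + i) q' - 1)) ∧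
    τ.W 29 0 = if i ≤ q' - q then 1 else 0) ?_ ?_ ?_
  · exact ⟨(Same.refl _ _ _ σ).setW _ (by simp) _ _, by simp [h2, hq], by simp, by simp⟩
  · rintro i hi τ ⟨hS, hR, h8, h29⟩
    have h7 := congrFun (hS.R 7 (by decide)) 0
    rw [if_pos (by omega)] at h29
    have hlt := pow_le_iff hr (σ.R 7 0) (min (q + i) q')
    rw [← hq'] at hlt
    simp [h29, hR, h7]
    and_intros
    all_goals try omega
    · intro hv
      have : ¬ min (q + i) q' < q' := fun h => absurd (hlt.2 h) (not_le.2 hv)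
      have e1 : min (q + i) q' = q' := by omega
      have e2 : min (q + (i + 1)) q' = q' := by omega
      rw [e1] at hR h8
      rw [e1, e2]
      and_intros
      all_goals first | omega | exact hS.setW _ (by simp) _ _ | rfl | exact fun h => h8 (by omega) h
    · intro hv
      have : min (q + i) q' < q' := hlt.1 hv
      have e2 : min (q + (i + 1)) q' = min (q + i) q' + 1 := by omega
      and_intros
      all_goals try omega
      · exact (hS.setR _ (by simp) _ _).setR _ (by simp) _ _
      · rw [e2, pow_succ, mul_comm]
      · intro _
        rw [e2, Nat.add_sub_cancel]
  · rintro τ t ⟨hS, hR, h8, h29⟩ ht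
    rw [if_neg (by omega)] at h29
    have e1 : min (q + (q' - q + 1)) q' = q' := by omega
    rw [e1] at hR h8
    simp [h29] at ht ⊢
    and_intros
    all_goals first | omega | exact hS | exact hR | exact fun h => h8 (by omega) h

/-- Counts the entries of buffer `4` whose keys are at least the next power of `r`. -/
def recount : HC :=
  .set 13 (.c 0) ;; .set 17 (.c 0) ;;
  .loop (.nz (.v 17 <ₑ .v 10))
    (.ite (.lt 4 (.v 17) 2 (.c 0)) .skip (.set 13 (.v 13 +ₑ .c 1)) ;; .set 17 (.v 17 +ₑ .c 1))

theorem recount_spec {E : Env} {K : ℕ} (hE : E.Fits K) (hK1 : 8 ≤ K) {X : Setting} {σ : Mem}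
    {L : List ℕ} (hL : Buf X σ 4 L) (hln : σ.W 10 0 = L.length) (hK : L.length ≤ K) :
    wp E K recount σ fun σ' o t => o = [] ∧ t ≤ 150 * L.length + 100 ∧
      Same [13, 17] [] [] σ σ' ∧
      σ'.W 13 0 = L.countP fun i => decide (σ.R 2 0 ≤ X.key i) := by
  have hw := hE.word
  simp [recount]
  and_intros
  all_goals try omega
  refine wp_silent_loop hE L.length 150 (fun i τ => Same [13, 17] [] [] σ τ ∧ τ.W 17 0 = i ∧
    τ.W 13 0 ≤ i ∧
    τ.W 13 0 = (L.take i).countP fun i => decide (σ.R 2 0 ≤ X.key i)) ?_ ?_ ?_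
  · exact ⟨((Same.refl _ _ _ σ).setW _ (by simp) _ _).setW _ (by simp) _ _, by simp, by simp,
      by simp⟩
  · rintro i hi τ ⟨hS, h17, h13, hc⟩
    have h10 := congrFun (hS.W 10 (by decide)) 0
    have h4 := congrFun (hS.R 4 (by decide)) i
    have h2 := congrFun (hS.R 2 (by decide)) 0
    rw [(hL i hi).2.1] at h4
    simp [h10, hln, h17, hi, h4, h2]
    and_intros
    all_goals try omega
    all_goals intro hv
    · and_intros
      all_goals try omega
      · exact hS.setW _ (by simp) _ _
      · rw [List.take_succ_eq_append_getElem hi, List.countP_append, ← hc]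
        simp [hv]
    · and_intros
      all_goals try omega
      · exact (hS.setW _ (by simp) _ _).setW _ (by simp) _ _
      · rw [List.take_succ_eq_append_getElem hi, List.countP_append, ← hc]
        simp [hv]
  · rintro τ t ⟨hS, h17, h13, hc⟩ ht
    have h10 := congrFun (hS.W 10 (by decide)) 0
    rw [List.take_length] at hc
    simp [h10, hln, h17] at ht ⊢
    exact ⟨by omega, by omega, hS, hc⟩

/-- The memory represents the sample of the released items: buffer `4` contains the sample and fewer
than `2 s` items in all. -/
structure SampleInv (X : Setting) (σ : Mem) (c : CoordState) (L : List ℕ) : Prop where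
  buf : Buf X σ 4 L
  len : σ.W 10 0 = L.length
  short : L.length < 2 * X.s
  nodup : L.Nodup
  top : top X.s X.key L.toFinset = c.S
  ok : c.Ok X
  next : σ.R 2 0 = X.r ^ epochIdx X.r c.u
  high : σ.W 13 0 = L.countP fun i => decide (X.r ^ epochIdx X.r c.u ≤ X.key i)

/-- Enough entries are at least `x` exactly if the threshold is. -/
theorem le_countP_iff {X : Setting} (hX : X.Good) {L : List ℕ} (hL : L.Nodup) {x : ℝ} (hx : 0 < x) :
    (X.s ≤ L.countP fun i => decide (x ≤ X.key i)) ↔ x ≤ uOf X (top X.s X.key L.toFinset) := by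
  rw [le_uOf_top_iff hX _ hx, card_filter_toFinset hL]

theorem SampleInv.congr {X : Setting} {σ σ' : Mem} {c c' : CoordState} {L : List ℕ}
    (h : SampleInv X σ c L) (hW : σ'.W 4 = σ.W 4) (hR : σ'.R 4 = σ.R 4) (hI : σ'.I 4 = σ.I 4)
    (h10 : σ'.W 10 = σ.W 10) (h13 : σ'.W 13 = σ.W 13) (h2 : σ'.R 2 = σ.R 2) (hS : c'.S = c.S)
    (hu : c'.u = c.u) : SampleInv X σ' c' L where
  buf := h.buf.congr hI hR hW
  len := by rw [h10, h.len]
  short := h.short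
  nodup := h.nodup
  top := by rw [h.top, hS]
  ok := ⟨hS ▸ h.ok.card, by rw [hu, hS, h.ok.u]⟩
  next := by rw [h2, h.next, hu]
  high := by rw [h13, h.high, hu]

/-- Compresses the buffer `4` if necessary, and starts a new epoch if there is one. -/
def settle : HC :=
  .ite (.nz (.v 13 <ₑ .v 0))
    (.ite (.nz (.v 10 <ₑ .c 2 *ₑ .v 0)) .skip (compress 4 10))
    (compress 4 10 ;; advance ;; .castEpoch 8 (.c 0) ;; recount)

/-- Inserts the item in item variable `0`, with its key in real variable `1` and its level in word
variable `3`. -/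
def insertItem : HC :=
  .putI 4 (.v 10) 0 (.c 0) ;; .putR 4 (.v 10) 1 (.c 0) ;; .putW 4 (.v 10) (.v 3) ;;
  .set 10 (.v 10 +ₑ .c 1) ;;
  .ite (.lt 1 (.c 0) 2 (.c 0)) .skip (.set 13 (.v 13 +ₑ .c 1)) ;; settle

/-- The word arrays changed by an insertion. -/
def insertW : List (Fin 32) := 13 :: 29 :: compW 4 10

theorem topList_top {X : Setting} (hX : X.Good) (L : List ℕ) :
    top X.s X.key (topList X L).toFinset = top X.s X.key L.toFinset := by
  rw [topList_toFinset, top_top hX.inj]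

theorem countP_topList {X : Setting} (hX : X.Good) {L : List ℕ} (hL : L.Nodup) (x : ℝ) :
    ((topList X L).countP fun i => decide (x ≤ X.key i)) =
      min X.s (L.countP fun i => decide (x ≤ X.key i)) := by
  rw [← card_filter_toFinset (hL.sublist (topList_sublist X L)), topList_toFinset,
    card_top_filter hX.inj _ _ fun i j h h' => h.trans h'.le, card_filter_toFinset hL]

/-- The program does not maintain `u`: it counts the entries with keys at least the next power of
`r`, and by `le_countP_iff` a new epoch begins exactly when this count reaches `s`. Time is
amortized with 210000 credits per buffer entry. A compression at length `2 s` takes about 202000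
steps per item of the sample size and frees `s` entries. A compression caused by a new epoch,
together with the broadcast and the recount, is charged to the rise of the epoch index at the price
`s + k`. -/
theorem insertItem_spec {E : Env} {K : ℕ} (hE : E.Fits K) {X : Setting} (hX : X.Good)
    (hK : 16 * X.s ≤ K) (hr : E.r = X.r) (hk : E.k = X.k) {σ : Mem} {c : CoordState} {L : List ℕ}
    (h : SampleInv X σ c L) {i : ℕ} (hI : σ.I 0 0 = some i) (hR : σ.R 1 0 = X.key i)
    (hW : σ.W 3 0 = X.lev i) (hi : i ∉ L) (h0 : σ.W 0 0 = X.s)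
    (hlev : ∀ j ∈ L ++ [i], X.lev j ≤ E.maxWord) :
    wp E K insertItem σ fun σ' o t => o = (addToSample X c i).2 ∧
      Same insertW [2, 4, 6, 7, 8] [4] σ σ' ∧
      ∃ L', SampleInv X σ' (addToSample X c i).1 L' ∧ L' ⊆ L ++ [i] ∧
        t + 210000 * L'.length ≤ 210000 * L.length + 220000 +
          400000 * ((X.s + X.k) *
            (epochIdx X.r (addToSample X c i).1.u - epochIdx X.r c.u)) := by
  have hw := hE.word
  have hs := hX.s_pos
  have hlen := h.len
  have hshort := h.short
  have hle : ∀ p : ℕ → Bool, L.countP p ≤ L.length := fun p => List.countP_le_length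
  have hhigh := h.high
  have hle' := hle fun j => decide (X.r ^ epochIdx X.r c.u ≤ X.key j)
  have hli := hlev i (by simp)
  have hnd : (L ++ [i]).Nodup := by
    simpa [List.nodup_append, h.nodup] using fun a ha => fun e : a = i => hi (e ▸ ha)
  have hpow : ∀ m, 0 < X.r ^ m := fun m => pow_pos (by linarith [X.one_lt_r]) m
  have hok := addToSample_ok hX c i
  have hS : top X.s X.key (L ++ [i]).toFinset = (addToSample X c i).1.S := by
    rw [addToSample_S, ← h.top, top_insert_top hX.inj]
    congr 1
    ext j; simp
  have hu : (addToSample X c i).1.u = uOf X (top X.s X.key (L ++ [i]).toFinset) := by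
    rw [hS, hok.u]
  have hmono := epochIdx_mono X.one_lt_r (addToSample_u_le hX h.ok i)
  have hmsg := addToSample_msgs hX h.ok i
  -- the condition for a new epoch
  have hiff : (X.s ≤ (L ++ [i]).countP fun j => decide (X.r ^ epochIdx X.r c.u ≤ X.key j)) ↔
      epochIdx X.r c.u < epochIdx X.r (addToSample X c i).1.u := by
    rw [le_countP_iff hX hnd (hpow _), ← hu, pow_le_iff X.one_lt_r]
  set c' := (addToSample X c i).1 with hc'
  set q := epochIdx X.r c.u with hq
  set q' := epochIdx X.r c'.u with hq'
  have hcount : (L ++ [i]).countP (fun j => decide (X.r ^ q ≤ X.key j)) = σ.W 13 0 +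
      if X.key i < X.r ^ q then 0 else 1 := by
    rw [hhigh, List.countP_append]
    by_cases hv : X.key i < X.r ^ q
    · simp [hv]
    · simp [hv, not_lt.1 hv]
  have hLt : (L ++ [i]).length = L.length + 1 := by simp
  simp only [insertItem, wp.eq_2, wp.eq_5, wp.eq_6, wp.eq_7, wp.eq_3, wp.eq_1]
  simp [-Fin.isValue]
  simp [hlen, hW, h.next, hR, hI]
  -- after the optional increment of the count
  suffices H : ∀ τ : Mem, ∀ t0 ≤ 200, Same insertW [2, 4, 6, 7, 8] [4] σ τ → Buf X τ 4 (L ++ [i]) →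
      τ.W 10 0 = L.length + 1 → τ.R 2 0 = X.r ^ q →
      τ.W 13 0 = (L ++ [i]).countP (fun j => decide (X.r ^ q ≤ X.key j)) →
      wp E K settle τ fun σ' o t =>
      o = (addToSample X c i).2 ∧ Same insertW [2, 4, 6, 7, 8] [4] σ σ' ∧
      ∃ L', SampleInv X σ' c' L' ∧ L' ⊆ L ++ [i] ∧
        t + t0 + 210000 * L'.length ≤ 210000 * L.length + 220000 +
          400000 * ((X.s + X.k) * (q' - q)) by
    have hB : ∀ τ : Mem, (∀ j, τ.I 4 j = if j = L.length then some i else σ.I 4 j) →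
        (∀ j, τ.R 4 j = if j = L.length then X.key i else σ.R 4 j) →
        (∀ j, τ.W 4 j = if j = L.length then X.lev i else σ.W 4 j) → Buf X τ 4 (L ++ [i]) :=
      fun τ a1 a2 a3 => h.buf.append (fun j hj => by
        rw [a1, a2, a3, if_neg (by omega), if_neg (by omega), if_neg (by omega)]
        exact ⟨rfl, rfl, rfl⟩) (by rw [a1, a2, a3]; simp)
    have hSame : Same insertW [2, 4, 6, 7, 8] [4] σ
        ((((σ.setI 4 L.length (some i)).setR 4 L.length (X.key i)).setW 4 L.length (X.lev i)).setW 10 0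
          (L.length + 1)) :=
      ((((Same.refl _ _ _ σ).setI _ (by simp) _ _).setR _ (by simp) _ _).setW _
        (by simp [insertW, compW]) _ _).setW _ (by simp [insertW, compW]) _ _
    and_intros
    all_goals try omega
    all_goals intro hv
    · refine wp_mono _ (H _ 100 (by omega) hSame (hB _ ?_ ?_ ?_) ?_ ?_ ?_) ?_
      · simp
      · simp
      · simp
      · simp
      · simp [h.next, hq]
      · rw [hcount, if_pos hv]; simp
      · rintro ρ o t ⟨h1, h2, L', h3, h4, h5⟩
        exact ⟨h1, h2, L', h3, h4, by omega⟩
    · and_intros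
      all_goals try omega
      refine wp_mono _ (H _ 200 (by omega) (hSame.setW 13 (by simp [insertW]) _ _) (hB _ ?_ ?_ ?_)
        ?_ ?_ ?_) ?_
      · simp
      · simp
      · simp
      · simp
      · simp [h.next, hq]
      · rw [hcount, if_neg (not_lt.2 hv)]; simp
      · rintro ρ o t ⟨h1, h2, L', h3, h4, h5⟩
        exact ⟨h1, h2, L', h3, h4, by omega⟩
  intro τ t0 ht0 hSame hB k10 k2 k13
  have k0 : τ.W 0 0 = X.s := by rw [hSame.W 0 (by decide), h0]
  have hc1 : (L ++ [i]).countP (fun j => decide (X.r ^ q ≤ X.key j)) ≤ L.length + 1 :=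
    hLt ▸ List.countP_le_length
  have hcs : ∀ ρ : Mem, ρ.W 10 0 = (topList X (L ++ [i])).length → Buf X ρ 4 (topList X (L ++ [i])) →
      ρ.R 2 0 = X.r ^ q' → (X.s ≤ L.length + 1) →
      ρ.W 13 0 = (topList X (L ++ [i])).countP (fun j => decide (X.r ^ q' ≤ X.key j)) →
      SampleInv X ρ c' (topList X (L ++ [i])) := fun ρ a1 a2 a3 a4 a5 =>
    { buf := a2, len := a1, short := by rw [topList_length hX hnd]; omega
      nodup := hnd.sublist (topList_sublist _ _)
      top := by rw [topList_top hX, hS]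
      ok := hok, next := a3, high := a5 }
  have htl : X.s ≤ L.length + 1 → (topList X (L ++ [i])).length = X.s := fun h => by
    rw [topList_length hX hnd, hLt]; omega
  simp only [settle, wp.eq_3, wp.eq_2, wp.eq_1]
  obtain ⟨N, hN⟩ : ∃ N, N = (L ++ [i]).countP fun j => decide (X.r ^ q ≤ X.key j) := ⟨_, rfl⟩
  rw [← hN] at hiff k13 hc1
  simp [k0, k10, k13]
  and_intros
  all_goals try omega
  all_goals try (split_ifs <;> omega)
  · intro hlt
    have heq : ¬ q < q' := fun h => by have := hiff.2 h; omega
    have heq' : q' = q := by omega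
    rw [if_neg heq] at hmsg
    and_intros
    all_goals try omega
    all_goals try (split_ifs <;> omega)
    · intro hlt2
      refine ⟨hmsg, hSame, L ++ [i], ?_, List.Subset.refl _, by rw [hLt]; omega⟩
      exact { buf := hB, len := by rw [k10, hLt], short := by omega, nodup := hnd, top := hS, ok := hok,
              next := by rw [k2, ← heq'], high := by rw [k13, hN, ← hq', heq'] }
    · intro hge
      refine wp_mono _ (compress_spec hE (by omega) hX (Or.inl ⟨rfl, rfl⟩) hB (by rw [k10, hLt])
        hnd k0 (by omega) (by omega) hlev) ?_
      rintro ρ o t ⟨rfl, ht, hS', hl, hB', h7⟩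
      refine ⟨hmsg.symm, hSame.trans (hS'.mono ?_ (by simp) (by simp)), _, hcs ρ hl hB' ?_ (by omega) ?_,
        (topList_sublist _ _).subset, ?_⟩
      · intro x hx; simp [insertW, hx]
      · rw [hS'.R 2 (by decide), k2, heq']
      · rw [hS'.W 13 (by decide), heq', countP_topList hX hnd, ← hN, k13]
        omega
      · rw [htl (by omega)]
        omega
  · intro hge
    have hlt : q < q' := hiff.1 hge
    rw [if_pos hlt] at hmsg
    refine wp_mono _ (compress_spec hE (by omega) hX (Or.inl ⟨rfl, rfl⟩) hB (by rw [k10, hLt])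
      hnd k0 (by omega) (by omega) hlev) ?_
    rintro ρ o t ⟨rfl, ht, hS', hl, hB', h7⟩
    rw [← hu] at h7
    refine wp_mono _ (advance_spec hE (by omega) (hr ▸ X.one_lt_r) (q := q) ?_ ?_) ?_
    · rw [hS'.R 2 (by decide), k2, hr]
    · rw [h7, hr]; exact hmono
    rintro ρ1 o t1 ⟨rfl, ht1, hS1, h2, h8⟩
    rw [h7, hr, ← hq'] at h2 h8 ht1
    have h8' := h8 hlt
    simp [h8']
    and_intros
    all_goals try omega
    have hB1 := hB'.congr (hS1.I 4 (by simp)) (hS1.R 4 (by decide)) (hS1.W 4 (by decide))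
    refine wp_mono _ (recount_spec hE (by omega) hB1 ?_ ?_) ?_
    · rw [hS1.W 10 (by decide), hl]
    · rw [htl (by omega)]; omega
    rintro ρ2 o t2 ⟨rfl, ht2, hS2, h13⟩
    refine ⟨?_, ?_, _, hcs ρ2 ?_ ?_ ?_ (by omega) ?_, (topList_sublist _ _).subset, ?_⟩
    · rw [hmsg, epochStart_eq, if_neg (by omega)]
    · refine ((hSame.trans (hS'.mono ?_ (by simp) (by simp))).trans (hS1.mono (by simp [insertW])
        (by simp) (by simp))).trans (hS2.mono ?_ (by simp) (by simp))
      · intro x hx; simp [insertW, hx]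
      · simp [insertW, compW, selW]
    · rw [hS2.W 10 (by decide), hS1.W 10 (by decide), hl]
    · exact hB1.congr (hS2.I 4 (by simp)) (hS2.R 4 (by simp)) (hS2.W 4 (by decide))
    · rw [hS2.R 2 (by simp), h2]
    · rw [h13, h2]
    · rw [htl (by omega)] at ht2 ⊢
      have e1 : X.s + X.k ≤ (X.s + X.k) * (q' - q) := Nat.le_mul_of_pos_right _ (by omega)
      have e2 : q' - q ≤ (X.s + X.k) * (q' - q) := Nat.le_mul_of_pos_left _ (by omega)
      omega

infix:70 " <<ₑ " => HE.b Op.shiftLeft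

/-! ### Counters packed into words -/

/-- Incrementing digit `d`, without overflow, changes no other digit. -/
theorem digit_add_pow {B x d : ℕ} (h : x / B ^ d % B + 1 < B) (d' : ℕ) :
    (x + B ^ d) / B ^ d' % B = if d' = d then x / B ^ d % B + 1 else x / B ^ d' % B := by
  have hB : 0 < B := by omega
  have hpos : ∀ m, 0 < B ^ m := fun m => pow_pos hB m
  rcases lt_trichotomy d' d with hlt | rfl | hlt
  · rw [if_neg hlt.ne]
    obtain ⟨m, rfl⟩ : ∃ m, d = d' + 1 + m := ⟨d - (d' + 1), by omega⟩
    rw [show B ^ (d' + 1 + m) = B ^ d' * (B * B ^ m) by ring, Nat.add_mul_div_left _ _ (hpos _),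
      Nat.add_mul_mod_self_left]
  · rw [if_pos rfl, Nat.add_div_right _ (hpos _), Nat.add_mod,
      Nat.mod_eq_of_lt (show 1 < B by omega), Nat.mod_eq_of_lt h]
  · rw [if_neg hlt.ne']
    obtain ⟨m, rfl⟩ : ∃ m, d' = d + 1 + m := ⟨d' - (d + 1), by omega⟩
    have key : (x + B ^ d) / B ^ (d + 1) = x / B ^ (d + 1) := by
      rw [pow_succ, ← Nat.div_div_eq_div_mul, ← Nat.div_div_eq_div_mul, Nat.add_div_right _ (hpos _),
        Nat.add_div hB, Nat.div_eq_of_lt (show 1 < B by omega), Nat.mod_eq_of_lt (show 1 < B by omega),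
        if_neg (by omega)]
      rfl
    rw [pow_add, ← Nat.div_div_eq_div_mul, ← Nat.div_div_eq_div_mul, key]

/-- Overflow would require the incremented quotient by `B ^ d` to be a power of `B` with positive
exponent, hence divisible by `B`; but its last digit is positive and less than `B`. -/
theorem add_pow_lt {B x d D : ℕ} (h : x / B ^ d % B + 1 < B) (hd : d < D) (hx : x < B ^ D) :
    x + B ^ d < B ^ D := by
  have hB : 0 < B := by omega
  obtain ⟨m, rfl⟩ : ∃ m, D = d + 1 + m := ⟨D - (d + 1), by omega⟩
  have h1 : x = B ^ d * (x / B ^ d) + x % B ^ d := (Nat.div_add_mod _ _).symm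
  have h2 := Nat.mod_lt x (pow_pos hB d)
  have h3 : x / B ^ d < B ^ (m + 1) := by
    rw [Nat.div_lt_iff_lt_mul (pow_pos hB d)]
    calc x < _ := hx
      _ = _ := by ring
  have h4 : x / B ^ d + 1 ≠ B ^ (m + 1) := by
    intro he
    have : (x / B ^ d + 1) % B = 0 := by rw [he, pow_succ]; exact Nat.mul_mod_left _ _
    rw [Nat.add_mod, Nat.mod_eq_of_lt (show 1 < B by omega), Nat.mod_eq_of_lt h] at this
    omega
  calc x + B ^ d < B ^ d * (x / B ^ d) + B ^ d + B ^ d := by omega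
    _ = B ^ d * (x / B ^ d + 1 + 1) := by ring
    _ ≤ B ^ d * B ^ (m + 1) := Nat.mul_le_mul_left _ (by omega)
    _ = _ := by ring

/-- The number of bits of a counter. -/
def Setting.bits (X : Setting) : ℕ := Nat.size (8 * X.s + 4 * X.k)

theorem Setting.cap_lt {X : Setting} : X.cap < 2 ^ X.bits := by
  refine lt_of_le_of_lt ?_ (Nat.lt_size_self _)
  unfold Setting.cap
  omega

theorem Setting.bits_pos {X : Setting} (hs : 0 < X.s) : 0 < X.bits :=
  Nat.lt_size.2 (by simp; omega)

theorem Setting.bits_le {X : Setting} (hs : 0 < X.s) : X.bits ≤ Nat.log 2 X.cap + 2 := by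
  have h1 : 2 ^ (X.bits - 1) ≤ 8 * X.s + 4 * X.k :=
    Nat.lt_size.1 (by have := X.bits_pos hs; simp only [Setting.bits] at this ⊢; omega)
  have h2 : 8 * X.s + 4 * X.k ≤ X.cap * 2 := by unfold Setting.cap; omega
  have h3 := Nat.le_log_of_pow_le (by norm_num) (h1.trans h2)
  rw [Nat.log_mul_base (by norm_num) (Setting.cap_pos hs).ne'] at h3
  omega

theorem Setting.pow_bits_le {X : Setting} (hs : 0 < X.s) :
    2 ^ X.bits ≤ 2 * (8 * X.s + 4 * X.k) := by
  have h1 : 2 ^ (X.bits - 1) ≤ 8 * X.s + 4 * X.k :=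
    Nat.lt_size.1 (by have := X.bits_pos hs; simp only [Setting.bits] at this ⊢; omega)
  have := X.bits_pos hs
  obtain ⟨m, hm⟩ : ∃ m, X.bits = m + 1 := ⟨X.bits - 1, by omega⟩
  rw [hm, Nat.add_sub_cancel] at h1
  rw [hm, pow_succ]
  omega

/-- Computes the number of bits of a counter. -/
def findBits : HC :=
  .set 12 (.c 0) ;;
  .loop (.nz (.c 1 <<ₑ .v 12 <ₑ (.c 8 *ₑ .v 0 +ₑ .c 4 *ₑ .v 1 +ₑ .c 1)))
    (.set 12 (.v 12 +ₑ .c 1))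

theorem findBits_spec {E : Env} {K : ℕ} (hE : E.Fits K) (hK1 : 8 ≤ K) {X : Setting}
    (hs : 0 < X.s) {σ : Mem} (h0 : σ.W 0 0 = X.s) (h1 : σ.W 1 0 = X.k)
    (hB : 2 * (8 * X.s + 4 * X.k) ≤ E.maxWord) :
    wp E K findBits σ fun σ' o t => o = [] ∧ t ≤ 100 * X.bits + 100 ∧
      Same [12] [] [] σ σ' ∧ σ'.W 12 0 = X.bits := by
  have hw := hE.word
  have hbits := X.bits_pos hs
  have hpb := X.pow_bits_le hs
  have hlt : X.bits < 2 ^ X.bits := Nat.lt_two_pow_self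
  have hiff : ∀ i, 2 ^ i ≤ 8 * X.s + 4 * X.k ↔ i < X.bits := fun i => Nat.lt_size.symm
  simp [findBits]
  and_intros
  all_goals try omega
  refine wp_silent_loop hE X.bits 100 (fun i τ => Same [12] [] [] σ τ ∧ τ.W 12 0 = i) ?_ ?_ ?_
  · exact ⟨(Same.refl _ _ _ σ).setW _ (by simp) _ _, by simp⟩
  · rintro i hi τ ⟨hS, h12⟩
    have k0 := congrFun (hS.W 0 (by decide)) 0
    have k1 := congrFun (hS.W 1 (by decide)) 0
    have := (hiff i).2 hi
    simp [k0, k1, h0, h1, h12, this]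
    and_intros
    all_goals try omega
    exact hS.setW _ (by simp) _ _
  · rintro τ t ⟨hS, h12⟩ ht
    have k0 := congrFun (hS.W 0 (by decide)) 0
    have k1 := congrFun (hS.W 1 (by decide)) 0
    have := mt (hiff X.bits).1 (lt_irrefl _)
    simp [k0, k1, h0, h1, h12, this] at ht ⊢
    and_intros
    all_goals omega

/-- The words of array `6` represent the counters `f`, for levels at most `J`. -/
def Counters (X : Setting) (J : ℕ) (σ : Mem) (f : ℕ → ℕ) : Prop :=
  (∀ j, σ.W 6 (j % X.s) / (2 ^ X.bits) ^ (j / X.s) % 2 ^ X.bits = f j) ∧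
    ∀ m, σ.W 6 m < (2 ^ X.bits) ^ (J / X.s + 1)

/-- Increments the counter of the level in variable `3`; variable `30` receives its new value. -/
def bump : HC :=
  .set 29 (.c 1 <<ₑ (.v 12 *ₑ (.v 3 /ₑ .v 0))) ;;
  .set 30 (.w 6 (.v 3 %ₑ .v 0) +ₑ .v 29) ;;
  .putW 6 (.v 3 %ₑ .v 0) (.v 30) ;;
  .set 30 (.v 30 /ₑ .v 29 %ₑ (.c 1 <<ₑ .v 12))

/-- Level `j` is digit `j / s` of word `j % s`, in base `2 ^ bits`. The new value stays below the
base, so there is no carry and the other digits are untouched. -/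
theorem bump_spec {E : Env} {K : ℕ} (hE : E.Fits K) {X : Setting} (hs : 0 < X.s)
    (hK : 16 * X.s ≤ K) {J : ℕ} {σ : Mem} {f : ℕ → ℕ} (hf : Counters X J σ f) {j : ℕ} (hj : j ≤ J)
    (h3 : σ.W 3 0 = j) (h0 : σ.W 0 0 = X.s) (h12 : σ.W 12 0 = X.bits)
    (hB : (2 ^ X.bits) ^ (J / X.s + 1) ≤ E.maxWord) (hlt : f j + 1 < 2 ^ X.bits) :
    wp E K bump σ fun σ' o t => o = [] ∧ t ≤ 200 ∧ Same [6, 29, 30] [] [] σ σ' ∧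
      σ'.W 30 0 = f j + 1 ∧ Counters X J σ' (Function.update f j (f j + 1)) := by
  have hw := hE.word
  have hbp := X.bits_pos hs
  have hmod := Nat.mod_lt j hs
  have hdiv : j / X.s < J / X.s + 1 := Nat.lt_succ_of_le (Nat.div_le_div_right hj)
  have hd := hf.1 j
  have hnew := digit_add_pow (hd.symm ▸ hlt) (j / X.s)
  have hlt2 := add_pow_lt (hd.symm ▸ hlt) hdiv (hf.2 (j % X.s))
  rw [if_pos rfl, hd] at hnew
  have hB1 : 1 < 2 ^ X.bits := by omega
  have hp1 : (2 ^ X.bits) ^ (j / X.s) < (2 ^ X.bits) ^ (J / X.s + 1) := Nat.pow_lt_pow_right hB1 hdiv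
  have hp2 : 2 ^ X.bits ≤ (2 ^ X.bits) ^ (J / X.s + 1) := Nat.le_self_pow (Nat.succ_ne_zero _) _
  have hp3 : X.bits * (j / X.s) < 2 ^ (X.bits * (j / X.s)) := Nat.lt_two_pow_self
  have hp4 : X.bits < 2 ^ X.bits := Nat.lt_two_pow_self
  have hp5 : j / X.s < (2 ^ X.bits) ^ (j / X.s) := Nat.lt_pow_self hB1
  rw [← pow_mul] at hp1 hlt2 hnew hp5
  have hq : (σ.W 6 (j % X.s) + 2 ^ (X.bits * (j / X.s))) / 2 ^ (X.bits * (j / X.s)) ≤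
    σ.W 6 (j % X.s) + 2 ^ (X.bits * (j / X.s)) := Nat.div_le_self _ _
  simp [bump, h0, h12, h3, hnew, -Nat.add_div_right]
  and_intros
  all_goals try omega
  · exact ((((Same.refl _ _ _ σ).setW _ (by simp) _ _).setW _ (by simp) _ _).setW _ (by simp) _ _).setW _
      (by simp) _ _
  · intro l
    simp only [W_setW]
    have hl := hf.1 l
    rw [Function.update_apply]
    by_cases hmm : l % X.s = j % X.s
    · have hdd := digit_add_pow (hd.symm ▸ hlt) (l / X.s)
      rw [hd, ← hmm, hl] at hdd
      simp [hmm, ← pow_mul] at hdd ⊢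
      rw [hdd]
      have : l = j ↔ l / X.s = j / X.s := by
        refine ⟨fun h => by rw [h], fun h => ?_⟩
        rw [← Nat.div_add_mod l X.s, h, hmm, Nat.div_add_mod]
      simp [this]
    · have : l ≠ j := by rintro rfl; exact hmm rfl
      simp [hmm, this, hl]
  · intro m
    have := hf.2 m
    simp only [W_setW]
    split_ifs <;> simp_all

/-! ### Release of a level -/

theorem addAll_append_singleton (X : Setting) (l : List ℕ) (i : ℕ) : ∀ c : CoordState,
    addAll X c (l ++ [i]) = ((addToSample X (addAll X c l).1 i).1,
      (addAll X c l).2 ++ (addToSample X (addAll X c l).1 i).2) := by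
  induction l with
  | nil => intro c; simp [addAll]
  | cons j l ih => intro c; simp [addAll, ih]

/-- Inserts the withheld items of the level in variable `28` into the sample. -/
def release : HC :=
  .set 27 (.c 0) ;;
  .loop (.nz (.v 27 <ₑ .v 11))
    (.ite (.nz (.w 5 (.v 27) =ₑ .v 28))
      (.putI 0 (.c 0) 5 (.v 27) ;; .putR 1 (.c 0) 5 (.v 27) ;; .set 3 (.w 5 (.v 27)) ;; insertItem)
      .skip ;;
      .set 27 (.v 27 +ₑ .c 1))

/-- The word arrays changed by the release of a level. -/
def releaseW : List (Fin 32) := 27 :: 3 :: insertW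

/-- The costs of the insertions add up, because their charges for new epochs telescope. -/
theorem release_spec {E : Env} {K : ℕ} (hE : E.Fits K) {X : Setting} (hX : X.Good)
    (hK : 16 * X.s ≤ K) (hr : E.r = X.r) (hk : E.k = X.k) {σ : Mem} {c : CoordState} {L D : List ℕ}
    (h : SampleInv X σ c L) (hD : Buf X σ 5 D) (hlen : σ.W 11 0 = D.length) (hDK : D.length ≤ K)
    (hDn : D.Nodup) {j : ℕ} (h28 : σ.W 28 0 = j) (h0 : σ.W 0 0 = X.s)
    (hLj : ∀ i ∈ L, X.lev i ≠ j) (hlev : ∀ i ∈ L ++ D, X.lev i ≤ E.maxWord) :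
    wp E K release σ fun σ' o t =>
      o = (addAll X c (D.filter fun i => decide (X.lev i = j))).2 ∧
      Same releaseW [1, 2, 4, 6, 7, 8] [0, 4] σ σ' ∧
      ∃ L', SampleInv X σ' (addAll X c (D.filter fun i => decide (X.lev i = j))).1 L' ∧
        L' ⊆ L ++ (D.filter fun i => decide (X.lev i = j)) ∧
        t + 210000 * L'.length ≤ 210000 * L.length + 220300 * D.length + 100 +
          400000 * ((X.s + X.k) * (epochIdx X.r
            (addAll X c (D.filter fun i => decide (X.lev i = j))).1.u - epochIdx X.r c.u)) := by
  have hw := hE.word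
  have hs := hX.s_pos
  set R : ℕ → List ℕ := fun i => (D.take i).filter fun i => decide (X.lev i = j) with hR
  have hRlen : R D.length = D.filter fun i => decide (X.lev i = j) := by simp [hR]
  rw [← hRlen]
  have hmono : ∀ l, epochIdx X.r c.u ≤ epochIdx X.r (addAll X c l).1.u := fun l =>
    epochIdx_mono X.one_lt_r (addAll_ok hX l h.ok).2.2.2.2.1
  simp [release]
  and_intros
  all_goals try omega
  refine wp_loop hE D.length (fun i τ o t => o = (addAll X c (R i)).2 ∧
    Same releaseW [1, 2, 4, 6, 7, 8] [0, 4] σ τ ∧ τ.W 27 0 = i ∧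
    ∃ L', SampleInv X τ (addAll X c (R i)).1 L' ∧ L' ⊆ L ++ R i ∧
      t + 210000 * L'.length ≤ 210000 * L.length + 220300 * i +
        400000 * ((X.s + X.k) * (epochIdx X.r (addAll X c (R i)).1.u - epochIdx X.r c.u))) ?_ ?_ ?_
  · refine ⟨by simp [hR, addAll], (Same.refl _ _ _ σ).setW _ (by simp [releaseW]) _ _, by simp, L, ?_,
      by simp, by simp [hR, addAll]⟩
    simp only [hR, List.take_zero, List.filter_nil, addAll]
    exact h.congr (by funext; simp) (by simp) (by simp) (by funext; simp) (by funext; simp) (by simp)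
      rfl rfl
  · rintro i hi τ o t ⟨rfl, hS, h27, L', hL', hsub, ht⟩
    have k11 := congrFun (hS.W 11 (by decide)) 0
    have k28 := congrFun (hS.W 28 (by decide)) 0
    have k0 := congrFun (hS.W 0 (by decide)) 0
    have k5 := congrFun (hS.W 5 (by decide)) i
    have r5 := congrFun (hS.R 5 (by decide)) i
    have i5 := congrFun (hS.I 5 (by decide)) i
    obtain ⟨b1, b2, b3⟩ := hD i hi
    rw [b3] at k5
    rw [b2] at r5
    rw [b1] at i5
    have hli := hlev D[i] (by simp)
    have htake0 : X.lev D[i] ≠ j → R (i + 1) = R i := fun hp => by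
      simp only [hR]
      rw [List.take_succ_eq_append_getElem hi, List.filter_append, List.filter_singleton]
      simp [hp]
    have htake1 : X.lev D[i] = j → R (i + 1) = R i ++ [D[i]] := fun hp => by
      simp only [hR]
      rw [List.take_succ_eq_append_getElem hi, List.filter_append, List.filter_singleton]
      simp [hp]
    simp [h27, k11, hlen, hi, k28, h28, k5, r5, i5]
    and_intros
    all_goals try omega
    all_goals try (split_ifs <;> omega)
    · intro hj
      and_intros
      all_goals try omega
      -- The buffer holds old entries, whose levels differ from `j`, and items released before,
      -- which occupy other positions of the duplicate-free list `D`.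
      have hni : D[i] ∉ L' := fun hm => by
        rcases List.mem_append.1 (hsub hm) with hm | hm
        · exact hLj _ hm hj
        · have := (List.mem_filter.1 hm).1
          rw [List.mem_take_iff_getElem] at this
          obtain ⟨m, hm, he⟩ := this
          have := (hDn.getElem_inj_iff).1 he
          omega
      refine wp_mono _ (insertItem_spec hE hX hK hr hk (i := D[i]) (L := L')
        (c := (addAll X c (R i)).1) (hL'.congr ?_ ?_ ?_ ?_ ?_ ?_ rfl rfl) ?_ ?_ ?_ hni ?_ ?_) ?_
      · funext m; simp
      · funext m; simp
      · funext m; simp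
      · funext m; simp
      · funext m; simp
      · funext m; simp
      · simp
      · simp
      · simp [hj]
      · simp [k0, h0]
      · intro m hm
        rcases List.mem_append.1 hm with hm | hm
        · rcases List.mem_append.1 (hsub hm) with hm | hm
          · exact hlev m (by simp [hm])
          · exact hlev m (List.mem_append_right _ (List.mem_of_mem_take (List.mem_filter.1 hm).1))
        · rw [List.mem_singleton.1 hm]; exact hli
      rintro ρ o t' ⟨rfl, hS', L2, hL2, hsub2, ht'⟩
      have m27 := congrFun (hS'.W 27 (by decide)) 0
      simp [h27] at m27
      simp [m27]
      rw [htake1 hj, addAll_append_singleton]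
      and_intros
      all_goals try omega
      · rfl
      · refine Same.setW (Same.trans ?_ (hS'.mono ?_ ?_ ?_)) _ (by simp [releaseW]) _ _
        · exact ((hS.setI _ (by simp) _ _).setR _ (by simp) _ _).setW _ (by simp [releaseW]) _ _
        · intro x hx; simp [releaseW, hx]
        · simp
        · simp
      · refine ⟨L2, ?_, ?_, ?_⟩
        · exact hL2.congr (by funext; simp) (by simp) (by simp) (by funext; simp) (by funext; simp)
            (by simp) rfl rfl
        · intro m hm
          rcases List.mem_append.1 (hsub2 hm) with hm | hm
          · rcases List.mem_append.1 (hsub hm) with hm | hm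
            · simp [hm]
            · simp [hm]
          · simp [List.mem_singleton.1 hm]
        · have e1 := hmono (R i)
          have e2 := epochIdx_mono X.one_lt_r (addToSample_u_le hX hL'.ok D[i])
          have e3 : epochIdx X.r (addToSample X (addAll X c (R i)).1 D[i]).1.u - epochIdx X.r c.u =
            (epochIdx X.r (addToSample X (addAll X c (R i)).1 D[i]).1.u -
              epochIdx X.r (addAll X c (R i)).1.u) +
            (epochIdx X.r (addAll X c (R i)).1.u - epochIdx X.r c.u) := by omega
          simp only
          rw [e3, Nat.mul_add (X.s + X.k)]
          omega
    · intro hj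
      and_intros
      all_goals try omega
      · rw [htake0 hj]
      · exact hS.setW _ (by simp [releaseW]) _ _
      · rw [htake0 hj]
        refine ⟨L', ?_, hsub, by omega⟩
        exact hL'.congr (by funext; simp) (by simp) (by simp) (by funext; simp) (by funext; simp)
            (by simp) rfl rfl
  · rintro τ o t ⟨rfl, hS, h27, L', hL', hsub, ht⟩
    have k11 := congrFun (hS.W 11 (by decide)) 0
    simp [h27, k11, hlen]
    and_intros
    all_goals try omega
    · exact ⟨L', hL', hsub, by omega⟩

/-! ### Early messages -/

theorem topList_eq_self {X : Setting} {L : List ℕ} (h : L.length ≤ X.s) : topList X L = L := by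
  refine List.filter_eq_self.2 fun i hi => ?_
  rw [top_eq_self ((List.toFinset_card_le L).trans h)]
  simpa using hi

/-- Releases the items of the level in variable `28` and announces its saturation. -/
def dissolve : HC :=
  release ;; sift 5 11 (.nz (.w 5 (.v 17) =ₑ .v 28)) ;; .castSaturated (.v 28)

/-- Saturates the level in variable `3`. -/
def saturate : HC :=
  .set 28 (.v 3) ;; .ite (.nz (.v 11 <ₑ .v 0)) .skip (compress 5 11) ;; dissolve

/-- The word arrays changed by the saturation of a level. -/
def saturateW : List (Fin 32) := 28 :: 5 :: 11 :: releaseW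

theorem dissolve_spec {E : Env} {K : ℕ} (hE : E.Fits K) {X : Setting} (hX : X.Good)
    (hK : 16 * X.s ≤ K) (hr : E.r = X.r) (hk : E.k = X.k) {τ : Mem} {c : CoordState} {L D : List ℕ}
    (hSI : SampleInv X τ c L) (hB : Buf X τ 5 D) (h11 : τ.W 11 0 = D.length)
    (hDs : D.length ≤ X.s) (hDn : D.Nodup) {j : ℕ} (h28 : τ.W 28 0 = j)
    (k0 : τ.W 0 0 = X.s) (hLj : ∀ i ∈ L, X.lev i ≠ j) (hlev : ∀ i ∈ L ++ D, X.lev i ≤ E.maxWord) :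
    wp E K dissolve τ fun σ' o t =>
      o = (addAll X c (D.filter fun i => decide (X.lev i = j))).2 ++ [.saturated j] ∧
      Same saturateW [1, 2, 4, 5, 6, 7, 8] [0, 4, 5] τ σ' ∧
      Buf X σ' 5 (D.filter fun i => !decide (X.lev i = j)) ∧
      σ'.W 11 0 = (D.filter fun i => !decide (X.lev i = j)).length ∧
      ∃ L', SampleInv X σ' (addAll X c (D.filter fun i => decide (X.lev i = j))).1 L' ∧
        L' ⊆ L ++ (D.filter fun i => decide (X.lev i = j)) ∧
        t + 210000 * L'.length ≤ 210000 * L.length + 220500 * X.s + X.k + 400 +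
          400000 * ((X.s + X.k) * (epochIdx X.r (addAll X c (D.filter fun i =>
            decide (X.lev i = j))).1.u - epochIdx X.r c.u)) := by
  have hw := hE.word
  have hs := hX.s_pos
  have hTlev : ∀ i ∈ D, X.lev i ≤ E.maxWord := fun i hi => hlev i (List.mem_append_right _ hi)
  simp only [dissolve, wp.eq_2]
  refine wp_mono _ (release_spec hE hX hK hr hk hSI hB h11 (by omega) hDn h28 k0 hLj hlev) ?_
  rintro ρ o t1 ⟨rfl, hS1, L', hL', hsub, ht1⟩
  have j28 : ρ.W 28 0 = j := by rw [hS1.W 28 (by decide), h28]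
  refine wp_mono _ (sift_spec hE (by omega) (X := X) (L := D)
    (p := fun i => !decide (X.lev i = j)) (by decide) (by decide) (by decide) (by decide) (by decide)
    (hB.congr (hS1.I 5 (by decide)) (hS1.R 5 (by decide)) (hS1.W 5 (by decide))) ?_ (by omega)
    hTlev ?_) ?_
  · rw [hS1.W 11 (by decide), h11]
  · intro ρ' i hSρ h17 hi hR hW
    have l28 := congrFun (hSρ.W 28 (by decide)) 0
    have := hTlev _ (List.getElem_mem hi)
    simp [h17, hW, l28, j28]
    and_intros
    all_goals try omega
    split_ifs <;> omega
  rintro ρ2 o t2 ⟨rfl, ht2, hS2, hl, hB2⟩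
  have m28 : ρ2.W 28 0 = j := by rw [hS2.W 28 (by decide), j28]
  simp only [wp.eq_13, HE.ok, HE.val]
  simp [-Fin.isValue, -List.mem_filter, -List.filter_filter, m28] at hl hB2 ⊢
  refine ⟨by omega, ?_, hB2, hl, L', hL'.congr ?_ ?_ ?_ ?_ ?_ ?_ rfl rfl, by simpa using hsub, ?_⟩
  · refine (hS1.mono ?_ (by simp) (by simp)).trans (hS2.mono ?_ (by simp) (by simp))
    · intro x hx; simp [saturateW, hx]
    · simp [saturateW, releaseW, insertW, compW, selW]
  · exact hS2.W 4 (by decide)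
  · exact hS2.R 4 (by decide)
  · exact hS2.I 4 (by decide)
  · exact hS2.W 10 (by decide)
  · exact hS2.W 13 (by decide)
  · exact hS2.R 2 (by decide)
  · omega

/-- The algorithm releases from the trimmed set, while the buffer may still contain items that
trimming has discarded. So the buffer is compressed first, unless it has fewer than `s` entries and
is its own top. -/
theorem saturate_spec {E : Env} {K : ℕ} (hE : E.Fits K) {X : Setting} (hX : X.Good)
    (hK : 16 * X.s ≤ K) (hr : E.r = X.r) (hk : E.k = X.k) {σ : Mem} {c : CoordState} {L D : List ℕ}
    (h : SampleInv X σ c L) (hD : Buf X σ 5 D) (hlen : σ.W 11 0 = D.length)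
    (hDs : D.length ≤ 2 * X.s) (hDn : D.Nodup) {j : ℕ}
    (h3 : σ.W 3 0 = j)
    (h0 : σ.W 0 0 = X.s) (hLj : ∀ i ∈ L, X.lev i ≠ j) (hlev : ∀ i ∈ L ++ D, X.lev i ≤ E.maxWord)
    {R : List ℕ} (hR : R = (topList X D).filter fun i => decide (X.lev i = j)) :
    wp E K saturate σ fun σ' o t => o = (addAll X c R).2 ++ [.saturated j] ∧
      Same saturateW [1, 2, 4, 5, 6, 7, 8] [0, 4, 5] σ σ' ∧
      Buf X σ' 5 ((topList X D).filter fun i => !decide (X.lev i = j)) ∧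
      σ'.W 11 0 = ((topList X D).filter fun i => !decide (X.lev i = j)).length ∧
      ∃ L', SampleInv X σ' (addAll X c R).1 L' ∧ L' ⊆ L ++ R ∧
        t + 210000 * L'.length ≤ 210000 * L.length + 430000 * (X.s + X.k) +
          400000 * ((X.s + X.k) * (epochIdx X.r (addAll X c R).1.u - epochIdx X.r c.u)) := by
  have hw := hE.word
  have hs := hX.s_pos
  subst hR
  have hT : (topList X D).length ≤ X.s := by
    rw [topList_length hX hDn]
    exact min_le_left _ _
  have hTn : (topList X D).Nodup := hDn.sublist (topList_sublist X D)
  have hS1 : Same saturateW [1, 2, 4, 5, 6, 7, 8] [0, 4, 5] σ (σ.setW 28 0 j) :=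
    (Same.refl _ _ _ σ).setW _ (by simp [saturateW]) _ _
  have hSI : SampleInv X (σ.setW 28 0 j) c L := h.congr (by funext; simp) (by simp) (by simp)
    (by funext; simp) (by funext; simp) (by simp) rfl rfl
  have hB1 : Buf X (σ.setW 28 0 j) 5 D := hD.congr (by simp) (by simp) (by funext; simp)
  have hlev' : ∀ i ∈ L ++ topList X D, X.lev i ≤ E.maxWord := fun i hi => by
    rcases List.mem_append.1 hi with hi | hi
    · exact hlev i (by simp [hi])
    · exact hlev i (List.mem_append_right _ ((topList_sublist X D).subset hi))
  simp only [saturate, wp.eq_2, wp.eq_3, wp.eq_5]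
  simp [-Fin.isValue, -List.mem_filter, -List.filter_filter]
  simp only [h3, h0, hlen]
  and_intros
  all_goals try omega
  all_goals try (split_ifs <;> omega)
  · intro hlt
    rw [topList_eq_self (by omega)] at hlev' hTn ⊢
    refine wp_mono _ (dissolve_spec hE hX hK hr hk hSI hB1 (by simp [hlen]) (by omega) hDn (by simp)
      (by simp [h0]) hLj hlev') ?_
    rintro ρ o t ⟨rfl, a1, a2, a3, L', a4, a5, a6⟩
    exact ⟨rfl, hS1.trans a1, a2, a3, L', a4, a5, by omega⟩
  · intro hge
    refine wp_mono _ (compress_spec hE (by omega) hX (Or.inr ⟨rfl, rfl⟩) hB1 (by simp [hlen])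
      hDn (by simp [h0]) (by omega) (by omega) fun i hi => hlev i (by simp [hi])) ?_
    rintro ρ o t ⟨rfl, ht, hS', hl, hB', -⟩
    refine wp_mono _ (dissolve_spec hE hX hK hr hk (hSI.congr ?_ ?_ ?_ ?_ ?_ ?_ rfl rfl) hB' hl hT
      hTn (j := j) ?_ ?_ hLj hlev') ?_
    · exact hS'.W 4 (by decide)
    · exact hS'.R 4 (by decide)
    · exact hS'.I 4 (by decide)
    · exact hS'.W 10 (by decide)
    · exact hS'.W 13 (by decide)
    · exact hS'.R 2 (by decide)
    · rw [hS'.W 28 (by decide)]; simp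
    · rw [hS'.W 0 (by decide)]; simp [h0]
    rintro ρ2 o t ⟨rfl, a1, a2, a3, L', a4, a5, a6⟩
    exact ⟨rfl, (hS1.trans (hS'.mono (by decide) (by decide) (by decide))).trans a1, a2, a3, L', a4,
      a5, by omega⟩

/-- Writes the early item into buffer `5`, with its key and level, and counts it. -/
def withhold : HC :=
  .makeKey 1 (.c 0) 0 (.c 0) 0 (.c 0) ;; .getLevel 3 (.c 0) 0 (.c 0) ;;
  .putI 5 (.v 11) 0 (.c 0) ;; .putR 5 (.v 11) 1 (.c 0) ;; .putW 5 (.v 11) (.v 3) ;;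
  .set 11 (.v 11 +ₑ .c 1) ;; bump

/-- The word arrays changed by the receipt of an early item. -/
def withholdW : List (Fin 32) := [3, 5, 6, 11, 12, 29, 30]

theorem withhold_spec {E : Env} {K : ℕ} (hE : E.Fits K) {X : Setting} (hX : X.Good)
    (hK : 16 * X.s ≤ K) (hr : E.r = X.r) (hT : E.T = X.T) {σ : Mem} {D : List ℕ} {i : ℕ}
    (hD : Buf X σ 5 D) (hlen : σ.W 11 0 = D.length) (hDs : D.length < 2 * X.s)
    (hI : σ.I 0 0 = some i) (hR : σ.R 0 0 = X.w i) (h0 : σ.W 0 0 = X.s)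
    (h12 : σ.W 12 0 = X.bits) {J : ℕ} (hi : X.lev i ≤ J) (hJ : J ≤ E.maxWord)
    (hB : (2 ^ X.bits) ^ (J / X.s + 1) ≤ E.maxWord) {f : ℕ → ℕ} (hf : Counters X J σ f)
    (hlt : f (X.lev i) + 1 < 2 ^ X.bits) :
    wp E K withhold σ fun σ' o t => o = [] ∧ t ≤ 400 ∧ Same withholdW [1, 5] [5] σ σ' ∧
      Buf X σ' 5 (D ++ [i]) ∧ σ'.W 11 0 = (D ++ [i]).length ∧ σ'.W 3 0 = X.lev i ∧
      σ'.W 12 0 = X.bits ∧ σ'.W 30 0 = f (X.lev i) + 1 ∧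
      Counters X J σ' (Function.update f (X.lev i) (f (X.lev i) + 1)) := by
  have hw := hE.word
  have hs := hX.s_pos
  have hlev : level E.r (X.w i) = X.lev i := by rw [hr]; rfl
  have hkey : X.w i / E.T i = X.key i := by rw [hT]; rfl
  simp only [withhold, wp.eq_2, wp.eq_10, wp.eq_9, wp.eq_7, wp.eq_6, wp.eq_5]
  simp [-Fin.isValue, hI, hR, hlev, hkey, hlen]
  have hS : Same withholdW [1, 5] [5] σ ((((((σ.setR 1 0 (X.key i)).setW 3 0 (X.lev i)).setI 5 D.length
      (some i)).setR 5 D.length (X.key i)).setW 5 D.length (X.lev i)).setW 11 0 (D.length + 1)) :=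
    ((((((Same.refl _ _ _ σ).setR _ (by simp) _ _).setW _ (by simp [withholdW]) _ _).setI _ (by simp)
      _ _).setR _ (by simp) _ _).setW _ (by simp [withholdW]) _ _).setW _ (by simp [withholdW]) _ _
  have hBuf : Buf X ((((((σ.setR 1 0 (X.key i)).setW 3 0 (X.lev i)).setI 5 D.length
      (some i)).setR 5 D.length (X.key i)).setW 5 D.length (X.lev i)).setW 11 0 (D.length + 1)) 5
      (D ++ [i]) := by
    refine hD.append (fun j hj => ?_) ?_
    · have : j ≠ D.length := by omega
      simp [this]
    · simp
  and_intros
  all_goals try omega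
  refine wp_mono _ (bump_spec hE hs hK (f := f) (J := J) (j := X.lev i) ?_ hi ?_ ?_ ?_ hB hlt) ?_
  · refine ⟨fun j => ?_, fun m => ?_⟩
    · have := hf.1 j; simpa using this
    · have := hf.2 m; simpa using this
  · simp
  · simp [h0]
  · simp [h12]
  rintro ρ o t ⟨rfl, ht, hS', h30, hf'⟩
  refine ⟨by simp, by omega, hS.trans (hS'.mono (by decide) (by decide) (by decide)),
    hBuf.congr (hS'.I 5 (by decide)) (hS'.R 5 (by decide)) (hS'.W 5 (by decide)), ?_, ?_, ?_, h30, hf'⟩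
  · rw [hS'.W 11 (by decide)]; simp
  · rw [hS'.W 3 (by decide)]; simp
  · rw [hS'.W 12 (by decide)]; simp [h12]

/-- The memory represents the withheld items. -/
structure HeldInv (X : Setting) (σ : Mem) (D : Finset ℕ) (L : List ℕ) : Prop where
  buf : Buf X σ 5 L
  len : σ.W 11 0 = L.length
  short : L.length < 2 * X.s
  sorted : L.Pairwise (· < ·)
  top : top X.s X.key L.toFinset = D

/-- The memory of the coordinator after the first `t` items. -/
structure CoordInv (X : Setting) (J t : ℕ) (σ : Mem) (L D : List ℕ) : Prop where
  sample : SampleInv X σ (co true X t) L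
  held : HeldInv X σ (co true X t).D D
  s : σ.W 0 0 = X.s
  k : σ.W 1 0 = X.k
  bits : σ.W 12 0 = 0 ∨ σ.W 12 0 = X.bits
  counters : Counters X J σ (co true X t).count
  sample_sub : ∀ i ∈ L, i < t ∧ X.cap ≤ X.cnt t (X.lev i)
  held_sub : ∀ i ∈ D, i < t ∧ X.cnt t (X.lev i) < X.cap

/-- Compresses the buffer `5` if necessary, or saturates the level in variable `3`, depending on its
counter in variable `30`. -/
def settleEarly : HC :=
  .ite (.nz ((.v 30 <ₑ .c 8 *ₑ .v 0) +ₑ (.v 30 <ₑ .c 4 *ₑ .v 1)))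
    (.ite (.nz (.v 11 <ₑ .c 2 *ₑ .v 0)) .skip (compress 5 11))
    saturate

/-- What the coordinator does with a message. -/
def handle : HC :=
  .ite (.nz (.v 2)) (.getLevel 3 (.c 0) 0 (.c 0) ;; insertItem)
    (.ite (.nz (.v 12)) .skip findBits ;; withhold ;; settleEarly)

/-- The potential of the computation of the number of bits. -/
def bitsPot (X : Setting) (x : ℕ) : ℕ := if x = 0 then 100 * X.bits + 100 else 0

/-! ### Receipt of a message in terms of the arrays, and the handling of one message. -/

@[simp] theorem W_receive_early (σ : Mem) (i : ℕ) (w : ℝ) (a : Fin 32) (j : ℕ) :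
    (σ.receive (.early i w)).W a j = if a = 2 ∧ j = 0 then 0 else σ.W a j := by
  have := cell_eq_iff 2 a 0 j
  simp only [Mem.receive, Mem.W, Function.update_apply]
  congr 1
  exact propext this

@[simp] theorem R_receive_early (σ : Mem) (i : ℕ) (w : ℝ) (a : Fin 32) (j : ℕ) :
    (σ.receive (.early i w)).R a j = if a = 0 ∧ j = 0 then w else σ.R a j := by
  have := cell_eq_iff 0 a 0 j
  simp only [Mem.receive, Mem.R, Function.update_apply]
  congr 1
  exact propext this

@[simp] theorem I_receive_early (σ : Mem) (i : ℕ) (w : ℝ) (a : Fin 32) (j : ℕ) :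
    (σ.receive (.early i w)).I a j = if a = 0 ∧ j = 0 then some i else σ.I a j := by
  have := cell_eq_iff 0 a 0 j
  simp only [Mem.receive, Mem.I, Function.update_apply]
  congr 1
  exact propext this

@[simp] theorem W_receive_regular (σ : Mem) (i : ℕ) (w v : ℝ) (a : Fin 32) (j : ℕ) :
    (σ.receive (.regular i w v)).W a j = if a = 2 ∧ j = 0 then 1 else σ.W a j := by
  have := cell_eq_iff 2 a 0 j
  simp only [Mem.receive, Mem.W, Function.update_apply]
  congr 1
  exact propext this

@[simp] theorem R_receive_regular (σ : Mem) (i : ℕ) (w v : ℝ) (a : Fin 32) (j : ℕ) :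
    (σ.receive (.regular i w v)).R a j =
      if a = 1 ∧ j = 0 then v else if a = 0 ∧ j = 0 then w else σ.R a j := by
  have h0 := cell_eq_iff 0 a 0 j
  have h1 := cell_eq_iff 1 a 0 j
  simp only [Mem.receive, Mem.R, Function.update_apply]
  congr 1
  · exact propext h1
  · congr 1
    exact propext h0

@[simp] theorem I_receive_regular (σ : Mem) (i : ℕ) (w v : ℝ) (a : Fin 32) (j : ℕ) :
    (σ.receive (.regular i w v)).I a j = if a = 0 ∧ j = 0 then some i else σ.I a j := by
  have := cell_eq_iff 0 a 0 j
  simp only [Mem.receive, Mem.I, Function.update_apply]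
  congr 1
  exact propext this

/-- The memory, messages and time after item `t` has been handled, starting from buffers of the total
length `len` and from the potential `pot`. -/
def Handled (X : Setting) (J t len pot : ℕ) (σ : Mem) (o : List Msg) (τ : ℕ) : Prop :=
  o = down true X t ∧ ∃ L D, CoordInv X J (t + 1) σ L D ∧
    τ + 210000 * (L.length + D.length) + bitsPot X (σ.W 12 0) ≤ 210000 * len + pot +
      1000000 * (1 + (X.s + X.k) * ((if X.cnt t (X.lev t) + 1 = X.cap then 1 else 0) +
        (epo true X (t + 1) - epo true X t)))

theorem Setting.cnt_le_succ (X : Setting) (t j : ℕ) : X.cnt t j ≤ X.cnt (t + 1) j := by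
  rw [X.cnt_succ]; omega

/-- The item is inserted without a comparison with `u`, which `reply_cases` shows to have the same
effect. Its level is saturated, so the withheld items and their counters are not concerned. -/
theorem handle_regular {E : Env} {K : ℕ} (hE : E.Fits K) {X : Setting} (hX : X.Good)
    (hK : 16 * X.s ≤ K) (hr : E.r = X.r) (hk : E.k = X.k) {J t : ℕ}
    (hJ : ∀ i ≤ t, X.lev i ≤ J) (hJw : J ≤ E.maxWord) {σ : Mem} {L D : List ℕ}
    (h : CoordInv X J t σ L D) (hup : up true X t = some (.regular t (X.w t) (X.key t))) :
    wp E K handle (σ.receive (.regular t (X.w t) (X.key t)))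
      (Handled X J t (L.length + D.length) (bitsPot X (σ.W 12 0))) := by
  have hw := hE.word
  have hs := hX.s_pos
  have hN := netInv hX true t
  have hlev : level E.r (X.w t) = X.lev t := by rw [hr]; rfl
  obtain ⟨hsat, hc, hd⟩ : X.cap ≤ X.cnt t (X.lev t) ∧
      co true X (t + 1) = (addToSample X (co true X t) t).1 ∧
      down true X t = (addToSample X (co true X t) t).2 := by
    rw [addToSample_eq_addAll]
    rcases reply_cases hX hN with ⟨-, h1, -⟩ | ⟨h1, -, -, h2, h3⟩ | ⟨-, h1, -⟩ | ⟨-, h1, -⟩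
    · rw [hup] at h1; simp at h1
    · exact ⟨h1, h2, h3⟩
    · rw [hup] at h1; simp at h1
    · rw [hup] at h1; simp at h1
  have hJt := hJ t le_rfl
  simp only [handle, wp.eq_3, wp.eq_2, wp.eq_9]
  simp [-Fin.isValue, hlev]
  and_intros
  all_goals try omega
  refine wp_mono _ (insertItem_spec hE hX hK hr hk (i := t) (L := L) (c := co true X t)
    (h.sample.congr ?_ ?_ ?_ ?_ ?_ ?_ rfl rfl) ?_ ?_ ?_ ?_ ?_ ?_) ?_
  · funext; simp
  · funext; simp
  · funext; simp
  · funext; simp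
  · funext; simp
  · funext; simp
  · simp
  · simp
  · simp
  · intro hm; have := (h.sample_sub t hm).1; omega
  · simp [h.s]
  · intro i hi
    refine (hJ i ?_).trans hJw
    rcases List.mem_append.1 hi with hi | hi
    · exact (h.sample_sub i hi).1.le
    · rw [List.mem_singleton.1 hi]
  rintro ρ o τ ⟨rfl, hS, L', hL', hsub, hτ⟩
  have hne : ∀ i ∈ D, X.lev t ≠ X.lev i := fun i hi he => by
    have := (h.held_sub i hi).2
    rw [← he] at this; omega
  have e12 := congrFun (hS.W 12 (by decide)) 0
  simp at e12
  refine ⟨hd.symm, L', D, ?_, ?_⟩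
  · refine ⟨hc ▸ hL', ?_, ?_, ?_, ?_, ?_, ?_, ?_⟩
    · have hD : (co true X (t + 1)).D = (co true X t).D := by rw [hc]; rfl
      rw [hD]
      refine ⟨h.held.buf.congr ?_ ?_ ?_, ?_, h.held.short, h.held.sorted, h.held.top⟩
      · rw [hS.I 5 (by decide)]; funext; simp
      · rw [hS.R 5 (by decide)]; funext; simp
      · rw [hS.W 5 (by decide)]; funext; simp
      · rw [hS.W 11 (by decide)]; simp [h.held.len]
    · rw [hS.W 0 (by decide)]; simp [h.s]
    · rw [hS.W 1 (by decide)]; simp [h.k]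
    · rw [e12]; exact h.bits
    · have hC : (co true X (t + 1)).count = (co true X t).count := by rw [hc]; rfl
      have h6 := hS.W 6 (by decide)
      rw [hC]
      refine ⟨fun j => ?_, fun m => ?_⟩
      · rw [h6]; simpa using h.counters.1 j
      · rw [h6]; simpa using h.counters.2 m
    · intro i hi
      rcases List.mem_append.1 (hsub hi) with hi | hi
      · have := h.sample_sub i hi
        exact ⟨by omega, this.2.trans (X.cnt_le_succ t _)⟩
      · rw [List.mem_singleton.1 hi]
        exact ⟨by omega, hsat.trans (X.cnt_le_succ t _)⟩
    · intro i hi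
      have := h.held_sub i hi
      rw [X.cnt_succ, if_neg (hne i hi)]
      exact ⟨by omega, by omega⟩
  · have he : epo true X (t + 1) - epo true X t = epochIdx X.r (addToSample X (co true X t) t).1.u -
        epochIdx X.r (co true X t).u := by rw [epo, hc]
    rw [e12, he, if_neg (by omega), zero_add]
    omega

/-- Amortized like the sample: the entries removed by a compression pay for it. A saturation may
touch the whole buffer and costs of the order `s + k`, besides the new epochs caused by the released
items. -/
theorem settleEarly_spec {E : Env} {K : ℕ} (hE : E.Fits K) {X : Setting} (hX : X.Good)
    (hK : 16 * X.s ≤ K) (hr : E.r = X.r) (hk : E.k = X.k) {J t : ℕ}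
    (hJ : ∀ i ≤ t, X.lev i ≤ J) (hJw : J ≤ E.maxWord)
    (hB2 : 2 * (8 * X.s + 4 * X.k) ≤ E.maxWord) {σ : Mem} {L D : List ℕ}
    (h : SampleInv X σ (co true X t) L) (hD : Buf X σ 5 (D ++ [t])) (hDs : D.length < 2 * X.s)
    (hDp : D.Pairwise (· < ·)) (hDt : top X.s X.key D.toFinset = (co true X t).D)
    (h11 : σ.W 11 0 = (D ++ [t]).length) (h0 : σ.W 0 0 = X.s) (h1 : σ.W 1 0 = X.k)
    (h3 : σ.W 3 0 = X.lev t) (h12 : σ.W 12 0 = X.bits) (h30 : σ.W 30 0 = X.cnt t (X.lev t) + 1)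
    (hC : Counters X J σ (co true X (t + 1)).count)
    (hL : ∀ i ∈ L, i < t ∧ X.cap ≤ X.cnt t (X.lev i))
    (hDl : ∀ i ∈ D, i < t ∧ X.cnt t (X.lev i) < X.cap)
    (hup : up true X t = some (.early t (X.w t))) (pot : ℕ) (hpot : pot ≤ 10000) :
    wp E K settleEarly σ fun σ' o τ =>
      Handled X J t (L.length + D.length) 0 σ' o (τ + pot) := by
  have hw := hE.word
  have hs := hX.s_pos
  have hN := netInv hX true t
  have hbits := X.bits_pos hs
  have hJt := hJ t le_rfl
  have hDn : (D ++ [t]).Pairwise (· < ·) := by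
    rw [List.pairwise_append]
    exact ⟨hDp, by simp, fun i hi j hj => by rw [List.mem_singleton.1 hj]; exact (hDl i hi).1⟩
  have hnd : (D ++ [t]).Nodup := hDn.imp fun h => h.ne
  have hlev : ∀ i ∈ L ++ (D ++ [t]), X.lev i ≤ E.maxWord := fun i hi => by
    refine (hJ i ?_).trans hJw
    simp only [List.mem_append, List.mem_singleton] at hi
    rcases hi with hi | hi | hi
    · exact (hL i hi).1.le
    · exact (hDl i hi).1.le
    · exact hi.le
  have hlen : (D ++ [t]).length = D.length + 1 := by simp
  have hheld : top X.s X.key (D ++ [t]).toFinset = held true X t := by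
    rw [held, if_pos rfl, ← hDt, top_insert_top hX.inj]
    congr 1
    ext j; simp
  have hTh : (topList X (D ++ [t])).toFinset = held true X t := by
    rw [topList_toFinset, hheld]
  have hTp : (topList X (D ++ [t])).Pairwise (· < ·) := hDn.sublist (topList_sublist _ _)
  have hTl := topList_length hX hnd
  have hcapdef : X.cap = max (8 * X.s) (4 * X.k) := rfl
  simp only [settleEarly, wp.eq_3, wp.eq_1]
  simp [-Fin.isValue, h0, h1, h30, h11]
  have hcase := reply_cases hX hN
  rw [hup] at hcase
  simp only [reduceCtorEq, false_and, and_false, true_and, false_or, Option.some.injEq] at hcase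
  have hle1 : ∀ p : Prop, [Decidable p] → (if p then 1 else 0) ≤ 1 := fun p _ => by split_ifs <;> simp
  have hp1 := hle1 (X.cnt t (X.lev t) + 1 < 8 * X.s)
  have hp2 := hle1 (X.cnt t (X.lev t) + 1 < 4 * X.k)
  and_intros
  all_goals try omega
  · intro hlt
    -- The sum of the two tests is nonzero exactly if the counter is below one of `8 s` and `4 k`,
    -- that is, below their maximum.
    have hlt' : X.cnt t (X.lev t) + 1 < X.cap := by
      rw [hcapdef, lt_max_iff]
      by_contra! hcon
      have := hlt (by omega)
      omega
    obtain ⟨-, hc, hd⟩ := hcase.resolve_right fun h => by omega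
    have hsub' : ∀ i ∈ D ++ [t], i < t + 1 ∧ X.cnt (t + 1) (X.lev i) < X.cap := fun i hi => by
      rcases List.mem_append.1 hi with hi | hi
      · have := hDl i hi
        rw [X.cnt_succ]
        split_ifs with he
        · rw [← he]; omega
        · omega
      · rw [List.mem_singleton.1 hi, X.cnt_succ, if_pos rfl]
        exact ⟨by omega, hlt'⟩
    have hSub : ∀ i ∈ L, i < t + 1 ∧ X.cap ≤ X.cnt (t + 1) (X.lev i) := fun i hi =>
      ⟨by have := hL i hi; omega, (hL i hi).2.trans (X.cnt_le_succ t _)⟩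
    have fin : ∀ ρ D' τ, SampleInv X ρ (co true X t) L → HeldInv X ρ (held true X t) D' →
        ρ.W 0 0 = X.s → ρ.W 1 0 = X.k → ρ.W 12 0 = X.bits →
        Counters X J ρ (co true X (t + 1)).count → D' ⊆ D ++ [t] →
        τ + 210000 * D'.length ≤ 210000 * D.length + 1000000 →
        Handled X J t (L.length + D.length) 0 ρ [] τ := by
      intro ρ D' τ a1 a2 a3 a4 a5 a6 a7 a8
      refine ⟨hd.symm, L, D', ⟨?_, ?_, a3, a4, Or.inr a5, a6, hSub, fun i hi => hsub' i (a7 hi)⟩, ?_⟩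
      · exact a1.congr rfl rfl rfl rfl rfl rfl (by rw [hc]) (by rw [hc])
      · rw [hc]; exact a2
      · rw [bitsPot, if_neg (by omega)]
        have := Nat.zero_le ((X.s + X.k) * ((if X.cnt t (X.lev t) + 1 = X.cap then 1 else 0) +
          (epo true X (t + 1) - epo true X t)))
        omega
    and_intros
    all_goals try omega
    all_goals try (split_ifs <;> omega)
    · intro hlt2
      refine fin σ (D ++ [t]) _ h ⟨hD, h11, by omega, hDn, hheld⟩ h0 h1 h12 hC
        (List.Subset.refl _) (by omega)
    · intro hge
      refine wp_mono _ (compress_spec hE (by omega) hX (Or.inr ⟨rfl, rfl⟩) hD h11 hnd h0 (by omega)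
        (by omega) fun i hi => hlev i (List.mem_append_right _ hi)) ?_
      rintro ρ o τ ⟨rfl, hτ, hS, hl, hB, -⟩
      refine fin ρ (topList X (D ++ [t])) _ (h.congr ?_ ?_ ?_ ?_ ?_ ?_ rfl rfl)
        ⟨hB, hl, by omega, hTp, by rw [topList_top hX, hheld]⟩ ?_ ?_ ?_ ?_ (topList_sublist _ _).subset ?_
      · exact hS.W 4 (by decide)
      · exact hS.R 4 (by decide)
      · exact hS.I 4 (by decide)
      · exact hS.W 10 (by decide)
      · exact hS.W 13 (by decide)
      · exact hS.R 2 (by decide)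
      · rw [hS.W 0 (by decide), h0]
      · rw [hS.W 1 (by decide), h1]
      · rw [hS.W 12 (by decide), h12]
      · refine ⟨fun j => ?_, fun m => ?_⟩
        · rw [hS.W 6 (by decide)]; exact hC.1 j
        · rw [hS.W 6 (by decide)]; exact hC.2 m
      · omega
  · intro hge1 hge2
    have hge' : ¬ X.cnt t (X.lev t) + 1 < X.cap := by
      rw [hcapdef, lt_max_iff]
      omega
    obtain ⟨hcap, hc, hd⟩ := hcase.resolve_left fun h => hge' h.1
    have hSI : SampleInv X σ (counted true X t) L := h.congr rfl rfl rfl rfl rfl rfl rfl rfl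
    set R := (topList X (D ++ [t])).filter fun i => decide (X.lev i = X.lev t) with hR
    set D' := (topList X (D ++ [t])).filter fun i => !decide (X.lev i = X.lev t) with hD'
    -- The buffer is always in order of arrival, so its items of the level already form the sorted
    -- list that the algorithm prescribes.
    have hRR : released true X t = R := by
      have h5 : (held true X t).filter (fun m => X.lev m = X.lev t) = R.toFinset := by
        rw [hR, List.toFinset_filter, hTh]
        ext i; simp
      rw [released, h5, List.toFinset_sort]
      · exact (hTp.sublist List.filter_sublist).imp fun h => h.le
      · exact (hTp.sublist List.filter_sublist).imp fun h => h.ne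
    have hDD : (held true X t).filter (fun m => X.lev m ≠ X.lev t) = D'.toFinset := by
      rw [hD', List.toFinset_filter, hTh]
      ext i; simp
    rw [hRR] at hc hd
    have hao := addAll_ok hX R (c := counted true X t) ⟨h.ok.card, h.ok.u⟩
    have hD'T : D'.length ≤ (topList X (D ++ [t])).length := List.length_filter_le _ _
    refine wp_mono _ (saturate_spec hE hX hK hr hk hSI hD h11 (by omega) hnd h3 h0 ?_ hlev
      hR) ?_
    · intro i hi he
      have := (hL i hi).2
      rw [he] at this; omega
    rintro ρ o τ ⟨rfl, hS, hB, hl, L', hL', hsub, hτ⟩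
    refine ⟨hd.symm, L', D', ⟨hc ▸ hL', ⟨hB, hl, by omega, hTp.sublist List.filter_sublist, ?_⟩,
      ?_, ?_, Or.inr ?_, ?_, ?_, ?_⟩, ?_⟩
    · rw [hc, hao.2.2.1]
      change _ = (held true X t).filter fun m => X.lev m ≠ X.lev t
      rw [hDD, top_eq_self]
      exact (List.toFinset_card_le _).trans (by omega)
    · rw [hS.W 0 (by decide), h0]
    · rw [hS.W 1 (by decide), h1]
    · rw [hS.W 12 (by decide), h12]
    · refine ⟨fun j => ?_, fun m => ?_⟩
      · rw [hS.W 6 (by decide)]; exact hC.1 j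
      · rw [hS.W 6 (by decide)]; exact hC.2 m
    · intro i hi
      rcases List.mem_append.1 (hsub hi) with hi | hi
      · have := hL i hi
        exact ⟨by omega, this.2.trans (X.cnt_le_succ t _)⟩
      · have h5 := List.mem_filter.1 hi
        have h6 := (topList_sublist _ _).subset h5.1
        rw [of_decide_eq_true h5.2, X.cnt_succ, if_pos rfl]
        refine ⟨?_, by omega⟩
        rcases List.mem_append.1 h6 with h6 | h6
        · have := hDl i h6; omega
        · have := List.mem_singleton.1 h6; omega
    · intro i hi
      have h5 := List.mem_filter.1 hi
      have h6 := (topList_sublist _ _).subset h5.1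
      have h7 : X.lev i ≠ X.lev t := by simpa using h5.2
      rw [X.cnt_succ, if_neg h7.symm]
      rcases List.mem_append.1 h6 with h6 | h6
      · have := hDl i h6; omega
      · exact absurd (by rw [List.mem_singleton.1 h6]) h7
    · have he : epo true X (t + 1) - epo true X t =
          epochIdx X.r (addAll X (counted true X t) R).1.u - epochIdx X.r (counted true X t).u := by
        rw [epo, hc]; rfl
      have e12 : ρ.W 12 0 = X.bits := by rw [hS.W 12 (by decide), h12]
      rw [he, if_pos hcap, bitsPot, if_neg (by omega), Nat.mul_add (X.s + X.k)]
      omega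

theorem Handled.add_time {X : Setting} {J t len : ℕ} {σ : Mem} {o : List Msg} {τ τ' p p' : ℕ}
    (h : Handled X J t len p σ o τ) (hτ : τ' + p ≤ τ + p') : Handled X J t len p' σ o τ' := by
  obtain ⟨h1, L, D, h2, h3⟩ := h
  exact ⟨h1, L, D, h2, by omega⟩

theorem handle_early {E : Env} {K : ℕ} (hE : E.Fits K) {X : Setting} (hX : X.Good)
    (hK : 16 * X.s ≤ K) (hr : E.r = X.r) (hk : E.k = X.k) (hT : E.T = X.T) {J t : ℕ}
    (hJ : ∀ i ≤ t, X.lev i ≤ J) (hJw : J ≤ E.maxWord)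
    (hB : (2 ^ X.bits) ^ (J / X.s + 1) ≤ E.maxWord)
    (hB2 : 2 * (8 * X.s + 4 * X.k) ≤ E.maxWord) {σ : Mem} {L D : List ℕ}
    (h : CoordInv X J t σ L D) (hup : up true X t = some (.early t (X.w t))) :
    wp E K handle (σ.receive (.early t (X.w t)))
      (Handled X J t (L.length + D.length) (bitsPot X (σ.W 12 0))) := by
  have hw := hE.word
  have hs := hX.s_pos
  have hN := netInv hX true t
  have hbits := X.bits_pos hs
  have hJt := hJ t le_rfl
  obtain ⟨hcap, hcount⟩ : X.cnt t (X.lev t) < X.cap ∧ (co true X (t + 1)).count =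
      Function.update (co true X t).count (X.lev t) ((co true X t).count (X.lev t) + 1) := by
    rcases reply_cases hX hN with ⟨-, h1, -⟩ | ⟨-, h1, -⟩ | ⟨h1, -, h2, -⟩ | ⟨h1, -, h2, -⟩
    · rw [hup] at h1; simp at h1
    · rw [hup] at h1; simp at h1
    · rw [h2]; exact ⟨by omega, rfl⟩
    · rw [h2]
      exact ⟨by omega, (addAll_ok hX _ (c := counted true X t)
        ⟨hN.ok.card, hN.ok.u⟩).2.2.2.1⟩
  have hcnt : (co true X t).count (X.lev t) = X.cnt t (X.lev t) := by rw [hN.count]; omega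
  have hclt := X.cap_lt
  -- The common continuation, whether the number of bits was known or has just been computed; in the
  -- second case `bitsPot` pays.
  have H : ∀ τ : Mem, ∀ p ≤ 100, Same [12] [] [] (σ.receive (.early t (X.w t))) τ →
      τ.W 12 0 = X.bits → wp E K (withhold ;; settleEarly) τ fun σ' o t' =>
        Handled X J t (L.length + D.length) 0 σ' o (p + t') := by
    intro τ p hp hS h12
    simp only [wp.eq_2]
    refine wp_mono _ (withhold_spec hE hX hK hr hT (D := D) (i := t) (f := (co true X t).count)
      (J := J) ?_ ?_ h.held.short ?_ ?_ ?_ h12 hJt hJw hB ?_ (by omega)) ?_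
    · refine h.held.buf.congr ?_ ?_ ?_
      · rw [hS.I 5 (by decide)]; funext; simp
      · rw [hS.R 5 (by decide)]; funext; simp
      · rw [hS.W 5 (by decide)]; funext; simp
    · rw [hS.W 11 (by decide)]; simp [h.held.len]
    · rw [hS.I 0 (by decide)]; simp
    · rw [hS.R 0 (by decide)]; simp
    · rw [hS.W 0 (by decide)]; simp [h.s]
    · refine ⟨fun j => ?_, fun m => ?_⟩
      · rw [hS.W 6 (by decide)]; simpa using h.counters.1 j
      · rw [hS.W 6 (by decide)]; simpa using h.counters.2 m
    rintro ρ o t1 ⟨rfl, ht1, hS1, hB5, hl, h3, hbit, h30, hC⟩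
    rw [← hcount] at hC
    refine wp_mono _ (settleEarly_spec hE hX hK hr hk hJ hJw hB2 (L := L) (D := D)
      (h.sample.congr ?_ ?_ ?_ ?_ ?_ ?_ rfl rfl) hB5 h.held.short h.held.sorted h.held.top hl ?_ ?_ h3 hbit
      (by rw [h30, hcnt]) hC h.sample_sub h.held_sub hup (p + t1) (by omega)) ?_
    · rw [hS1.W 4 (by decide), hS.W 4 (by decide)]; funext; simp
    · rw [hS1.R 4 (by decide), hS.R 4 (by decide)]; funext; simp
    · rw [hS1.I 4 (by decide), hS.I 4 (by decide)]; funext; simp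
    · rw [hS1.W 10 (by decide), hS.W 10 (by decide)]; funext; simp
    · rw [hS1.W 13 (by decide), hS.W 13 (by decide)]; funext; simp
    · rw [hS1.R 2 (by decide), hS.R 2 (by decide)]; funext; simp
    · rw [hS1.W 0 (by decide), hS.W 0 (by decide)]; simp [h.s]
    · rw [hS1.W 1 (by decide), hS.W 1 (by decide)]; simp [h.k]
    · rintro ρ o t2 ht2
      exact ht2.add_time (by omega)
  -- The continuation is made opaque, so that `simp` evaluates only the test in front of it.
  generalize hP : (withhold ;; settleEarly) = P at H
  simp only [handle, wp.eq_3, wp.eq_2, hP]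
  simp [-Fin.isValue]
  and_intros
  all_goals try omega
  · intro hne
    have h12 := h.bits.resolve_left hne
    refine wp_mono _ (H _ 100 le_rfl (Same.refl _ _ _ _) (by simp [h12])) ?_
    intro ρ o t1 h1
    exact h1.add_time (by omega)
  · intro hz
    refine wp_mono _ (findBits_spec hE (by omega) hs (by simp [h.s]) (by simp [h.k]) hB2) ?_
    rintro ρ o t1 ⟨rfl, ht1, hS, h12⟩
    refine wp_mono _ (H _ 100 le_rfl hS h12) ?_
    intro ρ o t2 h2
    rw [hz, bitsPot, if_pos rfl]
    exact h2.add_time (by omega)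

/-! ### Queries -/

/-- Sends the items of the buffer `a`, of length `ln`, whose keys are at least the real variable
`7`. -/
def answerBuf (a ln : Fin 32) : HC :=
  .set 17 (.c 0) ;;
  .loop (.nz (.v 17 <ₑ .v ln))
    (.ite (.lt a (.v 17) 7 (.c 0)) .skip (.answer a (.v 17)) ;; .set 17 (.v 17 +ₑ .c 1))

theorem answerBuf_spec {E : Env} {K : ℕ} (hE : E.Fits K) (hK1 : 8 ≤ K) {X : Setting}
    {a ln : Fin 32} {σ : Mem} {L : List ℕ} (hl7 : ln ≠ 17)
    (hL : Buf X σ a L) (hln : σ.W ln 0 = L.length) (hK : L.length ≤ K) :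
    wp E K (answerBuf a ln) σ fun σ' o _ =>
      o = (L.filter fun i => !decide (X.key i < σ.R 7 0)).map Msg.answer ∧ Same [17] [] [] σ σ' := by
  have hw := hE.word
  simp only [answerBuf, wp.eq_2, wp.eq_5]
  simp
  and_intros
  all_goals try omega
  refine wp_loop hE L.length (fun i τ o _ => Same [17] [] [] σ τ ∧ τ.W 17 0 = i ∧
    o = ((L.take i).filter fun i => !decide (X.key i < σ.R 7 0)).map Msg.answer) ?_ ?_ ?_
  · exact ⟨(Same.refl _ _ _ σ).setW _ (by simp) _ _, by simp, by simp⟩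
  · rintro i hi τ o t ⟨hS, h17, rfl⟩
    have kl := congrFun (hS.W ln (by simp [hl7])) 0
    have ka := congrFun (hS.R a (by simp)) i
    have k7 := congrFun (hS.R 7 (by simp)) 0
    have ia := congrFun (hS.I a (by simp)) i
    rw [(hL i hi).2.1] at ka
    rw [(hL i hi).1] at ia
    simp [h17, kl, hln, hi, ka, k7, ia]
    and_intros
    all_goals try omega
    all_goals intro hv
    · and_intros
      all_goals try omega
      · exact hS.setW _ (by simp) _ _
      · rw [List.take_succ_eq_append_getElem hi, List.filter_append]
        simp [hv]
    · and_intros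
      all_goals try omega
      · exact hS.setW _ (by simp) _ _
      · rw [List.take_succ_eq_append_getElem hi, List.filter_append]
        simp [hv]
  · rintro τ o t ⟨hS, h17, rfl⟩
    have kl := congrFun (hS.W ln (by simp [hl7])) 0
    rw [List.take_length]
    simp [h17, kl, hln]
    exact ⟨by omega, hS⟩

/-- What the coordinator does with a query. -/
def query : HC :=
  .set 18 (.c 0) ;; copyKeys 4 10 ;; copyKeys 5 11 ;; .set 26 (.v 18) ;;
  .ite (.nz (.v 26))
    (.ite (.nz (.v 26 <ₑ .v 0)) (.set 25 (.v 26 -ₑ .c 1)) (.set 25 (.v 0 -ₑ .c 1)) ;; select)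
    .skip ;;
  answerBuf 4 10 ;; answerBuf 5 11

/-- The uncompressed buffers serve as well as the trimmed sets, since the top of a union can be
computed from any supersets with the same tops. Together they have fewer than `4 s` entries, so the
selection needs about `5 s` cells, which `16 * s` covers; a query carries no time bound. -/
theorem query_spec {E : Env} {K : ℕ} (hE : E.Fits K) {X : Setting} (hX : X.Good)
    (hK : 16 * X.s ≤ K) {J t : ℕ} {σ : Mem} {L D : List ℕ} (h : CoordInv X J t σ L D) :
    wp E K query σ fun _ o _ => ∃ l : List ℕ, o = l.map Msg.answer ∧ l.Nodup ∧
      l.toFinset = sample true X t := by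
  have hw := hE.word
  have hs := hX.s_pos
  have hLs := h.sample.short
  have hDs := h.held.short
  have hnd : (L ++ D).Nodup := by
    rw [List.nodup_append]
    refine ⟨h.sample.nodup, h.held.sorted.imp fun h => h.ne, fun a ha b hb he => ?_⟩
    have h1 := (h.sample_sub a ha).2
    have h2 := (h.held_sub b hb).2
    rw [he] at h1; omega
  have hlen : (L ++ D).length = L.length + D.length := List.length_append
  have hsamp : sample true X t = top X.s X.key (L ++ D).toFinset := by
    change top X.s X.key ((co true X t).S ∪ (co true X t).D) = _
    rw [← h.sample.top, ← h.held.top, top_union_top hX.inj, Finset.union_comm, top_union_top hX.inj,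
      Finset.union_comm, List.toFinset_append]
  have fin : ∀ τ : Mem, Same [17, 18, 25, 26, 7, 8, 9, 14, 15, 16, 19, 20, 21, 22, 23, 24] [6, 7] [] σ τ →
      (∀ i ∈ L ++ D, i ∈ top X.s X.key (L ++ D).toFinset ↔ ¬ X.key i < τ.R 7 0) →
      wp E K (answerBuf 4 10 ;; answerBuf 5 11) τ fun _ o _ => ∃ l : List ℕ, o = l.map Msg.answer ∧
        l.Nodup ∧ l.toFinset = sample true X t := by
    intro τ hS htop
    simp only [wp.eq_2]
    refine wp_mono _ (answerBuf_spec hE (by omega) (by decide) (X := X) (L := L)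
      (h.sample.buf.congr (hS.I 4 (by decide)) (hS.R 4 (by decide)) (hS.W 4 (by decide))) ?_
      (by omega)) ?_
    · rw [hS.W 10 (by decide), h.sample.len]
    rintro ρ o t1 ⟨rfl, hS1⟩
    have r7 := congrFun (hS1.R 7 (by decide)) 0
    have hS2 := hS.trans (hS1.mono (by decide) (by decide) (by decide))
    refine wp_mono _ (answerBuf_spec hE (by omega) (by decide) (X := X) (L := D)
      (h.held.buf.congr (hS2.I 5 (by decide)) (hS2.R 5 (by decide)) (hS2.W 5 (by decide))) ?_
      (by omega)) ?_
    · rw [hS2.W 11 (by decide), h.held.len]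
    rintro ρ2 o t2 ⟨rfl, -⟩
    refine ⟨(L ++ D).filter fun i => !decide (X.key i < τ.R 7 0), ?_, hnd.filter _, ?_⟩
    · rw [List.filter_append, List.map_append, r7]
    · rw [hsamp]
      ext i
      rw [List.mem_toFinset, List.mem_filter]
      constructor
      · rintro ⟨h1, h2⟩
        exact (htop i h1).2 (by simpa using h2)
      · intro h1
        have h2 := List.mem_toFinset.1 (top_subset _ _ _ h1)
        exact ⟨h2, by simpa using (htop i h2).1 h1⟩
  generalize hP : (answerBuf 4 10 ;; answerBuf 5 11) = P at fin
  simp only [query, wp.eq_2, wp.eq_3, wp.eq_5, wp.eq_1, hP]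
  simp [-Fin.isValue]
  and_intros
  all_goals try omega
  have S0 : Same [17, 18] [6] [] σ (σ.setW 18 0 0) := (Same.refl _ _ _ σ).setW _ (by simp) _ _
  refine wp_mono _ (copyKeys_spec hE (by omega) (X := X) (L := L) (L' := []) (by decide) (by decide)
    (by decide) (h.sample.buf.congr (S0.I 4 (by decide)) (S0.R 4 (by decide)) (S0.W 4 (by decide)))
    (by simp [h.sample.len]) (by simp; omega) (by simp) (by simp [seg])) ?_
  rintro ρ o t1 ⟨rfl, -, hS1, k18, hseg1⟩
  have S1 := S0.trans hS1
  rw [List.nil_append] at k18 hseg1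
  refine wp_mono _ (copyKeys_spec hE (by omega) (X := X) (L := D) (L' := L) (by decide) (by decide)
    (by decide) (h.held.buf.congr (S1.I 5 (by decide)) (S1.R 5 (by decide)) (S1.W 5 (by decide)))
    ?_ (by omega) k18 hseg1) ?_
  · rw [S1.W 11 (by decide), h.held.len]
  rintro ρ2 o t2 ⟨rfl, -, hS2, j18, hseg2⟩
  have S2 := (S1.trans hS2).mono (ws' := [17, 18, 25, 26, 7, 8, 9, 14, 15, 16, 19, 20, 21, 22, 23, 24])
    (rs' := [6, 7]) (is' := []) (by decide) (by decide) (by decide)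
  have j0 := congrFun (S2.W 0 (by decide)) 0
  rw [h.s] at j0
  rw [hlen] at j18
  simp [-Fin.isValue, j18, j0]
  -- With fewer than `s` items stored, the selected key is the smallest one and everything is
  -- returned.
  have hsel : ∀ m, m = min X.s (L ++ D).length → 0 < m → ∀ τ : Mem,
      Same [17, 18, 25, 26, 7, 8, 9, 14, 15, 16, 19, 20, 21, 22, 23, 24] [6, 7] [] σ τ →
      seg τ 0 (L ++ D).length = (L ++ D).map X.key → τ.W 26 0 = L.length + D.length →
      τ.W 25 0 = m - 1 → wp E K select τ fun σ' o _ => o = [] ∧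
        Same [17, 18, 25, 26, 7, 8, 9, 14, 15, 16, 19, 20, 21, 22, 23, 24] [6, 7] [] σ σ' ∧
        (∀ i ∈ L ++ D, i ∈ top X.s X.key (L ++ D).toFinset ↔ ¬ X.key i < σ'.R 7 0) := by
    intro m hm hm0 τ hS hseg h26 h25
    rw [hlen] at hm
    have hndk : ((L ++ D).map X.key).Nodup := hnd.map hX.inj
    refine wp_mono _ (select_spec hE (by omega) (n := (L ++ D).length) (by rw [h26, hlen])
      (by omega) (by omega) (by rw [hseg]; exact hndk)) ?_
    rintro σ' o t ⟨rfl, -, hS', hv, hc⟩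
    rw [hseg] at hv hc
    refine ⟨rfl, hS.trans (hS'.mono (by decide) (by decide) (by decide)), fun i hi => ?_⟩
    rw [← mem_top_iff_of_rank hnd hm0 hv (by rw [hc, h25]) i hi]
    by_cases hle : X.s ≤ (L ++ D).length
    · rw [show m = X.s by omega]
    · have hcard := List.toFinset_card_le (L ++ D)
      rw [top_eq_self (by omega), top_eq_self (by omega)]
  and_intros
  all_goals try omega
  · intro hne
    have hpos : 0 < L.length + D.length := by
      by_contra! h0
      exact hne (List.length_eq_zero_iff.1 (by omega)) (List.length_eq_zero_iff.1 (by omega))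
    and_intros
    all_goals try omega
    all_goals try (split_ifs <;> omega)
    all_goals intro hlt
    all_goals
      and_intros
      all_goals try omega
      refine wp_mono _ (hsel _ rfl (by omega) _ ((S2.setW 26 (by decide) _ _).setW 25 (by decide) _ _)
        (by simpa using hseg2) (by simp) (by simp; omega)) ?_
      rintro σ' o t ⟨rfl, h1, h2⟩
      simpa using fin σ' h1 h2
  · intro h1 h2
    simpa using fin _ (S2.setW 26 (by decide) _ _) (by simp [h1, h2])

/-! ### The sites -/

/-- What a site does with an arriving item. -/
def arrive : HC :=
  .getLevel 5 (.c 0) 0 (.c 0) ;;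
  .ite (.nz (.v 4 /ₑ (.c 1 <<ₑ .v 5) %ₑ .c 2))
    (.makeKey 1 (.c 0) 0 (.c 0) 0 (.c 0) ;;
      .ite (.lt 3 (.c 0) 1 (.c 0)) (.sendRegular 0 (.c 0) 0 (.c 0) 1 (.c 0)) .skip)
    (.sendEarly 0 (.c 0) 0 (.c 0))

/-- What a site does with a broadcast. -/
def notice : HC :=
  .ite (.nz (.v 2 =ₑ .c 2))
    (.ite (.nz (.v 4 /ₑ (.c 1 <<ₑ .v 3) %ₑ .c 2)) .skip (.set 4 (.v 4 +ₑ (.c 1 <<ₑ .v 3))))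
    (.putR 3 (.c 0) 0 (.c 0))

/-- The memory of a site represents the state `a`; the levels are at most `J`. -/
structure SiteInv (J : ℕ) (a : SiteState) (σ : Mem) : Prop where
  bit : ∀ j, σ.W 4 0 / 2 ^ j % 2 = if a.saturated j = true then 1 else 0
  lt : σ.W 4 0 < 2 ^ (J + 1)
  thr : σ.R 3 0 = a.thr

@[simp] theorem W_arrival (σ : Mem) (i : ℕ) (w : ℝ) : (σ.arrival i w).W = σ.W := rfl

@[simp] theorem R_arrival (σ : Mem) (i : ℕ) (w : ℝ) (a : Fin 32) (j : ℕ) :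
    (σ.arrival i w).R a j = if a = 0 ∧ j = 0 then w else σ.R a j := by
  have := cell_eq_iff 0 a 0 j
  simp only [Mem.arrival, Mem.R, Function.update_apply]
  congr 1
  exact propext this

@[simp] theorem I_arrival (σ : Mem) (i : ℕ) (w : ℝ) (a : Fin 32) (j : ℕ) :
    (σ.arrival i w).I a j = if a = 0 ∧ j = 0 then some i else σ.I a j := by
  have := cell_eq_iff 0 a 0 j
  simp only [Mem.arrival, Mem.I, Function.update_apply]
  congr 1
  exact propext this

@[simp] theorem W_receive_saturated (σ : Mem) (l : ℕ) (a : Fin 32) (j : ℕ) :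
    (σ.receive (.saturated l)).W a j =
      if a = 3 ∧ j = 0 then l else if a = 2 ∧ j = 0 then 2 else σ.W a j := by
  have h2 := cell_eq_iff 2 a 0 j
  have h3 := cell_eq_iff 3 a 0 j
  simp only [Mem.receive, Mem.W, Function.update_apply]
  congr 1
  · exact propext h3
  · congr 1
    exact propext h2

@[simp] theorem R_receive_saturated (σ : Mem) (l : ℕ) : (σ.receive (.saturated l)).R = σ.R := rfl

@[simp] theorem W_receive_epoch (σ : Mem) (x : ℝ) (a : Fin 32) (j : ℕ) :
    (σ.receive (.epoch x)).W a j = if a = 2 ∧ j = 0 then 3 else σ.W a j := by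
  have := cell_eq_iff 2 a 0 j
  simp only [Mem.receive, Mem.W, Function.update_apply]
  congr 1
  exact propext this

@[simp] theorem R_receive_epoch (σ : Mem) (x : ℝ) (a : Fin 32) (j : ℕ) :
    (σ.receive (.epoch x)).R a j = if a = 0 ∧ j = 0 then x else σ.R a j := by
  have := cell_eq_iff 0 a 0 j
  simp only [Mem.receive, Mem.R, Function.update_apply]
  congr 1
  exact propext this

theorem arrive_spec {E : Env} (hE : E.Fits 1) {X : Setting} (hr : E.r = X.r) (hT : E.T = X.T)
    {J t : ℕ} (hJ : X.lev t ≤ J) (hB : 2 ^ (J + 1) ≤ E.maxWord) {a : SiteState} {σ : Mem}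
    (h : SiteInv J a σ) :
    wp E 1 arrive (σ.arrival t (X.w t)) fun σ' o b =>
      o = (siteArrive X a t).toList ∧ b ≤ 200 ∧ SiteInv J a σ' := by
  have hw := hE.word
  have hlev : level E.r (X.w t) = X.lev t := by rw [hr]; rfl
  have hkey : X.w t / E.T t = X.key t := by rw [hT]; rfl
  have h1 : J < 2 ^ J := Nat.lt_two_pow_self
  have h2 : 2 ^ X.lev t ≤ 2 ^ J := Nat.pow_le_pow_right (by norm_num) hJ
  rw [pow_succ] at hB
  have h3 : σ.W 4 0 / 2 ^ X.lev t ≤ σ.W 4 0 := Nat.div_le_self _ _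
  have h4 := h.lt
  rw [pow_succ] at h4
  have hI : ∀ τ : Mem, τ.W 4 0 = σ.W 4 0 → τ.R 3 0 = σ.R 3 0 → SiteInv J a τ := fun τ e1 e2 =>
    ⟨by rw [e1]; exact h.bit, by rw [e1]; exact h.lt, by rw [e2]; exact h.thr⟩
  simp [arrive, hlev, hkey, h.bit, siteArrive, h.thr]
  rw [show level X.r (X.w t) = X.lev t from rfl]
  and_intros
  all_goals try omega
  · split_ifs <;> omega
  · intro hs
    rw [if_pos hs]
    refine ⟨fun hv => ?_, fun hv => ?_⟩
    · rw [if_pos hv]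
      exact ⟨rfl, hI _ (by simp) (by simp)⟩
    · rw [if_neg (not_lt.2 hv)]
      exact ⟨rfl, hI _ (by simp) (by simp)⟩
  · intro hs
    rw [if_neg (by simp [hs])]
    exact ⟨rfl, hI _ (by simp) (by simp)⟩

/-- The power of two is added only if the bit is not set, so no carry reaches the bits of other
levels. -/
theorem notice_spec {E : Env} (hE : E.Fits 1) {J : ℕ} (hB : 2 ^ (J + 1) ≤ E.maxWord)
    {a : SiteState} {σ : Mem} (h : SiteInv J a σ) {m : Msg}
    (hm : (∃ x, m = .epoch x) ∨ ∃ j ≤ J, m = .saturated j) :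
    wp E 1 notice (σ.receive m) fun σ' o b => o = [] ∧ b ≤ 200 ∧ SiteInv J (siteReceive a m) σ' := by
  have hw := hE.word
  rcases hm with ⟨x, rfl⟩ | ⟨j, hj, rfl⟩
  · simp [notice]
    and_intros
    all_goals try omega
    exact ⟨fun i => (congrArg (· / 2 ^ i % 2) (by simp)).trans (h.bit i), by simpa using h.lt, by simp [siteReceive]⟩
  · have h1 : J < 2 ^ J := Nat.lt_two_pow_self
    have h2 : 2 ^ j ≤ 2 ^ J := Nat.pow_le_pow_right (by norm_num) hj
    have h3 : σ.W 4 0 / 2 ^ j ≤ σ.W 4 0 := Nat.div_le_self _ _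
    have h4 := h.lt
    rw [pow_succ] at hB
    have h5 := pow_succ 2 J
    have hbit := h.bit j
    simp [notice, h.bit]
    and_intros
    all_goals try omega
    · intro hs
      refine ⟨fun i => ?_, by simpa using h.lt, by simp [siteReceive, h.thr]⟩
      have := h.bit i
      simp only [siteReceive, Function.update_apply, W_receive_saturated]
      by_cases hij : i = j
      · subst hij; simp [this, hs]
      · simp [this, hij]
    · intro hs
      rw [hs] at hbit
      have h6 := digit_add_pow (B := 2) (x := σ.W 4 0) (d := j) (by simp at hbit; omega)
      have h7 := add_pow_lt (B := 2) (x := σ.W 4 0) (d := j) (D := J + 1) (by simp at hbit; omega)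
        (by omega) h.lt
      and_intros
      all_goals try omega
      refine ⟨fun i => ?_, by simpa using h7, by simp [siteReceive, h.thr]⟩
      have := h6 i
      simp at hbit
      simp only [siteReceive, Function.update_apply, W_setW]
      by_cases hij : i = j
      · subst hij
        rw [if_pos rfl, hbit] at this
        simpa using this
      · simp [this, hij, h.bit]

theorem exists_notices {E : Env} (hE : E.Fits 1) {J : ℕ} (hB : 2 ^ (J + 1) ≤ E.maxWord) (l : List Msg) :
    ∀ {a : SiteState} {σ : Mem}, SiteInv J a σ →
      (∀ m ∈ l, (∃ x, m = .epoch x) ∨ ∃ j ≤ J, m = .saturated j) →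
      ∃ σ', Notices E notice.toC 200 l σ σ' ∧ SiteInv J (l.foldl siteReceive a) σ' := by
  induction l with
  | nil => intro a σ h _; exact ⟨σ, .nil, h⟩
  | cons m l ih =>
      intro a σ h hl
      obtain ⟨σ1, o, b, h1, rfl, hb, h2⟩ := wp_sound hE _ (notice_spec hE hB h (hl m (by simp)))
      obtain ⟨σ2, h3, h4⟩ := ih h2 fun m hm => hl m (by simp [hm])
      exact ⟨σ2, .cons h1 hb h3, h4⟩

theorem Notices.mono {E : Env} {c : Cmd} {b b' : ℕ} (hb : b ≤ b') {l : List Msg} {σ σ' : Mem}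
    (h : Notices E c b l σ σ') : Notices E c b' l σ σ' := by
  induction h with
  | nil => exact .nil
  | cons h1 h2 _ ih => exact .cons h1 (h2.trans hb) ih

theorem mem_down {X : Setting} (hX : X.Good) {t : ℕ} {m : Msg} (hm : m ∈ down true X t) :
    (∃ x, m = .epoch x) ∨ m = .saturated (X.lev t) := by
  have hN := netInv hX true t
  rcases reply_cases hX hN with ⟨-, -, -, -, hd⟩ | ⟨-, -, -, -, hd⟩ | ⟨-, -, -, hd⟩ | ⟨-, -, -, hd⟩
  · rw [hd] at hm; simp at hm
  · rw [hd] at hm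
    exact Or.inl ((addAll_ok hX _ hN.ok).2.2.2.2.2.1 m hm)
  · rw [hd] at hm; simp at hm
  · rw [hd] at hm
    rcases List.mem_append.1 hm with hm | hm
    · exact Or.inl ((addAll_ok hX _ (c := counted true X t) ⟨hN.ok.card, hN.ok.u⟩).2.2.2.2.2.1 m hm)
    · exact Or.inr (List.mem_singleton.1 hm)

/-- Dependent choice for `n` steps. -/
theorem exists_seq {α : Type*} {P : ℕ → α → Prop} {R : ℕ → α → α → Prop} {n : ℕ} {x : α} (h0 : P 0 x)
    (h : ∀ t < n, ∀ x, P t x → ∃ y, R t x y ∧ P (t + 1) y) :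
    ∃ f : ℕ → α, f 0 = x ∧ (∀ t < n, R t (f t) (f (t + 1))) ∧ ∀ t ≤ n, P t (f t) := by
  classical
  let f : ℕ → α := fun t => Nat.rec x
    (fun t y => if h' : t < n ∧ P t y then (h t h'.1 y h'.2).choose else y) t
  have hstep : ∀ t < n, P t (f t) → R t (f t) (f (t + 1)) ∧ P (t + 1) (f (t + 1)) := by
    intro t ht hP
    have : f (t + 1) = (h t ht (f t) hP).choose := dif_pos ⟨ht, hP⟩
    rw [this]
    exact (h t ht (f t) hP).choose_spec
  have hP : ∀ t ≤ n, P t (f t) := by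
    intro t
    induction t with
    | zero => exact fun _ => h0
    | succ t ih => exact fun ht => (hstep t (by omega) (ih (by omega))).2
  exact ⟨f, rfl, fun t ht => (hstep t ht (hP t ht.le)).1, hP⟩

/-! ### The programs carry out the algorithm -/

/-- The programs for the sites and the coordinator. -/
def programs : Protocol := ⟨arrive.toC, notice.toC, handle.toC, query.toC⟩

theorem W_start (s k : ℕ) (a : Fin 32) (i : ℕ) :
    (Mem.start s k).W a i = if a = 0 ∧ i = 0 then s else if a = 1 ∧ i = 0 then k else 0 := by
  have h0 := cell_eq_iff 0 a 0 i
  have h1 := cell_eq_iff 1 a 0 i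
  simp only [Mem.start, Mem.W]
  congr 1
  · exact propext h0
  · congr 1
    exact propext h1

theorem R_start (s k : ℕ) (a : Fin 32) (i : ℕ) :
    (Mem.start s k).R a i = if a = 2 ∧ i = 0 then 1 else 0 := by
  have h2 := cell_eq_iff 2 a 0 i
  simp only [Mem.start, Mem.R]
  congr 1
  exact propext h2

/-- The initial memory fits the layout of the arrays: the constant `1` in real cell `2` is `r ^ 0`,
the first power beyond `u = 0`, and word variable `12` is `0`, which marks the number of bits as
unknown. -/
theorem coordInv_start {X : Setting} (hX : X.Good) (J : ℕ) :
    CoordInv X J 0 (Mem.start X.s X.k) [] [] := by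
  have hs := hX.s_pos
  have hu : epochIdx X.r (co true X 0).u = 0 := epo_zero true
  refine ⟨⟨fun j hj => by simp at hj, by simp [W_start], by simp; omega, by simp, by simp [co, net, top],
    (netInv hX true 0).ok, by rw [hu]; simp [R_start], by simp [W_start]⟩,
    ⟨fun j hj => by simp at hj, by simp [W_start], by simp; omega, by simp, by simp [co, net, top]⟩,
    by simp [W_start], by simp [W_start], by simp [W_start], ⟨fun j => ?_, fun m => ?_⟩,
    by simp, by simp⟩
  · simp [W_start, co, net]
  · simp [W_start]

theorem siteInv_start {X : Setting} (J : ℕ) (y : Fin X.k) :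
    SiteInv J ((net true X 0).sites y) (Mem.start X.s X.k) :=
  ⟨fun j => by simp [W_start, net], by simp [W_start], by simp [R_start, net]⟩

/-- The coordinator takes the step number `t`, from the memory and buffers `x` to `y`. -/
def CoordStep (E : Env) (X : Setting) (t : ℕ) (x y : Mem × List ℕ × List ℕ) (τ : ℕ) : Prop :=
  (match up true X t with
    | none => y.1 = x.1 ∧ τ = 0
    | some m => Exec E handle.toC (x.1.receive m) y.1 (down true X t) τ) ∧
  τ + 210000 * (y.2.1.length + y.2.2.length) + bitsPot X (y.1.W 12 0) ≤
    210000 * (x.2.1.length + x.2.2.length) + bitsPot X (x.1.W 12 0) +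
      1000000 * ((up true X t).toList.length +
        (X.s + X.k) * ((if X.cnt t (X.lev t) + 1 = X.cap then 1 else 0) +
          (epo true X (t + 1) - epo true X t)))

theorem exists_coordStep {E : Env} (hE : E.Fits (16 * s)) {X : Setting} (hX : X.Good) (hs : X.s = s)
    (hr : E.r = X.r) (hk : E.k = X.k) (hT : E.T = X.T) {J t : ℕ}
    (hJ : ∀ i ≤ t, X.lev i ≤ J) (hJw : J ≤ E.maxWord)
    (hB : (2 ^ X.bits) ^ (J / X.s + 1) ≤ E.maxWord)
    (hB2 : 2 * (8 * X.s + 4 * X.k) ≤ E.maxWord) (x : Mem × List ℕ × List ℕ)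
    (h : CoordInv X J t x.1 x.2.1 x.2.2) :
    ∃ y, (∃ τ, CoordStep E X t x y τ) ∧ CoordInv X J (t + 1) y.1 y.2.1 y.2.2 := by
  subst hs
  have key : ∀ m, up true X t = some m → wp E (16 * X.s) handle (x.1.receive m)
      (Handled X J t (x.2.1.length + x.2.2.length) (bitsPot X (x.1.W 12 0))) →
      ∃ y, (∃ τ, CoordStep E X t x y τ) ∧ CoordInv X J (t + 1) y.1 y.2.1 y.2.2 := by
    intro m hm hwp
    obtain ⟨σ, o, τ, h1, rfl, L, D, h2, h3⟩ := wp_sound hE _ hwp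
    refine ⟨(σ, L, D), ⟨τ, ?_, ?_⟩, h2⟩
    · rw [hm]; exact h1
    · rw [hm]; exact h3
  have hN := netInv hX true t
  rcases reply_cases hX hN with ⟨hsat, hup, -, hc, hd⟩ | ⟨-, hup, -⟩ | ⟨-, hup, -⟩ | ⟨-, hup, -⟩
  · refine ⟨x, ⟨0, by rw [hup]; exact ⟨rfl, rfl⟩, by omega⟩, ?_⟩
    refine ⟨hc ▸ h.sample, hc ▸ h.held, h.s, h.k, h.bits, hc ▸ h.counters, fun i hi => ?_, fun i hi => ?_⟩
    · have := h.sample_sub i hi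
      exact ⟨by omega, this.2.trans (X.cnt_le_succ t _)⟩
    · have := h.held_sub i hi
      have hne : X.lev t ≠ X.lev i := fun he => by rw [he] at hsat; omega
      rw [X.cnt_succ, if_neg hne]
      exact ⟨by omega, by omega⟩
  · exact key _ hup (handle_regular hE hX le_rfl hr hk hJ hJw h hup)
  · exact key _ hup (handle_early hE hX le_rfl hr hk hT hJ hJw hB hB2 h hup)
  · exact key _ hup (handle_early hE hX le_rfl hr hk hT hJ hJw hB hB2 h hup)

/-- The messages are those of the algorithm, known beforehand, so the coordinator and every site can
be simulated separately, each by dependent choice along its own invariant. The constant `512 = 32 *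
16` provides 32 arrays of `16 s` entries. -/
theorem realizes {X : Setting} (hX : X.Good) {n J B C : ℕ} (hC : 512 ≤ C)
    (hJ : ∀ i < n, X.lev i ≤ J) (hB1 : 512 * X.s ≤ B) (hB2 : 2 ^ (J + 1) ≤ B)
    (hB3 : (2 ^ X.bits) ^ (J / X.s + 1) ≤ B) (hB4 : 2 * (8 * X.s + 4 * X.k) ≤ B) :
    Realizes programs C B X n (2000000 * load true X n) := by
  have hs := hX.s_pos
  have hEs : (⟨C, B, X.r, X.k, X.T⟩ : Env).Fits 1 := ⟨by simp; omega, by simp; omega⟩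
  have hEc : (⟨C * X.s, B, X.r, X.k, X.T⟩ : Env).Fits (16 * X.s) :=
    ⟨by simp only; nlinarith, by simp only; omega⟩
  have hJB : J ≤ B := by
    have : J + 1 < 2 ^ (J + 1) := Nat.lt_two_pow_self
    omega
  obtain ⟨f, f0, fstep, finv⟩ := exists_seq (n := n)
    (P := fun t (x : Mem × List ℕ × List ℕ) => CoordInv X J t x.1 x.2.1 x.2.2)
    (R := fun t x y => ∃ τ, CoordStep ⟨C * X.s, B, X.r, X.k, X.T⟩ X t x y τ)
    (x := (Mem.start X.s X.k, [], [])) (coordInv_start hX J)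
    fun t ht x hx => exists_coordStep hEc hX rfl rfl rfl rfl (fun i hi => hJ i (by omega)) hJB hB3 hB4 x hx
  have hmsgs : ∀ t < n, ∀ m ∈ down true X t, (∃ x, m = .epoch x) ∨ ∃ j ≤ J, m = .saturated j :=
    fun t ht m hm => (mem_down hX hm).imp_right fun h => ⟨_, hJ t ht, h⟩
  have hsite : ∀ y : Fin X.k, ∃ g : ℕ → Mem, g 0 = Mem.start X.s X.k ∧
      ∀ t < n, (X.site t = y → ∃ σ b, Exec ⟨C, B, X.r, X.k, X.T⟩ arrive.toC
          ((g t).arrival t (X.w t)) σ (up true X t).toList b ∧ b ≤ C ∧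
          Notices ⟨C, B, X.r, X.k, X.T⟩ notice.toC C (down true X t) σ (g (t + 1))) ∧
        (X.site t ≠ y → Notices ⟨C, B, X.r, X.k, X.T⟩ notice.toC C (down true X t) (g t) (g (t + 1))) := by
    intro y
    obtain ⟨g, g0, gstep, -⟩ := exists_seq (n := n)
      (P := fun t σ => SiteInv J ((net true X t).sites y) σ)
      (R := fun t σ0 σ1 => (X.site t = y → ∃ σ b, Exec ⟨C, B, X.r, X.k, X.T⟩ arrive.toC
          (σ0.arrival t (X.w t)) σ (up true X t).toList b ∧ b ≤ C ∧
          Notices ⟨C, B, X.r, X.k, X.T⟩ notice.toC C (down true X t) σ σ1) ∧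
        (X.site t ≠ y → Notices ⟨C, B, X.r, X.k, X.T⟩ notice.toC C (down true X t) σ0 σ1))
      (x := Mem.start X.s X.k) (siteInv_start J y) (fun t ht σ hσ => by
        rw [sites_succ]
        by_cases hy : X.site t = y
        · obtain ⟨σ1, o, b, h1, rfl, hb, h2⟩ := wp_sound hEs _
            (arrive_spec hEs (t := t) rfl rfl (hJ t ht) hB2 hσ)
          obtain ⟨σ2, h3, h4⟩ := exists_notices hEs hB2 (down true X t) h2 (hmsgs t ht)
          refine ⟨σ2, ⟨fun _ => ⟨σ1, b, ?_, by omega, h3.mono (by omega)⟩, fun h => absurd hy h⟩, h4⟩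
          have : up true X t = siteArrive X ((net true X t).sites y) t := by rw [← hy]; rfl
          rw [this]; exact h1
        · obtain ⟨σ2, h3, h4⟩ := exists_notices hEs hB2 (down true X t) hσ (hmsgs t ht)
          exact ⟨σ2, ⟨fun h => absurd h hy, fun _ => h3.mono (by omega)⟩, h4⟩)
    exact ⟨g, g0, gstep⟩
  choose g g0 gstep using hsite
  have htime : ∀ t, ∃ τ, t < n → CoordStep ⟨C * X.s, B, X.r, X.k, X.T⟩ X t (f t) (f (t + 1)) τ := by
    intro t
    by_cases ht : t < n
    · obtain ⟨τ, h⟩ := fstep t ht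
      exact ⟨τ, fun _ => h⟩
    · exact ⟨0, fun h => absurd h ht⟩
  choose time htime using htime
  refine ⟨fun t y => g y t, fun t => (f t).1, time, g0, by simp only [f0], fun t ht => ⟨?_, ?_, ?_⟩,
    fun t ht => ?_, ?_⟩
  · exact (gstep _ t ht).1 rfl
  · exact fun y hy => (gstep y t ht).2 hy.symm
  · exact (htime t ht).1
  · obtain ⟨σ, o, b, h1, l, rfl, h3, h4⟩ := wp_sound hEc _ (query_spec hEc hX le_rfl (finv t ht))
    exact ⟨σ, l, b, h1, h3, h4⟩
  -- The potentials of the buffers and of `findBits` telescope, leaving the counts of messages,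
  -- saturations and epochs.
  · have hsum : ∀ m ≤ n, ∑ t ∈ Finset.range m, time t + 210000 * ((f m).2.1.length + (f m).2.2.length) +
        bitsPot X ((f m).1.W 12 0) ≤ 100 * X.bits + 100 +
          1000000 * (X.early m + regs true X m + (X.s + X.k) * (X.sats m + epo true X m)) := by
      intro m hm
      rw [← sum_epo hX, Setting.early, Setting.sats, regs, Finset.card_filter, Finset.card_filter,
        Finset.card_filter]
      induction m with
      | zero =>
          rw [f0]
          simp only [Finset.range_zero, Finset.sum_empty, List.length_nil, bitsPot]
          split_ifs <;> omega
      | succ m ih =>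
          have h1 := ih (by omega)
          have h2 := (htime m (by omega)).2
          have h3 := up_length hX true m
          simp only [Finset.sum_range_succ]
          simp only [Nat.mul_add] at h1 h2 ⊢
          omega
    have h1 := hsum n le_rfl
    have h2 := X.bits_le hs
    have h3 := Nat.zero_le ((X.s + X.k) * (X.sats n + epo true X n))
    unfold load
    omega

/-! ### Bounds for the words -/

theorem rate_nonneg {k s : ℕ} (hs : 0 < s) {W : ℝ} (hW : 2 * (s : ℝ) ≤ W) : 0 ≤ rate k s W := by
  have hs' : (0 : ℝ) < s := by exact_mod_cast hs
  refine mul_nonneg (Nat.cast_nonneg _) (div_nonneg (Real.log_nonneg ?_) (Real.log_nonneg ?_))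
  · rw [le_div_iff₀ hs']; linarith
  · have : (0 : ℝ) ≤ (k : ℝ) / s := by positivity
    linarith

/-- The base is at most `16 r s`. With exponent `d = J / s` the three factors are harmless: `16 ^ d
= (2 ^ d) ^ 4 ≤ W ^ 4`, then `r ^ d ≤ r ^ J ≤ W`, and `s ^ d ≤ 2 ^ (s d) ≤ 2 ^ J ≤ W`. The last one
is the reason for spreading the counters over `s` words. -/
theorem Setting.pow_bits_pow_le {X : Setting} (hs : 0 < X.s) {J : ℕ} {W : ℝ} (hJ : X.r ^ J ≤ W) :
    ((2 ^ X.bits : ℕ) : ℝ) ^ (J / X.s) ≤ W ^ 6 := by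
  have hs' : (0 : ℝ) < X.s := by exact_mod_cast hs
  have hr := X.two_le_r
  have hr1 := X.one_lt_r.le
  have h1 : ((2 ^ X.bits : ℕ) : ℝ) ≤ 16 * X.r * X.s := by
    have h2 : ((2 ^ X.bits : ℕ) : ℝ) ≤ ((2 * (8 * X.s + 4 * X.k) : ℕ) : ℝ) :=
      Nat.cast_le.2 (X.pow_bits_le hs)
    have h3 : (X.k : ℝ) ≤ X.r * X.s := by
      have : (X.k : ℝ) / X.s ≤ X.r := le_max_right _ _
      rwa [div_le_iff₀ hs'] at this
    push_cast at h2 ⊢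
    nlinarith
  have hd : J / X.s ≤ J := Nat.div_le_self _ _
  have hp : ∀ {x : ℝ} {m : ℕ}, x ≤ X.r → 0 ≤ x → m ≤ J → x ^ m ≤ W := fun {x m} hx h0 hm =>
    (pow_le_pow_left₀ h0 hx m).trans ((pow_le_pow_right₀ hr1 hm).trans hJ)
  have h16 : (16 : ℝ) ^ (J / X.s) ≤ W ^ 4 := by
    have : (16 : ℝ) ^ (J / X.s) = (2 ^ (J / X.s)) ^ 4 := by
      rw [← pow_mul, mul_comm, pow_mul]; norm_num
    rw [this]
    exact pow_le_pow_left₀ (by positivity) (hp hr (by norm_num) hd) 4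
  have hrd : X.r ^ (J / X.s) ≤ W := hp le_rfl (by linarith) hd
  have hsd : (X.s : ℝ) ^ (J / X.s) ≤ W := by
    have : (X.s : ℝ) ≤ 2 ^ X.s := by exact_mod_cast Nat.lt_two_pow_self.le
    calc (X.s : ℝ) ^ (J / X.s) ≤ (2 ^ X.s) ^ (J / X.s) := pow_le_pow_left₀ hs'.le this _
      _ = 2 ^ (X.s * (J / X.s)) := (pow_mul _ _ _).symm
      _ ≤ W := hp hr (by norm_num) (Nat.mul_div_le _ _)
  have hW0 : 0 ≤ W := (by positivity : (0 : ℝ) ≤ X.r ^ J).trans hJ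
  calc ((2 ^ X.bits : ℕ) : ℝ) ^ (J / X.s) ≤ (16 * X.r * X.s) ^ (J / X.s) :=
        pow_le_pow_left₀ (Nat.cast_nonneg _) h1 _
    _ = 16 ^ (J / X.s) * X.r ^ (J / X.s) * (X.s : ℝ) ^ (J / X.s) := by rw [mul_pow, mul_pow]
    _ ≤ W ^ 4 * W * W := by gcongr
    _ = W ^ 6 := by ring

/-- No item exceeds the total weight, so the level of `W` bounds all levels. Every number the
programs need is then at most `Y ^ 11` with `Y = k n W ≥ 2`; constant factors are absorbed as powers
of two. -/
theorem realizes_of_two_mul_le {X : Setting} (hX : X.Good) {n C : ℕ} (hC : 512 ≤ C) {W : ℝ}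
    (hW : W = ∑ i ∈ Finset.range n, X.w i) (h2 : 2 * (X.s : ℝ) ≤ W) :
    Realizes programs C ⌊((X.k : ℝ) * n * W) ^ C⌋₊ X n (2000000 * load true X n) := by
  have hs := hX.s_pos
  have hk : 0 < X.k := (X.site 0).pos
  have hs1 : (1 : ℝ) ≤ X.s := by exact_mod_cast hs
  have hk1 : (1 : ℝ) ≤ X.k := by exact_mod_cast hk
  have hn : 0 < n := by
    rcases Nat.eq_zero_or_pos n with rfl | h
    · simp only [Finset.range_zero, Finset.sum_empty] at hW
      linarith
    · exact h
  have hn1 : (1 : ℝ) ≤ n := by exact_mod_cast hn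
  set Y : ℝ := (X.k : ℝ) * n * W with hY
  have hkn : (1 : ℝ) ≤ (X.k : ℝ) * n := one_le_mul_of_one_le_of_one_le hk1 hn1
  have hWY : W ≤ Y := le_mul_of_one_le_left (by linarith) hkn
  have hY2 : 2 ≤ Y := by linarith
  have hkY : 2 * (X.k : ℝ) ≤ Y := by
    have : (X.k : ℝ) ≤ (X.k : ℝ) * n := le_mul_of_one_le_right (by linarith) hn1
    nlinarith
  have hpow : ∀ {m p : ℕ}, p ≤ 11 → (m : ℝ) ≤ Y ^ p → m ≤ ⌊Y ^ C⌋₊ := fun {m p} hp hm =>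
    Nat.le_floor (hm.trans (pow_le_pow_right₀ (by linarith) (by omega)))
  have hmul : ∀ {x : ℝ} (m : ℕ), x ≤ Y → (2 : ℝ) ^ m * x ≤ Y ^ (m + 1) := fun {x} m hx => by
    rw [pow_succ]
    have h3 : (2 : ℝ) ^ m ≤ Y ^ m := pow_le_pow_left₀ (by norm_num) hY2 m
    have h4 : (0 : ℝ) ≤ 2 ^ m := by positivity
    nlinarith [mul_le_mul_of_nonneg_left hx h4]
  have hJW : X.r ^ level X.r W ≤ W :=
    (pow_le_iff_level X.one_lt_r (by linarith) _).2 le_rfl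
  have hb : ((2 * (8 * X.s + 4 * X.k) : ℕ) : ℝ) ≤ Y ^ 5 := by
    push_cast
    have := hmul 4 (le_refl Y)
    norm_num at this
    linarith
  refine realizes hX hC (J := level X.r W) (fun i hi => ?_) (hpow (p := 9) (by norm_num) ?_)
    (hpow (p := 2) (by norm_num) ?_) (hpow (p := 11) le_rfl ?_) (hpow (p := 5) (by norm_num) hb)
  · rw [← pow_le_iff_level X.one_lt_r (by linarith)]
    refine (X.pow_lev_le hX.one_le i).trans ?_
    rw [hW]
    exact Finset.single_le_sum (fun j _ => by linarith [hX.one_le j]) (Finset.mem_range.2 hi)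
  · push_cast
    have := hmul 8 hWY
    norm_num at this
    linarith
  · push_cast
    have h3 : (2 : ℝ) ^ level X.r W ≤ W :=
      (pow_le_pow_left₀ (by norm_num) X.two_le_r _).trans hJW
    have := hmul 1 hWY
    norm_num at this
    rw [pow_succ]
    linarith
  · have h3 := X.pow_bits_pow_le hs hJW
    have h4 : ((2 ^ X.bits : ℕ) : ℝ) ≤ Y ^ 5 := (Nat.cast_le.2 (X.pow_bits_le hs)).trans hb
    have h5 : W ^ 6 ≤ Y ^ 6 := pow_le_pow_left₀ (by linarith) hWY 6
    rw [Nat.cast_pow, pow_succ]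
    calc _ ≤ Y ^ 6 * Y ^ 5 := mul_le_mul (h3.trans h5) h4 (Nat.cast_nonneg _) (by positivity)
      _ = Y ^ 11 := by ring

theorem ExpLE.mono {Ω : Type*} [MeasurableSpace Ω] {μ : Measure Ω} {f g : Ω → ℕ} {b b' : ℝ}
    (h : ExpLE μ g b) (hf : Measurable f) (hfg : ∀ᵐ ω ∂μ, f ω ≤ g ω) (hb : b ≤ b') : ExpLE μ f b' := by
  have hm : Measurable fun ω => (f ω : ℝ) := measurable_from_top.comp hf
  have hle : ∀ᵐ ω ∂μ, (f ω : ℝ) ≤ g ω := hfg.mono fun ω h => Nat.cast_le.2 h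
  have hi : Integrable (fun ω => (f ω : ℝ)) μ := h.1.mono' hm.aestronglyMeasurable
    (hle.mono fun ω h => by rwa [Real.norm_of_nonneg (Nat.cast_nonneg _)])
  exact ⟨hi, (integral_mono_ae hi h.1 hle).trans (h.2.trans hb)⟩

end WSWOR

end

theorem theorem3p1 :
    ∃ (P : WSWOR.Protocol) (C : ℕ), ∀ (k s : ℕ) (site : ℕ → Fin k) (w : ℕ → ℝ),
      0 < s → (∀ i, 1 ≤ w i) →
      ∀ (Ω : Type*) [MeasurableSpace Ω] (μ : MeasureTheory.Measure Ω)
        [MeasureTheory.IsProbabilityMeasure μ] (T : ℕ → Ω → ℝ),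
        (∀ i, Measurable (T i)) → ProbabilityTheory.iIndepFun T μ →
        (∀ i, μ.map (T i) = ProbabilityTheory.expMeasure 1) →
        let X : Ω → WSWOR.Setting := fun ω => ⟨k, s, site, w, fun i => T i ω⟩
        (∀ (trim : Bool) (t : ℕ) (A : Finset ℕ),
          μ {ω | WSWOR.sample trim (X ω) t = A} = WSWOR.swor w (Finset.range t) s A) ∧
        (∀ᵐ ω ∂μ, ∀ t, WSWOR.sample true (X ω) t = WSWOR.sample false (X ω) t) ∧
        (∀ (n : ℕ) (W : ℝ), W = ∑ i ∈ Finset.range n, w i → 2 * (s : ℝ) ≤ W →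
          (∀ trim : Bool, WSWOR.ExpLE μ (fun ω => WSWOR.messages trim (X ω) n)
            (C * WSWOR.rate k s W)) ∧
          ∃ τ : Ω → ℕ, WSWOR.ExpLE μ τ (C * WSWOR.rate k s W) ∧
            ∀ᵐ ω ∂μ, WSWOR.Realizes P C ⌊((k : ℝ) * n * W) ^ C⌋₊ (X ω) n (τ ω)) := by
  open MeasureTheory WSWOR in
    -- The constant is `2000000 * 174`: the time per unit of `load`, times the bound for the
    -- expected `load` in units of the rate.
    obtain ⟨C, hC⟩ : ∃ C : ℕ, 348000000 ≤ C := ⟨_, le_rfl⟩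
    refine ⟨programs, C, fun k s site w hs hw Ω _ μ _ T hm hi hl => ?_⟩
    intro X
    have h : ExpSeq μ T := ⟨hm, hi, hl⟩
    have hgood : ∀ᵐ ω ∂μ, (X ω).Good := h.ae_good hs hw
    have hCr : (348000000 : ℝ) ≤ C := by exact_mod_cast hC
    refine ⟨fun trim t A => ?_, ?_, fun n W hW h2 => ?_⟩
    · rw [← h.measure_top hw]
      refine measure_congr ?_
      filter_upwards [hgood] with ω hω
      have := sample_eq hω trim t
      change (sample trim (X ω) t = A) = (top s (X ω).key (Finset.range t) = A)
      rw [this]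
    · filter_upwards [hgood] with ω hω t
      rw [sample_eq hω, sample_eq hω]
    · have hrate := rate_nonneg (k := k) hs h2
      have hload : ∀ trim, ExpLE μ (fun ω => load trim (X ω) n) (174 * rate k s W) := fun trim => by
        subst hW
        exact expLE_of_lintegral (h.measurable_load trim n) (by linarith)
          (h.lintegral_load_le hs hw trim n h2)
      refine ⟨fun trim => ?_, fun ω => 2000000 * load true (X ω) n, ?_, ?_⟩
      · exact (hload trim).mono (h.measurable_messages trim n)
          (hgood.mono fun ω hω => messages_le_load hω trim n) (by nlinarith)
      · obtain ⟨h3, h4⟩ := hload true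
        have e : (fun ω => ((2000000 * load true (X ω) n : ℕ) : ℝ)) =
            fun ω => 2000000 * (load true (X ω) n : ℝ) := by
          funext ω; push_cast; ring
        refine ⟨by rw [e]; exact h3.const_mul _, ?_⟩
        rw [e, integral_const_mul]
        nlinarith
      · filter_upwards [hgood] with ω hω
        exact realizes_of_two_mul_le hω (by omega) hW h2
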